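/- **Conventions.** Let $n\ge 1$. Partitions are Young diagrams in English notation; the box $(i,j)$ is in row $i$ and column $j$, counted from $0$; $\rho'$ is the conjugate of $\rho$. Indices of $\mathbf q=(q_0,\dots,q_{n-1})$ are read modulo $n$, $q:=q_0\cdots q_{n-1}$, and $\mathfrak q_t$ ($t\in\mathbb Z$) is defined by $\mathfrak q_0=1$, $\mathfrak q_t=q_t\mathfrak q_{t-1}$. Write $\tau\succ\sigma$ if $\tau_0\ge\sigma_0\ge\tau_1\ge\sigma_1\ge\cdots$. For a monomial $x$ let $$\Gamma_{+1}(x)\tau=\sum_{\sigma\prec\tau}x^{|\tau|-|\sigma|}\sigma,\qquad \Gamma_{-1}(x)\tau=\sum_{\sigma\succ\tau}x^{|\sigma|-|\tau|}\sigma ,$$ and let $\langle\sigma|O|\tau\rangle$ be the coefficient of $\sigma$ in $O\tau$. The slope sequence of a partition $\mu$ is $\mu(t)=+1$ if $t\in\{\mu_0-1,\mu_1-2,\mu_2-3,\dots\}$ and $\mu(t)=-1$ otherwise. Put $$V^n_{\rho^+,\rho^-,\mu}(\mathbf q)=q_0^{-|\rho^+|}\Big\langle(\rho^-)'\Big|\prod_{t\in\mathbb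 Z}^{\rightarrow}\Gamma_{\mu(t)}\big(\mathfrak q_t^{-\mu(t)}\big)\Big|\rho^+\Big\rangle,\qquad P^n_{\rho^+,\rho^-,\mu}=\frac{V^n_{\rho^+,\rho^-,\mu}}{V^n_{\emptyset,\emptyset,\emptyset}},$$ with $t$ increasing from left to right, as formal Laurent series in $q_0,\dots,q_{n-1}$ (for $n=1$, in $q=q_0$). The matrix coefficient of the infinite product is the formal sum over all sequences of intermediate partitions that are eventually constant, equal to $(\rho^-)'$ far to the left and to $\rho^+$ far to the right. Colour the box $(i,j)$ by $j-i \bmod n$. Let $\bar\lambda$ be a balanced partition, that is, one with the same number of boxes of each colour. Let $\lambda=(\lambda_0,\dots,\lambda_{n-1})$ be its $n$-quotient: $\bar\lambda(t)=\lambda_{\underline t}\big((t-\underline t)/n\big)$ for all $t\in\mathbb Z$, where $\underline t=t\bmod n\in\{0,\dots,n-1\}$. Let $$\frac{\chi_{\bar\lambda}(n^d)}{\dim(\lambda)}:=(-1)^{\sum_i \mathrm{ht}(\nu_i)}=\pm1,$$ where $\nu_1,\nu_2,\dots$ are the $n$-border strips (connected sets of $n$ boxes, without a $2\times2$ square, whose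 removal leaves a Young diagram) of any decomposition of $\bar\lambda$ obtained by successively removing such strips down to $\emptyset$, and $\mathrm{ht}$ is the number of rows occupied minus one. Define $$\tilde P^{\mathcal X}_{\rho^+,\rho^-,\bar\lambda}(\mathbf q)=\Big(\frac{\chi_{\bar\lambda}(n^d)}{\dim(\lambda)}\prod_{(i,j)\in\bar\lambda}q_{j-i}^{\,i}\Big)P^{n}_{\rho^+,\rho^-,\bar\lambda}(\mathbf q),$$ and, as power series in $\mathbf v=(v_1,\dots,v_{n-1})$ over the Laurent series in $q$, with $\tau_0:=(\rho^-)'$ and $\tau_n:=\rho^+$, $$P^Y_{\rho^+,\rho^-,\lambda}(q,\mathbf v)=\sum_{\tau_1,\dots,\tau_{n-1}}\ \prod_{k=1}^{n-1}(qv_k)^{|\tau_k|}\ \prod_{k=0}^{n-1}P^1_{\tau_{k+1},\tau_k',\lambda_k}(q),\qquad \tilde P^Y_{\rho^+,\rho^-,\lambda}=\Big(\prod_{k}\prod_{(i,j)\in\lambda_k}q^{i}\Big)P^Y_{\rho^+,\rho^-,\lambda}.$$ **Theorem 3.1.** For every $n\ge1$, all partitions $\rho^+,\rho^-$ and every balanced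 partition $\bar\lambda$ with $n$-quotient $\lambda=(\lambda_0,\dots,\lambda_{n-1})$, after the change of variables $v_i\leftrightarrow q_i$ ($1\le i\le n-1$), $q=q_0q_1\cdots q_{n-1}$, $$\tilde P^{\mathcal X}_{\rho^+,\rho^-,\bar\lambda}(\mathbf q)=\frac{\tilde P^Y_{\rho^+,\rho^-,\lambda}(q,\mathbf v)}{\tilde P^Y_{\emptyset,\emptyset,\emptyset}(q,\mathbf v)}\prod_{k=0}^{n-1}\prod_{(i,j)\in\lambda_k}\Big((-1)^{n-k-1}q^{(n-k-1)(i-j)}\prod_{l=k+1}^{n-1}q_l^{\,n-l}\Big).$$ The equality is one of rational functions: there is a rational function $R(q,v_1,\dots,v_{n-1})$ over $\mathbb Q$ whose expansion as a power series in $v_1,\dots,v_{n-1}$ over the Laurent series in $q$ is the right-hand side (with $v_l$ in place of $q_l$), and such that the expansion of $R(q_0q_1\cdots q_{n-1},q_1,\dots,q_{n-1})$ as a Laurent series in $q_0,\dots,q_{n-1}$ is the left-hand side. -/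

import Mathlib

/-!
Conventions. Partitions are Mathlib Young diagrams in English notation: the box `(i, j)` lies in
row `i` and column `j` (both counted from `0`), `rowLen i` is the `i`-th part, `card` is the size
and `transpose` is the conjugate partition. All series have rational coefficients.
-/

namespace VertexCRC

/-- A field of formal Laurent series in `q_0, …, q_{n-1}`, with exponent vectors in `ℤ^n`. It
contains every Laurent series whose exponents are bounded below in each variable; all series
below are of this kind. The lexicographic order on exponents only serves to make it a field. -/
abbrev LaurentField (n : ℕ) : Type := HahnSeries (Lex (Fin n → ℤ)) ℚ

/-- The residue of `t` modulo `n`, as an index in `{0, …, n-1}`. -/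
def color (n : ℕ) [NeZero n] (t : ℤ) : Fin n :=
  ⟨(t % (n : ℤ)).toNat, by
    have hn : (0 : ℤ) < n := by exact_mod_cast Nat.pos_of_ne_zero (NeZero.ne n)
    have h1 := Int.emod_nonneg t hn.ne'
    have h2 := Int.emod_lt_of_pos t hn
    omega⟩

/-- The variable `q_i`. -/
noncomputable def qvar (n : ℕ) (i : Fin n) : LaurentField n :=
  HahnSeries.single (toLex (Pi.single i (1 : ℤ))) 1

/-- `q = q_0 q_1 ⋯ q_{n-1}`. -/
noncomputable def qtot (n : ℕ) : LaurentField n := ∏ i, qvar n i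

/-- The monomials `𝔮_t`, `t ∈ ℤ`: `q_1 ⋯ q_t` for `t ≥ 0` and `(q_0 q_{-1} ⋯ q_{t+1})⁻¹` for
`t < 0`, with indices modulo `n`. See `frakq_zero` and `frakq_rec` for the recursion. -/
noncomputable def frakq (n : ℕ) [NeZero n] (t : ℤ) : LaurentField n :=
  (∏ s ∈ Finset.Ioc 0 t, qvar n (color n s)) * (∏ s ∈ Finset.Ioc t 0, qvar n (color n s))⁻¹

/-- `τ ≻ σ`, that is `τ_0 ≥ σ_0 ≥ τ_1 ≥ σ_1 ≥ ⋯`. -/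
def Interlace (τ σ : YoungDiagram) : Prop :=
  ∀ i, σ.rowLen i ≤ τ.rowLen i ∧ τ.rowLen (i + 1) ≤ σ.rowLen i

open Classical in
/-- The slope sequence: `+1` if `t ∈ {μ_0 - 1, μ_1 - 2, μ_2 - 3, …}` and `-1` otherwise. -/
noncomputable def slope (μ : YoungDiagram) (t : ℤ) : ℤˣ :=
  if ∃ i : ℕ, t = (μ.rowLen i : ℤ) - (i + 1) then 1 else -1

open Classical in
/-- The vertex operators `Γ_{+1}(x)` and `Γ_{-1}(x)`, given by their matrix coefficients
`⟨σ| Γ_ε(x) |τ⟩`, the coefficient of `σ` in `Γ_ε(x) τ`: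
`Γ_{+1}(x) τ = ∑_{σ ≺ τ} x^{|τ|-|σ|} σ` and `Γ_{-1}(x) τ = ∑_{σ ≻ τ} x^{|σ|-|τ|} σ`. -/
noncomputable def Gamma {n : ℕ} (ε : ℤˣ) (x : LaurentField n) :
    Matrix YoungDiagram YoungDiagram (LaurentField n) :=
  Matrix.of fun σ τ =>
    if ε = 1 then (if Interlace τ σ then x ^ (τ.card - σ.card) else 0)
    else (if Interlace σ τ then x ^ (σ.card - τ.card) else 0)

/-- The intermediate states in the expansion of `⟨α| ∏_{t ∈ ℤ} O_t |β⟩`: `toFun t` stands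
immediately to the left of `O_t` and `toFun (t + 1)` immediately to the right of it. The states
are `α` far to the left and `β` far to the right. -/
structure Path (α β : YoungDiagram) where
  toFun : ℤ → YoungDiagram
  eventually_left : ∀ᶠ t in Filter.atBot, toFun t = α
  eventually_right : ∀ᶠ t in Filter.atTop, toFun t = β

/-- The contribution `∏_t ⟨σ_t| Γ_{μ(t)}(𝔮_t^{-μ(t)}) |σ_{t+1}⟩` of the intermediate states `σ`
to the expectation. All but finitely many factors are `1`. -/
noncomputable def pathWeight (n : ℕ) [NeZero n] (μ : YoungDiagram) {α β : YoungDiagram}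
    (σ : Path α β) : LaurentField n :=
  ∏ᶠ t : ℤ, Gamma (slope μ t) (frakq n t ^ (-(slope μ t : ℤ))) (σ.toFun t) (σ.toFun (t + 1))

/-! The following lemmas show that these contributions form a summable family. -/

theorem sum_Ioc_sub (w : ℤ → ℤ) (t : ℤ) :
    (∑ s ∈ Finset.Ioc 0 t, w s - ∑ s ∈ Finset.Ioc t 0, w s) =
    (∑ s ∈ Finset.Ioc 0 (t-1), w s - ∑ s ∈ Finset.Ioc (t-1) 0, w s) + w t := by
  rcases le_or_gt t 0 with h | h
  · rw [Finset.Ioc_eq_empty (by omega), Finset.Ioc_eq_empty (by omega : ¬ (0:ℤ) < t - 1)]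
    have : Finset.Ioc (t-1) 0 = insert t (Finset.Ioc t 0) := by ext; simp; omega
    rw [this, Finset.sum_insert (by simp)]; simp
  · rw [Finset.Ioc_eq_empty (by omega : ¬ t < 0), Finset.Ioc_eq_empty (by omega : ¬ t - 1 < 0)]
    have : Finset.Ioc 0 t = insert t (Finset.Ioc 0 (t-1)) := by ext; simp; omega
    rw [this, Finset.sum_insert (by simp)]; simp; ring

theorem telescope (w c : ℤ → ℤ) (N : ℕ) :
    ∑ t ∈ Finset.Ico (-(N:ℤ)) N, (c t - c (t + 1)) *
      (∑ s ∈ Finset.Ioc 0 t, w s - ∑ s ∈ Finset.Ioc t 0, w s) =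
    ∑ t ∈ Finset.Ioc (-(N:ℤ)) 0, w t * (c t - c (-N)) + ∑ t ∈ Finset.Ioc 0 (N:ℤ), w t * (c t - c N) := by
  induction N with
  | zero => simp
  | succ N ih =>
    have e1 : Finset.Ico (-((N+1:ℕ):ℤ)) (N+1:ℕ) =
        insert (N:ℤ) (insert (-((N+1:ℕ):ℤ)) (Finset.Ico (-(N:ℤ)) N)) := by
      ext; simp; omega
    have e2 : Finset.Ioc (-((N+1:ℕ):ℤ)) 0 = insert (-(N:ℤ)) (Finset.Ioc (-(N:ℤ)) 0) := by
      ext; simp; omega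
    have e3 : Finset.Ioc 0 ((N+1:ℕ):ℤ) = insert ((N+1:ℕ):ℤ) (Finset.Ioc 0 (N:ℤ)) := by
      ext; simp; omega
    rw [e1, Finset.sum_insert (by simp; omega), Finset.sum_insert (by simp), ih, e2,
      Finset.sum_insert (by simp), e3, Finset.sum_insert (by simp)]
    rw [Finset.Ioc_eq_empty (by omega : ¬ (N:ℤ) < 0),
      Finset.Ioc_eq_empty (by omega : ¬ (0:ℤ) < (-((N+1:ℕ):ℤ))),
      Finset.sum_insert (by simp)]
    simp only [mul_sub, Finset.sum_sub_distrib, ← Finset.sum_mul, Finset.sum_empty]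
    have e4 : (-((N+1:ℕ):ℤ)) + 1 = -N := by push_cast; ring
    rw [e4]
    push_cast
    ring


/-- The monomial with exponent vector `e`. -/
noncomputable def mono {n : ℕ} (e : Fin n → ℤ) : LaurentField n :=
  HahnSeries.single (toLex e) 1

theorem mono_zero {n : ℕ} : mono (0 : Fin n → ℤ) = 1 := rfl

theorem mono_add {n : ℕ} (a b : Fin n → ℤ) : mono (a + b) = mono a * mono b := by
  simp [mono, HahnSeries.single_mul_single]

theorem mono_neg {n : ℕ} (a : Fin n → ℤ) : mono (-a) = (mono a)⁻¹ := by
  refine eq_inv_of_mul_eq_one_left ?_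
  rw [← mono_add, neg_add_cancel, mono_zero]

theorem mono_nsmul {n : ℕ} (a : Fin n → ℤ) (k : ℕ) : mono (k • a) = mono a ^ k := by
  induction k with
  | zero => simp [mono_zero]
  | succ k ih => rw [succ_nsmul, mono_add, ih, pow_succ]

theorem mono_sum {n : ℕ} {ι : Type*} (s : Finset ι) (f : ι → Fin n → ℤ) :
    mono (∑ i ∈ s, f i) = ∏ i ∈ s, mono (f i) := by
  classical
  induction s using Finset.induction_on with
  | empty => simp [mono_zero]
  | insert a s ha ih => rw [Finset.sum_insert ha, Finset.prod_insert ha, mono_add, ih]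

/-- The indicator of `t ≡ i` modulo `n`. -/
def colorInd (n : ℕ) [NeZero n] (i : Fin n) (t : ℤ) : ℤ := if color n t = i then 1 else 0

theorem qvar_eq_mono (n : ℕ) [NeZero n] (s : ℤ) :
    qvar n (color n s) = mono (fun i => colorInd n i s) := by
  unfold qvar mono
  congr 2
  funext i
  by_cases h : color n s = i
  · subst h; simp [colorInd]
  · have h' : i ≠ color n s := fun hh => h hh.symm
    simp [colorInd, h, h']

theorem frakq_eq_mono (n : ℕ) [NeZero n] (t : ℤ) :
    frakq n t = mono (fun i => ∑ s ∈ Finset.Ioc 0 t, colorInd n i s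
      - ∑ s ∈ Finset.Ioc t 0, colorInd n i s) := by
  have h := qvar_eq_mono n
  unfold frakq
  simp only [h, ← mono_sum, ← mono_neg, ← mono_add]
  congr 1
  ext i
  simp [sub_eq_add_neg]

theorem frakq_zero (n : ℕ) [NeZero n] : frakq n 0 = 1 := by simp [frakq]

theorem frakq_rec (n : ℕ) [NeZero n] (t : ℤ) :
    frakq n t = qvar n (color n t) * frakq n (t - 1) := by
  have h : qvar n (color n t) = mono (fun i => colorInd n i t) := qvar_eq_mono n t
  rw [h, frakq_eq_mono, frakq_eq_mono, ← mono_add]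
  congr 1
  funext i
  rw [sum_Ioc_sub (colorInd n i) t, Pi.add_apply, add_comm]

theorem rowLen_of_card {μ : YoungDiagram} {i : ℕ} (h : μ.card ≤ i) : μ.rowLen i = 0 := by
  by_contra hne
  have h1 : (i, 0) ∈ μ := YoungDiagram.mem_iff_lt_rowLen.2 (Nat.pos_of_ne_zero hne)
  have : (Finset.range (i+1)).map ⟨fun k => (k, 0), fun a b h => by simpa using h⟩ ⊆ μ.cells := by
    intro c hc
    simp only [Finset.mem_map, Finset.mem_range] at hc
    obtain ⟨k, hk, rfl⟩ := hc
    exact μ.up_left_mem (by omega) le_rfl h1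
  have := Finset.card_le_card this
  simp at this
  change i + 1 ≤ μ.card at this
  omega

theorem rowLen_le_card (μ : YoungDiagram) (i : ℕ) : μ.rowLen i ≤ μ.card := by
  rw [YoungDiagram.rowLen_eq_card]
  exact Finset.card_le_card (Finset.filter_subset _ _)

theorem slope_of_neg {μ : YoungDiagram} {t : ℤ} (h : t < -(μ.card : ℤ)) : slope μ t = 1 := by
  have : ∃ i : ℕ, t = (μ.rowLen i : ℤ) - (i + 1) := by
    refine ⟨(-t - 1).toNat, ?_⟩
    rw [rowLen_of_card (by omega)]
    omega
  simp [slope, this]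

theorem slope_of_pos {μ : YoungDiagram} {t : ℤ} (h : (μ.card : ℤ) ≤ t) : slope μ t = -1 := by
  have : ¬ ∃ i : ℕ, t = (μ.rowLen i : ℤ) - (i + 1) := by
    rintro ⟨i, hi⟩
    have := rowLen_le_card μ i
    omega
  simp only [slope, this, if_false]

theorem Interlace.le {τ σ : YoungDiagram} (h : Interlace τ σ) : σ ≤ τ := by
  intro c hc
  obtain ⟨i, j⟩ := c
  have h1 : j < σ.rowLen i := YoungDiagram.mem_iff_lt_rowLen.1 hc
  exact YoungDiagram.mem_iff_lt_rowLen.2 (h1.trans_le (h i).1)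

theorem Interlace.refl (τ : YoungDiagram) : Interlace τ τ :=
  fun i => ⟨le_rfl, τ.rowLen_anti _ _ (Nat.le_succ i)⟩

theorem card_mono {σ τ : YoungDiagram} (h : σ ≤ τ) : σ.card ≤ τ.card :=
  Finset.card_le_card (YoungDiagram.cells_subset_iff.2 h)

theorem Gamma_self {n : ℕ} (ε : ℤˣ) (x : LaurentField n) (τ : YoungDiagram) :
    Gamma ε x τ τ = 1 := by
  simp [Gamma, Interlace.refl]

theorem Gamma_frakq {n : ℕ} [NeZero n] (ε : ℤˣ) (t : ℤ) (σ τ : YoungDiagram) :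
    (Gamma ε (frakq n t ^ (-(ε : ℤ))) σ τ = 0) ∨
    (((ε = 1 ∧ Interlace τ σ) ∨ (ε = -1 ∧ Interlace σ τ)) ∧
      Gamma ε (frakq n t ^ (-(ε : ℤ))) σ τ = mono (fun i => ((σ.card : ℤ) - τ.card) *
        (∑ s ∈ Finset.Ioc 0 t, colorInd n i s - ∑ s ∈ Finset.Ioc t 0, colorInd n i s))) := by
  rcases Int.units_eq_one_or ε with rfl | rfl
  · by_cases h : Interlace τ σ
    · right
      refine ⟨Or.inl ⟨rfl, h⟩, ?_⟩
      have hc := card_mono h.le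
      simp only [Gamma, Matrix.of_apply, if_true, h, Units.val_one, zpow_neg, zpow_one]
      rw [frakq_eq_mono, ← mono_neg, ← mono_nsmul]
      congr 1
      ext i
      simp only [Pi.smul_apply, Pi.neg_apply, nsmul_eq_mul]
      push_cast [hc]
      ring
    · left; simp [Gamma, h]
  · by_cases h : Interlace σ τ
    · right
      refine ⟨Or.inr ⟨rfl, h⟩, ?_⟩
      have hc := card_mono h.le
      have h1 : (-1 : ℤˣ) ≠ 1 := by decide
      simp only [Gamma, Matrix.of_apply, h1, if_false, h, if_true, Units.val_neg, Units.val_one,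
        neg_neg, zpow_one]
      rw [frakq_eq_mono, ← mono_nsmul]
      congr 1
      ext i
      simp only [Pi.smul_apply, nsmul_eq_mul]
      push_cast [hc]
      ring
    · left; simp [Gamma, h]

/-- The interlacing conditions under which the contribution of `σ` is nonzero. -/
def Path.Admissible (μ : YoungDiagram) {α β : YoungDiagram} (σ : Path α β) : Prop :=
  ∀ t, (slope μ t = 1 ∧ Interlace (σ.toFun (t + 1)) (σ.toFun t)) ∨
    (slope μ t = -1 ∧ Interlace (σ.toFun t) (σ.toFun (t + 1)))

theorem Path.exists_bound {α β : YoungDiagram} (σ : Path α β) :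
    ∃ N₀ : ℕ, ∀ N : ℕ, N₀ ≤ N → (∀ t : ℤ, t ≤ -N → σ.toFun t = α) ∧ (∀ t : ℤ, (N : ℤ) ≤ t → σ.toFun t = β) := by
  obtain ⟨a, ha⟩ := Filter.eventually_atBot.1 σ.eventually_left
  obtain ⟨b, hb⟩ := Filter.eventually_atTop.1 σ.eventually_right
  exact ⟨a.natAbs + b.natAbs, fun N hN => ⟨fun t ht => ha t (by omega), fun t ht => hb t (by omega)⟩⟩

theorem pathWeight_eq_prod (n : ℕ) [NeZero n] (μ : YoungDiagram) {α β : YoungDiagram}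
    (σ : Path α β) (N : ℕ) (h1 : ∀ t : ℤ, t ≤ -N → σ.toFun t = α) (h2 : ∀ t : ℤ, (N : ℤ) ≤ t → σ.toFun t = β) :
    pathWeight n μ σ = ∏ t ∈ Finset.Ico (-(N:ℤ)) N,
      Gamma (slope μ t) (frakq n t ^ (-(slope μ t : ℤ))) (σ.toFun t) (σ.toFun (t + 1)) := by
  unfold pathWeight
  apply finprod_eq_prod_of_mulSupport_subset
  intro t ht
  by_contra hn
  apply ht
  have : t + 1 ≤ -(N:ℤ) ∨ (N:ℤ) ≤ t := by
    simp at hn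
    by_contra hcon
    push Not at hcon
    have := hn (by omega)
    omega
  rcases this with h | h
  · beta_reduce
    rw [h1 _ h, h1 t (by omega), Gamma_self]
  · beta_reduce
    rw [h2 _ h, h2 (t+1) (by omega), Gamma_self]

/-- The exponent vector of the contribution of `σ`, for `N` large. -/
noncomputable def pathExp (n : ℕ) [NeZero n] {α β : YoungDiagram} (σ : Path α β) (N : ℕ) (i : Fin n) : ℤ :=
  ∑ t ∈ Finset.Ioc (-(N:ℤ)) 0, colorInd n i t * ((σ.toFun t).card - α.card) +
    ∑ t ∈ Finset.Ioc 0 (N:ℤ), colorInd n i t * ((σ.toFun t).card - β.card)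

theorem pathWeight_cases (n : ℕ) [NeZero n] (μ : YoungDiagram) {α β : YoungDiagram}
    (σ : Path α β) : pathWeight n μ σ = 0 ∨ (σ.Admissible μ ∧
      ∀ N : ℕ, (∀ t : ℤ, t ≤ -N → σ.toFun t = α) → (∀ t : ℤ, (N : ℤ) ≤ t → σ.toFun t = β) →
        pathWeight n μ σ = mono (pathExp n σ N)) := by
  by_cases h0 : pathWeight n μ σ = 0
  · exact Or.inl h0
  refine Or.inr ⟨fun t => ?_, fun N h1 h2 => ?_⟩
  · obtain ⟨N₀, hN⟩ := σ.exists_bound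
    have := hN (N₀ + t.natAbs + 1) (by omega)
    rw [pathWeight_eq_prod n μ σ _ this.1 this.2, Finset.prod_eq_zero_iff] at h0
    push Not at h0
    have h3 := h0 t (by rw [Finset.mem_Ico]; omega)
    exact ((Gamma_frakq (n := n) (slope μ t) t (σ.toFun t) (σ.toFun (t+1))).resolve_left h3).1
  · rw [pathWeight_eq_prod n μ σ N h1 h2] at h0 ⊢
    rw [Finset.prod_eq_zero_iff] at h0
    push Not at h0
    rw [Finset.prod_congr rfl fun t ht =>
      ((Gamma_frakq (n := n) (slope μ t) t (σ.toFun t) (σ.toFun (t+1))).resolve_left (h0 t ht)).2, ← mono_sum]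
    congr 1
    ext i
    rw [Finset.sum_apply, telescope (colorInd n i) (fun t => ((σ.toFun t).card : ℤ)) N]
    simp only [pathExp, h1 (-N) le_rfl, h2 N le_rfl]


theorem sum_lower (S : Finset ℤ) (P : ℤ → Prop) [DecidablePred P] (T : ℕ) (a : ℕ) (c w : ℤ → ℤ)
    (hT : (S.filter P).card ≤ T) (hc : ∀ t, 0 ≤ c t) (hP : ∀ t ∈ S, ¬ P t → (a : ℤ) ≤ c t)
    (hw : ∀ t, w t = 0 ∨ w t = 1) :
    -((T : ℤ) * a) ≤ ∑ t ∈ S, w t * (c t - a) := by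
  have h1 : ∑ t ∈ S, (-(if P t then (a : ℤ) else 0)) ≤ ∑ t ∈ S, w t * (c t - a) := by
    refine Finset.sum_le_sum fun t ht => ?_
    have := hc t
    have := hP t ht
    rcases hw t with h | h <;> rw [h] <;> split_ifs with h2
    · simp
    · simp
    · linarith
    · linarith [this h2]
  rw [Finset.sum_neg_distrib, ← Finset.sum_filter, Finset.sum_const, nsmul_eq_mul] at h1
  have : ((S.filter P).card : ℤ) * a ≤ T * a := by gcongr
  linarith

theorem sum_upper (S R : Finset ℤ) (P : ℤ → Prop) [DecidablePred P] (T : ℕ) (a : ℕ) (c : ℤ → ℤ)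
    (hT : (S.filter P).card ≤ T) (hc : ∀ t, 0 ≤ c t) (hP : ∀ t ∈ S, ¬ P t → (a : ℤ) ≤ c t)
    (hR : R ⊆ S) :
    ∑ t ∈ R, (c t - a + if P t then (a : ℤ) else 0) ≤ ∑ t ∈ S, (c t - a) + T * a := by
  have h1 : ∑ t ∈ R, (c t - a + if P t then (a : ℤ) else 0) ≤
      ∑ t ∈ S, (c t - a + if P t then (a : ℤ) else 0) := by
    refine Finset.sum_le_sum_of_subset_of_nonneg hR fun t ht _ => ?_
    have := hc t
    have := hP t ht
    split_ifs with h2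
    · linarith
    · linarith [this h2]
  rw [Finset.sum_add_distrib (s := S), ← Finset.sum_filter, Finset.sum_const, nsmul_eq_mul] at h1
  have : ((S.filter P).card : ℤ) * a ≤ T * a := by gcongr
  linarith

theorem Path.Admissible.mono_left {μ α β : YoungDiagram} {σ : Path α β} (h : σ.Admissible μ)
    {s t : ℤ} (hst : s ≤ t) (ht : t ≤ -(μ.card : ℤ)) : σ.toFun s ≤ σ.toFun t := by
  revert ht
  induction t, hst using Int.leInduction with
  | base => intro _; exact le_rfl
  | succ t hst ih =>
    intro ht
    refine (ih (by omega)).trans ?_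
    rcases h t with h | h
    · exact h.2.le
    · rw [slope_of_neg (by omega)] at h
      exact absurd h.1 (by decide)

theorem Path.Admissible.mono_right {μ α β : YoungDiagram} {σ : Path α β} (h : σ.Admissible μ)
    {s t : ℤ} (hst : s ≤ t) (hs : (μ.card : ℤ) ≤ s) : σ.toFun t ≤ σ.toFun s := by
  induction t, hst using Int.leInduction with
  | base => exact le_rfl
  | succ t hst ih =>
    refine le_trans ?_ ih
    rcases h t with h | h
    · rw [slope_of_pos (by omega)] at h
      exact absurd h.1 (by decide)
    · exact h.2.le

theorem Path.Admissible.left_le {μ α β : YoungDiagram} {σ : Path α β} (h : σ.Admissible μ)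
    {t : ℤ} (ht : t ≤ -(μ.card : ℤ)) : α ≤ σ.toFun t := by
  obtain ⟨N, hN⟩ := σ.exists_bound
  exact ((hN (N + t.natAbs) (by omega)).1 (-((N + t.natAbs : ℕ) : ℤ)) le_rfl).ge.trans
    (h.mono_left (by omega) ht)

theorem Path.Admissible.right_le {μ α β : YoungDiagram} {σ : Path α β} (h : σ.Admissible μ)
    {t : ℤ} (ht : (μ.card : ℤ) ≤ t) : β ≤ σ.toFun t := by
  obtain ⟨N, hN⟩ := σ.exists_bound
  exact ((hN (N + t.natAbs) (by omega)).2 ((N + t.natAbs : ℕ) : ℤ) le_rfl).ge.trans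
    (h.mono_right (by omega) ht)

theorem card_filter_left (N T : ℕ) :
    ((Finset.Ioc (-(N:ℤ)) 0).filter (fun t => -(T:ℤ) < t)).card ≤ T := by
  have : (Finset.Ioc (-(N:ℤ)) 0).filter (fun t => -(T:ℤ) < t) ⊆ Finset.Ioc (-(T:ℤ)) 0 := by
    intro t; simp only [Finset.mem_filter, Finset.mem_Ioc]; omega
  simpa using Finset.card_le_card this

theorem card_filter_right (N T : ℕ) :
    ((Finset.Ioc 0 (N:ℤ)).filter (fun t => t < (T:ℤ))).card ≤ T := by
  have : (Finset.Ioc 0 (N:ℤ)).filter (fun t => t < (T:ℤ)) ⊆ Finset.Ioc 0 (T:ℤ) := by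
    intro t; simp only [Finset.mem_filter, Finset.mem_Ioc]; omega
  simpa using Finset.card_le_card this

theorem pathExp_lower (n : ℕ) [NeZero n] {μ α β : YoungDiagram} {σ : Path α β}
    (h : σ.Admissible μ) (N : ℕ) (i : Fin n) :
    -((μ.card : ℤ) * α.card + μ.card * β.card) ≤ pathExp n σ N i := by
  have hw : ∀ t, colorInd n i t = 0 ∨ colorInd n i t = 1 := fun t => by
    unfold colorInd; split_ifs <;> simp
  have h1 := sum_lower (Finset.Ioc (-(N:ℤ)) 0) (fun t => -(μ.card:ℤ) < t) μ.card α.card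
    (fun t => (σ.toFun t).card) (colorInd n i) (card_filter_left _ _) (fun t => by positivity)
    (fun t _ ht => by exact_mod_cast card_mono (h.left_le (by omega))) hw
  have h2 := sum_lower (Finset.Ioc 0 (N:ℤ)) (fun t => t < (μ.card:ℤ)) μ.card β.card
    (fun t => (σ.toFun t).card) (colorInd n i) (card_filter_right _ _) (fun t => by positivity)
    (fun t _ ht => by exact_mod_cast card_mono (h.right_le (by omega))) hw
  unfold pathExp
  linarith

theorem sum_pathExp (n : ℕ) [NeZero n] {α β : YoungDiagram} (σ : Path α β) (N : ℕ) :
    ∑ i, pathExp n σ N i = ∑ t ∈ Finset.Ioc (-(N:ℤ)) 0, (((σ.toFun t).card : ℤ) - α.card) +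
      ∑ t ∈ Finset.Ioc 0 (N:ℤ), (((σ.toFun t).card : ℤ) - β.card) := by
  simp only [pathExp, Finset.sum_add_distrib]
  rw [Finset.sum_comm, Finset.sum_comm (s := Finset.univ)]
  simp [colorInd]

theorem finite_card_le (M : ℕ) : {μ : YoungDiagram | μ.card ≤ M}.Finite := by
  have : Set.InjOn YoungDiagram.cells {μ : YoungDiagram | μ.card ≤ M} := by
    intro a _ b _ h
    exact YoungDiagram.ext h
  refine Set.Finite.of_finite_image (Set.Finite.subset
    (Finset.finite_toSet (Finset.range M ×ˢ Finset.range M).powerset) ?_) this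
  rintro _ ⟨μ, hμ, rfl⟩
  simp only [Finset.coe_powerset, Set.mem_preimage, Set.mem_powerset_iff]
  rintro ⟨i, j⟩ hc
  have hc' : (i, j) ∈ μ := hc
  have h1 := YoungDiagram.mem_iff_lt_rowLen.1 hc'
  have h2 := rowLen_le_card μ i
  have h3 : ¬ μ.card ≤ i := fun h => by rw [rowLen_of_card h] at h1; omega
  have hμ' : μ.card ≤ M := hμ
  simp
  omega

theorem Path.ext' {α β : YoungDiagram} {σ τ : Path α β} (h : σ.toFun = τ.toFun) : σ = τ := by
  cases σ; cases τ; cases h; rfl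

theorem path_bounds {n : ℕ} [NeZero n] {μ α β : YoungDiagram} {σ : Path α β}
    (h : σ.Admissible μ) {N : ℕ}
    (h1 : ∀ t : ℤ, t ≤ -N → σ.toFun t = α) (h2 : ∀ t : ℤ, (N : ℤ) ≤ t → σ.toFun t = β) {M : ℕ}
    (hM : ∑ i, pathExp n σ N i + μ.card * α.card + μ.card * β.card ≤ M) :
    (∀ t, (σ.toFun t).card ≤ M + α.card + β.card) ∧
    (∀ t : ℤ, t < -(μ.card + M : ℤ) → σ.toFun t = α) ∧
    (∀ t : ℤ, (μ.card + M : ℤ) < t → σ.toFun t = β) := by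
  rw [sum_pathExp] at hM
  have hl : ∀ t : ℤ, ¬ (-(μ.card:ℤ) < t) → (α.card : ℤ) ≤ (σ.toFun t).card :=
    fun t ht => by exact_mod_cast card_mono (h.left_le (by omega))
  have hr : ∀ t : ℤ, ¬ (t < (μ.card:ℤ)) → (β.card : ℤ) ≤ (σ.toFun t).card :=
    fun t ht => by exact_mod_cast card_mono (h.right_le (by omega))
  have L := fun R hR => sum_upper (Finset.Ioc (-(N:ℤ)) 0) R (fun t => -(μ.card:ℤ) < t) μ.card α.card
    (fun t => (σ.toFun t).card) (card_filter_left _ _) (fun t => by positivity)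
    (fun t _ ht => hl t ht) hR
  have U := fun R hR => sum_upper (Finset.Ioc 0 (N:ℤ)) R (fun t => t < (μ.card:ℤ)) μ.card β.card
    (fun t => (σ.toFun t).card) (card_filter_right _ _) (fun t => by positivity)
    (fun t _ ht => hr t ht) hR
  have L0 := L ∅ (Finset.empty_subset _)
  have U0 := U ∅ (Finset.empty_subset _)
  simp only [Finset.sum_empty] at L0 U0
  refine ⟨fun t => ?_, fun t ht => ?_, fun t ht => ?_⟩
  · rcases le_or_gt t (-N) with h3 | h3
    · rw [h1 t h3]; omega
    rcases le_or_gt (N:ℤ) t with h4 | h4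
    · rw [h2 t h4]; omega
    rcases le_or_gt t 0 with h5 | h5
    · have := L {t} (by simp; omega)
      rw [Finset.sum_singleton] at this
      split_ifs at this <;> omega
    · have := U {t} (by simp; omega)
      rw [Finset.sum_singleton] at this
      split_ifs at this <;> omega
  · by_contra hne
    have hN : -(N:ℤ) < t := by by_contra hh; exact hne (h1 t (by omega))
    have hlt : α.card < (σ.toFun t).card := by
      refine lt_of_le_of_ne (card_mono (h.left_le (by omega))) fun he => hne ?_
      refine (YoungDiagram.ext (Finset.eq_of_subset_of_card_le ?_ he.ge)).symm
      exact YoungDiagram.cells_subset_iff.2 (h.left_le (by omega))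
    have := L (Finset.Icc t (-(μ.card:ℤ))) (by intro s; simp only [Finset.mem_Icc, Finset.mem_Ioc]; omega)
    have h6 : ∑ s ∈ Finset.Icc t (-(μ.card:ℤ)), (1:ℤ) ≤ ∑ s ∈ Finset.Icc t (-(μ.card:ℤ)),
        (((σ.toFun s).card : ℤ) - α.card + if -(μ.card:ℤ) < s then (α.card : ℤ) else 0) := by
      refine Finset.sum_le_sum fun s hs => ?_
      rw [Finset.mem_Icc] at hs
      have := card_mono (h.mono_left hs.1 hs.2)
      rw [if_neg (by omega)]
      omega
    rw [Finset.sum_const, Int.card_Icc, nsmul_eq_mul] at h6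
    omega
  · by_contra hne
    have hN : t < (N:ℤ) := by by_contra hh; exact hne (h2 t (by omega))
    have hlt : β.card < (σ.toFun t).card := by
      refine lt_of_le_of_ne (card_mono (h.right_le (by omega))) fun he => hne ?_
      refine (YoungDiagram.ext (Finset.eq_of_subset_of_card_le ?_ he.ge)).symm
      exact YoungDiagram.cells_subset_iff.2 (h.right_le (by omega))
    have := U (Finset.Icc (μ.card + 1 : ℤ) t) (by intro s; simp only [Finset.mem_Icc, Finset.mem_Ioc]; omega)
    have h6 : ∑ s ∈ Finset.Icc (μ.card + 1 : ℤ) t, (1:ℤ) ≤ ∑ s ∈ Finset.Icc (μ.card + 1 : ℤ) t,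
        (((σ.toFun s).card : ℤ) - β.card + if s < (μ.card:ℤ) then (β.card : ℤ) else 0) := by
      refine Finset.sum_le_sum fun s hs => ?_
      rw [Finset.mem_Icc] at hs
      have := card_mono (h.mono_right hs.2 (by omega))
      rw [if_neg (by omega)]
      omega
    rw [Finset.sum_const, Int.card_Icc, nsmul_eq_mul] at h6
    omega

/-- The family of all contributions. It is formally summable: the exponents that occur are
bounded below in each variable, and each monomial occurs finitely often. -/
noncomputable def pathFamily (n : ℕ) [NeZero n] (μ α β : YoungDiagram) :
    HahnSeries.SummableFamily (Lex (Fin n → ℤ)) ℚ (Path α β) where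
  toFun := pathWeight n μ
  isPWO_iUnion_support' := by
    have hmono : Monotone (fun x : Fin n → ℕ =>
        toLex (fun i => (x i : ℤ) - ((μ.card : ℤ) * α.card + μ.card * β.card))) :=
      fun x y hxy => Pi.toLex_monotone fun i => by
        have h : x i ≤ y i := hxy i
        change (x i : ℤ) - _ ≤ (y i : ℤ) - _
        omega
    refine ((Set.isPWO_of_wellQuasiOrderedLE (Set.univ : Set (Fin n → ℕ))).image_of_monotone hmono).mono ?_
    refine Set.iUnion_subset fun σ => ?_
    rcases pathWeight_cases n μ σ with h | ⟨hadm, h⟩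
    · rw [h]; simp
    · obtain ⟨N, hN⟩ := σ.exists_bound
      rw [h N (hN N le_rfl).1 (hN N le_rfl).2]
      refine HahnSeries.support_single_subset.trans ?_
      rintro _ rfl
      refine ⟨fun i => (pathExp n σ N i + ((μ.card : ℤ) * α.card + μ.card * β.card)).toNat,
        trivial, ?_⟩
      dsimp only
      congr 1
      funext i
      have := pathExp_lower n hadm N i
      omega
  finite_co_support' g := by
    set M : ℕ := (∑ i, ofLex g i + μ.card * α.card + μ.card * β.card).toNat with hM
    have key : ∀ σ : Path α β, (pathWeight n μ σ).coeff g ≠ 0 →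
        (∀ t, (σ.toFun t).card ≤ M + α.card + β.card) ∧
        (∀ t : ℤ, t < -(μ.card + M : ℤ) → σ.toFun t = α) ∧
        (∀ t : ℤ, (μ.card + M : ℤ) < t → σ.toFun t = β) := by
      intro σ hσ
      rcases pathWeight_cases n μ σ with h | ⟨hadm, h⟩
      · rw [h] at hσ; exact absurd rfl hσ
      · obtain ⟨N, hN⟩ := σ.exists_bound
        rw [h N (hN N le_rfl).1 (hN N le_rfl).2] at hσ
        have hg : g = toLex (pathExp n σ N) := by
          by_contra hne
          exact hσ (HahnSeries.coeff_single_of_ne hne)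
        refine path_bounds (n := n) hadm (hN N le_rfl).1 (hN N le_rfl).2 ?_
        rw [hM, hg]
        exact Int.self_le_toNat _
    have hfin : Finite {ν : YoungDiagram // ν.card ≤ M + α.card + β.card} :=
      (finite_card_le _).to_subtype
    refine Set.Finite.of_injOn (t := Set.univ)
      (f := fun (σ : Path α β) (s : Finset.Icc (-(μ.card + M : ℤ)) (μ.card + M)) =>
        if h : (σ.toFun s).card ≤ M + α.card + β.card then
          (⟨σ.toFun s, h⟩ : {ν : YoungDiagram // ν.card ≤ M + α.card + β.card})
        else ⟨α, by omega⟩) (fun _ _ => trivial) ?_ Set.finite_univ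
    intro σ hσ τ hτ hst
    obtain ⟨a1, a2, a3⟩ := key σ hσ
    obtain ⟨b1, b2, b3⟩ := key τ hτ
    refine Path.ext' (funext fun t => ?_)
    rcases lt_or_ge t (-(μ.card + M : ℤ)) with h | h
    · rw [a2 t h, b2 t h]
    rcases lt_or_ge (μ.card + M : ℤ) t with h' | h'
    · rw [a3 t h', b3 t h']
    have := congrFun hst ⟨t, Finset.mem_Icc.2 ⟨h, h'⟩⟩
    simpa [a1 t, b1 t] using this

/-- The vertex operator expectation `⟨α| ∏_{t ∈ ℤ} Γ_{μ(t)}(𝔮_t^{-μ(t)}) |β⟩`, with `t` increasing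
from left to right: the matrix coefficient of the ordered infinite product, that is the formal sum
over all intermediate states. -/
noncomputable def expectation (n : ℕ) [NeZero n] (μ α β : YoungDiagram) : LaurentField n :=
  (pathFamily n μ α β).hsum

/-- `V^n_{ρ⁺,ρ⁻,μ} = q_0^{-|ρ⁺|} ⟨(ρ⁻)'| ∏_t Γ_{μ(t)}(𝔮_t^{-μ(t)}) |ρ⁺⟩`. -/
noncomputable def vertexV (n : ℕ) [NeZero n] (ρp ρm μ : YoungDiagram) : LaurentField n :=
  qvar n 0 ^ (-(ρp.card : ℤ)) * expectation n μ ρm.transpose ρp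

/-- The reduced multi-regular vertex `P^n_{ρ⁺,ρ⁻,μ} = V^n_{ρ⁺,ρ⁻,μ} / V^n_{∅,∅,∅}`. For `n = 1`
this is a Laurent series in the single variable `q = q_0`. -/
noncomputable def vertexP (n : ℕ) [NeZero n] (ρp ρm μ : YoungDiagram) : LaurentField n :=
  vertexV n ρp ρm μ / vertexV n ⊥ ⊥ ⊥

/-- The box `(i, j)` has colour `j - i` modulo `n`. -/
def boxColor (n : ℕ) [NeZero n] (c : ℕ × ℕ) : Fin n := color n ((c.2 : ℤ) - c.1)

/-- The same number of boxes of each colour. -/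
def Balanced (n : ℕ) [NeZero n] (μ : YoungDiagram) : Prop :=
  ∀ a b : Fin n, (μ.cells.filter (fun c => boxColor n c = a)).card =
    (μ.cells.filter (fun c => boxColor n c = b)).card

/-- `lam = (lam_0, …, lam_{n-1})` is the `n`-quotient of `μ`: the slope sequence of `μ` interlaces
those of the `lam_k`, `μ(t) = lam_{t mod n}((t - (t mod n)) / n)`. -/
def IsQuotient (n : ℕ) [NeZero n] (lam : Fin n → YoungDiagram) (μ : YoungDiagram) : Prop :=
  ∀ t : ℤ, slope μ t = slope (lam (color n t)) ((t - t % (n : ℤ)) / n)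

/-- Two boxes share an edge. -/
def BoxAdj (c d : ℕ × ℕ) : Prop :=
  (c.1 = d.1 ∧ (c.2 + 1 = d.2 ∨ d.2 + 1 = c.2)) ∨ (c.2 = d.2 ∧ (c.1 + 1 = d.1 ∨ d.1 + 1 = c.1))

/-- A set of boxes is connected through shared edges. -/
def BoxConnected (S : Finset (ℕ × ℕ)) : Prop :=
  ∀ c ∈ S, ∀ d ∈ S, Relation.ReflTransGen (fun a b => a ∈ S ∧ b ∈ S ∧ BoxAdj a b) c d

/-- The boxes of `μ` outside `ν` form an `n`-border strip of `μ`: removing them leaves the Young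
diagram `ν`, there are `n` of them, they are connected and contain no `2 × 2` square. -/
def IsBorderStrip (n : ℕ) (ν μ : YoungDiagram) : Prop :=
  ν ≤ μ ∧ (μ.cells \ ν.cells).card = n ∧ BoxConnected (μ.cells \ ν.cells) ∧
    ¬ ∃ i j : ℕ, (i, j) ∈ μ.cells \ ν.cells ∧ (i + 1, j) ∈ μ.cells \ ν.cells ∧
      (i, j + 1) ∈ μ.cells \ ν.cells ∧ (i + 1, j + 1) ∈ μ.cells \ ν.cells

/-- The height of the strip: the number of rows that it occupies, minus one. -/
def stripHeight (ν μ : YoungDiagram) : ℕ := ((μ.cells \ ν.cells).image Prod.fst).card - 1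

/-- `μ` can be decomposed by successively pulling off `n`-border strips, down to the empty diagram,
with total height `H`. -/
inductive StripDecomposition (n : ℕ) : YoungDiagram → ℕ → Prop
  | empty : StripDecomposition n ⊥ 0
  | add {ν μ : YoungDiagram} {H : ℕ} : StripDecomposition n ν H → IsBorderStrip n ν μ →
      StripDecomposition n μ (H + stripHeight ν μ)

open Classical in
/-- The sign `χ_μ(n^d) / dim(λ) = (-1)^{∑ ht(ν_i)}` of a decomposition of `μ` into `n`-border
strips (and `0` if there is none, which does not happen for balanced `μ`). -/
noncomputable def chiSign (n : ℕ) (μ : YoungDiagram) : ℤ :=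
  if h : ∃ H, StripDecomposition n μ H then (-1) ^ h.choose else 0

/-- The normalized orbifold vertex
`P̃^X_{ρ⁺,ρ⁻,μ} = (χ_μ(n^d)/dim(λ) · ∏_{(i,j) ∈ μ} q_{j-i}^i) P^X_{ρ⁺,ρ⁻,μ}`. -/
noncomputable def normalizedX (n : ℕ) [NeZero n] (ρp ρm μ : YoungDiagram) : LaurentField n :=
  ((chiSign n μ : LaurentField n) * ∏ c ∈ μ.cells, qvar n (boxColor n c) ^ c.1) *
    vertexP n ρp ρm μ

/-- Power series in `v_1, …, v_m` over the Laurent series in `q`; the index `i : Fin m` stands for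
the variable `v_{i+1}`. Here and below `n = m + 1`. -/
abbrev YSeries (m : ℕ) : Type := MvPowerSeries (Fin m) (LaurentField 1)

/-- The finite set of partitions of size `d`. -/
noncomputable def partitionsOfSize (d : ℕ) : Finset YoungDiagram :=
  ((finite_card_le d).subset (fun _ h => le_of_eq h) : {μ : YoungDiagram | μ.card = d}.Finite).toFinset

/-- The sequence `τ_0 = (ρ⁻)', τ_1, …, τ_{n-1}, τ_n = ρ⁺`; the index `i : Fin m` of the argument
`τ` stands for `τ_{i+1}`. -/
def chain (m : ℕ) (ρp ρm : YoungDiagram) (τ : Fin m → YoungDiagram) : Fin (m + 2) → YoungDiagram :=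
  Fin.cons ρm.transpose (Fin.snoc τ ρp : Fin (m + 1) → YoungDiagram)

/-- The resolved vertex
`P^Y_{ρ⁺,ρ⁻,(λ_0,…,λ_{n-1})} = ∑_{τ_1,…,τ_{n-1}} P^1_{τ_1,ρ⁻,λ_0} (q v_1)^{|τ_1|}
P^1_{τ_2,τ_1',λ_1} ⋯ (q v_{n-1})^{|τ_{n-1}|} P^1_{ρ⁺,τ_{n-1}',λ_{n-1}}`, where `P^1` is the one-variable
vertex in `q`. The coefficient of `v_1^{d_1} ⋯ v_{n-1}^{d_{n-1}}` is the sum over the finitely many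
`τ` with `|τ_k| = d_k`. -/
noncomputable def vertexY (m : ℕ) (ρp ρm : YoungDiagram) (lam : Fin (m + 1) → YoungDiagram) :
    YSeries m :=
  fun d => ∑ τ ∈ Fintype.piFinset (fun k => partitionsOfSize (d k)),
    (∏ k, qtot 1 ^ (τ k).card) *
      ∏ k : Fin (m + 1), vertexP 1 (chain m ρp ρm τ k.succ)
        (chain m ρp ρm τ k.castSucc).transpose (lam k)

/-- The normalized resolved vertex `P̃^Y = (∏_k ∏_{(i,j) ∈ λ_k} q^i) P^Y`. -/
noncomputable def normalizedY (m : ℕ) (ρp ρm : YoungDiagram) (lam : Fin (m + 1) → YoungDiagram) :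
    YSeries m :=
  MvPowerSeries.C (∏ k, ∏ c ∈ (lam k).cells, qtot 1 ^ c.1) * vertexY m ρp ρm lam

/-- The factor `∏_k ∏_{(i,j) ∈ λ_k} (-1)^{n-k-1} q^{(n-k-1)(i-j)} ∏_{l > k} v_l^{n-l}`, with
`n = m + 1`; the index `l : Fin m` stands for `v_{l+1}`, so `n - (l + 1) = m - l`. -/
noncomputable def changeFactor (m : ℕ) (lam : Fin (m + 1) → YoungDiagram) : YSeries m :=
  ∏ k : Fin (m + 1), ∏ c ∈ (lam k).cells,
    ((-1) ^ (m - (k : ℕ)) *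
      MvPowerSeries.C (qtot 1 ^ (((m : ℤ) - (k : ℕ)) * ((c.1 : ℤ) - c.2))) *
      ∏ l ∈ Finset.univ.filter (fun l : Fin m => (k : ℕ) < (l : ℕ) + 1),
        MvPowerSeries.X l ^ (m - (l : ℕ)))

/-- `x = y` after the change of variables `v_i ↔ q_i` (`1 ≤ i ≤ m`) and `q = q_0 q_1 ⋯ q_m`, as an
equality of rational functions: there is one rational function `A / B` in `q, v_1, …, v_m` of
which `y` is the expansion as a power series in the `v_i` over the Laurent series in `q`, and of
which, after substituting `v_i = q_i` and `q = q_0 q_1 ⋯ q_m`, `x` is the expansion as a Laurent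
series in `q_0, …, q_m`. In the polynomials `A`, `B` the variable `0` is `q` and the variable
`i ≥ 1` is `v_i`. -/
def EqAfterChange (m : ℕ) (x : LaurentField (m + 1)) (y : YSeries m) : Prop :=
  ∃ A B : MvPolynomial (Fin (m + 1)) ℚ, B ≠ 0 ∧
    MvPolynomial.aeval
        (Fin.cons (MvPowerSeries.C (qtot 1)) MvPowerSeries.X : Fin (m + 1) → YSeries m) B * y =
      MvPolynomial.aeval
        (Fin.cons (MvPowerSeries.C (qtot 1)) MvPowerSeries.X : Fin (m + 1) → YSeries m) A ∧
    MvPolynomial.aeval (Fin.cons (qtot (m + 1)) (fun i : Fin m => qvar (m + 1) i.succ) :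
        Fin (m + 1) → LaurentField (m + 1)) B * x =
      MvPolynomial.aeval (Fin.cons (qtot (m + 1)) (fun i : Fin m => qvar (m + 1) i.succ) :
        Fin (m + 1) → LaurentField (m + 1)) A

/-! The two denominators are invertible. -/

theorem coeff_pathWeight_nonneg (n : ℕ) [NeZero n] (μ : YoungDiagram) {α β : YoungDiagram}
    (σ : Path α β) (g) : 0 ≤ (pathWeight n μ σ).coeff g := by
  rcases pathWeight_cases n μ σ with h | ⟨_, h⟩
  · rw [h]; simp
  · obtain ⟨N, hN⟩ := σ.exists_bound
    rw [h N (hN N le_rfl).1 (hN N le_rfl).2]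
    unfold mono
    by_cases hg : g = toLex (pathExp n σ N)
    · subst hg; simp
    · rw [HahnSeries.coeff_single_of_ne hg]

/-- The denominator `V^n_{∅,∅,∅}` is nonzero. -/
theorem vertexV_empty_ne_zero (n : ℕ) [NeZero n] : vertexV n ⊥ ⊥ ⊥ ≠ 0 := by
  have hb : (⊥ : YoungDiagram).transpose = ⊥ := by
    ext c; simp [YoungDiagram.transpose]
  have hc : (⊥ : YoungDiagram).card = 0 := rfl
  unfold vertexV expectation
  rw [hb, hc]
  intro h
  simp only [Nat.cast_zero, neg_zero, zpow_zero, one_mul] at h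
  have h1 := congrArg (fun x => HahnSeries.coeff x 0) h
  simp only [HahnSeries.SummableFamily.coeff_hsum, HahnSeries.coeff_zero] at h1
  let σ : Path ⊥ ⊥ := ⟨fun _ => ⊥, by simp, by simp⟩
  have h2 : (pathWeight n ⊥ σ) = 1 := by
    simp [pathWeight, σ, Gamma_self]
  have h3 := single_le_finsum σ ((pathFamily n ⊥ ⊥ ⊥).finite_co_support 0)
    (fun τ => coeff_pathWeight_nonneg n ⊥ τ 0)
  rw [h1] at h3
  change (pathWeight n ⊥ σ).coeff 0 ≤ 0 at h3
  rw [h2] at h3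
  simp at h3
  exact absurd h3 (by norm_num)

/-- The series `P^Y_{∅,∅,∅}` has constant coefficient `1`, hence is invertible. -/
theorem vertexY_empty (m : ℕ) :
    MvPowerSeries.constantCoeff (vertexY m ⊥ ⊥ (fun _ => ⊥)) = 1 := by
  have hb : (⊥ : YoungDiagram).transpose = ⊥ := by
    ext c; simp [YoungDiagram.transpose]
  have hp : partitionsOfSize 0 = {⊥} := by
    ext μ
    simp only [partitionsOfSize, Set.Finite.mem_toFinset, Set.mem_ofPred_eq, Finset.mem_singleton]
    constructor
    · intro h; exact YoungDiagram.ext (Finset.card_eq_zero.1 h)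
    · rintro rfl; rfl
  have hch : ∀ k, chain m ⊥ ⊥ (fun _ => ⊥) k = ⊥ := by
    intro k
    refine Fin.cases ?_ (fun k => ?_) k
    · simp [chain, hb]
    · refine Fin.lastCases ?_ (fun k => ?_) k <;> simp [chain]
  change ∑ τ ∈ Fintype.piFinset (fun k => partitionsOfSize ((0 : Fin m →₀ ℕ) k)), _ = _
  simp only [Finsupp.coe_zero, Pi.zero_apply, hp]
  rw [Fintype.piFinset_singleton, Finset.sum_singleton]
  simp only [hch, hb]
  have : vertexP 1 ⊥ ⊥ ⊥ = 1 := div_self (vertexV_empty_ne_zero 1)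
  simp [this, YoungDiagram.card]

end VertexCRC

/-!
Write `n = m + 1`. Both vertices are matrix coefficients of words of vertex operators: the operator
of the slope `λ_k(s)` stands at the position `(k, s)`, and its argument is the monomial
`Q(k, s) = q^s v_1 ⋯ v_k` or its inverse (`posMono`), which becomes `𝔮_{ns+k}` after the change of
variables. For the orbifold the positions are ordered by `ns + k`, since the slope of the diagram at
`ns + k` is `λ_k(s)`. For the resolution they are ordered by `k` first: conjugation by weight
operators absorbs the weights `(q v_k)^{|τ_k|}` between the blocks into the arguments
(`chainOp_conj`, `wordCoeff_posY`). So the theorem compares two orders of the same operators.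

Normal ordering, by the commutation relation of `Γ_{+1}` and `Γ_{-1}` (`gammaPlus_gammaMinus`), splits
such a matrix coefficient into two factors (`wordDenom_mul_wordCoeff`). One is a sum of products of
skew Schur polynomials in the arguments. It depends on the boundary states but not on the order,
because skew Schur polynomials are symmetric (`skew_perm`), and it tends to a rational function when
the window of positions grows, because the arguments are geometric progressions apart from finitely
many (`exists_limXY_skew`). Hence the boundary states contribute the same rational function on both
sides (`exists_expectation_factor`). The other factor is the inverse of the product of
`1 - Q(p') / Q(p)` over all pairs of a slope `+1` at `p` and a slope `-1` at `p'` to its right. It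
depends on the order and is not rational, but its ratio to that of the empty partitions is.

That ratio is computed one box at a time. Adding a box to `λ_k` exchanges the slopes at two
consecutive positions of the class `k`, which changes the second factor by an explicit rational
function (`expectation_addBox`, `fullY_addBox`). On the diagram it adds an `n`-border strip
(`RimStep`, `IsBorderStrip.exists_rimStep`). The rational functions for the two orders differ by
factors of the form `(1 - x) / (1 - x⁻¹) = -x`, so by a signed monomial, after a telescoping product
over each class (`step_comparison`). The signed monomial for the orbifold is the sign and the
monomial `∏ q_{j-i}^i` of the border strip (`prod_stripWeight`), the one for the resolution is the
factor of the new box in the normalization and in the change of variables (`expandY_boxWeight`).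
Induction on a decomposition into border strips gives `exists_expectation_ratio`.

Limits are taken with an auxiliary variable `z` that counts the boxes removed by the operators
`Γ_{+1}`; it makes all sums finite in each degree, and `ConvX`, `ConvY` describe the passage to
`z = 1` and to an infinite window. The rational function of the theorem is found in the field
`RatField m`, which is mapped to Laurent series by `expandX` and to quotients of power series in the
`v_i` by `expandY`.
-/

namespace VertexCRC

/-! ### Partitions given by their row lengths -/

theorem rowLen_ext {μ ν : YoungDiagram} (h : ∀ i, μ.rowLen i = ν.rowLen i) : μ = ν := by
  ext ⟨i, j⟩
  rw [YoungDiagram.mem_cells, YoungDiagram.mem_cells, YoungDiagram.mem_iff_lt_rowLen,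
    YoungDiagram.mem_iff_lt_rowLen, h]

/-- The partition with prescribed parts `f 0 ≥ f 1 ≥ ⋯`, where `f L = 0`. -/
def ofRows (f : ℕ → ℕ) (hf : Antitone f) (L : ℕ) (_hL : f L = 0) : YoungDiagram where
  cells := (Finset.range L ×ˢ Finset.range (f 0)).filter fun c => c.2 < f c.1
  isLowerSet := by
    rintro ⟨i, j⟩ ⟨i', j'⟩ ⟨h1, h2⟩ hc
    simp only [Finset.coe_filter, Finset.mem_product, Finset.mem_range, Set.mem_ofPred_eq] at hc ⊢
    have := hf h1
    simp only at h1 h2 this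
    omega

theorem rowLen_ofRows (f : ℕ → ℕ) (hf : Antitone f) (L : ℕ) (hL : f L = 0) (i : ℕ) :
    (ofRows f hf L hL).rowLen i = f i := by
  have key : ∀ j, j < (ofRows f hf L hL).rowLen i ↔ j < f i := by
    intro j
    rw [← YoungDiagram.mem_iff_lt_rowLen, ← YoungDiagram.mem_cells]
    simp only [ofRows, Finset.mem_filter, Finset.mem_product, Finset.mem_range]
    constructor
    · exact fun h => h.2
    · intro h
      refine ⟨⟨?_, h.trans_le (hf (Nat.zero_le _))⟩, h⟩
      by_contra hi
      have := hf (not_lt.1 hi)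
      omega
  exact eq_of_forall_lt_iff key

theorem card_eq_sum_rowLen (μ : YoungDiagram) {L : ℕ} (hL : μ.rowLen L = 0) :
    μ.card = ∑ i ∈ Finset.range L, μ.rowLen i := by
  have h : ∀ c ∈ μ.cells, c.1 ∈ Finset.range L := by
    rintro ⟨i, j⟩ hc
    have h1 := YoungDiagram.mem_iff_lt_rowLen.1 ((YoungDiagram.mem_cells _).1 hc)
    by_contra hi
    have := μ.rowLen_anti L i (by simpa using hi)
    omega
  unfold YoungDiagram.card
  rw [Finset.card_eq_sum_card_fiberwise h]
  refine Finset.sum_congr rfl fun i _ => ?_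
  rw [YoungDiagram.rowLen_eq_card]
  rfl

theorem rowLen_mono {μ ν : YoungDiagram} (h : μ ≤ ν) (i : ℕ) : μ.rowLen i ≤ ν.rowLen i := by
  by_contra hlt
  have h1 : (i, ν.rowLen i) ∈ μ := YoungDiagram.mem_iff_lt_rowLen.2 (not_le.1 hlt)
  exact lt_irrefl _ (YoungDiagram.mem_iff_lt_rowLen.1 (h h1))

theorem eq_of_le_of_card {μ ν : YoungDiagram} (h : μ ≤ ν) (hc : ν.card ≤ μ.card) : μ = ν :=
  YoungDiagram.ext (Finset.eq_of_subset_of_card_le (YoungDiagram.cells_subset_iff.2 h) hc)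

/-- The partitions of size at most `M`. -/
noncomputable def upto (M : ℕ) : Finset YoungDiagram := (finite_card_le M).toFinset

@[simp] theorem mem_upto {M : ℕ} {μ : YoungDiagram} : μ ∈ upto M ↔ μ.card ≤ M := by
  simp [upto]

open Classical in
/-- The partitions `κ ≺ σ`. -/
noncomputable def below (σ : YoungDiagram) : Finset YoungDiagram :=
  (upto σ.card).filter (Interlace σ)

@[simp] theorem mem_below {σ κ : YoungDiagram} : κ ∈ below σ ↔ Interlace σ κ := by
  simp only [below, Finset.mem_filter, mem_upto, and_iff_right_iff_imp]
  exact fun h => card_mono h.le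

theorem Interlace.card_le {τ σ : YoungDiagram} (h : Interlace τ σ) : σ.card ≤ τ.card :=
  card_mono h.le

/-! ### The bijections behind the commutation relations -/

/-- Adding a box to the first row. -/
def bump (τ : YoungDiagram) : YoungDiagram :=
  ofRows (fun i => if i = 0 then τ.rowLen 0 + 1 else τ.rowLen i)
    (by
      intro a b hab
      have := τ.rowLen_anti a b hab
      have := τ.rowLen_anti 0 b (Nat.zero_le _)
      dsimp only
      split_ifs <;> subst_vars <;> omega)
    (τ.card + 1) (by simp [rowLen_of_card (Nat.le_succ τ.card)])

theorem rowLen_bump (τ : YoungDiagram) (i : ℕ) :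
    (bump τ).rowLen i = if i = 0 then τ.rowLen 0 + 1 else τ.rowLen i :=
  rowLen_ofRows _ _ _ _ _

theorem card_bump (τ : YoungDiagram) : (bump τ).card = τ.card + 1 := by
  have e := card_eq_sum_rowLen τ (L := τ.card + 1) (rowLen_of_card (Nat.le_succ _))
  rw [Finset.sum_range_succ'] at e
  rw [card_eq_sum_rowLen (bump τ) (L := τ.card + 1)
    (by rw [rowLen_bump]; simp [rowLen_of_card (Nat.le_succ τ.card)]), Finset.sum_range_succ']
  simp only [rowLen_bump, Nat.add_eq_zero_iff, one_ne_zero, and_false, if_false, if_true]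
  omega

theorem bump_injective : Function.Injective bump := by
  intro a b h
  refine rowLen_ext fun i => ?_
  have := congrArg (fun μ => μ.rowLen i) h
  simp only [rowLen_bump] at this
  split_ifs at this with hi
  · subst hi; omega
  · exact this

theorem interlace_bump {τ σ : YoungDiagram} (h : Interlace τ σ) : Interlace (bump τ) σ := by
  intro i
  have := h i
  rw [rowLen_bump, rowLen_bump]
  simp only [Nat.add_eq_zero_iff, one_ne_zero, and_false, if_false]
  split_ifs with hi
  · subst hi; omega
  · exact this

/-- If the first part of `τ` exceeds those of `σ` and `κ`, then a box can be removed from the first row. -/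
theorem exists_bump {τ σ κ : YoungDiagram} (h1 : Interlace τ σ) (h2 : Interlace τ κ)
    (h : max (σ.rowLen 0) (κ.rowLen 0) < τ.rowLen 0) :
    ∃ τ', bump τ' = τ ∧ Interlace τ' σ ∧ Interlace τ' κ := by
  have hanti : Antitone fun i => if i = 0 then τ.rowLen 0 - 1 else τ.rowLen i := by
    refine antitone_nat_of_succ_le fun i => ?_
    have := (h1 i)
    have := τ.rowLen_anti i (i + 1) (Nat.le_succ i)
    simp only [Nat.add_eq_zero_iff, one_ne_zero, and_false, if_false]
    split_ifs with hi
    · subst hi; simp only [max_lt_iff] at h; simp only [zero_add] at *; omega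
    · omega
  have hr := rowLen_ofRows _ hanti (τ.card + 1) (by simp [rowLen_of_card (Nat.le_succ τ.card)])
  rw [max_lt_iff] at h
  refine ⟨ofRows _ hanti (τ.card + 1) (by simp [rowLen_of_card (Nat.le_succ τ.card)]), ?_, ?_, ?_⟩
  · refine rowLen_ext fun i => ?_
    rw [rowLen_bump, hr, hr]
    rcases i with _ | i
    · simp only [if_true]; omega
    · simp
  · intro i
    have := h1 i
    rw [hr, hr]
    simp only [Nat.add_eq_zero_iff, one_ne_zero, and_false, if_false]
    split_ifs with hi
    · subst hi; omega
    · exact this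
  · intro i
    have := h2 i
    rw [hr, hr]
    simp only [Nat.add_eq_zero_iff, one_ne_zero, and_false, if_false]
    split_ifs with hi
    · subst hi; omega
    · exact this

/-- For `η ≺ σ` and `η ≺ κ`, the partition `τ ≻ σ, κ` whose first part is as small as possible and
whose other parts are the reflections of the parts of `η` in the interlacing intervals. -/
def flipUp (σ κ η : YoungDiagram) (h1 : Interlace σ η) (h2 : Interlace κ η) : YoungDiagram :=
  ofRows (fun i => if i = 0 then max (σ.rowLen 0) (κ.rowLen 0) else
      max (σ.rowLen i) (κ.rowLen i) + min (σ.rowLen (i - 1)) (κ.rowLen (i - 1)) - η.rowLen (i - 1))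
    (by
      refine antitone_nat_of_succ_le fun i => ?_
      simp only [Nat.add_eq_zero_iff, one_ne_zero, and_false, if_false, Nat.add_sub_cancel]
      have a1 := h1 i
      have a2 := h2 i
      split_ifs with hi
      · subst hi; omega
      · have b1 := h1 (i - 1)
        have b2 := h2 (i - 1)
        rw [Nat.sub_add_cancel (Nat.pos_of_ne_zero hi)] at b1 b2
        omega)
    (σ.card + κ.card + 1) (by
      simp [rowLen_of_card (show σ.card ≤ σ.card + κ.card + 1 by omega),
        rowLen_of_card (show κ.card ≤ σ.card + κ.card + 1 by omega),
        rowLen_of_card (show σ.card ≤ σ.card + κ.card by omega),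
        rowLen_of_card (show κ.card ≤ σ.card + κ.card by omega)])

theorem rowLen_flipUp_zero (σ κ η : YoungDiagram) (h1 : Interlace σ η) (h2 : Interlace κ η) :
    (flipUp σ κ η h1 h2).rowLen 0 = max (σ.rowLen 0) (κ.rowLen 0) := by
  simp [flipUp, rowLen_ofRows]

theorem rowLen_flipUp_succ (σ κ η : YoungDiagram) (h1 : Interlace σ η) (h2 : Interlace κ η)
    (i : ℕ) : (flipUp σ κ η h1 h2).rowLen (i + 1) + η.rowLen i =
      max (σ.rowLen (i + 1)) (κ.rowLen (i + 1)) + min (σ.rowLen i) (κ.rowLen i) := by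
  have a1 := h1 i
  have a2 := h2 i
  simp only [flipUp, rowLen_ofRows, Nat.add_eq_zero_iff, one_ne_zero, and_false, if_false,
    Nat.add_sub_cancel]
  omega

theorem interlace_flipUp_left (σ κ η : YoungDiagram) (h1 : Interlace σ η) (h2 : Interlace κ η) :
    Interlace (flipUp σ κ η h1 h2) σ := by
  intro i
  have a1 := h1 i
  have a2 := h2 i
  have a3 := rowLen_flipUp_succ σ κ η h1 h2 i
  refine ⟨?_, by omega⟩
  rcases i with _ | i
  · rw [rowLen_flipUp_zero]; exact le_max_left _ _
  · have := rowLen_flipUp_succ σ κ η h1 h2 i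
    have b1 := h1 i
    have b2 := h2 i
    omega

theorem interlace_flipUp_right (σ κ η : YoungDiagram) (h1 : Interlace σ η) (h2 : Interlace κ η) :
    Interlace (flipUp σ κ η h1 h2) κ := by
  intro i
  have a1 := h1 i
  have a2 := h2 i
  have a3 := rowLen_flipUp_succ σ κ η h1 h2 i
  refine ⟨?_, by omega⟩
  rcases i with _ | i
  · rw [rowLen_flipUp_zero]; exact le_max_right _ _
  · have := rowLen_flipUp_succ σ κ η h1 h2 i
    have b1 := h1 i
    have b2 := h2 i
    omega

theorem card_flipUp (σ κ η : YoungDiagram) (h1 : Interlace σ η) (h2 : Interlace κ η) :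
    (flipUp σ κ η h1 h2).card + η.card = σ.card + κ.card := by
  set L := σ.card + κ.card + η.card with hL
  have hf : (flipUp σ κ η h1 h2).rowLen (L + 1) = 0 := by
    have := rowLen_flipUp_succ σ κ η h1 h2 L
    rw [rowLen_of_card (show σ.card ≤ L + 1 by omega),
      rowLen_of_card (show κ.card ≤ L + 1 by omega), rowLen_of_card (show σ.card ≤ L by omega)]
      at this
    simp at this
    omega
  rw [card_eq_sum_rowLen _ hf, card_eq_sum_rowLen η (L := L) (rowLen_of_card (by omega)),
    card_eq_sum_rowLen σ (L := L) (rowLen_of_card (by omega)),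
    card_eq_sum_rowLen κ (L := L) (rowLen_of_card (by omega)),
    Finset.sum_range_succ', rowLen_flipUp_zero, add_right_comm, ← Finset.sum_add_distrib,
    Finset.sum_congr rfl fun i _ => rowLen_flipUp_succ σ κ η h1 h2 i, Finset.sum_add_distrib,
    add_right_comm, ← Finset.sum_range_succ' fun i => max (σ.rowLen i) (κ.rowLen i),
    Finset.sum_range_succ, rowLen_of_card (show σ.card ≤ L by omega),
    rowLen_of_card (show κ.card ≤ L by omega), max_self, add_zero, ← Finset.sum_add_distrib,
    ← Finset.sum_add_distrib]
  exact Finset.sum_congr rfl fun i _ => max_add_min _ _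

/-- The partitions `τ ≻ σ, κ` with smallest possible first part are those of the form `flipUp`. -/
theorem exists_flipUp {σ κ τ : YoungDiagram} (h1 : Interlace τ σ) (h2 : Interlace τ κ)
    (h : τ.rowLen 0 = max (σ.rowLen 0) (κ.rowLen 0)) :
    ∃ η, ∃ (a : Interlace σ η) (b : Interlace κ η), flipUp σ κ η a b = τ := by
  have hanti : Antitone fun i => max (σ.rowLen (i + 1)) (κ.rowLen (i + 1)) +
      min (σ.rowLen i) (κ.rowLen i) - τ.rowLen (i + 1) := by
    refine antitone_nat_of_succ_le fun i => ?_
    have a1 := h1 i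
    have a2 := h2 i
    have b1 := h1 (i + 1)
    have b2 := h2 (i + 1)
    have c1 := h1 (i + 1 + 1)
    have c2 := h2 (i + 1 + 1)
    omega
  have hr := rowLen_ofRows _ hanti (σ.card + κ.card) (by
    simp [rowLen_of_card (show σ.card ≤ σ.card + κ.card + 1 by omega),
        rowLen_of_card (show κ.card ≤ σ.card + κ.card + 1 by omega),
        rowLen_of_card (show σ.card ≤ σ.card + κ.card by omega),
        rowLen_of_card (show κ.card ≤ σ.card + κ.card by omega)])
  have a : Interlace σ (ofRows _ hanti (σ.card + κ.card) (by
    simp [rowLen_of_card (show σ.card ≤ σ.card + κ.card + 1 by omega),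
        rowLen_of_card (show κ.card ≤ σ.card + κ.card + 1 by omega),
        rowLen_of_card (show σ.card ≤ σ.card + κ.card by omega),
        rowLen_of_card (show κ.card ≤ σ.card + κ.card by omega)])) := by
    intro i
    have a1 := h1 i
    have a2 := h2 i
    have b1 := h1 (i + 1)
    have b2 := h2 (i + 1)
    rw [hr]
    omega
  have b : Interlace κ (ofRows _ hanti (σ.card + κ.card) (by
    simp [rowLen_of_card (show σ.card ≤ σ.card + κ.card + 1 by omega),
        rowLen_of_card (show κ.card ≤ σ.card + κ.card + 1 by omega),
        rowLen_of_card (show σ.card ≤ σ.card + κ.card by omega),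
        rowLen_of_card (show κ.card ≤ σ.card + κ.card by omega)])) := by
    intro i
    have a1 := h1 i
    have a2 := h2 i
    have b1 := h1 (i + 1)
    have b2 := h2 (i + 1)
    rw [hr]
    omega
  refine ⟨_, a, b, rowLen_ext fun i => ?_⟩
  rcases i with _ | i
  · rw [rowLen_flipUp_zero, h]
  · have := rowLen_flipUp_succ σ κ _ a b i
    rw [hr] at this
    have a1 := h1 i
    have a2 := h2 i
    have b1 := h1 (i + 1)
    have b2 := h2 (i + 1)
    omega

theorem flipUp_injective {σ κ η η' : YoungDiagram} {a : Interlace σ η} {b : Interlace κ η}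
    {a' : Interlace σ η'} {b' : Interlace κ η'} (h : flipUp σ κ η a b = flipUp σ κ η' a' b') :
    η = η' := by
  refine rowLen_ext fun i => ?_
  have h1 := rowLen_flipUp_succ σ κ η a b i
  have h2 := rowLen_flipUp_succ σ κ η' a' b' i
  rw [h] at h1
  omega

/-- The Bender–Knuth involution on the partitions `τ` with `σ ≻ τ ≻ κ`: every part is reflected in
its interlacing interval. -/
def benderKnuth (σ κ τ : YoungDiagram) (h1 : Interlace σ τ) (h2 : Interlace τ κ) : YoungDiagram :=
  ofRows (fun i => max (κ.rowLen i) (σ.rowLen (i + 1)) +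
      (if i = 0 then σ.rowLen 0 else min (σ.rowLen i) (κ.rowLen (i - 1))) - τ.rowLen i)
    (by
      refine antitone_nat_of_succ_le fun i => ?_
      simp only [Nat.add_eq_zero_iff, one_ne_zero, and_false, if_false, Nat.add_sub_cancel]
      have a1 := h1 i
      have a2 := h2 i
      have a3 := h1 (i + 1)
      have a4 := h2 (i + 1)
      split_ifs with hi
      · subst hi; simp only [zero_add] at *; omega
      · have b1 := h1 (i - 1)
        have b2 := h2 (i - 1)
        rw [Nat.sub_add_cancel (Nat.pos_of_ne_zero hi)] at b1 b2
        omega)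
    (σ.card + κ.card + 1) (by
      simp [rowLen_of_card (show σ.card ≤ σ.card + κ.card + 1 by omega),
        rowLen_of_card (show κ.card ≤ σ.card + κ.card + 1 by omega),
        rowLen_of_card (show σ.card ≤ σ.card + κ.card + 1 + 1 by omega)])

theorem rowLen_benderKnuth_zero (σ κ τ : YoungDiagram) (h1 : Interlace σ τ)
    (h2 : Interlace τ κ) : (benderKnuth σ κ τ h1 h2).rowLen 0 + τ.rowLen 0 =
      max (κ.rowLen 0) (σ.rowLen 1) + σ.rowLen 0 := by
  have a1 := h1 0
  have a2 := h2 0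
  simp [benderKnuth, rowLen_ofRows]
  omega

theorem rowLen_benderKnuth_succ (σ κ τ : YoungDiagram) (h1 : Interlace σ τ)
    (h2 : Interlace τ κ) (i : ℕ) :
    (benderKnuth σ κ τ h1 h2).rowLen (i + 1) + τ.rowLen (i + 1) =
      max (κ.rowLen (i + 1)) (σ.rowLen (i + 2)) + min (σ.rowLen (i + 1)) (κ.rowLen i) := by
  have a1 := h1 i
  have a2 := h2 i
  have a3 := h1 (i + 1)
  have a4 := h2 (i + 1)
  simp only [benderKnuth, rowLen_ofRows, Nat.add_eq_zero_iff, one_ne_zero, and_false, if_false,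
    Nat.add_sub_cancel]
  simp only [add_assoc, Nat.reduceAdd] at *
  omega

theorem interlace_benderKnuth (σ κ τ : YoungDiagram) (h1 : Interlace σ τ) (h2 : Interlace τ κ) :
    Interlace σ (benderKnuth σ κ τ h1 h2) ∧ Interlace (benderKnuth σ κ τ h1 h2) κ := by
  have key : ∀ i, ((benderKnuth σ κ τ h1 h2).rowLen i ≤ σ.rowLen i ∧
      σ.rowLen (i + 1) ≤ (benderKnuth σ κ τ h1 h2).rowLen i) ∧
      (κ.rowLen i ≤ (benderKnuth σ κ τ h1 h2).rowLen i ∧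
      (benderKnuth σ κ τ h1 h2).rowLen (i + 1) ≤ κ.rowLen i) := by
    intro i
    have a1 := h1 i
    have a2 := h2 i
    have a3 := h1 (i + 1)
    have a4 := h2 (i + 1)
    have c := rowLen_benderKnuth_succ σ κ τ h1 h2 i
    simp only [add_assoc, Nat.reduceAdd] at *
    rcases i with _ | i
    · have := rowLen_benderKnuth_zero σ κ τ h1 h2
      simp only [zero_add] at *
      omega
    · have := rowLen_benderKnuth_succ σ κ τ h1 h2 i
      have b1 := h1 i
      have b2 := h2 i
      simp only [add_assoc, Nat.reduceAdd] at *
      omega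
  exact ⟨fun i => (key i).1, fun i => (key i).2⟩

theorem card_benderKnuth (σ κ τ : YoungDiagram) (h1 : Interlace σ τ) (h2 : Interlace τ κ) :
    (benderKnuth σ κ τ h1 h2).card + τ.card = σ.card + κ.card := by
  set L := σ.card + κ.card + τ.card + (benderKnuth σ κ τ h1 h2).card with hL
  have e1 : ∑ i ∈ Finset.range L, max (κ.rowLen i) (σ.rowLen (i + 1)) +
      ∑ i ∈ Finset.range L, min (κ.rowLen i) (σ.rowLen (i + 1)) + σ.rowLen 0 =
      σ.card + κ.card := by
    rw [← Finset.sum_add_distrib, Finset.sum_congr rfl fun i _ => max_add_min _ _,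
      Finset.sum_add_distrib, add_assoc, ← Finset.sum_range_succ' fun i => σ.rowLen i,
      ← card_eq_sum_rowLen σ (rowLen_of_card (by omega)),
      ← card_eq_sum_rowLen κ (rowLen_of_card (by omega)), add_comm]
  rw [← e1, card_eq_sum_rowLen (benderKnuth σ κ τ h1 h2) (L := L + 1) (rowLen_of_card (by omega)),
    card_eq_sum_rowLen τ (L := L + 1) (rowLen_of_card (by omega)),
    ← Finset.sum_add_distrib, Finset.sum_range_succ', rowLen_benderKnuth_zero,
    Finset.sum_congr rfl fun i _ => rowLen_benderKnuth_succ σ κ τ h1 h2 i,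
    Finset.sum_add_distrib]
  have e2 : ∑ i ∈ Finset.range L, max (κ.rowLen i) (σ.rowLen (i + 1)) =
      ∑ i ∈ Finset.range L, max (κ.rowLen (i + 1)) (σ.rowLen (i + 2)) +
        max (κ.rowLen 0) (σ.rowLen 1) := by
    have := Finset.sum_range_succ' (fun i => max (κ.rowLen i) (σ.rowLen (i + 1))) L
    rw [Finset.sum_range_succ, rowLen_of_card (show κ.card ≤ L by omega),
      rowLen_of_card (show σ.card ≤ L + 1 by omega)] at this
    simpa using this
  rw [e2]
  simp only [min_comm (σ.rowLen (_ + 1))]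
  omega

theorem benderKnuth_benderKnuth (σ κ τ : YoungDiagram) (a : Interlace σ τ) (b : Interlace τ κ) :
    benderKnuth σ κ (benderKnuth σ κ τ a b) (interlace_benderKnuth σ κ τ a b).1
      (interlace_benderKnuth σ κ τ a b).2 = τ := by
  refine rowLen_ext fun i => ?_
  have h := interlace_benderKnuth σ κ τ a b
  rcases i with _ | i
  · have h1 := rowLen_benderKnuth_zero σ κ τ a b
    have h2 := rowLen_benderKnuth_zero σ κ _ h.1 h.2
    omega
  · have h1 := rowLen_benderKnuth_succ σ κ τ a b i
    have h2 := rowLen_benderKnuth_succ σ κ _ h.1 h.2 i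
    omega

/-! ### Skew Schur polynomials -/

section Skew

variable {A : Type*} [CommRing A]

open Classical in
/-- The skew Schur polynomial `s_{α/η}` at a finite list of arguments, defined by peeling off one
argument at a time: `skew (y :: l) α η = ∑_{κ ≺ α} y^{|α|-|κ|} skew l κ η`. -/
noncomputable def skew : List A → YoungDiagram → YoungDiagram → A
  | [], α, η => if α = η then 1 else 0
  | y :: l, α, η => ∑ κ ∈ below α, y ^ (α.card - κ.card) * skew l κ η

theorem skew_nil (α η : YoungDiagram) [Decidable (α = η)] :
    skew ([] : List A) α η = if α = η then 1 else 0 := by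
  simp only [skew]
  congr

theorem skew_cons (y : A) (l : List A) (α η : YoungDiagram) :
    skew (y :: l) α η = ∑ κ ∈ below α, y ^ (α.card - κ.card) * skew l κ η := rfl

theorem skew_eq_zero (l : List A) {α η : YoungDiagram} (h : ¬ η ≤ α) : skew l α η = 0 := by
  classical
  induction l generalizing α with
  | nil => rw [skew_nil, if_neg]; rintro rfl; exact h le_rfl
  | cons y l ih =>
    rw [skew_cons]
    refine Finset.sum_eq_zero fun κ hκ => ?_
    rw [ih fun hle => h (hle.trans (mem_below.1 hκ).le), mul_zero]

theorem skew_eq_zero_of_card (l : List A) {α η : YoungDiagram} (h : α.card < η.card) :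
    skew l α η = 0 :=
  skew_eq_zero l fun hle => absurd (card_mono hle) (by omega)

theorem skew_self (l : List A) (α : YoungDiagram) : skew l α α = 1 := by
  classical
  induction l with
  | nil => simp [skew_nil]
  | cons y l ih =>
    rw [skew_cons, Finset.sum_eq_single α]
    · simp [ih]
    · intro κ hκ hne
      rw [skew_eq_zero_of_card, mul_zero]
      have h := (mem_below.1 hκ).le
      by_contra hc
      exact hne (eq_of_le_of_card h (by omega))
    · intro h; exact absurd (mem_below.2 (Interlace.refl α)) h

theorem skew_eq_zero_of_card_eq (l : List A) {α η : YoungDiagram} (h : α.card = η.card)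
    (hne : α ≠ η) : skew l α η = 0 :=
  skew_eq_zero l fun hle => hne (eq_of_le_of_card hle h.le).symm

theorem skew_smul (c : A) (l : List A) {α η : YoungDiagram} (h : η.card ≤ α.card) :
    skew (l.map (c * ·)) α η = c ^ (α.card - η.card) * skew l α η := by
  classical
  induction l generalizing α with
  | nil =>
    by_cases hh : α = η
    · subst hh; simp [skew_nil]
    · simp [skew_nil, hh]
  | cons y l ih =>
    rw [List.map_cons, skew_cons, skew_cons, Finset.mul_sum]
    refine Finset.sum_congr rfl fun κ hκ => ?_
    have h1 := (mem_below.1 hκ).card_le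
    rcases lt_or_ge κ.card η.card with h2 | h2
    · simp [skew_eq_zero_of_card _ h2]
    · rw [ih h2, mul_pow, show α.card - η.card = (α.card - κ.card) + (κ.card - η.card) by omega,
        pow_add]
      ring

theorem skew_append (l l' : List A) (α η : YoungDiagram) {M : ℕ} (hM : α.card ≤ M) :
    skew (l ++ l') α η = ∑ κ ∈ upto M, skew l α κ * skew l' κ η := by
  classical
  induction l generalizing α with
  | nil =>
    simp only [skew_nil, List.nil_append, ite_mul, one_mul, zero_mul]
    rw [Finset.sum_ite_eq, if_pos (by simpa using hM)]
  | cons y l ih =>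
    simp only [List.cons_append, skew_cons, Finset.sum_mul]
    rw [Finset.sum_comm]
    refine Finset.sum_congr rfl fun κ hκ => ?_
    rw [ih κ ((mem_below.1 hκ).card_le.trans hM), Finset.mul_sum]
    exact Finset.sum_congr rfl fun _ _ => by ring

theorem skew_swap (x y : A) (l : List A) (α η : YoungDiagram) :
    skew (x :: y :: l) α η = skew (y :: x :: l) α η := by
  classical
  simp only [skew_cons, Finset.mul_sum]
  rw [Finset.sum_sigma', Finset.sum_sigma']
  have hm : ∀ p : (_ : YoungDiagram) × YoungDiagram,
      p ∈ (below α).sigma (fun κ => below κ) ↔ Interlace α p.1 ∧ Interlace p.1 p.2 := by simp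
  have key : ∀ p (hp : p ∈ (below α).sigma (fun κ => below κ)),
      (⟨benderKnuth α p.2 p.1 ((hm p).1 hp).1 ((hm p).1 hp).2, p.2⟩ :
        (_ : YoungDiagram) × YoungDiagram) ∈ (below α).sigma (fun κ => below κ) := by
    intro p hp
    rw [hm]
    exact interlace_benderKnuth _ _ _ ((hm p).1 hp).1 ((hm p).1 hp).2
  refine Finset.sum_bij' (fun p hp => ⟨benderKnuth α p.2 p.1 ((hm p).1 hp).1 ((hm p).1 hp).2, p.2⟩)
    (fun p hp => ⟨benderKnuth α p.2 p.1 ((hm p).1 hp).1 ((hm p).1 hp).2, p.2⟩) key key ?_ ?_ ?_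
  · rintro ⟨τ, κ⟩ hp
    simp only [benderKnuth_benderKnuth]
  · rintro ⟨τ, κ⟩ hp
    simp only [benderKnuth_benderKnuth]
  · rintro ⟨τ, κ⟩ hp
    have h := (hm _).1 hp
    have hc := card_benderKnuth α κ τ h.1 h.2
    have h1 := h.1.card_le
    have h2 := h.2.card_le
    dsimp only at *
    rw [show α.card - (benderKnuth α κ τ h.1 h.2).card = τ.card - κ.card by omega,
      show (benderKnuth α κ τ h.1 h.2).card - κ.card = α.card - τ.card by omega]
    ring

/-- Skew Schur polynomials are symmetric, by the Bender–Knuth involution. -/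
theorem skew_perm {l l' : List A} (h : l.Perm l') (α η : YoungDiagram) :
    skew l α η = skew l' α η := by
  induction h generalizing α with
  | nil => rfl
  | cons x _ ih => rw [skew_cons, skew_cons]; exact Finset.sum_congr rfl fun κ _ => by rw [ih]
  | swap x y l => exact skew_swap y x l α η
  | trans _ _ ih1 ih2 => rw [ih1, ih2]

theorem skew_cons' (x : A) (l : List A) (β η : YoungDiagram) :
    skew (x :: l) β η = ∑ κ ∈ upto β.card, skew l β κ *
      ∑ δ ∈ below κ, x ^ (κ.card - δ.card) * skew [] δ η := by
  rw [skew_perm (List.perm_append_singleton x l).symm, skew_append l [x] β η le_rfl]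
  rfl

end Skew

/-! ### Vertex operators over power series -/

section Operators

open PowerSeries

variable {A B : Type*} [CommRing A] [CommRing B]

/-- The functions on partitions on which the vertex operators act: `f` stands for the formal
combination `∑ f(τ) τ`. The variable `z` of the power series counts the boxes removed by the
operators `Γ_{+1}`, so that the infinite sums below are finite in each degree. -/
abbrev State (A : Type*) [CommRing A] : Type _ := YoungDiagram → PowerSeries A

open Classical in
/-- The partitions `τ ≻ σ` with `|τ| ≤ |σ| + j`. -/
noncomputable def above (σ : YoungDiagram) (j : ℕ) : Finset YoungDiagram :=
  (upto (σ.card + j)).filter fun τ => Interlace τ σ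

theorem mem_above {σ τ : YoungDiagram} {j : ℕ} :
    τ ∈ above σ j ↔ τ.card ≤ σ.card + j ∧ Interlace τ σ := by simp [above]

theorem coeff_mul_X_pow_mul (a : A) (e j : ℕ) (f : PowerSeries A) :
    coeff j ((C a * X) ^ e * f) = if e ≤ j then a ^ e * coeff (j - e) f else 0 := by
  rw [mul_pow, mul_assoc, ← map_pow, coeff_C_mul, coeff_X_pow_mul']
  split_ifs <;> simp

theorem sum_above_eq (x : A) (f : State A) (σ : YoungDiagram) (c : PowerSeries A) {j M : ℕ}
    (hM : j ≤ M) :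
    ∑ τ ∈ above σ M, coeff j (c * ((C x * X) ^ (τ.card - σ.card) * f τ)) =
      ∑ τ ∈ above σ j, coeff j (c * ((C x * X) ^ (τ.card - σ.card) * f τ)) := by
  symm
  refine Finset.sum_subset (fun τ hτ => ?_) fun τ hτ hn => ?_
  · rw [mem_above] at *; exact ⟨by omega, hτ.2⟩
  · rw [mem_above] at hτ hn
    have : j < τ.card - σ.card := by
      by_contra hc
      exact hn ⟨by have := hτ.2.card_le; omega, hτ.2⟩
    rw [mul_left_comm, coeff_mul_X_pow_mul, if_neg (by omega)]

/-- The function `Γ_{+1}(z x) f`. -/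
noncomputable def gammaPlusFun (x : A) (f : State A) : State A := fun σ =>
  PowerSeries.mk fun j => ∑ τ ∈ above σ j, coeff j ((C x * X) ^ (τ.card - σ.card) * f τ)

theorem coeff_mul_gammaPlusFun (x : A) (f : State A) (σ : YoungDiagram) (c : PowerSeries A)
    {j M : ℕ} (hM : j ≤ M) : coeff j (c * gammaPlusFun x f σ) =
      ∑ τ ∈ above σ M, coeff j (c * ((C x * X) ^ (τ.card - σ.card) * f τ)) := by
  simp only [coeff_mul (φ := c)]
  rw [Finset.sum_comm]
  refine Finset.sum_congr rfl fun p hp => ?_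
  rw [← Finset.mul_sum, gammaPlusFun, coeff_mk]
  have h := sum_above_eq x f σ 1 (j := p.2) (M := M)
    (by rw [Finset.HasAntidiagonal.mem_antidiagonal] at hp; omega)
  simp only [one_mul] at h
  rw [h]

theorem coeff_gammaPlusFun (x : A) (f : State A) (σ : YoungDiagram) {j M : ℕ} (hM : j ≤ M) :
    coeff j (gammaPlusFun x f σ) =
      ∑ τ ∈ above σ M, coeff j ((C x * X) ^ (τ.card - σ.card) * f τ) := by
  have := coeff_mul_gammaPlusFun x f σ 1 hM
  simpa only [one_mul] using this

/-- The operator `Γ_{+1}(z x)`. -/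
noncomputable def gammaPlus (x : A) : Module.End (PowerSeries A) (State A) where
  toFun := gammaPlusFun x
  map_add' f g := by
    ext σ j
    rw [Pi.add_apply, map_add]
    simp only [coeff_gammaPlusFun _ _ _ le_rfl, Pi.add_apply, mul_add, map_add,
      Finset.sum_add_distrib]
  map_smul' c f := by
    ext σ j
    simp only [Pi.smul_apply, smul_eq_mul, RingHom.id_apply]
    rw [coeff_mul_gammaPlusFun _ _ _ _ le_rfl, coeff_gammaPlusFun _ _ _ le_rfl]
    exact Finset.sum_congr rfl fun τ _ => by rw [Pi.smul_apply, smul_eq_mul, mul_left_comm]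

/-- The operator `Γ_{-1}(y)`. -/
noncomputable def gammaMinus (y : A) : Module.End (PowerSeries A) (State A) where
  toFun f := fun σ => ∑ κ ∈ below σ, C (y ^ (σ.card - κ.card)) * f κ
  map_add' f g := by
    ext1 σ
    simp only [Pi.add_apply, mul_add, Finset.sum_add_distrib]
  map_smul' c f := by
    ext1 σ
    simp only [Pi.smul_apply, smul_eq_mul, RingHom.id_apply, Finset.mul_sum]
    exact Finset.sum_congr rfl fun _ _ => by ring

theorem gammaMinus_apply (y : A) (f : State A) (σ : YoungDiagram) :
    gammaMinus y f σ = ∑ κ ∈ below σ, C (y ^ (σ.card - κ.card)) * f κ := rfl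

theorem coeff_gammaPlus (x : A) (f : State A) (σ : YoungDiagram) {j M : ℕ} (hM : j ≤ M) :
    coeff j (gammaPlus x f σ) =
      ∑ τ ∈ above σ M, coeff j ((C x * X) ^ (τ.card - σ.card) * f τ) :=
  coeff_gammaPlusFun x f σ hM

/-- The contribution of `τ` and `κ` to `Γ_{+1}(z x) Γ_{-1}(y)` in degree `j`. -/
noncomputable def crossTerm (x y : A) (f : State A) (σ : YoungDiagram) (j : ℕ)
    (p : (_ : YoungDiagram) × YoungDiagram) : A :=
  coeff j ((C x * X) ^ (p.1.card - σ.card) * (C (y ^ (p.1.card - p.2.card)) * f p.2))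

theorem coeff_gammaPlus_gammaMinus (x y : A) (f : State A) (σ : YoungDiagram) (j : ℕ) :
    coeff j (gammaPlus x (gammaMinus y f) σ) =
      ∑ p ∈ (above σ j).sigma (fun τ => below τ), crossTerm x y f σ j p := by
  rw [coeff_gammaPlus _ _ _ le_rfl, Finset.sum_sigma]
  refine Finset.sum_congr rfl fun τ _ => ?_
  rw [gammaMinus_apply, Finset.mul_sum, map_sum]
  rfl

theorem crossTerm_bump (x y : A) (f : State A) (σ : YoungDiagram) (j : ℕ)
    {τ κ : YoungDiagram} (h1 : Interlace τ σ) (h2 : Interlace τ κ) :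
    crossTerm x y f σ (j + 1) ⟨bump τ, κ⟩ = x * y * crossTerm x y f σ j ⟨τ, κ⟩ := by
  have := h1.card_le
  have := h2.card_le
  simp only [crossTerm, card_bump, coeff_mul_X_pow_mul, coeff_C_mul]
  rw [show τ.card + 1 - σ.card = τ.card - σ.card + 1 by omega,
    show τ.card + 1 - κ.card = τ.card - κ.card + 1 by omega,
    show j + 1 - (τ.card - σ.card + 1) = j - (τ.card - σ.card) by omega]
  simp only [add_le_add_iff_right]
  split_ifs
  · ring
  · ring

open Classical in
/-- The commutation relation `Γ_{+1}(x) Γ_{-1}(y) = (1 - x y)⁻¹ Γ_{-1}(y) Γ_{+1}(x)`. For fixed `σ` and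
`κ`, the partitions `τ ≻ σ, κ` whose first part exceeds those of `σ` and `κ` arise from all `τ ≻ σ, κ`
by adding a box to the first row, which gives the factor `x y`. The others correspond to the partitions
`η ≺ σ, κ` through `flipUp`. -/
theorem gammaPlus_gammaMinus (x y : A) (f : State A) :
    (1 - X * C (x * y)) • gammaPlus x (gammaMinus y f) = gammaMinus y (gammaPlus x f) := by
  ext σ j
  have hsplit : coeff j (gammaPlus x (gammaMinus y f) σ) =
      coeff j (X * (C (x * y) * gammaPlus x (gammaMinus y f) σ)) +
      ∑ p ∈ ((above σ j).sigma (fun τ => below τ)).filter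
        (fun p => p.1.rowLen 0 = max (σ.rowLen 0) (p.2.rowLen 0)), crossTerm x y f σ j p := by
    rw [coeff_gammaPlus_gammaMinus, ← Finset.sum_filter_add_sum_filter_not _
      (fun p => p.1.rowLen 0 = max (σ.rowLen 0) (p.2.rowLen 0)), add_comm]
    congr 1
    have hgt : ∀ p ∈ ((above σ j).sigma (fun τ => below τ)).filter
        (fun p => ¬ p.1.rowLen 0 = max (σ.rowLen 0) (p.2.rowLen 0)),
        ∃ τ', bump τ' = p.1 ∧ Interlace τ' σ ∧ Interlace τ' p.2 := by
      rintro ⟨τ, κ⟩ hp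
      simp only [Finset.mem_filter, Finset.mem_sigma, mem_above, mem_below] at hp
      refine exists_bump hp.1.1.2 hp.1.2 (lt_of_le_of_ne ?_ (Ne.symm hp.2))
      exact max_le (hp.1.1.2 0).1 (hp.1.2 0).1
    -- The pairs with a longer first row are those with one box less in the first row.
    rcases j with _ | j
    · rw [coeff_zero_X_mul]
      refine Finset.sum_eq_zero fun p hp => ?_
      obtain ⟨τ', h1, h2, -⟩ := hgt p hp
      simp only [Finset.mem_filter, Finset.mem_sigma, mem_above, mem_below] at hp
      have := h2.card_le
      have h3 := hp.1.1.1
      rw [← h1, card_bump] at h3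
      omega
    · rw [coeff_succ_X_mul, coeff_C_mul, coeff_gammaPlus_gammaMinus, Finset.mul_sum]
      symm
      refine Finset.sum_bij (fun p _ => ⟨bump p.1, p.2⟩) ?_ ?_ ?_ ?_
      · rintro ⟨τ, κ⟩ hp
        simp only [Finset.mem_filter, Finset.mem_sigma, mem_above, mem_below] at hp ⊢
        refine ⟨⟨⟨by rw [card_bump]; omega, interlace_bump hp.1.2⟩, interlace_bump hp.2⟩, ?_⟩
        rw [rowLen_bump, if_pos rfl]
        have := max_le (hp.1.2 0).1 (hp.2 0).1
        omega
      · rintro ⟨τ, κ⟩ _ ⟨τ', κ'⟩ _ h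
        simp only [Sigma.mk.injEq, heq_eq_eq] at h
        rw [bump_injective h.1, h.2]
      · rintro ⟨τ, κ⟩ hp
        obtain ⟨τ', h1, h2, h3⟩ := hgt _ hp
        dsimp only at h1 h3
        subst h1
        simp only [Finset.mem_filter, Finset.mem_sigma, mem_above, card_bump] at hp
        exact ⟨⟨τ', κ⟩, by
          simp only [Finset.mem_sigma, mem_above, mem_below]
          exact ⟨⟨by omega, h2⟩, h3⟩, rfl⟩
      · rintro ⟨τ, κ⟩ hp
        simp only [Finset.mem_sigma, mem_above, mem_below] at hp
        rw [crossTerm_bump x y f σ j hp.1.2 hp.2]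
  have hR : coeff j (gammaMinus y (gammaPlus x f) σ) =
      ∑ p ∈ (below σ).sigma (fun η => above η j),
        coeff j (C (y ^ (σ.card - p.1.card)) * ((C x * X) ^ (p.2.card - p.1.card) * f p.2)) := by
    rw [gammaMinus_apply, map_sum, Finset.sum_sigma]
    exact Finset.sum_congr rfl fun η _ => coeff_mul_gammaPlusFun x f η _ le_rfl
  rw [Pi.smul_apply, smul_eq_mul, sub_mul, one_mul, map_sub, hsplit, hR, mul_assoc,
    add_sub_cancel_left]
  symm
  have hm : ∀ p ∈ (below σ).sigma (fun η => above η j), Interlace σ p.1 ∧ Interlace p.2 p.1 := by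
    rintro ⟨η, κ⟩ hp
    simp only [Finset.mem_sigma, mem_above, mem_below] at hp
    exact ⟨hp.1, hp.2.2⟩
  refine Finset.sum_bij (fun p hp => ⟨flipUp σ p.2 p.1 (hm p hp).1 (hm p hp).2, p.2⟩)
    ?_ ?_ ?_ ?_
  · rintro ⟨η, κ⟩ hp
    have h := hm _ hp
    simp only [Finset.mem_filter, Finset.mem_sigma, mem_above, mem_below] at hp ⊢
    have hc := card_flipUp σ κ η h.1 h.2
    exact ⟨⟨⟨by omega, interlace_flipUp_left _ _ _ _ _⟩, interlace_flipUp_right _ _ _ _ _⟩,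
      rowLen_flipUp_zero _ _ _ _ _⟩
  · rintro ⟨η, κ⟩ h1 ⟨η', κ'⟩ h2 h
    simp only [Sigma.mk.injEq, heq_eq_eq] at h
    obtain ⟨h, rfl⟩ := h
    rw [flipUp_injective h]
  · rintro ⟨τ, κ⟩ hp
    simp only [Finset.mem_filter, Finset.mem_sigma, mem_above, mem_below] at hp
    obtain ⟨η, a, b, h⟩ := exists_flipUp hp.1.1.2 hp.1.2 hp.2
    have hc := card_flipUp σ κ η a b
    rw [h] at hc
    exact ⟨⟨η, κ⟩, by
      simp only [Finset.mem_sigma, mem_above, mem_below]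
      exact ⟨a, by omega, b⟩, by simp only [h]⟩
  · rintro ⟨η, κ⟩ hp
    have h := hm _ hp
    have hc := card_flipUp σ κ η h.1 h.2
    have h1 := h.1.card_le
    have h2 := h.2.card_le
    dsimp only at hc h1 h2
    rw [crossTerm]
    dsimp only
    rw [show (flipUp σ κ η h.1 h.2).card - σ.card = κ.card - η.card by omega,
      show (flipUp σ κ η h.1 h.2).card - κ.card = σ.card - η.card by omega]
    congr 1
    ring

/-! ### Words of vertex operators and their normal ordering -/

open Classical in
/-- The vertex operator of a letter `(ε, a)`: `Γ_{+1}(z a)` if `ε = 1` and `Γ_{-1}(a)` if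
`ε = -1`. -/
noncomputable def letterOp (p : ℤˣ × A) : Module.End (PowerSeries A) (State A) :=
  if p.1 = 1 then gammaPlus p.2 else gammaMinus p.2

/-- The product of the vertex operators of a word, from left to right. -/
noncomputable def wordOp (l : List (ℤˣ × A)) : Module.End (PowerSeries A) (State A) :=
  (l.map letterOp).prod

/-- The arguments of the operators `Γ_{+1}` in a word. -/
def plusArgs (l : List (ℤˣ × A)) : List A := (l.filter fun p => p.1 = 1).map Prod.snd

/-- The arguments of the operators `Γ_{-1}` in a word. -/
def minusArgs (l : List (ℤˣ × A)) : List A := (l.filter fun p => ¬ p.1 = 1).map Prod.snd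

/-- The product of the factors `1 - z x y` over all pairs of an operator `Γ_{+1}(z x)` and an
operator `Γ_{-1}(y)` to its right. -/
noncomputable def wordDenom : List (ℤˣ × A) → PowerSeries A
  | [] => 1
  | p :: l => wordDenom l *
      if p.1 = 1 then ((minusArgs l).map fun y => 1 - X * C (p.2 * y)).prod else 1

/-- The product of the operators `Γ_{-1}(y)`. -/
noncomputable def minusOp (l : List A) : Module.End (PowerSeries A) (State A) :=
  (l.map gammaMinus).prod

/-- The product of the operators `Γ_{+1}(z x)`. -/
noncomputable def plusOp (l : List A) : Module.End (PowerSeries A) (State A) :=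
  (l.map gammaPlus).prod

theorem gammaPlus_minusOp (x : A) (l : List A) (f : State A) :
    (l.map fun y => 1 - X * C (x * y)).prod • gammaPlus x (minusOp l f) =
      minusOp l (gammaPlus x f) := by
  induction l with
  | nil => simp [minusOp]
  | cons y l ih =>
    have : ∀ g, minusOp (y :: l) g = gammaMinus y (minusOp l g) := by
      intro g; simp [minusOp]
    rw [List.map_cons, List.prod_cons, mul_comm, mul_smul, this, gammaPlus_gammaMinus,
      ← map_smul (gammaMinus y), ih, this]

/-- Normal ordering: all operators `Γ_{-1}` are moved to the left. -/
theorem wordDenom_smul_wordOp (l : List (ℤˣ × A)) (f : State A) :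
    wordDenom l • wordOp l f = minusOp (minusArgs l) (plusOp (plusArgs l) f) := by
  induction l with
  | nil => simp [wordDenom, wordOp, minusOp, plusOp, minusArgs, plusArgs]
  | cons p l ih =>
    have hw : wordOp (p :: l) f = letterOp p (wordOp l f) := by simp [wordOp]
    rw [hw, wordDenom]
    obtain ⟨ε, a⟩ := p
    by_cases h : ε = 1
    · have h1 : minusArgs ((ε, a) :: l) = minusArgs l := by simp [minusArgs, h]
      have h2 : plusArgs ((ε, a) :: l) = a :: plusArgs l := by simp [plusArgs, h]
      simp only [h, if_true, letterOp]
      rw [← h, h1, h2, mul_comm, mul_smul, ← map_smul (gammaPlus a), ih, gammaPlus_minusOp]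
      simp [plusOp]
    · have h1 : minusArgs ((ε, a) :: l) = a :: minusArgs l := by simp [minusArgs, h]
      have h2 : plusArgs ((ε, a) :: l) = plusArgs l := by simp [plusArgs, h]
      simp only [h, if_false, letterOp, mul_one]
      rw [h1, h2, ← map_smul (gammaMinus a), ih]
      simp [minusOp]

/-- The basis vector `β`. -/
noncomputable def basisState (β : YoungDiagram) : State A :=
  open Classical in fun τ => if τ = β then 1 else 0

theorem minusOp_apply (l : List A) (f : State A) (α : YoungDiagram) {M : ℕ} (hM : α.card ≤ M) :
    minusOp l f α = ∑ κ ∈ upto M, C (skew l α κ) * f κ := by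
  classical
  induction l generalizing α with
  | nil =>
    simp only [minusOp, List.map_nil, List.prod_nil, Module.End.one_apply, skew_nil]
    rw [Finset.sum_eq_single α]
    · simp
    · intro b _ hb; simp [hb.symm]
    · intro h; exact absurd (mem_upto.2 hM) h
  | cons y l ih =>
    have : minusOp (y :: l) f = gammaMinus y (minusOp l f) := by simp [minusOp]
    rw [this, gammaMinus_apply]
    simp only [skew_cons, map_sum, Finset.sum_mul]
    rw [Finset.sum_comm]
    refine Finset.sum_congr rfl fun κ hκ => ?_
    rw [ih κ ((mem_below.1 hκ).card_le.trans hM), Finset.mul_sum]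
    exact Finset.sum_congr rfl fun _ _ => by rw [map_mul]; ring

theorem plusOp_basisState (l : List A) (β η : YoungDiagram) :
    plusOp l (basisState β) η = C (skew l β η) * X ^ (β.card - η.card) := by
  classical
  induction l generalizing η with
  | nil =>
    by_cases h : η = β
    · subst h; simp [plusOp, basisState, skew_nil]
    · simp [plusOp, basisState, skew_nil, h, Ne.symm h]
  | cons x l ih =>
    have : plusOp (x :: l) (basisState β) = gammaPlus x (plusOp l (basisState β)) := by
      simp [plusOp]
    rw [this]
    ext j
    have hM : j ≤ j + β.card := Nat.le_add_right _ _
    rw [coeff_gammaPlus _ _ _ hM, skew_cons']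
    have h2 : ∀ κ : YoungDiagram, ∑ δ ∈ below κ, x ^ (κ.card - δ.card) * skew [] δ η =
        if Interlace κ η then x ^ (κ.card - η.card) else 0 := by
      intro κ
      by_cases h : Interlace κ η
      · rw [if_pos h, Finset.sum_eq_single η]
        · simp [skew_nil]
        · intro b _ hb; simp [skew_nil, hb]
        · intro h'; exact absurd (mem_below.2 h) h'
      · rw [if_neg h]
        refine Finset.sum_eq_zero fun δ hδ => ?_
        rw [skew_nil, if_neg, mul_zero]
        rintro rfl
        exact h (mem_below.1 hδ)
    simp only [h2]
    rw [coeff_C_mul, coeff_X_pow, Finset.sum_mul]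
    have e1 : ∑ κ ∈ upto β.card, skew l β κ * (if Interlace κ η then x ^ (κ.card - η.card) else 0)
          * (if j = β.card - η.card then 1 else 0) =
        ∑ κ ∈ (upto β.card).filter (fun κ => Interlace κ η),
          coeff j ((C x * X) ^ (κ.card - η.card) * plusOp l (basisState β) κ) := by
      rw [Finset.sum_filter]
      refine Finset.sum_congr rfl fun κ hκ => ?_
      rw [mem_upto] at hκ
      by_cases hi : Interlace κ η
      · have := hi.card_le
        rw [if_pos hi, if_pos hi, coeff_mul_X_pow_mul, ih, coeff_C_mul, coeff_X_pow]
        by_cases hj : j = β.card - η.card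
        · rw [if_pos hj, if_pos (by omega), if_pos (by omega)]; ring
        · rw [if_neg hj]
          split_ifs
          · omega
          · simp
          · simp
      · simp [hi]
    rw [e1]
    have e2 : ∀ S : Finset YoungDiagram, (∀ κ, κ ∈ S ↔ κ.card ≤ η.card + j + β.card ∧ Interlace κ η)
        → ∑ κ ∈ S, coeff j ((C x * X) ^ (κ.card - η.card) * plusOp l (basisState β) κ) =
        ∑ κ ∈ (upto β.card).filter (fun κ => Interlace κ η),
          coeff j ((C x * X) ^ (κ.card - η.card) * plusOp l (basisState β) κ) := by
      intro S hS
      symm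
      refine Finset.sum_subset (fun κ hκ => ?_) fun κ hκ hn => ?_
      · rw [Finset.mem_filter, mem_upto] at hκ
        exact (hS κ).2 ⟨by omega, hκ.2⟩
      · rw [Finset.mem_filter, mem_upto] at hn
        rw [ih, skew_eq_zero_of_card]
        · simp
        · by_contra hc
          exact hn ⟨by omega, ((hS κ).1 hκ).2⟩
    exact e2 _ fun κ => by rw [mem_above]; constructor <;> rintro ⟨h, h'⟩ <;> exact ⟨by omega, h'⟩

/-- The normally ordered matrix coefficient `∑_η s_{α/η}(y) s_{β/η}(z x)`. -/
noncomputable def normalCoeff (ys xs : List A) (α β : YoungDiagram) : PowerSeries A :=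
  ∑ η ∈ upto α.card, C (skew ys α η * skew xs β η) * X ^ (β.card - η.card)

/-- The matrix coefficient `⟨α| wordOp l |β⟩`. -/
noncomputable def wordCoeff (l : List (ℤˣ × A)) (α β : YoungDiagram) : PowerSeries A :=
  wordOp l (basisState β) α

theorem wordDenom_mul_wordCoeff (l : List (ℤˣ × A)) (α β : YoungDiagram) :
    wordDenom l * wordCoeff l α β = normalCoeff (minusArgs l) (plusArgs l) α β := by
  have h := congrFun (wordDenom_smul_wordOp l (basisState β)) α
  rw [Pi.smul_apply, smul_eq_mul, minusOp_apply _ _ _ le_rfl] at h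
  rw [wordCoeff, h, normalCoeff]
  exact Finset.sum_congr rfl fun η _ => by rw [plusOp_basisState, map_mul]; ring

theorem normalCoeff_bot (ys xs : List A) : normalCoeff ys xs ⊥ ⊥ = 1 := by
  have hc : (⊥ : YoungDiagram).card = 0 := rfl
  rw [normalCoeff, Finset.sum_eq_single ⊥]
  · simp [skew_self, hc]
  · intro η hη hne
    rw [mem_upto, hc] at hη
    exact absurd (YoungDiagram.ext (Finset.card_eq_zero.1 (Nat.le_zero.1 hη))) hne
  · intro h; simp [hc] at h

theorem wordDenom_mul_wordCoeff_bot (l : List (ℤˣ × A)) :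
    wordDenom l * wordCoeff l ⊥ ⊥ = 1 := by
  rw [wordDenom_mul_wordCoeff, normalCoeff_bot]

theorem wordCoeff_eq (l : List (ℤˣ × A)) (α β : YoungDiagram) :
    wordCoeff l α β = wordCoeff l ⊥ ⊥ * normalCoeff (minusArgs l) (plusArgs l) α β := by
  rw [← wordDenom_mul_wordCoeff, ← mul_assoc, mul_comm (wordCoeff l ⊥ ⊥),
    wordDenom_mul_wordCoeff_bot, one_mul]

end Operators

/-! ### Rescaling, composition with weight operators, and expansion over intermediate states -/

section Expansion

open PowerSeries

variable {A B : Type*} [CommRing A] [CommRing B]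

theorem letterOp_map (f : A →+* B) (p : ℤˣ × A) (g : State A) (σ : YoungDiagram) :
    letterOp (p.1, f p.2) (fun τ => PowerSeries.map f (g τ)) σ =
      PowerSeries.map f (letterOp p g σ) := by
  unfold letterOp
  split_ifs
  · ext j
    rw [coeff_gammaPlus _ _ _ le_rfl, coeff_map, coeff_gammaPlus _ _ _ le_rfl, map_sum]
    refine Finset.sum_congr rfl fun τ _ => ?_
    simp only [coeff_mul_X_pow_mul]
    split_ifs <;> simp
  · simp [gammaMinus_apply, map_sum]

theorem wordOp_cons (p : ℤˣ × A) (l : List (ℤˣ × A)) (g : State A) :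
    wordOp (p :: l) g = letterOp p (wordOp l g) := by simp [wordOp]

theorem wordOp_map (f : A →+* B) (l : List (ℤˣ × A)) (g : State A) :
    wordOp (l.map fun p => (p.1, f p.2)) (fun τ => PowerSeries.map f (g τ)) =
      fun σ => PowerSeries.map f (wordOp l g σ) := by
  induction l with
  | nil => simp [wordOp]
  | cons p l ih =>
    rw [List.map_cons, wordOp_cons, ih, wordOp_cons]
    exact funext fun σ => letterOp_map f p _ σ

theorem basisState_map (f : A →+* B) (β : YoungDiagram) :
    (fun τ => PowerSeries.map f (basisState β τ)) = basisState β := by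
  funext τ
  simp only [basisState, apply_ite (PowerSeries.map f), map_one, map_zero]

theorem wordCoeff_map (f : A →+* B) (l : List (ℤˣ × A)) (α β : YoungDiagram) :
    wordCoeff (l.map fun p => (p.1, f p.2)) α β = PowerSeries.map f (wordCoeff l α β) := by
  rw [wordCoeff, ← basisState_map f, wordOp_map]
  rfl

/-- The operator `τ ↦ c^{|τ|} τ`. -/
noncomputable def weightOp (c : A) : Module.End (PowerSeries A) (State A) where
  toFun f := fun τ => C (c ^ τ.card) * f τ
  map_add' f g := by ext1 τ; simp [mul_add]
  map_smul' c f := by ext1 τ; simp [mul_left_comm]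

theorem weightOp_apply (c : A) (f : State A) (τ : YoungDiagram) :
    weightOp c f τ = C (c ^ τ.card) * f τ := rfl

theorem weightOp_mul (c d : A) : weightOp c * weightOp d = weightOp (c * d) := by
  ext f τ : 2
  simp only [Module.End.mul_apply, weightOp_apply, mul_pow, map_mul]
  ring

theorem weightOp_one : weightOp (1 : A) = 1 := by
  ext f τ : 2
  simp [weightOp_apply]

/-- The letter obtained by conjugation with the weight operator of `c`, where `c' = c⁻¹`. -/
def scaleLetter (c c' : A) (p : ℤˣ × A) : ℤˣ × A :=
  (p.1, if p.1 = 1 then c' * p.2 else c * p.2)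

theorem pow_mul_pow_of_mul_eq_one {c c' : A} (h : c * c' = 1) {a b : ℕ} (hab : a ≤ b) :
    c ^ a * c' ^ b = c' ^ (b - a) := by
  obtain ⟨d, rfl⟩ := Nat.exists_eq_add_of_le hab
  rw [pow_add, ← mul_assoc, ← mul_pow, h, one_pow, one_mul, Nat.add_sub_cancel_left]

theorem weightOp_letterOp (c c' : A) (h : c * c' = 1) (p : ℤˣ × A) :
    weightOp c * letterOp p * weightOp c' = letterOp (scaleLetter c c' p) := by
  obtain ⟨ε, a⟩ := p
  ext f σ : 2
  simp only [Module.End.mul_apply, weightOp_apply, letterOp, scaleLetter]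
  split_ifs
  · ext j
    rw [coeff_C_mul, coeff_gammaPlus _ _ _ le_rfl, coeff_gammaPlus _ _ _ le_rfl, Finset.mul_sum]
    refine Finset.sum_congr rfl fun τ hτ => ?_
    have h1 := (mem_above.1 hτ).2.card_le
    simp only [coeff_mul_X_pow_mul, weightOp_apply, coeff_C_mul]
    split_ifs
    · rw [mul_pow, ← pow_mul_pow_of_mul_eq_one h h1]; ring
    · simp
  · simp only [gammaMinus_apply, weightOp_apply, Finset.mul_sum]
    refine Finset.sum_congr rfl fun κ hκ => ?_
    have h1 := (mem_below.1 hκ).card_le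
    rw [mul_pow, ← pow_mul_pow_of_mul_eq_one (c := c') (c' := c) (by rw [mul_comm, h]) h1]
    simp only [map_mul]
    ring

theorem weightOp_wordOp (c c' : A) (h : c * c' = 1) (l : List (ℤˣ × A)) :
    weightOp c * wordOp l * weightOp c' = wordOp (l.map (scaleLetter c c')) := by
  induction l with
  | nil => simp [wordOp, weightOp_mul, h, weightOp_one]
  | cons p l ih =>
    have h' : weightOp c' * weightOp c = 1 := by
      rw [weightOp_mul, mul_comm, h, weightOp_one]
    have e : ∀ (q : ℤˣ × A) (k : List (ℤˣ × A)), wordOp (q :: k) = letterOp q * wordOp k := by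
      intro q k; simp [wordOp]
    rw [List.map_cons, e, e, ← ih, ← weightOp_letterOp c c' h]
    simp only [mul_assoc]
    rw [← mul_assoc (weightOp c') (weightOp c), h', one_mul]

/-- The composition `B_0 v_1^{|·|} B_1 v_2^{|·|} ⋯ v_m^{|·|} B_m`, where the index `i : Fin m` of `v`
stands for `v_{i+1}`. -/
noncomputable def chainOp : (m : ℕ) → (Fin (m + 1) → Module.End (PowerSeries A) (State A)) →
    (Fin m → A) → Module.End (PowerSeries A) (State A)
  | 0, B, _ => B 0
  | m + 1, B, v => B 0 * weightOp (v 0) * chainOp m (fun k => B k.succ) (fun k => v k.succ)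

theorem chainOp_one (m : ℕ) (B : Fin (m + 1) → Module.End (PowerSeries A) (State A)) :
    chainOp m B (fun _ => 1) = (List.ofFn B).prod := by
  induction m with
  | zero => simp [chainOp]
  | succ m ih => rw [chainOp, ih, List.ofFn_succ (n := m + 1), List.prod_cons, weightOp_one, mul_one]

/-- A composition with weight operators is a product of rescaled operators. -/
theorem chainOp_conj (m : ℕ) (B : Fin (m + 1) → Module.End (PowerSeries A) (State A))
    (v : Fin m → A) (c c' : Fin (m + 1) → A) (h : ∀ k, c k * c' k = 1)
    (hc : ∀ k : Fin m, c k.succ = c k.castSucc * v k) :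
    (List.ofFn fun k => weightOp (c k) * B k * weightOp (c' k)).prod =
      weightOp (c 0) * chainOp m B v * weightOp (c' (Fin.last m)) := by
  induction m with
  | zero => simp [chainOp]
  | succ m ih =>
    rw [List.ofFn_succ, List.prod_cons,
      ih (fun k => B k.succ) (fun k => v k.succ) (fun k => c k.succ) (fun k => c' k.succ)
        (fun k => h k.succ) (fun k => hc k.succ), chainOp]
    have e : weightOp (c' 0) * weightOp (c (Fin.succ 0)) = weightOp (v 0) := by
      rw [weightOp_mul, hc 0, ← mul_assoc, Fin.castSucc_zero, mul_comm (c' 0), h, one_mul]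
    rw [← e]
    simp only [mul_assoc, Fin.succ_last]

theorem coeff_wordOp (l : List (ℤˣ × A)) (f : State A) (σ : YoungDiagram) {j M : ℕ}
    (hM : σ.card + j ≤ M) :
    coeff j (wordOp l f σ) = ∑ τ ∈ upto M, coeff j (wordCoeff l σ τ * f τ) := by
  classical
  induction l generalizing σ j with
  | nil =>
    simp only [wordCoeff, wordOp, List.map_nil, List.prod_nil, Module.End.one_apply, basisState]
    rw [Finset.sum_eq_single σ]
    · simp
    · intro b _ hb; simp [hb.symm]
    · intro h; exact absurd (mem_upto.2 (by omega)) h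
  | cons p l ih =>
    have hw : ∀ τ, wordCoeff (p :: l) σ τ = letterOp p (fun κ => wordCoeff l κ τ) σ := by
      intro τ; simp only [wordCoeff, wordOp_cons]
    simp only [wordOp_cons, hw]
    unfold letterOp
    split_ifs
    · rw [coeff_gammaPlus _ _ _ le_rfl]
      have e : ∀ τ, coeff j (gammaPlus p.2 (fun κ => wordCoeff l κ τ) σ * f τ) =
          ∑ κ ∈ above σ j, coeff j
            (f τ * ((C p.2 * X) ^ (κ.card - σ.card) * wordCoeff l κ τ)) := by
        intro τ
        rw [mul_comm]
        exact coeff_mul_gammaPlusFun _ _ _ _ le_rfl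
      simp only [e]
      rw [Finset.sum_comm]
      refine Finset.sum_congr rfl fun κ hκ => ?_
      have h1 := (mem_above.1 hκ)
      have h2 := h1.2.card_le
      rw [coeff_mul_X_pow_mul, if_pos (by omega), ih κ (by omega), Finset.mul_sum]
      refine Finset.sum_congr rfl fun τ _ => ?_
      rw [mul_left_comm, coeff_mul_X_pow_mul, if_pos (by omega), mul_comm (f τ)]
    · simp only [gammaMinus_apply, map_sum, Finset.sum_mul]
      rw [Finset.sum_comm]
      refine Finset.sum_congr rfl fun κ hκ => ?_
      have h2 := (mem_below.1 hκ).card_le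
      rw [coeff_C_mul, ih κ (by omega), Finset.mul_sum]
      exact Finset.sum_congr rfl fun τ _ => by rw [mul_assoc, coeff_C_mul]

/-- In degree `j` at most `j` boxes are removed. -/
theorem coeff_wordCoeff_eq_zero (l : List (ℤˣ × A)) {σ τ : YoungDiagram} {j : ℕ}
    (h : σ.card + j < τ.card) : coeff j (wordCoeff l σ τ) = 0 := by
  classical
  induction l generalizing σ j with
  | nil =>
    have : σ ≠ τ := by rintro rfl; omega
    simp [wordCoeff, wordOp, basisState, this]
  | cons p l ih =>
    have hw : wordCoeff (p :: l) σ τ = letterOp p (fun κ => wordCoeff l κ τ) σ := by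
      simp only [wordCoeff, wordOp_cons]
    rw [hw]
    unfold letterOp
    split_ifs
    · rw [coeff_gammaPlus _ _ _ le_rfl]
      refine Finset.sum_eq_zero fun κ hκ => ?_
      have h1 := (mem_above.1 hκ)
      have h2 := h1.2.card_le
      rw [coeff_mul_X_pow_mul, if_pos (by omega), ih (by omega), mul_zero]
    · rw [gammaMinus_apply, map_sum]
      refine Finset.sum_eq_zero fun κ hκ => ?_
      have h2 := (mem_below.1 hκ).card_le
      rw [coeff_C_mul, ih (by omega), mul_zero]

/-- The states `α, τ_1, …, τ_m, β`. -/
def states {m : ℕ} (α β : YoungDiagram) (τ : Fin m → YoungDiagram) : Fin (m + 2) → YoungDiagram :=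
  Fin.cons α (Fin.snoc τ β : Fin (m + 1) → YoungDiagram)

theorem states_zero {m : ℕ} (α β : YoungDiagram) (τ : Fin m → YoungDiagram) :
    states α β τ 0 = α := rfl

theorem states_cons_succ {m : ℕ} (α β κ : YoungDiagram) (τ : Fin m → YoungDiagram)
    (k : Fin (m + 2)) :
    states α β (Fin.cons κ τ : Fin (m + 1) → YoungDiagram) k.succ = states κ β τ k := by
  unfold states
  rw [Fin.cons_succ, ← Fin.cons_snoc_eq_snoc_cons]

theorem sum_piFinset_cons {m : ℕ} {M : Type*} [AddCommMonoid M] (S : Fin (m + 1) → Finset YoungDiagram)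
    (F : (Fin (m + 1) → YoungDiagram) → M) :
    ∑ τ ∈ Fintype.piFinset S, F τ =
      ∑ κ ∈ S 0, ∑ τ ∈ Fintype.piFinset (fun k => S (Fin.succ k)),
        F (Fin.cons κ τ : Fin (m + 1) → YoungDiagram) := by
  rw [← Finset.sum_product']
  refine Finset.sum_bij' (fun τ _ => (τ 0, fun k => τ k.succ))
    (fun p _ => (Fin.cons p.1 p.2 : Fin (m + 1) → YoungDiagram)) ?_ ?_ ?_ ?_ ?_
  · intro τ hτ
    rw [Fintype.mem_piFinset] at hτ
    simp [hτ]
  · rintro ⟨κ, τ⟩ h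
    simp only [Finset.mem_product, Fintype.mem_piFinset] at h ⊢
    intro k
    refine Fin.cases ?_ (fun k => ?_) k
    · exact h.1
    · exact h.2 k
  · intro τ _
    exact Fin.cons_self_tail τ
  · rintro ⟨κ, τ⟩ _
    simp
  · intro τ _
    exact congrArg F (Fin.cons_self_tail τ).symm

theorem coeff_chainOp (m : ℕ) (w : Fin (m + 1) → List (ℤˣ × A)) (v : Fin m → A)
    (α β : YoungDiagram) {j M : ℕ} (hM : α.card + j ≤ M) :
    coeff j (chainOp m (fun k => wordOp (w k)) v (basisState β) α) =
      ∑ τ ∈ Fintype.piFinset (fun _ : Fin m => upto M), (∏ k, v k ^ (τ k).card) *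
        coeff j (∏ k : Fin (m + 1),
          wordCoeff (w k) (states α β τ k.castSucc) (states α β τ k.succ)) := by
  induction m generalizing α j with
  | zero => simp [chainOp, wordCoeff, states, Fin.snoc]
  | succ m ih =>
    rw [sum_piFinset_cons, chainOp, Module.End.mul_apply, Module.End.mul_apply,
      coeff_wordOp _ _ _ hM]
    refine Finset.sum_congr rfl fun κ _ => ?_
    rw [weightOp_apply, mul_left_comm, coeff_C_mul, coeff_mul]
    have e : ∀ p ∈ Finset.HasAntidiagonal.antidiagonal j, coeff p.1 (wordCoeff (w 0) α κ) *
        coeff p.2 (chainOp m (fun k => wordOp (w k.succ)) (fun k => v k.succ) (basisState β) κ) =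
        ∑ τ ∈ Fintype.piFinset (fun _ : Fin m => upto M), (∏ k, v k.succ ^ (τ k).card) *
          (coeff p.1 (wordCoeff (w 0) α κ) * coeff p.2 (∏ k : Fin (m + 1),
            wordCoeff (w k.succ) (states κ β τ k.castSucc) (states κ β τ k.succ))) := by
      intro p hp
      rw [Finset.HasAntidiagonal.mem_antidiagonal] at hp
      by_cases hc : α.card + p.1 < κ.card
      · simp [coeff_wordCoeff_eq_zero _ hc]
      · rw [ih (fun k => w k.succ) (fun k => v k.succ) κ (by omega), Finset.mul_sum]
        exact Finset.sum_congr rfl fun _ _ => by ring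
    rw [Finset.sum_congr rfl e, Finset.sum_comm, Finset.mul_sum]
    refine Finset.sum_congr rfl fun τ _ => ?_
    have e1 := Fin.prod_univ_succ fun k : Fin (m + 1) =>
      v k ^ ((Fin.cons κ τ : Fin (m + 1) → YoungDiagram) k).card
    have e2 := Fin.prod_univ_succ fun k : Fin (m + 2) =>
      wordCoeff (w k) (states α β (Fin.cons κ τ : Fin (m + 1) → YoungDiagram) k.castSucc)
        (states α β (Fin.cons κ τ : Fin (m + 1) → YoungDiagram) k.succ)
    simp only [Fin.cons_zero, Fin.cons_succ, Fin.castSucc_zero, states_zero, states_cons_succ,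
      ← Fin.succ_castSucc] at e1 e2
    rw [← Finset.mul_sum, ← coeff_mul, ← mul_assoc, e1]
    simp only [states_cons_succ]
    rw [e2]

end Expansion

/-! ### Convergence of truncated expectations -/

section Convergence

variable {n : ℕ}

/-- All exponents of the Laurent series are at least `c`. -/
def ExpLowerBound (c : ℤ) (f : LaurentField n) : Prop :=
  ∀ g, f.coeff g ≠ 0 → ∀ i, c ≤ ofLex g i

theorem isPWO_cone (n : ℕ) (c : ℤ) : {g : Lex (Fin n → ℤ) | ∀ i, c ≤ ofLex g i}.IsPWO := by
  have hmono : Monotone (fun x : Fin n → ℕ => toLex (fun i => (x i : ℤ) + c)) :=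
    fun x y hxy => Pi.toLex_monotone fun i => by
      have h : x i ≤ y i := hxy i
      change (x i : ℤ) + c ≤ (y i : ℤ) + c
      omega
  refine ((Set.isPWO_of_wellQuasiOrderedLE
    (Set.univ : Set (Fin n → ℕ))).image_of_monotone hmono).mono ?_
  intro g hg
  refine ⟨fun i => (ofLex g i - c).toNat, trivial, ?_⟩
  have : (fun i => ((ofLex g i - c).toNat : ℤ) + c) = ofLex g := by
    funext i
    have := hg i
    omega
  simp only [this, toLex_ofLex]

theorem ExpLowerBound.mono {c d : ℤ} (h : d ≤ c) {f : LaurentField n} (hf : ExpLowerBound c f) :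
    ExpLowerBound d f := fun g hg i => h.trans (hf g hg i)

theorem ExpLowerBound.add {c : ℤ} {f f' : LaurentField n} (hf : ExpLowerBound c f)
    (hf' : ExpLowerBound c f') : ExpLowerBound c (f + f') := by
  intro g hg i
  rw [HahnSeries.coeff_add] at hg
  by_cases h : f.coeff g = 0
  · rw [h, zero_add] at hg; exact hf' g hg i
  · exact hf g h i

theorem expLowerBound_zero (c : ℤ) : ExpLowerBound c (0 : LaurentField n) := fun g hg => by
  simp at hg

theorem ExpLowerBound.sum {ι : Type*} {c : ℤ} (s : Finset ι) {f : ι → LaurentField n}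
    (h : ∀ i ∈ s, ExpLowerBound c (f i)) : ExpLowerBound c (∑ i ∈ s, f i) := by
  classical
  induction s using Finset.induction_on with
  | empty => simpa using expLowerBound_zero c
  | insert a s ha ih =>
    rw [Finset.sum_insert ha]
    exact (h a (Finset.mem_insert_self _ _)).add
      (ih fun i hi => h i (Finset.mem_insert_of_mem hi))

theorem ExpLowerBound.coeff_mul {c d : ℤ} {f f' : LaurentField n} (hf : ExpLowerBound c f)
    (hf' : ExpLowerBound d f') (g : Lex (Fin n → ℤ)) :
    (f * f').coeff g = ∑ p ∈ Finset.antidiagonal (isPWO_cone n c) (isPWO_cone n d) g,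
      f.coeff p.1 * f'.coeff p.2 := by
  rw [HahnSeries.coeff_mul_left' (isPWO_cone n c) (fun x hx => hf x hx)]
  refine Finset.sum_subset_zero_on_sdiff ?_ ?_ fun _ _ => rfl
  · intro p hp
    rw [Finset.mem_antidiagonal] at hp ⊢
    exact ⟨hp.1, fun i => hf' _ hp.2.1 i, hp.2.2⟩
  · intro p hp
    rw [Finset.mem_sdiff, Finset.mem_antidiagonal, Finset.mem_antidiagonal] at hp
    by_contra hne
    exact hp.2 ⟨hp.1.1, fun h0 => hne (by rw [h0, mul_zero]), hp.1.2.2⟩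

theorem ExpLowerBound.mul {c d : ℤ} {f f' : LaurentField n} (hf : ExpLowerBound c f)
    (hf' : ExpLowerBound d f') : ExpLowerBound (c + d) (f * f') := by
  intro g hg i
  rw [hf.coeff_mul hf'] at hg
  obtain ⟨p, hp, -⟩ := Finset.exists_ne_zero_of_sum_ne_zero hg
  rw [Finset.mem_antidiagonal] at hp
  have h1 := hp.1 i
  have h2 := hp.2.1 i
  rw [← hp.2.2]
  change c + d ≤ ofLex p.1 i + ofLex p.2 i
  omega

theorem expLowerBound_mono {c : ℤ} {e : Fin n → ℤ} (h : ∀ i, c ≤ e i) :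
    ExpLowerBound c (VertexCRC.mono e) := by
  intro g hg i
  have : g = toLex e := by
    by_contra hne
    exact hg (HahnSeries.coeff_single_of_ne hne)
  rw [this]
  exact h i

/-- In one variable the exponents of every Laurent series are bounded below. -/
theorem exists_expLowerBound (f : LaurentField 1) : ∃ c, ExpLowerBound c f := by
  refine ⟨ofLex f.order 0, fun g hg i => ?_⟩
  have h := HahnSeries.order_le_of_coeff_ne_zero hg
  rw [Subsingleton.elim i 0]
  rcases h.eq_or_lt with h | h
  · rw [h]
  · obtain ⟨j, -, hj⟩ := h
    rw [Subsingleton.elim j 0] at hj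
    exact hj.le

/-- The sequence `f N` of power series in `z` converges to `a` for `z → 1` and `N → ∞`: the exponents
are uniformly bounded below, and for each monomial in the `q_i`, its coefficient is a polynomial in
`z` of uniformly bounded degree whose value at `z = 1` is, for large `N`, the coefficient of `a`. -/
def ConvX (f : ℕ → PowerSeries (LaurentField n)) (a : LaurentField n) : Prop :=
  (∃ c, ∀ N j, ExpLowerBound c (PowerSeries.coeff j (f N))) ∧
  ∀ g, ∃ J N₀, (∀ N j, J ≤ j → (PowerSeries.coeff j (f N)).coeff g = 0) ∧
    ∀ N, N₀ ≤ N → ∑ j ∈ Finset.range J, (PowerSeries.coeff j (f N)).coeff g = a.coeff g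

theorem sum_range_of_le {F : ℕ → ℚ} {J K : ℕ} (hJK : J ≤ K) (h : ∀ j, J ≤ j → F j = 0) :
    ∑ j ∈ Finset.range K, F j = ∑ j ∈ Finset.range J, F j := by
  symm
  refine Finset.sum_subset (Finset.range_mono hJK) fun j _ hj => h j ?_
  simpa using hj

theorem sum_range_antidiagonal {F G : ℕ → ℚ} {J K : ℕ} (hF : ∀ j, J ≤ j → F j = 0)
    (hG : ∀ j, K ≤ j → G j = 0) :
    ∑ j ∈ Finset.range (J + K), ∑ p ∈ Finset.HasAntidiagonal.antidiagonal j, F p.1 * G p.2 =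
      (∑ j ∈ Finset.range J, F j) * ∑ j ∈ Finset.range K, G j := by
  rw [Finset.sum_mul_sum, ← Finset.sum_product', Finset.sum_sigma']
  refine Finset.sum_bij_ne_zero (fun x _ _ => x.2) ?_ ?_ ?_ ?_
  · rintro ⟨j, a, b⟩ _ h2
    simp only [Finset.mem_product, Finset.mem_range]
    dsimp only at h2
    refine ⟨?_, ?_⟩
    · by_contra hc; exact h2 (by rw [hF a (by omega), zero_mul])
    · by_contra hc; exact h2 (by rw [hG b (by omega), mul_zero])
  · rintro ⟨j, a, b⟩ h1 _ ⟨j', a', b'⟩ h2 _ h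
    simp only [Finset.mem_sigma, Finset.HasAntidiagonal.mem_antidiagonal] at h1 h2
    obtain ⟨-, rfl⟩ := h1
    obtain ⟨-, rfl⟩ := h2
    simp only [Prod.mk.injEq] at h
    rw [h.1, h.2]
  · rintro ⟨a, b⟩ h1 h2
    simp only [Finset.mem_product, Finset.mem_range] at h1
    refine ⟨⟨a + b, a, b⟩, ?_, h2, rfl⟩
    simp only [Finset.mem_sigma, Finset.mem_range, Finset.HasAntidiagonal.mem_antidiagonal,
      and_true]
    omega
  · intros; rfl

theorem ConvX.mul {f f' : ℕ → PowerSeries (LaurentField n)} {a a' : LaurentField n}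
    (h : ConvX f a) (h' : ConvX f' a') : ConvX (fun N => f N * f' N) (a * a') := by
  obtain ⟨⟨c, hc⟩, h⟩ := h
  obtain ⟨⟨c', hc'⟩, h'⟩ := h'
  refine ⟨⟨c + c', fun N j => ?_⟩, fun g => ?_⟩
  · rw [PowerSeries.coeff_mul]
    exact ExpLowerBound.sum _ fun p _ => (hc N p.1).mul (hc' N p.2)
  choose J N₀ hJ hN using h
  choose J' N₀' hJ' hN' using h'
  have ha : ExpLowerBound c a := by
    intro g hg
    rw [← hN g _ le_rfl] at hg
    obtain ⟨j, -, hj⟩ := Finset.exists_ne_zero_of_sum_ne_zero hg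
    exact hc _ j g hj
  have ha' : ExpLowerBound c' a' := by
    intro g hg
    rw [← hN' g _ le_rfl] at hg
    obtain ⟨j, -, hj⟩ := Finset.exists_ne_zero_of_sum_ne_zero hg
    exact hc' _ j g hj
  set D := Finset.antidiagonal (isPWO_cone n c) (isPWO_cone n c') g with hD
  have e : ∀ N j, (PowerSeries.coeff j (f N * f' N)).coeff g =
      ∑ p ∈ D, ∑ q ∈ Finset.HasAntidiagonal.antidiagonal j,
        (PowerSeries.coeff q.1 (f N)).coeff p.1 * (PowerSeries.coeff q.2 (f' N)).coeff p.2 := by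
    intro N j
    rw [PowerSeries.coeff_mul, HahnSeries.coeff_sum, Finset.sum_comm]
    exact Finset.sum_congr rfl fun q _ => (hc N q.1).coeff_mul (hc' N q.2) g
  refine ⟨D.sup (fun p => J p.1) + D.sup (fun p => J' p.2),
    D.sup (fun p => N₀ p.1) + D.sup (fun p => N₀' p.2), fun N j hj => ?_, fun N hNN => ?_⟩
  · rw [e]
    refine Finset.sum_eq_zero fun p hp => Finset.sum_eq_zero fun q hq => ?_
    have h1 := Finset.le_sup (f := fun p => J p.1) hp
    have h2 := Finset.le_sup (f := fun p => J' p.2) hp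
    rw [Finset.HasAntidiagonal.mem_antidiagonal] at hq
    rcases le_or_gt (J p.1) q.1 with h3 | h3
    · rw [hJ p.1 N q.1 h3, zero_mul]
    · rw [hJ' p.2 N q.2 (by omega), mul_zero]
  · simp only [e]
    rw [Finset.sum_comm, ha.coeff_mul ha' g, ← hD]
    refine Finset.sum_congr rfl fun p hp => ?_
    have h1 := Finset.le_sup (f := fun p => J p.1) hp
    have h2 := Finset.le_sup (f := fun p => J' p.2) hp
    have h3 := Finset.le_sup (f := fun p => N₀ p.1) hp
    have h4 := Finset.le_sup (f := fun p => N₀' p.2) hp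
    rw [sum_range_antidiagonal (F := fun j => (PowerSeries.coeff j (f N)).coeff p.1)
      (G := fun j => (PowerSeries.coeff j (f' N)).coeff p.2)
      (fun j hj => hJ p.1 N j (by omega)) (fun j hj => hJ' p.2 N j (by omega)),
      sum_range_of_le h1 (hJ p.1 N), sum_range_of_le h2 (hJ' p.2 N), hN p.1 N (by omega),
      hN' p.2 N (by omega)]

theorem ConvX.add {f f' : ℕ → PowerSeries (LaurentField n)} {a a' : LaurentField n}
    (h : ConvX f a) (h' : ConvX f' a') : ConvX (fun N => f N + f' N) (a + a') := by
  obtain ⟨⟨c, hc⟩, h⟩ := h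
  obtain ⟨⟨c', hc'⟩, h'⟩ := h'
  refine ⟨⟨min c c', fun N j => ?_⟩, fun g => ?_⟩
  · rw [map_add]
    exact ((hc N j).mono (min_le_left _ _)).add ((hc' N j).mono (min_le_right _ _))
  obtain ⟨J, N₀, hJ, hN⟩ := h g
  obtain ⟨J', N₀', hJ', hN'⟩ := h' g
  refine ⟨J + J', N₀ + N₀', fun N j hj => ?_, fun N hNN => ?_⟩
  · rw [map_add, HahnSeries.coeff_add, hJ N j (by omega), hJ' N j (by omega), add_zero]
  · simp only [map_add, HahnSeries.coeff_add, Finset.sum_add_distrib]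
    rw [sum_range_of_le (Nat.le_add_right J J') (hJ N),
      sum_range_of_le (Nat.le_add_left J' J) (hJ' N), hN N (by omega), hN' N (by omega)]

theorem ConvX.const {c : ℤ} {a : LaurentField n} (h : ExpLowerBound c a) :
    ConvX (fun _ => PowerSeries.C a) a := by
  refine ⟨⟨c, fun N j => ?_⟩, fun g => ⟨1, 0, fun N j hj => ?_, fun N _ => by simp⟩⟩
  · rw [PowerSeries.coeff_C]
    split_ifs
    · exact h
    · exact expLowerBound_zero c
  · rw [PowerSeries.coeff_C, if_neg (by omega), HahnSeries.coeff_zero]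

theorem expLowerBound_one : ExpLowerBound 0 (1 : LaurentField n) := by
  rw [← mono_zero]
  exact expLowerBound_mono fun i => le_rfl

theorem ConvX.one : ConvX (fun _ => (1 : PowerSeries (LaurentField n))) 1 := by
  have := ConvX.const (n := n) expLowerBound_one
  simpa using this

theorem ConvX.zero : ConvX (fun _ => (0 : PowerSeries (LaurentField n))) 0 := by
  have := ConvX.const (n := n) (expLowerBound_zero 0)
  simpa using this

theorem ConvX.X : ConvX (fun _ => (PowerSeries.X : PowerSeries (LaurentField n))) 1 := by
  refine ⟨⟨0, fun N j => ?_⟩, fun g => ⟨2, 0, fun N j hj => ?_, fun N _ => ?_⟩⟩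
  · rw [PowerSeries.coeff_X]
    split_ifs
    · exact expLowerBound_one
    · exact expLowerBound_zero 0
  · rw [PowerSeries.coeff_X, if_neg (by omega), HahnSeries.coeff_zero]
  · simp [Finset.sum_range_succ, PowerSeries.coeff_X]

theorem ConvX.sum {ι : Type*} (s : Finset ι) {f : ι → ℕ → PowerSeries (LaurentField n)}
    {a : ι → LaurentField n} (h : ∀ i ∈ s, ConvX (f i) (a i)) :
    ConvX (fun N => ∑ i ∈ s, f i N) (∑ i ∈ s, a i) := by
  classical
  induction s using Finset.induction_on with
  | empty => simpa using ConvX.zero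
  | insert b s hb ih =>
    simp only [Finset.sum_insert hb]
    exact (h b (Finset.mem_insert_self _ _)).add (ih fun i hi => h i (Finset.mem_insert_of_mem hi))

theorem ConvX.prod {ι : Type*} (s : Finset ι) {f : ι → ℕ → PowerSeries (LaurentField n)}
    {a : ι → LaurentField n} (h : ∀ i ∈ s, ConvX (f i) (a i)) :
    ConvX (fun N => ∏ i ∈ s, f i N) (∏ i ∈ s, a i) := by
  classical
  induction s using Finset.induction_on with
  | empty => simpa using ConvX.one
  | insert b s hb ih =>
    simp only [Finset.prod_insert hb]
    exact (h b (Finset.mem_insert_self _ _)).mul (ih fun i hi => h i (Finset.mem_insert_of_mem hi))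

/-- A sequence whose exponents tend to infinity converges to `0`. -/
theorem ConvX.to_zero [NeZero n] {c : ℤ} {r : ℕ → LaurentField n}
    (h : ∀ N : ℕ, ExpLowerBound (c + N) (r N)) : ConvX (fun N => PowerSeries.C (r N)) 0 := by
  refine ⟨⟨c, fun N j => ?_⟩, fun g => ⟨1, (ofLex g 0 - c + 1).toNat, fun N j hj => ?_,
    fun N hN => ?_⟩⟩
  · rw [PowerSeries.coeff_C]
    split_ifs
    · exact (h N).mono (by omega)
    · exact expLowerBound_zero c
  · rw [PowerSeries.coeff_C, if_neg (by omega), HahnSeries.coeff_zero]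
  · simp only [Finset.sum_range_one, PowerSeries.coeff_C, if_true, HahnSeries.coeff_zero]
    by_contra hne
    have := h N g hne 0
    omega

/-- The limit is determined by the tail of the sequence. -/
theorem ConvX.unique {f f' : ℕ → PowerSeries (LaurentField n)} {a a' : LaurentField n}
    (h : ConvX f a) (h' : ConvX f' a') (hf : ∃ N₀, ∀ N, N₀ ≤ N → f N = f' N) : a = a' := by
  obtain ⟨N₁, hf⟩ := hf
  ext g
  obtain ⟨J, N₀, hJ, hN⟩ := h.2 g
  obtain ⟨J', N₀', hJ', hN'⟩ := h'.2 g
  have e := hf (N₁ + N₀ + N₀') (by omega)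
  rw [← hN (N₁ + N₀ + N₀') (by omega), ← hN' (N₁ + N₀ + N₀') (by omega),
    ← sum_range_of_le (Nat.le_add_right J J') (hJ _),
    ← sum_range_of_le (Nat.le_add_left J' J) (hJ' _), e]

theorem ConvX.comp {f : ℕ → PowerSeries (LaurentField n)} {a : LaurentField n}
    (h : ConvX f a) {r : ℕ → ℕ} (hr : ∀ N, N ≤ r N) : ConvX (fun N => f (r N)) a := by
  obtain ⟨⟨c, hc⟩, h⟩ := h
  refine ⟨⟨c, fun N j => hc _ j⟩, fun g => ?_⟩
  obtain ⟨J, N₀, hJ, hN⟩ := h g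
  exact ⟨J, N₀, fun N j hj => hJ _ j hj, fun N hNN => hN _ (hNN.trans (hr N))⟩

/-- Coefficientwise convergence of power series in `v_1, …, v_m`. -/
def ConvY {m : ℕ} (f : ℕ → PowerSeries (YSeries m)) (y : YSeries m) : Prop :=
  ∀ d, ConvX (fun N => PowerSeries.mk fun j => MvPowerSeries.coeff d (PowerSeries.coeff j (f N)))
    (MvPowerSeries.coeff d y)

variable {m : ℕ}

theorem ConvY.mul {f f' : ℕ → PowerSeries (YSeries m)} {a a' : YSeries m}
    (h : ConvY f a) (h' : ConvY f' a') : ConvY (fun N => f N * f' N) (a * a') := by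
  classical
  intro d
  rw [MvPowerSeries.coeff_mul]
  have := ConvX.sum (Finset.HasAntidiagonal.antidiagonal d) fun p _ => (h p.1).mul (h' p.2)
  convert this using 2 with N
  ext j : 1
  rw [PowerSeries.coeff_mk, PowerSeries.coeff_mul, map_sum, map_sum]
  simp only [MvPowerSeries.coeff_mul, PowerSeries.coeff_mul, PowerSeries.coeff_mk]
  exact Finset.sum_comm

theorem ConvY.add {f f' : ℕ → PowerSeries (YSeries m)} {a a' : YSeries m}
    (h : ConvY f a) (h' : ConvY f' a') : ConvY (fun N => f N + f' N) (a + a') := by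
  intro d
  have := (h d).add (h' d)
  rw [map_add]
  convert this using 2 with N
  ext j : 1
  simp

theorem ConvY.const (a : YSeries m) : ConvY (fun _ => PowerSeries.C a) a := by
  intro d
  obtain ⟨c, hc⟩ := exists_expLowerBound (MvPowerSeries.coeff d a)
  convert ConvX.const hc using 2 with N
  ext j : 1
  rw [PowerSeries.coeff_mk, PowerSeries.coeff_C, PowerSeries.coeff_C]
  split_ifs <;> simp

theorem ConvY.one : ConvY (fun _ => (1 : PowerSeries (YSeries m))) 1 := by
  simpa using ConvY.const (1 : YSeries m)

theorem ConvY.X : ConvY (fun _ => (PowerSeries.X : PowerSeries (YSeries m))) 1 := by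
  classical
  intro d
  by_cases hd : d = 0
  · subst hd
    convert ConvX.X (n := 1) using 2 with N
    · ext j : 1
      rw [PowerSeries.coeff_mk, PowerSeries.coeff_X, PowerSeries.coeff_X]
      split_ifs <;> simp
    · simp
  · convert ConvX.zero (n := 1) using 2 with N
    · ext j : 1
      rw [PowerSeries.coeff_mk, PowerSeries.coeff_X]
      split_ifs <;> simp [MvPowerSeries.coeff_one, hd]
    · simp [MvPowerSeries.coeff_one, hd]

theorem ConvY.to_zero {r : ℕ → LaurentField 1} (y : YSeries m)
    (h : ConvX (fun N => PowerSeries.C (r N)) 0) :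
    ConvY (fun N => PowerSeries.C (MvPowerSeries.C (r N) * y)) 0 := by
  have : ConvY (fun N => PowerSeries.C (MvPowerSeries.C (σ := Fin m) (r N))) 0 := by
    classical
    intro d
    by_cases hd : d = 0
    · convert h using 2 with N
      · ext j : 1
        rw [PowerSeries.coeff_mk, PowerSeries.coeff_C, PowerSeries.coeff_C]
        split_ifs <;> simp [hd]
      · simp
    · convert ConvX.zero (n := 1) using 2 with N
      · ext j : 1
        rw [PowerSeries.coeff_mk, PowerSeries.coeff_C]
        split_ifs <;> simp [MvPowerSeries.coeff_C, hd]
      · simp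
  simpa using this.mul (ConvY.const y)

theorem ConvY.unique {f f' : ℕ → PowerSeries (YSeries m)} {a a' : YSeries m}
    (h : ConvY f a) (h' : ConvY f' a') (hf : ∃ N₀, ∀ N, N₀ ≤ N → f N = f' N) : a = a' := by
  obtain ⟨N₀, hf⟩ := hf
  ext1 d
  exact (h d).unique (h' d) ⟨N₀, fun N hN => by rw [hf N hN]⟩

theorem ConvY.comp {f : ℕ → PowerSeries (YSeries m)} {a : YSeries m}
    (h : ConvY f a) {r : ℕ → ℕ} (hr : ∀ N, N ≤ r N) : ConvY (fun N => f (r N)) a :=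
  fun d => (h d).comp hr

end Convergence

/-! ### Words of a finite window converge to the expectation -/

section Truncation

open PowerSeries

theorem wordOp_ofFn {A : Type*} [CommRing A] {L : ℕ} (f : Fin L → ℤˣ × A) :
    wordOp (List.ofFn f) = (List.ofFn fun k => wordOp [f k]).prod := by
  simp [wordOp, List.map_ofFn, Function.comp_def]

open Classical in
theorem wordCoeff_singleton {n : ℕ} (p : ℤˣ × LaurentField n) (σ τ : YoungDiagram) :
    wordCoeff [p] σ τ = C (Gamma p.1 p.2 σ τ) *
      X ^ (if p.1 = 1 then τ.card - σ.card else 0) := by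
  have hw : wordCoeff [p] σ τ = letterOp p (basisState τ) σ := by simp [wordCoeff, wordOp]
  rw [hw, letterOp, Gamma, Matrix.of_apply]
  split_ifs with h1 h2 h2
  · have := plusOp_basisState [p.2] τ σ
    simp only [plusOp, List.map_cons, List.map_nil, List.prod_cons, List.prod_nil, mul_one] at this
    rw [this, skew_cons, Finset.sum_eq_single σ]
    · simp [skew_nil]
    · intro b _ hb; simp [skew_nil, hb]
    · intro h; exact absurd (mem_below.2 h2) h
  · have := plusOp_basisState [p.2] τ σ
    simp only [plusOp, List.map_cons, List.map_nil, List.prod_cons, List.prod_nil, mul_one] at this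
    rw [this, skew_cons, Finset.sum_eq_zero]
    intro b hb
    rw [skew_nil, if_neg, mul_zero]
    rintro rfl
    exact h2 (mem_below.1 hb)
  · rw [gammaMinus_apply, Finset.sum_eq_single τ]
    · simp [basisState]
    · intro b _ hb; simp [basisState, hb]
    · intro h; exact absurd (mem_below.2 h2) h
  · rw [gammaMinus_apply, Finset.sum_eq_zero]
    · simp
    · intro b hb
      rw [basisState, if_neg, mul_zero]
      rintro rfl
      exact h2 (mem_below.1 hb)

variable (n : ℕ) [NeZero n] (μ : YoungDiagram)

/-- The letter of the vertex operator `Γ_{μ(t)}(𝔮_t^{-μ(t)})`. -/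
noncomputable def letterX (t : ℤ) : ℤˣ × LaurentField n :=
  (slope μ t, frakq n t ^ (-(slope μ t : ℤ)))

/-- The word of the vertex operators with `-(N + 1) ≤ t < N + 1`. -/
noncomputable def windowWord (N : ℕ) : List (ℤˣ × LaurentField n) :=
  List.ofFn fun i : Fin (2 * N + 1 + 1) => letterX n μ ((i : ℤ) - (N + 1))

variable {n μ}

/-- The path with states `α, τ_1, …, τ_{2N+1}, β` in the window. -/
def windowPath (N : ℕ) (α β : YoungDiagram) (τ : Fin (2 * N + 1) → YoungDiagram) : Path α β where
  toFun t := states α β τ ⟨min (t + (N + 1)).toNat (2 * N + 2), by omega⟩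
  eventually_left := by
    filter_upwards [Filter.eventually_le_atBot (-(N + 1 : ℤ))] with t ht
    have : (⟨min (t + (N + 1)).toNat (2 * N + 2), by omega⟩ : Fin (2 * N + 1 + 2)) = 0 := by
      ext; simp; omega
    rw [this, states_zero]
  eventually_right := by
    filter_upwards [Filter.eventually_ge_atTop (N + 1 : ℤ)] with t ht
    have : (⟨min (t + (N + 1)).toNat (2 * N + 2), by omega⟩ : Fin (2 * N + 1 + 2)) =
        Fin.succ (Fin.last _) := by
      ext; simp; omega
    rw [this]
    simp [states]

theorem windowPath_left (N : ℕ) (α β : YoungDiagram) (τ : Fin (2 * N + 1) → YoungDiagram) {t : ℤ}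
    (ht : t ≤ -((N + 1 : ℕ) : ℤ)) : (windowPath N α β τ).toFun t = α := by
  have : (⟨min (t + (N + 1)).toNat (2 * N + 2), by omega⟩ : Fin (2 * N + 1 + 2)) = 0 := by
    ext; simp; omega
  simp only [windowPath]
  rw [this, states_zero]

theorem windowPath_right (N : ℕ) (α β : YoungDiagram) (τ : Fin (2 * N + 1) → YoungDiagram) {t : ℤ}
    (ht : ((N + 1 : ℕ) : ℤ) ≤ t) : (windowPath N α β τ).toFun t = β := by
  have : (⟨min (t + (N + 1)).toNat (2 * N + 2), by omega⟩ : Fin (2 * N + 1 + 2)) =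
      Fin.succ (Fin.last _) := by
    ext; simp; omega
  simp only [windowPath]
  rw [this]
  simp [states]

theorem windowPath_mid (N : ℕ) (α β : YoungDiagram) (τ : Fin (2 * N + 1) → YoungDiagram)
    (k : Fin (2 * N + 1)) : (windowPath N α β τ).toFun ((k : ℤ) - N) = τ k := by
  have : (⟨min ((k : ℤ) - N + (N + 1)).toNat (2 * N + 2), by omega⟩ : Fin (2 * N + 1 + 2)) =
      Fin.succ (Fin.castSucc k) := by
    ext; simp; omega
  simp only [windowPath]
  rw [this]
  simp [states]

theorem windowPath_eq (N : ℕ) {α β : YoungDiagram} (σ : Path α β)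
    (h1 : ∀ t : ℤ, t ≤ -((N + 1 : ℕ) : ℤ) → σ.toFun t = α)
    (h2 : ∀ t : ℤ, ((N + 1 : ℕ) : ℤ) ≤ t → σ.toFun t = β) :
    windowPath N α β (fun k => σ.toFun ((k : ℤ) - N)) = σ := by
  refine Path.ext' (funext fun t => ?_)
  rcases le_or_gt t (-((N + 1 : ℕ) : ℤ)) with h | h
  · rw [windowPath_left N α β _ h, h1 t h]
  rcases le_or_gt ((N + 1 : ℕ) : ℤ) t with h' | h'
  · rw [windowPath_right N α β _ h', h2 t h']
  have := windowPath_mid N α β (fun k => σ.toFun ((k : ℤ) - N)) ⟨(t + N).toNat, by omega⟩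
  dsimp only at this
  rwa [show (((t + N).toNat : ℕ) : ℤ) - N = t by omega] at this

open Classical in
/-- The number of boxes removed by the operators `Γ_{+1}` along a path. -/
noncomputable def plusDegree (μ : YoungDiagram) {α β : YoungDiagram} (σ : Path α β) : ℕ :=
  ∑ᶠ t : ℤ, if slope μ t = 1 then (σ.toFun (t + 1)).card - (σ.toFun t).card else 0

theorem Ico_window (N : ℕ) : Finset.Ico (-((N + 1 : ℕ) : ℤ)) ((N + 1 : ℕ) : ℤ) =
    Finset.univ.image fun i : Fin (2 * N + 1 + 1) => (i : ℤ) - (N + 1) := by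
  ext t
  simp only [Finset.mem_Ico, Finset.mem_image, Finset.mem_univ, true_and]
  constructor
  · intro h
    exact ⟨⟨(t + (N + 1)).toNat, by omega⟩, by simp; omega⟩
  · rintro ⟨i, rfl⟩
    omega

theorem prod_Ico_window {M : Type*} [CommMonoid M] (N : ℕ) (F : ℤ → M) :
    ∏ t ∈ Finset.Ico (-((N + 1 : ℕ) : ℤ)) ((N + 1 : ℕ) : ℤ), F t =
      ∏ i : Fin (2 * N + 1 + 1), F ((i : ℤ) - (N + 1)) := by
  rw [Ico_window, Finset.prod_image]
  intro i _ j _ h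
  ext
  simpa using h

theorem sum_Ico_window {M : Type*} [AddCommMonoid M] (N : ℕ) (F : ℤ → M) :
    ∑ t ∈ Finset.Ico (-((N + 1 : ℕ) : ℤ)) ((N + 1 : ℕ) : ℤ), F t =
      ∑ i : Fin (2 * N + 1 + 1), F ((i : ℤ) - (N + 1)) := by
  rw [Ico_window, Finset.sum_image]
  intro i _ j _ h
  ext
  simpa using h

theorem states_castSucc (N : ℕ) (α β : YoungDiagram) (τ : Fin (2 * N + 1) → YoungDiagram)
    (k : Fin (2 * N + 1 + 1)) :
    states α β τ k.castSucc = (windowPath N α β τ).toFun ((k : ℤ) - (N + 1)) := by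
  simp only [windowPath]
  congr 1
  ext
  simp

theorem states_succ (N : ℕ) (α β : YoungDiagram) (τ : Fin (2 * N + 1) → YoungDiagram)
    (k : Fin (2 * N + 1 + 1)) :
    states α β τ k.succ = (windowPath N α β τ).toFun ((k : ℤ) - (N + 1) + 1) := by
  simp only [windowPath]
  congr 1
  ext
  simp
  omega

theorem prod_wordCoeff_window (N : ℕ) (α β : YoungDiagram) (τ : Fin (2 * N + 1) → YoungDiagram) :
    ∏ k : Fin (2 * N + 1 + 1), wordCoeff [letterX n μ ((k : ℤ) - (N + 1))]
      (states α β τ k.castSucc) (states α β τ k.succ) =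
    C (pathWeight n μ (windowPath N α β τ)) * X ^ plusDegree μ (windowPath N α β τ) := by
  classical
  have hd : plusDegree μ (windowPath N α β τ) =
      ∑ t ∈ Finset.Ico (-((N + 1 : ℕ) : ℤ)) ((N + 1 : ℕ) : ℤ), if slope μ t = 1 then
        ((windowPath N α β τ).toFun (t + 1)).card - ((windowPath N α β τ).toFun t).card else 0 := by
    unfold plusDegree
    rw [finsum_eq_sum_of_support_subset]
    intro t ht
    by_contra hn
    apply ht
    beta_reduce
    simp only [Finset.coe_Ico, Set.mem_Ico, not_and, not_lt] at hn
    rcases lt_or_ge t (-((N + 1 : ℕ) : ℤ)) with h | h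
    · rw [windowPath_left N α β τ (t := t) (by omega),
        windowPath_left N α β τ (t := t + 1) (by omega)]
      simp
    · rw [windowPath_right N α β τ (t := t) (by have := hn h; omega),
        windowPath_right N α β τ (t := t + 1) (by have := hn h; omega)]
      simp
  rw [pathWeight_eq_prod n μ _ (N + 1) (fun t ht => windowPath_left N α β τ ht)
    (fun t ht => windowPath_right N α β τ ht), hd, prod_Ico_window, sum_Ico_window,
    ← Finset.prod_pow_eq_pow_sum, map_prod, ← Finset.prod_mul_distrib]
  refine Finset.prod_congr rfl fun k _ => ?_
  rw [wordCoeff_singleton, states_castSucc, states_succ]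
  simp only [letterX]
  congr

theorem coeff_windowWord (N : ℕ) (α β : YoungDiagram) {j M : ℕ} (hM : α.card + j ≤ M) :
    coeff j (wordCoeff (windowWord n μ N) α β) =
      ∑ τ ∈ Fintype.piFinset (fun _ : Fin (2 * N + 1) => upto M),
        if plusDegree μ (windowPath N α β τ) = j then pathWeight n μ (windowPath N α β τ)
        else 0 := by
  rw [wordCoeff, windowWord, wordOp_ofFn, ← chainOp_one,
    coeff_chainOp _ (fun k => [letterX n μ ((k : ℤ) - (N + 1))]) _ _ _ hM]
  refine Finset.sum_congr rfl fun τ _ => ?_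
  rw [prod_wordCoeff_window, coeff_C_mul, coeff_X_pow]
  simp [eq_comm]

theorem expLowerBound_pathWeight {α β : YoungDiagram} (σ : Path α β) :
    ExpLowerBound (-((μ.card : ℤ) * α.card + μ.card * β.card)) (pathWeight n μ σ) := by
  rcases pathWeight_cases n μ σ with h | ⟨hadm, h⟩
  · rw [h]; exact expLowerBound_zero _
  · obtain ⟨N, hN⟩ := σ.exists_bound
    rw [h N (hN N le_rfl).1 (hN N le_rfl).2]
    exact expLowerBound_mono fun i => pathExp_lower n hadm N i

theorem sum_ite_comm_range {J : ℕ} {ι : Type*} (s : Finset ι) (d : ι → ℕ) (F : ι → ℚ)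
    (h : ∀ i ∈ s, F i ≠ 0 → d i < J) :
    ∑ j ∈ Finset.range J, ∑ i ∈ s, (if d i = j then F i else 0) = ∑ i ∈ s, F i := by
  rw [Finset.sum_comm]
  refine Finset.sum_congr rfl fun i hi => ?_
  rw [Finset.sum_ite_eq]
  split_ifs with hd
  · rfl
  · by_contra hne
    exact hd (Finset.mem_range.2 (h i hi (Ne.symm hne)))

/-- The truncated expectations converge to the expectation: the coefficient of a monomial involves only
finitely many paths, and a large window contains all of them. -/
theorem convX_windowWord (n : ℕ) [NeZero n] (μ α β : YoungDiagram) :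
    ConvX (fun N => wordCoeff (windowWord n μ N) α β) (expectation n μ α β) := by
  classical
  refine ⟨⟨-((μ.card : ℤ) * α.card + μ.card * β.card), fun N j => ?_⟩, fun g => ?_⟩
  · rw [coeff_windowWord N α β le_rfl]
    refine ExpLowerBound.sum _ fun τ _ => ?_
    split_ifs
    · exact expLowerBound_pathWeight _
    · exact expLowerBound_zero _
  have hfin : {σ : Path α β | (pathWeight n μ σ).coeff g ≠ 0}.Finite :=
    (pathFamily n μ α β).finite_co_support g
  set S := hfin.toFinset with hS
  have hmem : ∀ σ : Path α β, σ ∈ S ↔ (pathWeight n μ σ).coeff g ≠ 0 := by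
    intro σ
    rw [hS, Set.Finite.mem_toFinset]
    exact Iff.rfl
  choose b hb using fun σ : Path α β => σ.exists_bound
  have hcoeff : ∀ N j M, α.card + j ≤ M →
      (coeff j (wordCoeff (windowWord n μ N) α β)).coeff g =
      ∑ τ ∈ Fintype.piFinset (fun _ : Fin (2 * N + 1) => upto M),
        if plusDegree μ (windowPath N α β τ) = j then
          (pathWeight n μ (windowPath N α β τ)).coeff g else 0 := by
    intro N j M hM
    rw [coeff_windowWord N α β hM, HahnSeries.coeff_sum]
    refine Finset.sum_congr rfl fun τ _ => ?_
    split_ifs <;> simp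
  -- `S` is the set of paths that contribute to the coefficient; all of them have bounded degree in `z`
  -- and are constant outside of the window of width `S.sup b`.
  refine ⟨S.sup (plusDegree μ) + 1, S.sup b, fun N j hj => ?_, fun N hN => ?_⟩
  · rw [hcoeff N j _ le_rfl]
    refine Finset.sum_eq_zero fun τ _ => ?_
    split_ifs with hd
    · by_contra hne
      have := Finset.le_sup (f := plusDegree μ) ((hmem _).2 hne)
      omega
    · rfl
  · set J := S.sup (plusDegree μ) + 1 with hJ
    set M := α.card + J + ∑ σ ∈ S, ∑ k : Fin (2 * N + 1), (σ.toFun ((k : ℤ) - N)).card with hM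
    rw [Finset.sum_congr rfl fun j hj => hcoeff N j M
      (by rw [Finset.mem_range] at hj; omega)]
    rw [sum_ite_comm_range]
    · rw [expectation, HahnSeries.SummableFamily.coeff_hsum,
        finsum_eq_sum_of_support_subset _ (s := S) (by
          intro σ hσ
          exact (hmem σ).2 hσ)]
      have hf : ∑ τ ∈ Fintype.piFinset (fun _ : Fin (2 * N + 1) => upto M),
          (pathWeight n μ (windowPath N α β τ)).coeff g =
          ∑ τ ∈ (Fintype.piFinset (fun _ : Fin (2 * N + 1) => upto M)).filter
            (fun τ => windowPath N α β τ ∈ S),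
          (pathWeight n μ (windowPath N α β τ)).coeff g := by
        rw [Finset.sum_filter]
        refine Finset.sum_congr rfl fun τ _ => ?_
        split_ifs with h
        · rfl
        · rw [hmem, not_not] at h; exact h
      rw [hf]
      refine Finset.sum_bij (fun τ _ => windowPath N α β τ) ?_ ?_ ?_ ?_
      · intro τ hτ
        exact (Finset.mem_filter.1 hτ).2
      · intro τ _ τ' _ h
        funext k
        rw [← windowPath_mid N α β τ k, h, windowPath_mid]
      · intro σ hσ
        have hbσ := Finset.le_sup (f := b) hσ
        have he := windowPath_eq N σ (hb σ (N + 1) (by omega)).1 (hb σ (N + 1) (by omega)).2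
        refine ⟨fun k => σ.toFun ((k : ℤ) - N), ?_, he⟩
        rw [Finset.mem_filter, Fintype.mem_piFinset, he]
        refine ⟨fun k => ?_, hσ⟩
        rw [mem_upto, hM]
        have h1 := Finset.single_le_sum (f := fun k : Fin (2 * N + 1) =>
          (σ.toFun ((k : ℤ) - N)).card) (fun _ _ => Nat.zero_le _) (Finset.mem_univ k)
        have h2 := Finset.single_le_sum (f := fun σ : Path α β =>
          ∑ k : Fin (2 * N + 1), (σ.toFun ((k : ℤ) - N)).card) (fun _ _ => Nat.zero_le _) hσ
        omega
      · intro τ _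
        rfl
    · intro τ _ hne
      have := Finset.le_sup (f := plusDegree μ) ((hmem _).2 hne)
      omega

end Truncation

/-! ### The resolved vertex as a limit -/

section Resolved

open PowerSeries

theorem prod_X_pow {m : ℕ} {K : Type*} [CommRing K] (e : Fin m → ℕ) :
    ∏ k, (MvPowerSeries.X k : MvPowerSeries (Fin m) K) ^ e k =
      MvPowerSeries.monomial (Finsupp.equivFunOnFinite.symm e) 1 := by
  classical
  have h : ∀ s : Finset (Fin m), ∏ k ∈ s, (MvPowerSeries.X k : MvPowerSeries (Fin m) K) ^ e k =
      MvPowerSeries.monomial (∑ k ∈ s, Finsupp.single k (e k)) 1 := by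
    intro s
    induction s using Finset.induction_on with
    | empty => simp
    | insert a s ha ih =>
      rw [Finset.prod_insert ha, Finset.sum_insert ha, ih, MvPowerSeries.X_pow_eq,
        MvPowerSeries.monomial_mul_monomial, one_mul]
  have e1 : ∑ k, Finsupp.single k (e k) = Finsupp.equivFunOnFinite.symm e := by
    ext k
    simp [Finsupp.finsetSum_apply, Finsupp.single_apply]
  rw [h, e1]

variable {m : ℕ}

/-- The truncation of the composition of the one-variable blocks of `λ_0, …, λ_m` with the weights
`v_1, …, v_m`. -/
noncomputable def truncY (lam : Fin (m + 1) → YoungDiagram) (α β : YoungDiagram) (N : ℕ) :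
    PowerSeries (YSeries m) :=
  chainOp m (fun k => wordOp ((windowWord 1 (lam k) N).map fun p => (p.1, MvPowerSeries.C p.2)))
    MvPowerSeries.X (basisState β) α

/-- The sum over `τ_1, …, τ_m` of `∏ v_k^{|τ_k|}` times the product of the expectations of the
one-variable blocks. -/
noncomputable def fullY (lam : Fin (m + 1) → YoungDiagram) (α β : YoungDiagram) : YSeries m :=
  fun d => ∑ τ ∈ Fintype.piFinset (fun k => partitionsOfSize (d k)),
    ∏ k : Fin (m + 1), expectation 1 (lam k) (states α β τ k.castSucc) (states α β τ k.succ)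

theorem mem_partitionsOfSize {d : ℕ} {μ : YoungDiagram} :
    μ ∈ partitionsOfSize d ↔ μ.card = d := by
  simp [partitionsOfSize]

theorem coeff_truncY (lam : Fin (m + 1) → YoungDiagram) (α β : YoungDiagram) (N j : ℕ)
    (d : Fin m →₀ ℕ) :
    MvPowerSeries.coeff d (coeff j (truncY lam α β N)) =
      ∑ τ ∈ Fintype.piFinset (fun k => partitionsOfSize (d k)),
        coeff j (∏ k : Fin (m + 1), wordCoeff (windowWord 1 (lam k) N)
          (states α β τ k.castSucc) (states α β τ k.succ)) := by
  classical
  have hM : α.card + j ≤ α.card + j + ∑ k, d k := Nat.le_add_right _ _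
  rw [truncY, coeff_chainOp _ _ _ _ _ hM, map_sum]
  simp only [wordCoeff_map, ← map_prod, coeff_map, prod_X_pow, MvPowerSeries.coeff_mul_C,
    MvPowerSeries.coeff_monomial, ite_mul, one_mul, zero_mul]
  rw [← Finset.sum_filter]
  refine Finset.sum_congr ?_ fun _ _ => rfl
  ext τ
  simp only [Finset.mem_filter, Fintype.mem_piFinset, mem_upto, mem_partitionsOfSize]
  constructor
  · rintro ⟨-, h⟩ k
    rw [h]
    rfl
  · intro h
    refine ⟨fun k => ?_, ?_⟩
    · have := Finset.single_le_sum (f := fun k => d k) (fun _ _ => Nat.zero_le _) (Finset.mem_univ k)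
      have := h k
      omega
    · ext k
      exact (h k).symm

theorem convY_truncY (lam : Fin (m + 1) → YoungDiagram) (α β : YoungDiagram) :
    ConvY (truncY lam α β) (fullY lam α β) := by
  intro d
  have h := ConvX.sum (Fintype.piFinset (fun k => partitionsOfSize (d k))) fun τ _ =>
    ConvX.prod Finset.univ fun k _ =>
      convX_windowWord 1 (lam k) (states α β τ k.castSucc) (states α β τ k.succ)
  convert h using 2 with N
  · ext j : 1
    rw [coeff_mk, coeff_truncY, map_sum]
  · rfl

theorem qtot_one : qtot 1 = qvar 1 0 := by simp [qtot]

theorem qvar_ne_zero (n : ℕ) (i : Fin n) : qvar n i ≠ 0 := by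
  unfold qvar
  exact HahnSeries.single_ne_zero one_ne_zero

/-- The resolved vertex is a sum of products of one-variable expectations, up to a factor that depends
only on `ρ⁺`: the prefactors `q^{-|τ_k|}` of the one-variable vertices cancel the weights `q^{|τ_k|}`. -/
theorem vertexY_eq (ρp ρm : YoungDiagram) (lam : Fin (m + 1) → YoungDiagram) :
    vertexY m ρp ρm lam = MvPowerSeries.C (qtot 1 ^ (-(ρp.card : ℤ)) *
      (vertexV 1 ⊥ ⊥ ⊥ ^ (m + 1))⁻¹) * fullY lam ρm.transpose ρp := by
  ext1 d
  rw [MvPowerSeries.coeff_C_mul]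
  change ∑ τ ∈ Fintype.piFinset (fun k => partitionsOfSize (d k)), _ =
    _ * ∑ τ ∈ Fintype.piFinset (fun k => partitionsOfSize (d k)), _
  rw [Finset.mul_sum]
  refine Finset.sum_congr rfl fun τ _ => ?_
  have hc : chain m ρp ρm τ = states ρm.transpose ρp τ := rfl
  simp only [vertexP, vertexV, YoungDiagram.transpose_transpose, hc]
  simp only [div_eq_mul_inv, Finset.prod_mul_distrib, Finset.prod_const, Finset.card_univ,
    Fintype.card_fin]
  have e1 : ∏ k : Fin (m + 1), qvar 1 0 ^ (-((states ρm.transpose ρp τ k.succ).card : ℤ)) =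
      (∏ k : Fin m, (qtot 1 ^ (τ k).card))⁻¹ * qtot 1 ^ (-(ρp.card : ℤ)) := by
    rw [Fin.prod_univ_castSucc, qtot_one, ← Finset.prod_inv_distrib]
    congr 1
    · refine Finset.prod_congr rfl fun k _ => ?_
      simp [states]
    · simp [states]
  have e2 : (∏ k : Fin m, (qtot 1 ^ (τ k).card)) ≠ 0 :=
    Finset.prod_ne_zero_iff.2 fun k _ => pow_ne_zero _ (by rw [qtot_one]; exact qvar_ne_zero _ _)
  rw [e1, inv_pow]
  field_simp

end Resolved

/-! ### Slope sequences and border strips -/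

section Strips

theorem exists_rowLen_le (μ : YoungDiagram) (t : ℤ) : ∃ i : ℕ, (μ.rowLen i : ℤ) ≤ t + i := by
  refine ⟨μ.card + t.natAbs, ?_⟩
  rw [rowLen_of_card (Nat.le_add_right _ _)]
  omega

/-- The number of elements `≥ t` of the set `{μ_0 - 1, μ_1 - 2, …}`. Equivalently, a box `(i, j)` lies
in `μ` if and only if `i < rk μ (j - i)`. -/
noncomputable def rk (μ : YoungDiagram) (t : ℤ) : ℕ := Nat.find (exists_rowLen_le μ t)

theorem lt_rk {μ : YoungDiagram} {t : ℤ} {i : ℕ} : i < rk μ t ↔ t + i < μ.rowLen i := by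
  rw [rk, Nat.lt_find_iff]
  constructor
  · intro h
    exact not_le.1 (h i le_rfl)
  · intro h k hk
    have := μ.rowLen_anti k i hk
    omega

theorem mem_iff_lt_rk {μ : YoungDiagram} {i j : ℕ} : (i, j) ∈ μ ↔ i < rk μ ((j : ℤ) - i) := by
  rw [lt_rk, YoungDiagram.mem_iff_lt_rowLen]
  omega

theorem slope_eq_one_iff {μ : YoungDiagram} {t : ℤ} :
    slope μ t = 1 ↔ ∃ i : ℕ, t = (μ.rowLen i : ℤ) - (i + 1) := by
  unfold slope
  split_ifs with h
  · simp [h]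
  · simp only [h, iff_false]; decide

theorem slope_ne_one {μ : YoungDiagram} {t : ℤ} (h : slope μ t ≠ 1) : slope μ t = -1 :=
  (Int.units_eq_one_or _).resolve_left h

theorem rk_of_slope_one {μ : YoungDiagram} {t : ℤ} (h : slope μ t = 1) :
    rk μ t = rk μ (t + 1) + 1 := by
  obtain ⟨i, hi⟩ := slope_eq_one_iff.1 h
  have h1 : i < rk μ t := lt_rk.2 (by omega)
  have h2 : ¬ i + 1 < rk μ t := by
    rw [lt_rk]
    have := μ.rowLen_anti i (i + 1) (Nat.le_succ i)
    push_cast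
    omega
  have h3 : ¬ i < rk μ (t + 1) := by rw [lt_rk]; omega
  have h4 : ∀ k, k < i → k < rk μ (t + 1) := by
    intro k hk
    rw [lt_rk]
    have := μ.rowLen_anti k i hk.le
    omega
  rcases Nat.eq_zero_or_pos i with rfl | hpos
  · omega
  · have := h4 (i - 1) (by omega)
    omega

theorem rk_of_slope_ne {μ : YoungDiagram} {t : ℤ} (h : slope μ t ≠ 1) :
    rk μ t = rk μ (t + 1) := by
  refine eq_of_forall_lt_iff fun i => ?_
  rw [lt_rk, lt_rk]
  have : ¬ t = (μ.rowLen i : ℤ) - (i + 1) := fun hi => h (slope_eq_one_iff.2 ⟨i, hi⟩)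
  omega

theorem slope_eq_one_iff_rk {μ : YoungDiagram} {t : ℤ} :
    slope μ t = 1 ↔ rk μ t = rk μ (t + 1) + 1 := by
  constructor
  · exact rk_of_slope_one
  · intro h
    by_contra hne
    rw [rk_of_slope_ne hne] at h
    omega

theorem rk_step (μ : YoungDiagram) (t : ℤ) :
    rk μ (t + 1) ≤ rk μ t ∧ rk μ t ≤ rk μ (t + 1) + 1 := by
  by_cases h : slope μ t = 1
  · rw [rk_of_slope_one h]; omega
  · rw [rk_of_slope_ne h]; omega

theorem rk_antitone (μ : YoungDiagram) : Antitone (rk μ) :=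
  antitone_int_of_succ_le fun t => (rk_step μ t).1

theorem rk_of_card_le {μ : YoungDiagram} {t : ℤ} (h : (μ.card : ℤ) ≤ t) : rk μ t = 0 := by
  by_contra hne
  have := lt_rk.1 (Nat.pos_of_ne_zero hne)
  have := rowLen_le_card μ 0
  omega

theorem neg_le_rk (μ : YoungDiagram) (t : ℤ) : -t ≤ rk μ t := by
  by_contra hlt
  have h : ¬ rk μ t < rk μ t := lt_irrefl _
  rw [lt_rk] at h
  omega

theorem rk_of_le_neg_card {μ : YoungDiagram} {t : ℤ} (h : t ≤ -(μ.card : ℤ)) :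
    (rk μ t : ℤ) = -t := by
  have h1 := neg_le_rk μ t
  have h2 : ¬ (-t).toNat < rk μ t := by
    rw [lt_rk, rowLen_of_card (by omega)]
    omega
  omega

/-- A partition is determined by its slope sequence. -/
theorem eq_of_slope_eq {μ ν : YoungDiagram} (h : ∀ t, slope μ t = slope ν t) : μ = ν := by
  have hrk : ∀ t, rk μ t = rk ν t := by
    have key : ∀ k : ℕ, ∀ t : ℤ, (μ.card : ℤ) + ν.card - k ≤ t → rk μ t = rk ν t := by
      intro k
      induction k with
      | zero => intro t ht; rw [rk_of_card_le (by omega), rk_of_card_le (by omega)]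
      | succ k ih =>
        intro t ht
        have := ih (t + 1) (by push_cast at ht; omega)
        by_cases hs : slope μ t = 1
        · rw [rk_of_slope_one hs, rk_of_slope_one ((h t).symm.trans hs), this]
        · rw [rk_of_slope_ne hs, rk_of_slope_ne (fun h' => hs ((h t).trans h')), this]
    intro t
    exact key ((μ.card : ℤ) + ν.card - t).toNat t (by omega)
  ext ⟨i, j⟩
  rw [YoungDiagram.mem_cells, YoungDiagram.mem_cells, mem_iff_lt_rk, mem_iff_lt_rk, hrk]

/-- The diagram `μ` arises from `ν` by adding one box on each diagonal of content in `(a, b]`. On slope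
sequences, a `+1` moves from `a` to `b`. -/
def RimStep (a b : ℤ) (ν μ : YoungDiagram) : Prop :=
  ∀ t, rk μ t = rk ν t + if a < t ∧ t ≤ b then 1 else 0

variable {a b : ℤ} {ν μ : YoungDiagram}

theorem RimStep.slope_left (h : RimStep a b ν μ) (hab : a < b) :
    slope ν a = 1 ∧ slope μ a ≠ 1 := by
  have h1 := h a
  have h2 := h (a + 1)
  rw [if_neg (by omega)] at h1
  rw [if_pos (by omega)] at h2
  have := rk_step ν a
  have := rk_step μ a
  rw [Ne, slope_eq_one_iff_rk, slope_eq_one_iff_rk]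
  omega

theorem RimStep.slope_right (h : RimStep a b ν μ) (hab : a < b) :
    slope ν b ≠ 1 ∧ slope μ b = 1 := by
  have h1 := h b
  have h2 := h (b + 1)
  rw [if_pos (by omega)] at h1
  rw [if_neg (by omega)] at h2
  have := rk_step ν b
  have := rk_step μ b
  rw [Ne, slope_eq_one_iff_rk, slope_eq_one_iff_rk]
  omega

theorem slope_eq_of_iff {μ ν : YoungDiagram} {s t : ℤ} (h : slope μ s = 1 ↔ slope ν t = 1) :
    slope μ s = slope ν t := by
  by_cases hs : slope μ s = 1
  · rw [hs, h.1 hs]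
  · rw [slope_ne_one hs, slope_ne_one (fun ht => hs (h.2 ht))]

theorem RimStep.slope_eq (h : RimStep a b ν μ) {t : ℤ} (ha : t ≠ a) (hb : t ≠ b) :
    slope μ t = slope ν t := by
  refine slope_eq_of_iff ?_
  have h1 := h t
  have h2 := h (t + 1)
  rw [slope_eq_one_iff_rk, slope_eq_one_iff_rk]
  by_cases hc : a < t ∧ t ≤ b
  · rw [if_pos hc] at h1
    rw [if_pos (by omega)] at h2
    omega
  · rw [if_neg hc] at h1
    rw [if_neg (by omega)] at h2
    omega

/-- A sequence of the form of `rk ν` comes from a partition. -/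
theorem exists_rk_eq (N : ℤ → ℕ) (T : ℕ) (h1 : ∀ t, N (t + 1) ≤ N t ∧ N t ≤ N (t + 1) + 1)
    (h2 : ∀ t : ℤ, (T : ℤ) ≤ t → N t = 0) (h3 : ∀ t : ℤ, t ≤ -(T : ℤ) → (N t : ℤ) = -t) :
    ∃ ν : YoungDiagram, ∀ t, rk ν t = N t := by
  have hanti : Antitone N := antitone_int_of_succ_le fun t => (h1 t).1
  have hmono : Monotone fun t => (N t : ℤ) + t := by
    refine monotone_int_of_le_succ fun t => ?_
    have := (h1 t).2
    omega
  have hneg : ∀ t, -t ≤ (N t : ℤ) := by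
    intro t
    rcases le_total t (-(T : ℤ)) with h | h
    · rw [h3 t h]
    · have := hmono h
      have := h3 _ (le_refl (-(T : ℤ)))
      dsimp only at *
      omega
  let ν : YoungDiagram :=
    { cells := (Finset.range T ×ˢ Finset.range (2 * T)).filter
        fun c => c.1 < N ((c.2 : ℤ) - c.1)
      isLowerSet := by
        rintro ⟨i, j⟩ ⟨i', j'⟩ ⟨hi, hj⟩ hc
        simp only [Finset.coe_filter, Finset.mem_product, Finset.mem_range, Set.mem_ofPred_eq]
          at hc ⊢
        dsimp only at hi hj
        refine ⟨by omega, ?_⟩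
        have e1 := hanti (show (j' : ℤ) - i ≤ (j : ℤ) - i by omega)
        have e2 := hmono (show (j' : ℤ) - i ≤ (j' : ℤ) - i' by omega)
        dsimp only at e2
        omega }
  have hmem : ∀ i j : ℕ, (i, j) ∈ ν ↔ i < N ((j : ℤ) - i) := by
    intro i j
    rw [← YoungDiagram.mem_cells]
    simp only [ν, Finset.mem_filter, Finset.mem_product, Finset.mem_range, and_iff_right_iff_imp]
    intro h
    have e1 : (j : ℤ) - i < T := by
      by_contra hc
      rw [h2 _ (by omega)] at h
      omega
    have e2 : i < T := by
      by_contra hc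
      have := hanti (show -(i : ℤ) ≤ (j : ℤ) - i by omega)
      have := h3 (-(i : ℤ)) (by omega)
      omega
    omega
  refine ⟨ν, fun t => eq_of_forall_lt_iff fun i => ?_⟩
  rw [lt_rk]
  rcases le_or_gt 0 (t + i) with h | h
  · have := hmem i (t + i).toNat
    rw [YoungDiagram.mem_iff_lt_rowLen, show ((t + i).toNat : ℤ) - i = t by omega] at this
    omega
  · have := hneg t
    omega

theorem exists_rimStep (hab : a < b) (ha : slope μ a ≠ 1) (hb : slope μ b = 1) :
    ∃ ν, RimStep a b ν μ := by
  have e1 := rk_of_slope_ne ha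
  have e2 := rk_of_slope_one hb
  have hpos : ∀ t, t ≤ b → 1 ≤ rk μ t := fun t ht => by
    have := rk_antitone μ ht
    omega
  obtain ⟨ν, hν⟩ := exists_rk_eq (fun t => rk μ t - if a < t ∧ t ≤ b then 1 else 0)
    (μ.card + a.natAbs + b.natAbs + 1) (fun t => by
      have h1 := rk_step μ t
      have h3 := hpos t
      have h4 := hpos (t + 1)
      by_cases hta : t = a
      · subst hta
        split_ifs <;> omega
      by_cases htb : t = b
      · subst htb
        split_ifs <;> omega
      split_ifs <;> omega)
    (fun t ht => by rw [rk_of_card_le (by omega), Nat.zero_sub])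
    (fun t ht => by
      rw [if_neg (by omega), Nat.sub_zero, rk_of_le_neg_card (by omega)])
  refine ⟨ν, fun t => ?_⟩
  rw [hν]
  split_ifs with hc
  · have := hpos t hc.2
    omega
  · rfl

theorem RimStep.le (h : RimStep a b ν μ) : ν ≤ μ := by
  rintro ⟨i, j⟩ hc
  have hc' : i < rk ν ((j : ℤ) - i) := mem_iff_lt_rk.1 hc
  refine mem_iff_lt_rk.2 ?_
  rw [h]
  exact Nat.lt_add_right _ hc'

/-- The first box of content `t` outside of `ν`. -/
noncomputable def stripBox (ν : YoungDiagram) (t : ℤ) : ℕ × ℕ := (rk ν t, (rk ν t + t).toNat)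

theorem stripBox_content (ν : YoungDiagram) (t : ℤ) :
    ((stripBox ν t).2 : ℤ) - (stripBox ν t).1 = t := by
  have := neg_le_rk ν t
  simp only [stripBox]
  omega

theorem stripBox_injective (ν : YoungDiagram) : Function.Injective (stripBox ν) := by
  intro s t h
  rw [← stripBox_content ν s, h, stripBox_content]

theorem RimStep.cells_sdiff (h : RimStep a b ν μ) :
    μ.cells \ ν.cells = (Finset.Ioc a b).image (stripBox ν) := by
  ext ⟨i, j⟩
  rw [Finset.mem_sdiff, YoungDiagram.mem_cells, YoungDiagram.mem_cells, mem_iff_lt_rk,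
    mem_iff_lt_rk, h, Finset.mem_image]
  constructor
  · rintro ⟨h1, h2⟩
    refine ⟨(j : ℤ) - i, ?_, ?_⟩
    · rw [Finset.mem_Ioc]
      by_contra hc
      rw [if_neg hc] at h1
      omega
    · have : rk ν ((j : ℤ) - i) = i := by split_ifs at h1 <;> omega
      simp only [stripBox, this]
      ext <;> simp
  · rintro ⟨t, ht, he⟩
    rw [Finset.mem_Ioc] at ht
    have hc := stripBox_content ν t
    rw [he] at hc
    dsimp only at hc
    have h1 : rk ν t = i := congrArg Prod.fst he
    rw [hc, if_pos ht]
    omega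

theorem RimStep.prod_cells {M : Type*} [CommMonoid M] (h : RimStep a b ν μ) (F : ℕ × ℕ → M) :
    ∏ c ∈ μ.cells, F c = (∏ c ∈ ν.cells, F c) * ∏ t ∈ Finset.Ioc a b, F (stripBox ν t) := by
  rw [← Finset.prod_sdiff (YoungDiagram.cells_subset_iff.2 h.le), h.cells_sdiff,
    Finset.prod_image fun s _ t _ hst => stripBox_injective ν hst, mul_comm]

theorem RimStep.stripHeight_add (h : RimStep a b ν μ) (hab : a < b) :
    stripHeight ν μ + rk ν b = rk ν (a + 1) := by
  have key : ∀ c, a + 1 ≤ c →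
      ((Finset.Ioc a c).image (rk ν)).card + rk ν c = rk ν (a + 1) + 1 := by
    intro c hc
    induction c, hc using Int.leInduction with
    | base =>
      have : Finset.Ioc a (a + 1) = {a + 1} := by ext; simp; omega
      rw [this]
      simp
      omega
    | succ c hc ih =>
      have e : Finset.Ioc a (c + 1) = insert (c + 1) (Finset.Ioc a c) := by ext; simp; omega
      rw [e, Finset.image_insert]
      have h1 := rk_step ν c
      by_cases hs : rk ν c = rk ν (c + 1)
      · rw [Finset.insert_eq_of_mem, ← hs, ih]
        exact Finset.mem_image.2 ⟨c, by simp; omega, hs⟩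
      · rw [Finset.card_insert_of_notMem]
        · omega
        · intro hm
          obtain ⟨t, ht, he⟩ := Finset.mem_image.1 hm
          rw [Finset.mem_Ioc] at ht
          have := rk_antitone ν ht.2
          omega
  have himg : (μ.cells \ ν.cells).image Prod.fst = (Finset.Ioc a b).image (rk ν) := by
    rw [h.cells_sdiff, Finset.image_image]
    rfl
  have h1 := key b (by omega)
  have h2 := rk_antitone ν (show a + 1 ≤ b by omega)
  rw [stripHeight, himg]
  omega

/-- Adding a box on `n` consecutive diagonals is adding a border strip. -/
theorem RimStep.isBorderStrip {n : ℕ} (h : RimStep a (a + n) ν μ) : IsBorderStrip n ν μ := by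
  refine ⟨h.le, ?_, ?_, ?_⟩
  · rw [h.cells_sdiff, Finset.card_image_of_injective _ (stripBox_injective ν), Int.card_Ioc]
    omega
  · rw [h.cells_sdiff]
    set S := (Finset.Ioc a (a + n)).image (stripBox ν) with hS
    have hsymm : Std.Symm (fun c d : ℕ × ℕ => c ∈ S ∧ d ∈ S ∧ BoxAdj c d) := by
      refine ⟨fun c d hcd => ⟨hcd.2.1, hcd.1, ?_⟩⟩
      have := hcd.2.2
      unfold BoxAdj at *
      omega
    have key : ∀ s t : ℤ, a < s → s ≤ t → t ≤ a + n →
        Relation.ReflTransGen (fun c d => c ∈ S ∧ d ∈ S ∧ BoxAdj c d)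
          (stripBox ν s) (stripBox ν t) := by
      intro s t hs hst
      induction t, hst using Int.leInduction with
      | base => intro _; exact Relation.ReflTransGen.refl
      | succ t hst ih =>
        intro ht
        refine (ih (by omega)).tail ⟨?_, ?_, ?_⟩
        · exact Finset.mem_image_of_mem _ (Finset.mem_Ioc.2 ⟨by omega, by omega⟩)
        · exact Finset.mem_image_of_mem _ (Finset.mem_Ioc.2 ⟨by omega, by omega⟩)
        · have h1 := rk_step ν t
          have h2 := neg_le_rk ν t
          have h3 := neg_le_rk ν (t + 1)
          simp only [BoxAdj, stripBox]
          omega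
    intro c hc d hd
    obtain ⟨s, hs, rfl⟩ := Finset.mem_image.1 hc
    obtain ⟨t, ht, rfl⟩ := Finset.mem_image.1 hd
    rw [Finset.mem_Ioc] at hs ht
    rcases le_total s t with hst | hst
    · exact key s t hs.1 hst ht.2
    · exact Std.Symm.symm _ _ (key t s ht.1 hst hs.2)
  · rintro ⟨i, j, h1, -, -, h4⟩
    rw [h.cells_sdiff, Finset.mem_image] at h1 h4
    obtain ⟨s, -, hs⟩ := h1
    obtain ⟨t, -, ht⟩ := h4
    have e1 := stripBox_content ν s
    have e2 := stripBox_content ν t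
    rw [hs] at e1
    rw [ht] at e2
    have : s = t := by push_cast at e1 e2; omega
    rw [this, ht] at hs
    simp at hs

/-- Every border strip arises in this way. -/
theorem IsBorderStrip.exists_rimStep {n : ℕ} (hn : 0 < n) (h : IsBorderStrip n ν μ) :
    ∃ a, RimStep a (a + n) ν μ := by
  obtain ⟨hle, hcard, hconn, hsq⟩ := h
  set S := μ.cells \ ν.cells with hS
  have hmem : ∀ i j : ℕ, (i, j) ∈ S ↔ i < rk μ ((j : ℤ) - i) ∧ rk ν ((j : ℤ) - i) ≤ i := by
    intro i j
    rw [hS, Finset.mem_sdiff, YoungDiagram.mem_cells, YoungDiagram.mem_cells, mem_iff_lt_rk,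
      mem_iff_lt_rk, not_lt]
  have hrk : ∀ t, rk ν t ≤ rk μ t := by
    intro t
    refine le_of_forall_lt fun i hi => ?_
    rw [lt_rk] at hi ⊢
    have := rowLen_mono hle i
    omega
  -- Two boxes of the same content would give a `2 × 2` square.
  have hone : ∀ t, rk μ t ≤ rk ν t + 1 := by
    intro t
    by_contra hc
    apply hsq
    have hneg := neg_le_rk ν t
    obtain ⟨j, hj⟩ : ∃ j : ℕ, (j : ℤ) = rk ν t + t := ⟨(rk ν t + t).toNat, by omega⟩
    have e0 : (j : ℤ) - (rk ν t : ℤ) = t := by omega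
    have s1 := rk_step μ t
    have s2 := rk_step ν t
    have s3 := rk_step μ (t - 1)
    have s4 := rk_step ν (t - 1)
    rw [sub_add_cancel] at s3 s4
    refine ⟨rk ν t, j, (hmem _ _).2 ?_, (hmem _ _).2 ?_, (hmem _ _).2 ?_, (hmem _ _).2 ?_⟩
    · rw [e0]; omega
    · rw [show (j : ℤ) - ((rk ν t + 1 : ℕ) : ℤ) = t - 1 by push_cast; omega]; omega
    · rw [show ((j + 1 : ℕ) : ℤ) - (rk ν t : ℤ) = t + 1 by push_cast; omega]; omega
    · rw [show ((j + 1 : ℕ) : ℤ) - ((rk ν t + 1 : ℕ) : ℤ) = t by push_cast; omega]; omega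
  set T : Finset ℤ := S.image fun c => (c.2 : ℤ) - c.1 with hT
  have hinj : Set.InjOn (fun c : ℕ × ℕ => (c.2 : ℤ) - c.1) S := by
    rintro ⟨i, j⟩ h1 ⟨i', j'⟩ h2 he
    rw [Finset.mem_coe, hmem] at h1 h2
    dsimp only at he
    rw [← he] at h2
    have := hone ((j : ℤ) - i)
    ext
    · dsimp only; omega
    · dsimp only; omega
  have hTcard : T.card = n := by rw [hT, Finset.card_image_of_injOn hinj, hcard]
  have hconv : ∀ c ∈ S, ∀ d ∈ S, ∀ x : ℤ, (c.2 : ℤ) - c.1 ≤ x → x ≤ (d.2 : ℤ) - d.1 → x ∈ T := by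
    intro c hc d hd x
    have hp := hconn c hc d hd
    revert hc
    induction hp using Relation.ReflTransGen.head_induction_on with
    | refl =>
      intro _ h1 h2
      exact Finset.mem_image.2 ⟨d, hd, le_antisymm h1 h2⟩
    | @head c c' hcc' _ ih =>
      intro hc h1 h2
      rcases h1.eq_or_lt with h1 | h1
      · exact Finset.mem_image.2 ⟨c, hc, h1⟩
      · refine ih hcc'.2.1 ?_ h2
        have := hcc'.2.2
        unfold BoxAdj at this
        omega
  have hne : T.Nonempty := Finset.card_pos.1 (by omega)
  have hIcc : T = Finset.Icc (T.min' hne) (T.max' hne) := by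
    ext x
    rw [Finset.mem_Icc]
    constructor
    · exact fun hx => ⟨T.min'_le x hx, T.le_max' x hx⟩
    · rintro ⟨h1, h2⟩
      obtain ⟨c, hc, hc'⟩ := Finset.mem_image.1 (T.min'_mem hne)
      obtain ⟨d, hd, hd'⟩ := Finset.mem_image.1 (T.max'_mem hne)
      exact hconv c hc d hd x (hc'.trans_le h1) (h2.trans hd'.ge)
  have hmm : T.max' hne = T.min' hne - 1 + n := by
    have h1 := hTcard
    rw [hIcc, Int.card_Icc] at h1
    omega
  refine ⟨T.min' hne - 1, fun t => ?_⟩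
  have hTt : t ∈ T ↔ rk μ t = rk ν t + 1 := by
    constructor
    · intro ht
      obtain ⟨⟨i, j⟩, hc, rfl⟩ := Finset.mem_image.1 ht
      rw [hmem] at hc
      have := hone ((j : ℤ) - i)
      dsimp only
      omega
    · intro ht
      have hneg := neg_le_rk ν t
      refine Finset.mem_image.2 ⟨(rk ν t, (rk ν t + t).toNat), (hmem _ _).2 ?_, ?_⟩
      · rw [show (((rk ν t + t).toNat : ℕ) : ℤ) - (rk ν t : ℤ) = t by omega]; omega
      · dsimp only; omega
  rw [hIcc, Finset.mem_Icc, hmm] at hTt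
  have := hrk t
  have := hone t
  split_ifs with hc
  · exact hTt.1 ⟨by omega, by omega⟩
  · have : ¬ rk μ t = rk ν t + 1 := fun he => hc (by have := hTt.2 he; omega)
    omega

end Strips

/-! ### Rational functions and their two expansions -/

section Rational

open MvPolynomial

/-- The field of rational functions in `q, v_1, …, v_m`. -/
abbrev RatField (m : ℕ) : Type := FractionRing (MvPolynomial (Fin (m + 1)) ℚ)

instance (m : ℕ) : IsDomain (YSeries m) := NoZeroDivisors.to_isDomain _

/-- The fraction field of the power series in `v_1, …, v_m` over the Laurent series in `q`. -/
abbrev YFrac (m : ℕ) : Type := FractionRing (YSeries m)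

/-- Power series as elements of their fraction field. -/
noncomputable def toYFrac (m : ℕ) : YSeries m →+* YFrac m := algebraMap _ _

variable {m : ℕ}

theorem toYFrac_injective : Function.Injective (toYFrac m) := IsFractionRing.injective _ _

theorem coeff_aeval_mono {n : ℕ} {σ : Type*} [Fintype σ] (e : σ → Fin n → ℤ)
    (p : MvPolynomial σ ℚ) (g : Lex (Fin n → ℤ)) :
    (aeval (fun i => VertexCRC.mono (e i)) p : LaurentField n).coeff g =
      ∑ d ∈ p.support, if g = toLex (∑ i, d i • e i) then p.coeff d else 0 := by
  classical
  rw [aeval_def, eval₂_eq', HahnSeries.coeff_sum]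
  refine Finset.sum_congr rfl fun d _ => ?_
  have h1 : ∏ i, (VertexCRC.mono (e i) : LaurentField n) ^ d i =
      VertexCRC.mono (∑ i, d i • e i) := by
    rw [mono_sum]
    exact Finset.prod_congr rfl fun i _ => (mono_nsmul _ _).symm
  rw [h1, ← Algebra.smul_def, HahnSeries.coeff_smul]
  unfold VertexCRC.mono
  split_ifs with h
  · subst h; simp
  · rw [HahnSeries.coeff_single_of_ne h, smul_zero]

theorem aeval_mono_injective {n : ℕ} {σ : Type*} [Fintype σ] (e : σ → Fin n → ℤ)
    (he : ∀ d d' : σ →₀ ℕ, ∑ i, d i • e i = ∑ i, d' i • e i → d = d') :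
    Function.Injective (aeval (R := ℚ) fun i => (VertexCRC.mono (e i) : LaurentField n)) := by
  classical
  rw [injective_iff_map_eq_zero]
  intro p hp
  ext d
  have h := coeff_aeval_mono e p (toLex (∑ i, d i • e i))
  rw [hp, HahnSeries.coeff_zero] at h
  rw [coeff_zero]
  by_contra hne
  rw [Finset.sum_eq_single d] at h
  · rw [if_pos rfl] at h; exact hne h.symm
  · intro d' _ hd'
    rw [if_neg]
    intro h2
    exact hd' (he _ _ (toLex.injective h2)).symm
  · intro h2
    exact absurd (mem_support_iff.2 hne) h2

/-- The exponent vectors of `q_0 ⋯ q_m, q_1, …, q_m`. -/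
def exponentX (m : ℕ) : Fin (m + 1) → Fin (m + 1) → ℤ :=
  Fin.cons (fun _ => 1) fun i => Pi.single i.succ 1

theorem qvar_eq (n : ℕ) (i : Fin n) : qvar n i = VertexCRC.mono (Pi.single i 1) := rfl

theorem qtot_eq (n : ℕ) : qtot n = VertexCRC.mono fun _ => 1 := by
  unfold qtot
  simp only [qvar_eq]
  rw [← mono_sum]
  congr 1
  funext i
  simp [Pi.single_apply]

theorem substX_eq (m : ℕ) : (Fin.cons (qtot (m + 1)) (fun i : Fin m => qvar (m + 1) i.succ) :
    Fin (m + 1) → LaurentField (m + 1)) = fun i => VertexCRC.mono (exponentX m i) := by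
  funext i
  refine Fin.cases ?_ (fun i => ?_) i
  · simp [exponentX, qtot_eq]
  · simp [exponentX, qvar_eq]

theorem substX_injective (m : ℕ) : Function.Injective (aeval (R := ℚ)
    (Fin.cons (qtot (m + 1)) (fun i : Fin m => qvar (m + 1) i.succ) :
      Fin (m + 1) → LaurentField (m + 1))) := by
  rw [substX_eq]
  refine aeval_mono_injective _ fun d d' h => ?_
  have key : ∀ (d : Fin (m + 1) →₀ ℕ) (j : Fin (m + 1)), (∑ i, d i • exponentX m i) j =
      d 0 + if j = 0 then 0 else (d j : ℤ) := by
    intro d j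
    rw [Finset.sum_apply, Fin.sum_univ_succ]
    refine congrArg₂ _ (by simp [exponentX]) ?_
    refine Fin.cases ?_ (fun j => ?_) j
    · simp [exponentX, Fin.succ_ne_zero, eq_comm]
    · simp [exponentX, Pi.single_apply, Fin.succ_ne_zero]
  have h0 : d 0 = d' 0 := by
    have := congrFun h 0
    rw [key, key] at this
    simpa using this
  ext j
  have := congrFun h j
  rw [key, key, h0] at this
  by_cases hj : j = 0
  · rw [hj, h0]
  · simp only [hj, if_false] at this
    omega

theorem qtot_one_pow (j : ℕ) : qtot 1 ^ j = VertexCRC.mono fun _ => (j : ℤ) := by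
  rw [qtot_eq, ← mono_nsmul]
  congr 1
  funext i
  simp

theorem substY_injective (m : ℕ) : Function.Injective (aeval (R := ℚ)
    (Fin.cons (MvPowerSeries.C (qtot 1)) MvPowerSeries.X : Fin (m + 1) → YSeries m)) := by
  classical
  rw [injective_iff_map_eq_zero]
  intro p hp
  ext d
  rw [coeff_zero]
  by_contra hne
  have h1 : ∀ d : Fin (m + 1) →₀ ℕ, ∏ i, (Fin.cons (MvPowerSeries.C (qtot 1)) MvPowerSeries.X :
      Fin (m + 1) → YSeries m) i ^ d i = MvPowerSeries.monomial d.tail (qtot 1 ^ d 0) := by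
    intro d
    rw [Fin.prod_univ_succ]
    simp only [Fin.cons_zero, Fin.cons_succ]
    rw [prod_X_pow (fun i : Fin m => d i.succ), ← map_pow, ← MvPowerSeries.smul_eq_C_mul,
      ← map_smul, smul_eq_mul, mul_one]
    congr 1
  have hs : ∀ (a : ℚ) (f : YSeries m) (e : Fin m →₀ ℕ),
      MvPowerSeries.coeff e (a • f) = a • MvPowerSeries.coeff e f := fun _ _ _ => rfl
  have h := congrArg (fun f => (MvPowerSeries.coeff d.tail f).coeff (toLex fun _ => (d 0 : ℤ))) hp
  simp only [aeval_def, eval₂_eq', h1, ← Algebra.smul_def, map_sum, HahnSeries.coeff_sum,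
    map_zero, HahnSeries.coeff_zero] at h
  rw [Finset.sum_eq_single d] at h
  · rw [hs, MvPowerSeries.coeff_monomial_same, HahnSeries.coeff_smul,
      qtot_one_pow] at h
    simp [VertexCRC.mono] at h
    exact hne h
  · intro d' _ hd'
    rw [hs, MvPowerSeries.coeff_monomial]
    split_ifs with h2
    · rw [HahnSeries.coeff_smul, qtot_one_pow, VertexCRC.mono, HahnSeries.coeff_single_of_ne,
        smul_zero]
      intro h3
      apply hd'
      ext i
      refine Fin.cases ?_ (fun i => ?_) i
      · have := congrFun (toLex.injective h3) 0
        exact_mod_cast this.symm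
      · have := DFunLike.congr_fun h2 i
        exact this.symm
    · simp
  · intro h2
    exact absurd (mem_support_iff.2 hne) h2

/-- The expansion of a rational function as a Laurent series in `q_0, …, q_m`, for
`q = q_0 ⋯ q_m` and `v_i = q_i`. -/
noncomputable def expandX (m : ℕ) : RatField m →+* LaurentField (m + 1) :=
  IsFractionRing.lift (g := (aeval (R := ℚ)
    (Fin.cons (qtot (m + 1)) (fun i : Fin m => qvar (m + 1) i.succ) :
      Fin (m + 1) → LaurentField (m + 1))).toRingHom) (substX_injective m)

/-- The expansion of a rational function as a quotient of power series in `v_1, …, v_m` over the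
Laurent series in `q`. -/
noncomputable def expandY (m : ℕ) : RatField m →+* YFrac m :=
  IsFractionRing.lift (g := (toYFrac m).comp (aeval (R := ℚ)
    (Fin.cons (MvPowerSeries.C (qtot 1)) MvPowerSeries.X : Fin (m + 1) → YSeries m)).toRingHom)
    (toYFrac_injective.comp (substY_injective m))

theorem expandX_algebraMap (p : MvPolynomial (Fin (m + 1)) ℚ) :
    expandX m (algebraMap _ _ p) = aeval (Fin.cons (qtot (m + 1))
      (fun i : Fin m => qvar (m + 1) i.succ) : Fin (m + 1) → LaurentField (m + 1)) p :=
  IsFractionRing.lift_algebraMap _ _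

theorem expandY_algebraMap (p : MvPolynomial (Fin (m + 1)) ℚ) :
    expandY m (algebraMap _ _ p) = toYFrac m (aeval (Fin.cons (MvPowerSeries.C (qtot 1))
      MvPowerSeries.X : Fin (m + 1) → YSeries m) p) :=
  IsFractionRing.lift_algebraMap _ _

/-- It suffices to find one element of the field of rational functions with the given expansions. -/
theorem eqAfterChange_of_expand {x : LaurentField (m + 1)} {y : YSeries m} (r : RatField m)
    (hx : x = expandX m r) (hy : toYFrac m y = expandY m r) : EqAfterChange m x y := by
  obtain ⟨A, B, hB, rfl⟩ := IsFractionRing.div_surjective (A := MvPolynomial (Fin (m + 1)) ℚ) r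
  have hB0 : B ≠ 0 := nonZeroDivisors.ne_zero hB
  refine ⟨A, B, hB0, ?_, ?_⟩
  · apply toYFrac_injective
    rw [map_mul, hy, ← expandY_algebraMap, ← expandY_algebraMap, ← map_mul, mul_div_cancel₀]
    simpa using hB0
  · rw [hx, ← expandX_algebraMap, ← expandX_algebraMap, ← map_mul, mul_div_cancel₀]
    simpa using hB0

variable (m) in
/-- The variable `q`. -/
noncomputable def ratQ : RatField m := algebraMap _ _ (X 0 : MvPolynomial (Fin (m + 1)) ℚ)

/-- The variable `v_{i+1}`. -/
noncomputable def ratV (i : Fin m) : RatField m :=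
  algebraMap _ _ (X i.succ : MvPolynomial (Fin (m + 1)) ℚ)

theorem expandX_ratQ : expandX m (ratQ m) = qtot (m + 1) := by
  rw [ratQ, expandX_algebraMap, aeval_X, Fin.cons_zero]

theorem expandX_ratV (i : Fin m) : expandX m (ratV i) = qvar (m + 1) i.succ := by
  rw [ratV, expandX_algebraMap, aeval_X, Fin.cons_succ]

theorem expandY_ratQ : expandY m (ratQ m) = toYFrac m (MvPowerSeries.C (qtot 1)) := by
  rw [ratQ, expandY_algebraMap, aeval_X, Fin.cons_zero]

theorem expandY_ratV (i : Fin m) : expandY m (ratV i) = toYFrac m (MvPowerSeries.X i) := by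
  rw [ratV, expandY_algebraMap, aeval_X, Fin.cons_succ]

theorem qtot_ne_zero (n : ℕ) : qtot n ≠ 0 :=
  Finset.prod_ne_zero_iff.2 fun _ _ => qvar_ne_zero _ _

theorem ratQ_ne_zero : ratQ m ≠ 0 := fun h =>
  qtot_ne_zero (m + 1) (by rw [← expandX_ratQ, h, map_zero])

theorem ratV_ne_zero (i : Fin m) : ratV i ≠ 0 := fun h =>
  qvar_ne_zero (m + 1) i.succ (by rw [← expandX_ratV, h, map_zero])

theorem expandY_ratQ_zpow (s : ℤ) :
    expandY m (ratQ m ^ s) = toYFrac m (MvPowerSeries.C (qtot 1 ^ s)) := by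
  rw [map_zpow₀, expandY_ratQ]
  exact (map_zpow₀ ((toYFrac m).comp MvPowerSeries.C) (qtot 1) s).symm

/-- The product `v_1 ⋯ v_k`. -/
noncomputable def ratC (k : Fin (m + 1)) : RatField m :=
  ∏ i ∈ Finset.univ.filter (fun i : Fin m => (i : ℕ) < k), ratV i

theorem ratC_ne_zero (k : Fin (m + 1)) : ratC k ≠ 0 :=
  Finset.prod_ne_zero_iff.2 fun _ _ => ratV_ne_zero _

theorem ratC_zero : ratC (0 : Fin (m + 1)) = 1 := by simp [ratC]

theorem ratC_succ (k : Fin m) : ratC k.succ = ratC k.castSucc * ratV k := by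
  have : Finset.univ.filter (fun i : Fin m => (i : ℕ) < (k.succ : Fin (m + 1))) =
      insert k (Finset.univ.filter (fun i : Fin m => (i : ℕ) < (k.castSucc : Fin (m + 1)))) := by
    ext i
    simp [Fin.ext_iff]
    omega
  rw [ratC, this, Finset.prod_insert (by simp), mul_comm]
  rfl

/-- For `k ≤ l` the quotient of `v_1 ⋯ v_l` by `v_1 ⋯ v_k`. -/
theorem ratC_div {k l : Fin (m + 1)} (h : k ≤ l) : ratC l / ratC k =
    ∏ i ∈ Finset.univ.filter (fun i : Fin m => (k : ℕ) ≤ i ∧ (i : ℕ) < l), ratV i := by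
  rw [div_eq_iff (ratC_ne_zero k), ratC, ratC, ← Finset.prod_union]
  · refine Finset.prod_congr ?_ fun _ _ => rfl
    ext i
    have : (k : ℕ) ≤ l := h
    simp
    omega
  · rw [Finset.disjoint_left]
    intro i
    simp
    omega

/-- The monomial `q^s v_1 ⋯ v_k`, which corresponds to `𝔮_{ns+k}`. -/
noncomputable def posMono (p : Fin (m + 1) × ℤ) : RatField m := ratQ m ^ p.2 * ratC p.1

theorem posMono_ne_zero (p : Fin (m + 1) × ℤ) : posMono p ≠ 0 :=
  mul_ne_zero (zpow_ne_zero _ ratQ_ne_zero) (ratC_ne_zero _)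

end Rational

/-! ### Limits of rational functions -/

section RationalLimits

variable {m : ℕ}

/-- Convergence of the expansions in `q_0, …, q_m`. -/
def LimX (f : ℕ → PowerSeries (RatField m)) (a : RatField m) : Prop :=
  ConvX (fun N => PowerSeries.map (expandX m) (f N)) (expandX m a)

/-- Convergence of the expansions in `v_1, …, v_m`, which have to be power series. -/
def LimY (f : ℕ → PowerSeries (RatField m)) (a : RatField m) : Prop :=
  ∃ g b, (∀ N, PowerSeries.map (expandY m) (f N) = PowerSeries.map (toYFrac m) (g N)) ∧
    expandY m a = toYFrac m b ∧ ConvY g b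

/-- Convergence of both expansions. -/
def LimXY (f : ℕ → PowerSeries (RatField m)) (a : RatField m) : Prop := LimX f a ∧ LimY f a

theorem LimX.mul {f f' : ℕ → PowerSeries (RatField m)} {a a' : RatField m} (h : LimX f a)
    (h' : LimX f' a') : LimX (fun N => f N * f' N) (a * a') := by
  have := ConvX.mul h h'
  simpa only [LimX, map_mul] using this

theorem LimX.add {f f' : ℕ → PowerSeries (RatField m)} {a a' : RatField m} (h : LimX f a)
    (h' : LimX f' a') : LimX (fun N => f N + f' N) (a + a') := by
  have := ConvX.add h h'
  simpa only [LimX, map_add] using this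

theorem LimX.one : LimX (fun _ => (1 : PowerSeries (RatField m))) 1 := by
  simpa only [LimX, map_one] using ConvX.one

theorem LimX.X : LimX (fun _ => (PowerSeries.X : PowerSeries (RatField m))) 1 := by
  simpa only [LimX, map_one, PowerSeries.map_X] using ConvX.X

theorem LimX.const {c : ℤ} {a : RatField m} (h : ExpLowerBound c (expandX m a)) :
    LimX (fun _ => PowerSeries.C a) a := by
  simpa only [LimX, PowerSeries.map_C] using ConvX.const h

theorem LimY.mul {f f' : ℕ → PowerSeries (RatField m)} {a a' : RatField m} (h : LimY f a)
    (h' : LimY f' a') : LimY (fun N => f N * f' N) (a * a') := by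
  obtain ⟨g, b, h1, h2, h3⟩ := h
  obtain ⟨g', b', h1', h2', h3'⟩ := h'
  exact ⟨_, _, fun N => by rw [map_mul, h1, h1', ← map_mul], by rw [map_mul, h2, h2', ← map_mul],
    h3.mul h3'⟩

theorem LimY.add {f f' : ℕ → PowerSeries (RatField m)} {a a' : RatField m} (h : LimY f a)
    (h' : LimY f' a') : LimY (fun N => f N + f' N) (a + a') := by
  obtain ⟨g, b, h1, h2, h3⟩ := h
  obtain ⟨g', b', h1', h2', h3'⟩ := h'
  exact ⟨_, _, fun N => by rw [map_add, h1, h1', ← map_add], by rw [map_add, h2, h2', ← map_add],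
    h3.add h3'⟩

theorem LimY.one : LimY (fun _ => (1 : PowerSeries (RatField m))) 1 :=
  ⟨_, _, fun N => by rw [map_one, ← map_one (PowerSeries.map (toYFrac m))],
    by rw [map_one, ← map_one (toYFrac m)], ConvY.one⟩

theorem LimY.X : LimY (fun _ => (PowerSeries.X : PowerSeries (RatField m))) 1 :=
  ⟨_, _, fun N => by rw [PowerSeries.map_X, ← PowerSeries.map_X (toYFrac m)],
    by rw [map_one, ← map_one (toYFrac m)], ConvY.X⟩

theorem LimY.const {a : RatField m} {b : YSeries m} (h : expandY m a = toYFrac m b) :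
    LimY (fun _ => PowerSeries.C a) a :=
  ⟨_, b, fun N => by rw [PowerSeries.map_C, h, ← PowerSeries.map_C], h, ConvY.const b⟩

theorem LimXY.mul {f f' : ℕ → PowerSeries (RatField m)} {a a' : RatField m} (h : LimXY f a)
    (h' : LimXY f' a') : LimXY (fun N => f N * f' N) (a * a') := ⟨h.1.mul h'.1, h.2.mul h'.2⟩

theorem LimXY.add {f f' : ℕ → PowerSeries (RatField m)} {a a' : RatField m} (h : LimXY f a)
    (h' : LimXY f' a') : LimXY (fun N => f N + f' N) (a + a') := ⟨h.1.add h'.1, h.2.add h'.2⟩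

theorem LimXY.one : LimXY (fun _ => (1 : PowerSeries (RatField m))) 1 := ⟨LimX.one, LimY.one⟩

theorem LimXY.X : LimXY (fun _ => (PowerSeries.X : PowerSeries (RatField m))) 1 :=
  ⟨LimX.X, LimY.X⟩

/-- The rational function has a power series expansion in `v_1, …, v_m`, and the exponents of its
expansion in `q_0, …, q_m` are bounded below. -/
def Regular (a : RatField m) : Prop := LimXY (fun _ => PowerSeries.C a) a

theorem Regular.mul {a b : RatField m} (ha : Regular a) (hb : Regular b) : Regular (a * b) := by
  have := LimXY.mul ha hb
  simpa only [Regular, map_mul] using this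

theorem Regular.add {a b : RatField m} (ha : Regular a) (hb : Regular b) : Regular (a + b) := by
  have := LimXY.add ha hb
  simpa only [Regular, map_add] using this

theorem Regular.one : Regular (1 : RatField m) := by
  simpa only [Regular, map_one] using LimXY.one

theorem LimXY.const_mul {a : RatField m} (ha : Regular a) {f : ℕ → PowerSeries (RatField m)}
    {b : RatField m} (h : LimXY f b) : LimXY (fun N => PowerSeries.C a * f N) (a * b) :=
  LimXY.mul ha h

theorem regular_of_expand {c : ℤ} {a : RatField m} {b : YSeries m}
    (hx : ExpLowerBound c (expandX m a)) (hy : expandY m a = toYFrac m b) : Regular a :=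
  ⟨LimX.const hx, LimY.const hy⟩

theorem Regular.zero : Regular (0 : RatField m) :=
  regular_of_expand (c := 0) (b := 0) (by rw [map_zero]; exact expLowerBound_zero 0) (by simp)

theorem Regular.neg_one : Regular (-1 : RatField m) := by
  refine regular_of_expand (c := 0) (b := -1) ?_ (by simp)
  rw [map_neg, map_one]
  intro g hg
  exact expLowerBound_one g (by simpa using hg)

theorem Regular.pow {a : RatField m} (ha : Regular a) (j : ℕ) : Regular (a ^ j) := by
  induction j with
  | zero => rw [pow_zero]; exact Regular.one
  | succ j ih => rw [pow_succ]; exact ih.mul ha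

theorem Regular.sum {ι : Type*} (s : Finset ι) {f : ι → RatField m}
    (h : ∀ i ∈ s, Regular (f i)) : Regular (∑ i ∈ s, f i) := by
  classical
  induction s using Finset.induction_on with
  | empty => simpa using Regular.zero
  | insert a s ha ih =>
    rw [Finset.sum_insert ha]
    exact (h a (Finset.mem_insert_self _ _)).add
      (ih fun i hi => h i (Finset.mem_insert_of_mem hi))

theorem LimXY.zero : LimXY (fun _ => (0 : PowerSeries (RatField m))) 0 := by
  have := Regular.zero (m := m)
  simpa only [Regular, map_zero] using this

theorem LimXY.sum {ι : Type*} (s : Finset ι) {f : ι → ℕ → PowerSeries (RatField m)}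
    {a : ι → RatField m} (h : ∀ i ∈ s, LimXY (f i) (a i)) :
    LimXY (fun N => ∑ i ∈ s, f i N) (∑ i ∈ s, a i) := by
  classical
  induction s using Finset.induction_on with
  | empty => simpa using LimXY.zero
  | insert b s hb ih =>
    simp only [Finset.sum_insert hb]
    exact (h b (Finset.mem_insert_self _ _)).add (ih fun i hi => h i (Finset.mem_insert_of_mem hi))

theorem LimX.prod {ι : Type*} (s : Finset ι) {f : ι → ℕ → PowerSeries (RatField m)}
    {a : ι → RatField m} (h : ∀ i ∈ s, LimX (f i) (a i)) :
    LimX (fun N => ∏ i ∈ s, f i N) (∏ i ∈ s, a i) := by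
  classical
  induction s using Finset.induction_on with
  | empty => simpa using LimX.one
  | insert b s hb ih =>
    simp only [Finset.prod_insert hb]
    exact (h b (Finset.mem_insert_self _ _)).mul (ih fun i hi => h i (Finset.mem_insert_of_mem hi))

theorem LimY.prod {ι : Type*} (s : Finset ι) {f : ι → ℕ → PowerSeries (RatField m)}
    {a : ι → RatField m} (h : ∀ i ∈ s, LimY (f i) (a i)) :
    LimY (fun N => ∏ i ∈ s, f i N) (∏ i ∈ s, a i) := by
  classical
  induction s using Finset.induction_on with
  | empty => simpa using LimY.one
  | insert b s hb ih =>
    simp only [Finset.prod_insert hb]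
    exact (h b (Finset.mem_insert_self _ _)).mul (ih fun i hi => h i (Finset.mem_insert_of_mem hi))

theorem mono_zsmul {n : ℕ} (a : Fin n → ℤ) (s : ℤ) :
    (VertexCRC.mono (s • a) : LaurentField n) = VertexCRC.mono a ^ s := by
  cases s with
  | ofNat k => rw [Int.ofNat_eq_natCast, zpow_natCast, natCast_zsmul, mono_nsmul]
  | negSucc k => rw [zpow_negSucc, negSucc_zsmul, mono_neg, mono_nsmul]

theorem expandX_ratQ_zpow (s : ℤ) :
    expandX m (ratQ m ^ s) = VertexCRC.mono fun _ => s := by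
  rw [map_zpow₀, expandX_ratQ, qtot_eq, ← mono_zsmul]
  congr 1
  funext i
  simp

/-- The exponents of `v_1 ⋯ v_k`. -/
theorem expandX_ratC (k : Fin (m + 1)) :
    ∃ e : Fin (m + 1) → ℤ, (∀ i, e i = if i ≠ 0 ∧ i ≤ k then 1 else 0) ∧
      expandX m (ratC k) = VertexCRC.mono e := by
  classical
  refine ⟨_, fun i => ?_, by
    simp only [ratC, map_prod, expandX_ratV, qvar_eq]; exact (mono_sum _ _).symm⟩
  rw [Finset.sum_apply, Finset.sum_filter]
  refine Fin.cases ?_ (fun i => ?_) i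
  · simp [Fin.succ_ne_zero, eq_comm]
  · simp only [Pi.single_apply, Fin.succ_inj]
    have h : (i.succ ≠ 0 ∧ i.succ ≤ k) ↔ (i : ℕ) < k := by
      rw [and_iff_right (Fin.succ_ne_zero i), Fin.le_def, Fin.val_succ, Nat.succ_le_iff]
    rw [Finset.sum_eq_single i (fun b _ hb => by simp [hb.symm]) (by simp)]
    simp only [h, if_true]

/-- A product of powers of `q` and of quotients of the `v_1 ⋯ v_k` expands to a monomial. -/
theorem expandX_monomial (s : ℤ) (k l : Fin (m + 1)) :
    ∃ e : Fin (m + 1) → ℤ, (∀ i, e i + 1 ≥ s) ∧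
      expandX m (ratQ m ^ s * (ratC k / ratC l)) = VertexCRC.mono e := by
  obtain ⟨e, he, h⟩ := expandX_ratC k
  obtain ⟨e', he', h'⟩ := expandX_ratC l
  refine ⟨(fun _ => s) + (e + -e'), fun i => ?_, ?_⟩
  · simp only [Pi.add_apply, Pi.neg_apply, he, he']
    split_ifs <;> omega
  · rw [map_mul, map_div₀, h, h', expandX_ratQ_zpow, mono_add, mono_add, mono_neg, div_eq_mul_inv]

theorem limX_monomial (s : ℤ) (k l : Fin (m + 1)) :
    LimX (fun _ => PowerSeries.C (ratQ m ^ s * (ratC k / ratC l)))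
      (ratQ m ^ s * (ratC k / ratC l)) := by
  obtain ⟨e, he, h⟩ := expandX_monomial s k l
  refine LimX.const (c := s - 1) ?_
  rw [h]
  exact expLowerBound_mono fun i => by have := he i; omega

theorem limX_monomial_zero (s : ℤ) (k l : Fin (m + 1)) :
    LimX (fun N => PowerSeries.C (ratQ m ^ (s + N) * (ratC k / ratC l))) 0 := by
  simp only [LimX, map_zero, PowerSeries.map_C]
  refine ConvX.to_zero (c := s - 1) fun N => ?_
  obtain ⟨e, he, h⟩ := expandX_monomial (s + N) k l
  rw [h]
  exact expLowerBound_mono fun i => by have := he i; omega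

theorem expandY_ratC_div {k l : Fin (m + 1)} (h : k ≤ l) :
    ∃ b : YSeries m, expandY m (ratC l / ratC k) = toYFrac m b := by
  refine ⟨∏ i ∈ Finset.univ.filter (fun i : Fin m => (k : ℕ) ≤ i ∧ (i : ℕ) < l),
    MvPowerSeries.X i, ?_⟩
  rw [ratC_div h, map_prod, map_prod]
  exact Finset.prod_congr rfl fun i _ => expandY_ratV i

theorem limY_monomial (s : ℤ) {k l : Fin (m + 1)} (hkl : k ≤ l) :
    LimY (fun _ => PowerSeries.C (ratQ m ^ s * (ratC l / ratC k)))
      (ratQ m ^ s * (ratC l / ratC k)) := by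
  obtain ⟨b, hb⟩ := expandY_ratC_div hkl
  exact LimY.const (b := MvPowerSeries.C (qtot 1 ^ s) * b)
    (by rw [map_mul, hb, expandY_ratQ_zpow, ← map_mul])

theorem limY_monomial_zero (s : ℤ) {k l : Fin (m + 1)} (hkl : k ≤ l) :
    LimY (fun N => PowerSeries.C (ratQ m ^ (s + N) * (ratC l / ratC k))) 0 := by
  obtain ⟨b, hb⟩ := expandY_ratC_div hkl
  refine ⟨fun N => PowerSeries.C (MvPowerSeries.C (qtot 1 ^ (s + N)) * b), 0, fun N => ?_,
    by rw [map_zero, map_zero], ConvY.to_zero b (ConvX.to_zero (c := s) fun N => ?_)⟩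
  · rw [PowerSeries.map_C, PowerSeries.map_C, map_mul, hb, expandY_ratQ_zpow, ← map_mul]
  · have : qtot 1 ^ (s + N : ℤ) = VertexCRC.mono fun _ => (s + N : ℤ) := by
      rw [qtot_eq, ← mono_zsmul]
      congr 1
      funext i
      simp
    rw [this]
    exact expLowerBound_mono fun _ => le_rfl

theorem regular_monomial (s : ℤ) {k l : Fin (m + 1)} (hkl : k ≤ l) :
    Regular (ratQ m ^ s * (ratC l / ratC k)) := ⟨limX_monomial s l k, limY_monomial s hkl⟩

theorem regular_ratQ_zpow (s : ℤ) : Regular (ratQ m ^ s) := by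
  have := regular_monomial (m := m) s (le_refl 0)
  rwa [div_self (ratC_ne_zero _), mul_one] at this

theorem regular_ratC (k : Fin (m + 1)) : Regular (ratC k) := by
  have := regular_monomial (m := m) 0 (Fin.zero_le k)
  rwa [zpow_zero, one_mul, ratC_zero, div_one] at this

theorem limXY_ratQ_pow_zero {r : ℕ} (hr : 0 < r) :
    LimXY (fun N => PowerSeries.C (ratQ m ^ (N * r))) 0 := by
  have key : ∀ s : ℤ, LimXY (m := m) (fun N => PowerSeries.C (ratQ m ^ (s + N))) 0 := by
    intro s
    have h1 := limX_monomial_zero (m := m) s 0 0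
    have h2 := limY_monomial_zero (m := m) s (le_refl 0)
    simp only [div_self (ratC_ne_zero _), mul_one] at h1 h2
    exact ⟨h1, h2⟩
  obtain ⟨h1, g, b, h2, h3, h4⟩ := key 0
  have hle : ∀ N, N ≤ N * r := fun N => Nat.le_mul_of_pos_right N hr
  refine ⟨?_, fun N => g (N * r), b, fun N => ?_, h3, h4.comp hle⟩
  · have := ConvX.comp h1 hle
    simpa only [LimX, zero_add, zpow_natCast] using this
  · rw [← h2]
    simp only [zero_add, zpow_natCast]

/-- The inverse of `1 - x`, for a monomial `x` with positive exponents, has nonnegative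
exponents. -/
theorem expLowerBound_inv_one_sub {n : ℕ} {e : Fin n → ℤ} (he : ∀ i, 0 < e i) :
    ExpLowerBound 0 ((1 - VertexCRC.mono e : LaurentField n)⁻¹) := by
  by_cases h1 : (1 - VertexCRC.mono e : LaurentField n) = 0
  · rw [h1, inv_zero]
    exact expLowerBound_zero 0
  set f := (1 - VertexCRC.mono e : LaurentField n)⁻¹ with hf
  have hfe : f = 1 + f * VertexCRC.mono e := by
    have : f * (1 - VertexCRC.mono e) = 1 := inv_mul_cancel₀ h1
    rw [mul_sub, mul_one] at this
    rw [← this]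
    ring
  have hcoeff : ∀ g : Lex (Fin n → ℤ), g ≠ 0 → f.coeff g = f.coeff (g - toLex e) := by
    intro g hg
    conv_lhs => rw [hfe]
    have h2 : (1 : LaurentField n).coeff g = 0 := by
      rw [HahnSeries.coeff_one, if_neg hg]
    rw [HahnSeries.coeff_add, h2, zero_add]
    have := HahnSeries.coeff_mul_single_add (r := (1 : ℚ)) (x := f) (a := g - toLex e)
      (b := toLex e)
    rw [sub_add_cancel, mul_one] at this
    exact this
  -- A minimal exponent with a negative entry could be lowered further.
  intro g
  have hwf := f.isWF_support
  intro hg i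
  by_contra hneg
  have hne : {g | f.coeff g ≠ 0 ∧ ∃ i, ofLex g i < 0}.Nonempty := ⟨g, hg, i, not_le.1 hneg⟩
  have hwf' : {g | f.coeff g ≠ 0 ∧ ∃ i, ofLex g i < 0}.IsWF :=
    hwf.mono fun g hg => hg.1
  obtain ⟨h3, j, hj⟩ := hwf'.min_mem hne
  set g₀ := hwf'.min hne with hg₀
  have hj' : ofLex (g₀ - toLex e) j < 0 := by
    have := he j
    change ofLex g₀ j - e j < 0
    omega
  have hg0 : g₀ ≠ 0 := by
    intro h0
    rw [h0] at hj
    exact lt_irrefl _ hj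
  have h4 : g₀ - toLex e ∈ {g | f.coeff g ≠ 0 ∧ ∃ i, ofLex g i < 0} :=
    ⟨by rw [← hcoeff g₀ hg0]; exact h3, j, hj'⟩
  have h5 := hwf'.min_le hne h4
  rw [← hg₀] at h5
  have h6 : g₀ - toLex e ≤ g₀ := by
    rw [sub_le_self_iff]
    exact Pi.toLex_monotone fun i => (he i).le
  have h7 := le_antisymm h5 h6
  have := congrFun (congrArg ofLex h7) j
  have h8 := he j
  change ofLex g₀ j = ofLex g₀ j - e j at this
  omega

theorem ratQ_zpow_injective : Function.Injective fun s : ℤ => ratQ m ^ s := by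
  intro s t h
  have h := congrArg (expandX m) h
  simp only [expandX_ratQ_zpow] at h
  have h1 : toLex (fun _ : Fin (m + 1) => s) = toLex (fun _ : Fin (m + 1) => t) := by
    by_contra hne
    have := congrArg (fun f => HahnSeries.coeff f (toLex fun _ : Fin (m + 1) => s)) h
    simp [VertexCRC.mono, HahnSeries.coeff_single_of_ne hne] at this
  exact congrFun (toLex.injective h1) 0

theorem one_sub_ratQ_pow_ne_zero {r : ℕ} (hr : 0 < r) : 1 - ratQ m ^ r ≠ 0 := by
  intro h
  have h1 : ratQ m ^ (0 : ℤ) = ratQ m ^ (r : ℤ) := by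
    rw [zpow_zero, zpow_natCast]; exact sub_eq_zero.1 h
  have := ratQ_zpow_injective h1
  omega

theorem regular_inv_one_sub_ratQ_pow {r : ℕ} (hr : 0 < r) :
    Regular ((1 - ratQ m ^ r)⁻¹) := by
  refine regular_of_expand (c := 0) (b := MvPowerSeries.C ((1 - qtot 1 ^ r)⁻¹)) ?_ ?_
  · have h1 := expandX_ratQ_zpow (m := m) r
    rw [zpow_natCast] at h1
    rw [map_inv₀, map_sub, map_one, h1]
    exact expLowerBound_inv_one_sub fun _ => by exact_mod_cast hr
  · rw [map_inv₀, map_sub, map_one, map_pow, expandY_ratQ]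
    have := map_inv₀ ((toYFrac m).comp MvPowerSeries.C) (1 - qtot 1 ^ r)
    rw [map_sub, map_one, map_pow] at this
    exact this.symm

end RationalLimits

/-! ### Skew Schur polynomials of geometric progressions -/

section SkewLimits

variable {m : ℕ}

/-- The list of all `q^s u` with `0 ≤ s < N` and `u ∈ K`. -/
noncomputable def geomList (K : List (RatField m)) : ℕ → List (RatField m)
  | 0 => []
  | N + 1 => geomList K N ++ K.map (ratQ m ^ N * ·)

theorem geomList_succ (K : List (RatField m)) (N : ℕ) :
    geomList K (N + 1) = geomList K N ++ K.map (ratQ m ^ N * ·) := rfl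

theorem geomList_succ' (K : List (RatField m)) (N : ℕ) :
    geomList K (N + 1) = K ++ (geomList K N).map (ratQ m * ·) := by
  induction N with
  | zero => simp [geomList]
  | succ N ih =>
    conv_lhs => rw [geomList_succ, ih]
    rw [List.append_assoc, geomList_succ, List.map_append, List.map_map]
    simp only [Function.comp_def, pow_succ', mul_assoc]

theorem regular_skew (l : List (RatField m)) (h : ∀ u ∈ l, Regular u) (α η : YoungDiagram) :
    Regular (skew l α η) := by
  classical
  induction l generalizing α with
  | nil =>
    rw [skew_nil]
    split_ifs
    · exact Regular.one
    · exact Regular.zero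
  | cons y l ih =>
    rw [skew_cons]
    exact Regular.sum _ fun κ _ => ((h y List.mem_cons_self).pow _).mul
      (ih (fun u hu => h u (List.mem_cons_of_mem _ hu)) κ)

/-- Splitting off the first or the last block of the geometric list gives two expressions for
`skew (geomList K (N + 1)) α η`; their comparison expresses `skew (geomList K N) α η` through
smaller skew shapes. -/
theorem skew_geomList (K : List (RatField m)) (N : ℕ) {α η : YoungDiagram}
    (h : η.card ≤ α.card) :
    (1 - ratQ m ^ (α.card - η.card)) * skew (geomList K N) α η =
      ∑ κ ∈ (upto α.card).filter (fun κ => κ.card < α.card), ratQ m ^ (κ.card - η.card) *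
        (skew K α κ * skew (geomList K N) κ η) +
      (-1) * ∑ κ ∈ (upto α.card).filter (fun κ => η.card < κ.card),
        ratQ m ^ (N * (κ.card - η.card)) * (skew K κ η * skew (geomList K N) α κ) := by
  classical
  have e1 : skew (geomList K (N + 1)) α η = ratQ m ^ (α.card - η.card) *
      skew (geomList K N) α η + ∑ κ ∈ (upto α.card).filter (fun κ => κ.card < α.card),
        ratQ m ^ (κ.card - η.card) * (skew K α κ * skew (geomList K N) κ η) := by
    rw [geomList_succ', skew_append _ _ _ _ le_rfl,
      ← Finset.sum_filter_add_sum_filter_not _ (fun κ : YoungDiagram => κ.card < α.card), add_comm]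
    congr 1
    · rw [Finset.sum_eq_single α]
      · rw [skew_self, one_mul, skew_smul _ _ h]
      · intro κ hκ hne
        rw [Finset.mem_filter, mem_upto] at hκ
        rw [skew_eq_zero_of_card_eq K (by omega) hne.symm, zero_mul]
      · intro hn
        simp at hn
    · refine Finset.sum_congr rfl fun κ _ => ?_
      rcases le_or_gt η.card κ.card with h1 | h1
      · rw [skew_smul _ _ h1]; ring
      · rw [skew_eq_zero_of_card _ h1, skew_eq_zero_of_card _ h1]; ring
  have e2 : skew (geomList K (N + 1)) α η = skew (geomList K N) α η +
      ∑ κ ∈ (upto α.card).filter (fun κ => η.card < κ.card),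
        ratQ m ^ (N * (κ.card - η.card)) * (skew K κ η * skew (geomList K N) α κ) := by
    rw [geomList_succ, skew_append _ _ _ _ le_rfl,
      ← Finset.sum_filter_add_sum_filter_not _ (fun κ : YoungDiagram => η.card < κ.card), add_comm]
    congr 1
    · rw [Finset.sum_eq_single η]
      · rw [skew_self, mul_one]
      · intro κ hκ hne
        rw [Finset.mem_filter, not_lt] at hκ
        rcases hκ.2.eq_or_lt with h1 | h1
        · rw [skew_eq_zero_of_card_eq _ h1 hne, mul_zero]
        · rw [skew_eq_zero_of_card _ h1, mul_zero]
      · intro hn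
        simp [mem_upto] at hn
        omega
    · refine Finset.sum_congr rfl fun κ hκ => ?_
      rw [Finset.mem_filter] at hκ
      rw [skew_smul _ _ hκ.2.le, ← pow_mul]; ring
  linear_combination e1 - e2

/-- The skew Schur polynomial of finitely many geometric progressions with ratio `q` tends to a
rational function. The coefficient `1 - q^{|α|-|η|}` in `skew_geomList` is invertible if `|η| < |α|`. -/
theorem exists_limXY_skew_geomList (K : List (RatField m)) (hK : ∀ u ∈ K, Regular u)
    (α η : YoungDiagram) :
    ∃ b, LimXY (fun N => PowerSeries.C (skew (geomList K N) α η)) b := by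
  classical
  induction hr : α.card - η.card using Nat.strong_induction_on generalizing α η with
  | _ r ih =>
  rcases lt_trichotomy α.card η.card with h | h | h
  · exact ⟨0, by simpa [skew_eq_zero_of_card _ h] using LimXY.zero⟩
  · by_cases hαη : α = η
    · subst hαη
      exact ⟨1, by simpa [skew_self] using LimXY.one⟩
    · exact ⟨0, by simpa [skew_eq_zero_of_card_eq _ h hαη] using LimXY.zero⟩
  -- The smaller skew shapes have a limit, and the terms with a power of `q^N` disappear.
  have h1 : ∀ κ : YoungDiagram, ∃ b, κ.card < α.card →
      LimXY (fun N => PowerSeries.C (skew (geomList K N) κ η)) b := by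
    intro κ
    by_cases hκ : κ.card < α.card
    · obtain ⟨b, hb⟩ := ih _ (by omega) κ η rfl
      exact ⟨b, fun _ => hb⟩
    · exact ⟨0, fun h => absurd h hκ⟩
  have h2 : ∀ κ : YoungDiagram, ∃ b, η.card < κ.card →
      LimXY (fun N => PowerSeries.C (skew (geomList K N) α κ)) b := by
    intro κ
    by_cases hκ : η.card < κ.card
    · obtain ⟨b, hb⟩ := ih _ (by omega) α κ rfl
      exact ⟨b, fun _ => hb⟩
    · exact ⟨0, fun h => absurd h hκ⟩
  choose b₁ hb₁ using h1
  choose b₂ hb₂ using h2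
  have hreg : ∀ κ κ', Regular (skew K κ κ') := regular_skew K hK
  have l1 := LimXY.sum ((upto α.card).filter (fun κ => κ.card < α.card)) fun κ hκ =>
    LimXY.const_mul ((regular_ratQ_zpow (m := m) 1).pow (κ.card - η.card))
      (LimXY.const_mul (hreg α κ) (hb₁ κ (Finset.mem_filter.1 hκ).2))
  have l2 := LimXY.sum ((upto α.card).filter (fun κ => η.card < κ.card)) fun κ hκ =>
    LimXY.mul (limXY_ratQ_pow_zero (m := m) (Nat.sub_pos_of_lt (Finset.mem_filter.1 hκ).2))
      (LimXY.const_mul (hreg κ η) (hb₂ κ (Finset.mem_filter.1 hκ).2))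
  have l3 := LimXY.const_mul (regular_inv_one_sub_ratQ_pow (m := m) (Nat.sub_pos_of_lt h))
    (l1.add (LimXY.const_mul Regular.neg_one l2))
  refine ⟨?_, ?_⟩
  swap
  · convert l3 using 2 with N
    rw [zpow_one]
    simp only [← map_mul, ← map_sum, ← map_add]
    congr 1
    rw [← skew_geomList K N h.le, inv_mul_cancel_left₀ (one_sub_ratQ_pow_ne_zero (by omega))]

/-- The skew Schur polynomial of finitely many arguments and of finitely many geometric progressions
with ratio `q` tends to a rational function. -/
theorem exists_limXY_skew (l K : List (RatField m)) (hl : ∀ u ∈ l, Regular u)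
    (hK : ∀ u ∈ K, Regular u) (α η : YoungDiagram) :
    ∃ b, LimXY (fun N => PowerSeries.C (skew (l ++ geomList K N) α η)) b := by
  choose b hb using fun κ => exists_limXY_skew_geomList K hK κ η
  refine ⟨?_, ?_⟩
  swap
  · have := LimXY.sum (upto α.card) fun κ _ =>
      LimXY.const_mul (regular_skew l hl α κ) (hb κ)
    convert this using 2 with N
    rw [skew_append _ _ _ _ le_rfl, map_sum]
    simp only [map_mul]

end SkewLimits

/-! ### Words of rational functions -/

section Words

variable {m : ℕ}

/-- The positions `(k, s)`, standing for `t = n s + k`, with `-W ≤ s < W`. -/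
noncomputable def positions (m W : ℕ) : Finset (Fin (m + 1) × ℤ) := Finset.univ ×ˢ Finset.Ico (-(W : ℤ)) W

theorem mem_positions {W : ℕ} {p : Fin (m + 1) × ℤ} :
    p ∈ positions m W ↔ -(W : ℤ) ≤ p.2 ∧ p.2 < W := by simp [positions]

/-- The letter at the position `p`, for the slope sequences of `λ_0, …, λ_m`. -/
noncomputable def letterR (lam : Fin (m + 1) → YoungDiagram) (p : Fin (m + 1) × ℤ) :
    ℤˣ × RatField m :=
  (slope (lam p.1) p.2, posMono p ^ (-(slope (lam p.1) p.2 : ℤ)))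

variable (lam : Fin (m + 1) → YoungDiagram)

/-- The positions of slope `-1` in the window. -/
noncomputable def minusSet (W : ℕ) : Finset (Fin (m + 1) × ℤ) :=
  (positions m W).filter fun p => ¬ slope (lam p.1) p.2 = 1

/-- The positions of slope `+1` in the window. -/
noncomputable def plusSet (W : ℕ) : Finset (Fin (m + 1) × ℤ) :=
  (positions m W).filter fun p => slope (lam p.1) p.2 = 1

theorem minusArgs_map_letterR (P : List (Fin (m + 1) × ℤ)) :
    minusArgs (P.map (letterR lam)) =
      (P.filter fun p => ¬ slope (lam p.1) p.2 = 1).map posMono := by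
  rw [minusArgs, List.filter_map, List.map_map]
  refine List.map_congr_left fun p hp => ?_
  have h : ¬ slope (lam p.1) p.2 = 1 := by simpa [letterR] using (List.mem_filter.1 hp).2
  simp [letterR, slope_ne_one h]

theorem plusArgs_map_letterR (P : List (Fin (m + 1) × ℤ)) :
    plusArgs (P.map (letterR lam)) =
      (P.filter fun p => slope (lam p.1) p.2 = 1).map fun p => (posMono p)⁻¹ := by
  rw [plusArgs, List.filter_map, List.map_map]
  refine List.map_congr_left fun p hp => ?_
  have h : slope (lam p.1) p.2 = 1 := by simpa [letterR] using (List.mem_filter.1 hp).2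
  simp [letterR, h]

variable {lam}

theorem filter_perm_toList {α : Type*} {P : List α} (hP : P.Nodup) {S : Finset α}
    (hS : ∀ p, p ∈ P ↔ p ∈ S) (r : α → Prop) [DecidablePred r] :
    (P.filter fun p => r p).Perm (S.filter r).toList := by
  rw [List.perm_ext_iff_of_nodup (hP.filter _) (Finset.nodup_toList _)]
  intro p
  simp [hS]

theorem normalCoeff_perm {ys ys' xs xs' : List (RatField m)} (h : ys.Perm ys') (h' : xs.Perm xs')
    (α β : YoungDiagram) : normalCoeff ys xs α β = normalCoeff ys' xs' α β := by
  unfold normalCoeff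
  exact Finset.sum_congr rfl fun η _ => by rw [skew_perm h, skew_perm h']

/-- All slopes are `+1` to the left of `-S` and `-1` from `S` on. -/
def SlopeBound (lam : Fin (m + 1) → YoungDiagram) (S : ℕ) : Prop :=
  ∀ k, ∀ s : ℤ, (s < -(S : ℤ) → slope (lam k) s = 1) ∧ ((S : ℤ) ≤ s → slope (lam k) s ≠ 1)

theorem SlopeBound.mono {S T : ℕ} (h : SlopeBound lam S) (hST : S ≤ T) : SlopeBound lam T :=
  fun k s => ⟨fun hs => (h k s).1 (by omega), fun hs => (h k s).2 (by omega)⟩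

theorem slopeBound_sum_card (lam : Fin (m + 1) → YoungDiagram) :
    SlopeBound lam (∑ k, (lam k).card) := by
  intro k s
  have := Finset.single_le_sum (f := fun k => (lam k).card) (fun _ _ => Nat.zero_le _)
    (Finset.mem_univ k)
  refine ⟨fun hs => slope_of_neg (by omega), fun hs => ?_⟩
  rw [slope_of_pos (by omega)]
  decide

theorem minusSet_succ_perm {S W : ℕ} (hS : SlopeBound lam S) (hSW : S ≤ W) :
    (minusSet lam (W + 1)).toList.Perm
      ((minusSet lam W).toList ++ (List.finRange (m + 1)).map fun k => (k, (W : ℤ))) := by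
  rw [List.perm_ext_iff_of_nodup (Finset.nodup_toList _)]
  · rintro ⟨k, s⟩
    have h := hS k s
    simp only [Finset.mem_toList, minusSet, Finset.mem_filter, mem_positions, List.mem_append,
      List.mem_map, List.mem_finRange, true_and, Prod.mk.injEq, exists_eq_left]
    constructor
    · rintro ⟨h1, h2⟩
      have h3 : ¬ s < -(S : ℤ) := fun h3 => h2 (h.1 h3)
      by_cases h4 : s = W
      · exact Or.inr h4.symm
      · exact Or.inl ⟨by push_cast at h1; omega, h2⟩
    · rintro (⟨h1, h2⟩ | h1)
      · exact ⟨by push_cast; omega, h2⟩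
      · exact ⟨by push_cast; omega, h.2 (by omega)⟩
  · refine List.Nodup.append (Finset.nodup_toList _) ?_ ?_
    · exact (List.nodup_finRange _).map fun a b h => (Prod.mk.inj h).1
    · intro p hp hp'
      simp only [Finset.mem_toList, minusSet, Finset.mem_filter, mem_positions] at hp
      obtain ⟨k, -, rfl⟩ := List.mem_map.1 hp'
      dsimp only at hp
      omega

theorem plusSet_succ_perm {S W : ℕ} (hS : SlopeBound lam S) (hSW : S ≤ W) :
    (plusSet lam (W + 1)).toList.Perm
      ((plusSet lam W).toList ++ (List.finRange (m + 1)).map fun k => (k, -(W : ℤ) - 1)) := by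
  rw [List.perm_ext_iff_of_nodup (Finset.nodup_toList _)]
  · rintro ⟨k, s⟩
    have h := hS k s
    simp only [Finset.mem_toList, plusSet, Finset.mem_filter, mem_positions, List.mem_append,
      List.mem_map, List.mem_finRange, true_and, Prod.mk.injEq, exists_eq_left]
    constructor
    · rintro ⟨h1, h2⟩
      have h3 : ¬ (S : ℤ) ≤ s := fun h3 => h.2 h3 h2
      by_cases h4 : s = -(W : ℤ) - 1
      · exact Or.inr h4.symm
      · exact Or.inl ⟨by push_cast at h1; omega, h2⟩
    · rintro (⟨h1, h2⟩ | h1)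
      · exact ⟨by push_cast; omega, h2⟩
      · exact ⟨by push_cast; omega, h.1 (by omega)⟩
  · refine List.Nodup.append (Finset.nodup_toList _) ?_ ?_
    · exact (List.nodup_finRange _).map fun a b h => (Prod.mk.inj h).1
    · intro p hp hp'
      simp only [Finset.mem_toList, plusSet, Finset.mem_filter, mem_positions] at hp
      obtain ⟨k, -, rfl⟩ := List.mem_map.1 hp'
      dsimp only at hp
      omega

theorem minusSet_perm {S : ℕ} (hS : SlopeBound lam S) (N : ℕ) :
    ((minusSet lam (S + N)).toList.map posMono).Perm ((minusSet lam S).toList.map posMono ++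
      geomList ((List.finRange (m + 1)).map fun k => posMono (k, (S : ℤ))) N) := by
  induction N with
  | zero => simp [geomList]
  | succ N ih =>
    refine ((minusSet_succ_perm hS (Nat.le_add_right S N)).map _).trans ?_
    rw [List.map_append, geomList_succ, ← List.append_assoc, List.map_map, List.map_map]
    refine ih.append (List.Perm.of_eq (List.map_congr_left fun k _ => ?_))
    simp only [Function.comp_apply, posMono]
    rw [Nat.cast_add, zpow_add₀ ratQ_ne_zero, zpow_natCast (ratQ m) N]
    ring

theorem plusSet_perm {S : ℕ} (hS : SlopeBound lam S) (N : ℕ) :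
    ((plusSet lam (S + N)).toList.map fun p => ratC (Fin.last m) * (posMono p)⁻¹).Perm
      ((plusSet lam S).toList.map (fun p => ratC (Fin.last m) * (posMono p)⁻¹) ++
      geomList ((List.finRange (m + 1)).map fun k =>
        ratC (Fin.last m) * (posMono (k, -(S : ℤ) - 1))⁻¹) N) := by
  induction N with
  | zero => simp [geomList]
  | succ N ih =>
    refine ((plusSet_succ_perm hS (Nat.le_add_right S N)).map _).trans ?_
    rw [List.map_append, geomList_succ, ← List.append_assoc, List.map_map, List.map_map]
    refine ih.append (List.Perm.of_eq (List.map_congr_left fun k _ => ?_))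
    simp only [Function.comp_apply, posMono, mul_inv, ← zpow_neg]
    rw [show -(-((S + N : ℕ) : ℤ) - 1) = (N : ℤ) + -(-(S : ℤ) - 1) by push_cast; ring,
      zpow_add₀ ratQ_ne_zero, zpow_natCast (ratQ m) N]
    ring

theorem regular_posMono (p : Fin (m + 1) × ℤ) : Regular (posMono p) :=
  (regular_ratQ_zpow _).mul (regular_ratC _)

theorem regular_ratC_mul_inv_posMono (p : Fin (m + 1) × ℤ) :
    Regular (ratC (Fin.last m) * (posMono p)⁻¹) := by
  have : ratC (Fin.last m) * (posMono p)⁻¹ =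
      ratQ m ^ (-p.2) * (ratC (Fin.last m) / ratC p.1) := by
    rw [posMono, mul_inv, zpow_neg, div_eq_mul_inv]
    ring
  rw [this]
  exact regular_monomial _ (Fin.le_last _)

/-- The normally ordered matrix coefficient of the window of width `2 W`. -/
noncomputable def windowNormal (lam : Fin (m + 1) → YoungDiagram) (α β : YoungDiagram) (W : ℕ) :
    PowerSeries (RatField m) :=
  normalCoeff ((minusSet lam W).toList.map posMono)
    ((plusSet lam W).toList.map fun p => (posMono p)⁻¹) α β

/-- The normally ordered matrix coefficient converges to a rational function; the factor
`(v_1 ⋯ v_m)^{|β|}` clears the negative powers of the `v_i`. -/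
theorem exists_limXY_windowNormal {S : ℕ} (hS : SlopeBound lam S) (α β : YoungDiagram) :
    ∃ G, LimXY (fun N => PowerSeries.C (ratC (Fin.last m) ^ β.card) *
      windowNormal lam α β (S + N)) G := by
  classical
  choose b hb using fun η => exists_limXY_skew ((minusSet lam S).toList.map posMono)
    ((List.finRange (m + 1)).map fun k => posMono (k, (S : ℤ)))
    (fun u hu => by obtain ⟨p, -, rfl⟩ := List.mem_map.1 hu; exact regular_posMono p)
    (fun u hu => by obtain ⟨k, -, rfl⟩ := List.mem_map.1 hu; exact regular_posMono _) α η
  choose b' hb' using fun η => exists_limXY_skew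
    ((plusSet lam S).toList.map fun p => ratC (Fin.last m) * (posMono p)⁻¹)
    ((List.finRange (m + 1)).map fun k => ratC (Fin.last m) * (posMono (k, -(S : ℤ) - 1))⁻¹)
    (fun u hu => by
      obtain ⟨p, -, rfl⟩ := List.mem_map.1 hu; exact regular_ratC_mul_inv_posMono p)
    (fun u hu => by
      obtain ⟨k, -, rfl⟩ := List.mem_map.1 hu; exact regular_ratC_mul_inv_posMono _) β η
  have hX : ∀ j, LimXY (m := m) (fun _ => PowerSeries.X ^ j) 1 := by
    intro j
    induction j with
    | zero => simpa using LimXY.one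
    | succ j ih => simpa only [pow_succ, mul_one] using ih.mul LimXY.X
  refine ⟨?_, ?_⟩
  swap
  · have := LimXY.sum (upto α.card) fun η _ => ((hb η).mul (LimXY.const_mul
      ((regular_ratC (Fin.last m)).pow η.card) (hb' η))).mul (hX (β.card - η.card))
    convert this using 2 with N
    rw [windowNormal, normalCoeff, Finset.mul_sum]
    refine Finset.sum_congr rfl fun η _ => ?_
    rw [skew_perm (minusSet_perm hS N), ← skew_perm (plusSet_perm hS N), ← mul_assoc]
    congr 1
    rw [← map_mul, ← map_mul, ← map_mul]
    congr 1
    rcases le_or_gt η.card β.card with h | h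
    · have := skew_smul (ratC (Fin.last m))
        ((plusSet lam (S + N)).toList.map fun p => (posMono p)⁻¹) h
      rw [List.map_map] at this
      simp only [Function.comp_def] at this
      rw [this, ← mul_assoc (ratC (Fin.last m) ^ η.card), ← pow_add, Nat.add_sub_cancel' h]
      ring
    · rw [skew_eq_zero_of_card _ h, skew_eq_zero_of_card _ h]
      ring

end Words

/-! ### The two orders of the positions -/

section Orders

variable {m : ℕ}

/-- The positions `(k, s)` with `-(N + 1) ≤ s < N + 1`, ordered by `t = n s + k`. -/
def posX (m N : ℕ) : List (Fin (m + 1) × ℤ) :=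
  (List.ofFn fun i : Fin (2 * N + 1 + 1) =>
    List.ofFn fun k : Fin (m + 1) => (k, (i : ℤ) - (N + 1))).flatten

/-- The positions `(k, s)` with `-(N + 1) ≤ s < N + 1`, ordered by `k` and then by `s`. -/
def posY (m N : ℕ) : List (Fin (m + 1) × ℤ) :=
  (List.ofFn fun k : Fin (m + 1) =>
    List.ofFn fun i : Fin (2 * N + 1 + 1) => (k, (i : ℤ) - (N + 1))).flatten

/-- The order of the positions in the word of the orbifold vertex. -/
def LtX (p p' : Fin (m + 1) × ℤ) : Prop := p.2 < p'.2 ∨ (p.2 = p'.2 ∧ p.1 < p'.1)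

/-- The order of the positions in the word of the resolved vertex. -/
def LtY (p p' : Fin (m + 1) × ℤ) : Prop := p.1 < p'.1 ∨ (p.1 = p'.1 ∧ p.2 < p'.2)

theorem pairwise_posX (N : ℕ) : (posX m N).Pairwise LtX := by
  rw [posX, List.pairwise_flatten]
  constructor
  · intro l hl
    obtain ⟨i, rfl⟩ := List.mem_ofFn.1 hl
    rw [List.pairwise_ofFn]
    exact fun k l hkl => Or.inr ⟨rfl, hkl⟩
  · rw [List.pairwise_ofFn]
    intro i j hij p hp p' hp'
    obtain ⟨k, rfl⟩ := List.mem_ofFn.1 hp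
    obtain ⟨l, rfl⟩ := List.mem_ofFn.1 hp'
    refine Or.inl ?_
    have : (i : ℕ) < j := hij
    dsimp only
    omega

theorem pairwise_posY (N : ℕ) : (posY m N).Pairwise LtY := by
  rw [posY, List.pairwise_flatten]
  constructor
  · intro l hl
    obtain ⟨i, rfl⟩ := List.mem_ofFn.1 hl
    rw [List.pairwise_ofFn]
    intro i j hij
    refine Or.inr ⟨rfl, ?_⟩
    have : (i : ℕ) < j := hij
    dsimp only
    omega
  · rw [List.pairwise_ofFn]
    intro i j hij p hp p' hp'
    obtain ⟨k, rfl⟩ := List.mem_ofFn.1 hp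
    obtain ⟨l, rfl⟩ := List.mem_ofFn.1 hp'
    exact Or.inl hij

theorem mem_posX {N : ℕ} {p : Fin (m + 1) × ℤ} : p ∈ posX m N ↔ p ∈ positions m (N + 1) := by
  rw [mem_positions, posX, List.mem_flatten]
  constructor
  · rintro ⟨l, hl, hp⟩
    obtain ⟨i, rfl⟩ := List.mem_ofFn.1 hl
    obtain ⟨k, rfl⟩ := List.mem_ofFn.1 hp
    push_cast
    omega
  · intro h
    push_cast at h
    refine ⟨_, List.mem_ofFn.2 ⟨⟨(p.2 + (N + 1)).toNat, by omega⟩, rfl⟩,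
      List.mem_ofFn.2 ⟨p.1, ?_⟩⟩
    ext
    · rfl
    · dsimp only
      omega

theorem mem_posY {N : ℕ} {p : Fin (m + 1) × ℤ} : p ∈ posY m N ↔ p ∈ positions m (N + 1) := by
  rw [mem_positions, posY, List.mem_flatten]
  constructor
  · rintro ⟨l, hl, hp⟩
    obtain ⟨k, rfl⟩ := List.mem_ofFn.1 hl
    obtain ⟨i, rfl⟩ := List.mem_ofFn.1 hp
    push_cast
    omega
  · intro h
    push_cast at h
    refine ⟨_, List.mem_ofFn.2 ⟨p.1, rfl⟩,
      List.mem_ofFn.2 ⟨⟨(p.2 + (N + 1)).toNat, by omega⟩, ?_⟩⟩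
    ext
    · rfl
    · dsimp only
      omega

theorem LtX.ne {p p' : Fin (m + 1) × ℤ} (h : LtX p p') : p ≠ p' := by
  rintro rfl
  rcases h with h | h
  · exact lt_irrefl _ h
  · exact lt_irrefl _ h.2

theorem LtY.ne {p p' : Fin (m + 1) × ℤ} (h : LtY p p') : p ≠ p' := by
  rintro rfl
  rcases h with h | h
  · exact lt_irrefl _ h
  · exact lt_irrefl _ h.2

theorem nodup_posX (N : ℕ) : (posX m N).Nodup := (pairwise_posX N).imp LtX.ne

theorem nodup_posY (N : ℕ) : (posY m N).Nodup := (pairwise_posY N).imp LtY.ne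

theorem wordCoeff_positions (lam : Fin (m + 1) → YoungDiagram) {P : List (Fin (m + 1) × ℤ)}
    (hP : P.Nodup) {W : ℕ} (hW : ∀ p, p ∈ P ↔ p ∈ positions m W) (α β : YoungDiagram) :
    wordCoeff (P.map (letterR lam)) α β =
      wordCoeff (P.map (letterR lam)) ⊥ ⊥ * windowNormal lam α β W := by
  rw [wordCoeff_eq, minusArgs_map_letterR, plusArgs_map_letterR, windowNormal]
  congr 1
  exact normalCoeff_perm ((filter_perm_toList hP hW _).map _) ((filter_perm_toList hP hW _).map _)
    _ _

end Orders

section WordX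

variable {m : ℕ}

theorem color_add_mul (n : ℕ) [NeZero n] (t s : ℤ) : color n (t + n * s) = color n t := by
  unfold color
  simp

theorem color_mul_add (k : Fin (m + 1)) (s : ℤ) :
    color (m + 1) (((m + 1 : ℕ) : ℤ) * s + (k : ℕ)) = k := by
  rw [add_comm (_ * s), color_add_mul]
  ext
  have := k.2
  simp only [color]
  rw [Int.emod_eq_of_lt (by omega) (by omega)]
  omega

theorem frakq_ne_zero (n : ℕ) [NeZero n] (t : ℤ) : frakq n t ≠ 0 := by
  rw [frakq_eq_mono]
  exact HahnSeries.single_ne_zero one_ne_zero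

theorem frakq_natCast (k : Fin (m + 1)) : frakq (m + 1) (k : ℕ) = expandX m (ratC k) := by
  induction k using Fin.induction with
  | zero => simp [ratC_zero, frakq_zero]
  | succ k ih =>
    rw [frakq_rec, ratC_succ, map_mul, expandX_ratV, mul_comm]
    have h1 := color_mul_add (m := m) k.succ 0
    rw [mul_zero, zero_add] at h1
    rw [h1, ← ih]
    congr 2
    simp

theorem frakq_add_card (t : ℤ) :
    frakq (m + 1) (t + (m + 1 : ℕ)) = qtot (m + 1) * frakq (m + 1) t := by
  have hcol : ∀ t, color (m + 1) (t + (m + 1 : ℕ)) = color (m + 1) t := by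
    intro t
    have := color_add_mul (m + 1) t 1
    rwa [mul_one] at this
  have hstep : ∀ t, frakq (m + 1) (t + (m + 1 : ℕ)) = qtot (m + 1) * frakq (m + 1) t ↔
      frakq (m + 1) (t - 1 + (m + 1 : ℕ)) = qtot (m + 1) * frakq (m + 1) (t - 1) := by
    intro t
    rw [frakq_rec (m + 1) t, frakq_rec (m + 1) (t + (m + 1 : ℕ)), hcol,
      show t + ((m + 1 : ℕ) : ℤ) - 1 = t - 1 + (m + 1 : ℕ) by ring, mul_left_comm]
    exact mul_right_inj' (qvar_ne_zero _ _)
  have h0 : frakq (m + 1) (0 + (m + 1 : ℕ)) = qtot (m + 1) * frakq (m + 1) 0 := by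
    have h1 := frakq_natCast (Fin.last m)
    have h2 := hcol 0
    have h3 : color (m + 1) 0 = 0 := by
      have := color_mul_add (m := m) 0 0
      simpa using this
    rw [frakq_rec, h2, h3, frakq_zero, mul_one,
      show (0 : ℤ) + (m + 1 : ℕ) - 1 = ((Fin.last m : Fin (m + 1)) : ℕ) by simp, h1, qtot,
      Fin.prod_univ_succ, ratC, map_prod]
    congr 1
    refine Finset.prod_congr ?_ fun i _ => expandX_ratV i
    ext i
    simp
  induction t using Int.induction_on with
  | zero => exact h0
  | succ t ih => rw [hstep]; simpa using ih
  | pred t ih => exact (hstep _).1 ih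

theorem frakq_mul_add (s t : ℤ) :
    frakq (m + 1) (((m + 1 : ℕ) : ℤ) * s + t) = qtot (m + 1) ^ s * frakq (m + 1) t := by
  have hstep : ∀ s : ℤ,
      frakq (m + 1) (((m + 1 : ℕ) : ℤ) * s + t) = qtot (m + 1) ^ s * frakq (m + 1) t ↔
      frakq (m + 1) (((m + 1 : ℕ) : ℤ) * (s + 1) + t) =
        qtot (m + 1) ^ (s + 1) * frakq (m + 1) t := by
    intro s
    rw [show ((m + 1 : ℕ) : ℤ) * (s + 1) + t = (m + 1 : ℕ) * s + t + (m + 1 : ℕ) by ring,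
      frakq_add_card, zpow_add_one₀ (qtot_ne_zero _), mul_comm (qtot (m + 1) ^ s) (qtot _),
      mul_assoc]
    exact (mul_right_inj' (qtot_ne_zero _)).symm
  induction s using Int.induction_on with
  | zero => simp
  | succ s ih => exact (hstep _).1 ih
  | pred s ih =>
    rw [hstep]
    simpa using ih

theorem expandX_posMono (p : Fin (m + 1) × ℤ) :
    expandX m (posMono p) = frakq (m + 1) (((m + 1 : ℕ) : ℤ) * p.2 + (p.1 : ℕ)) := by
  rw [posMono, map_mul, map_zpow₀, expandX_ratQ, ← frakq_natCast, ← frakq_mul_add]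

theorem slope_of_isQuotient {lam : Fin (m + 1) → YoungDiagram} {μ : YoungDiagram}
    (h : IsQuotient (m + 1) lam μ) (k : Fin (m + 1)) (s : ℤ) :
    slope μ (((m + 1 : ℕ) : ℤ) * s + (k : ℕ)) = slope (lam k) s := by
  have hk := k.2
  rw [h, color_mul_add]
  congr 1
  have : (((m + 1 : ℕ) : ℤ) * s + (k : ℕ)) % ((m + 1 : ℕ) : ℤ) = (k : ℕ) := by
    rw [add_comm, Int.add_mul_emod_self_left, Int.emod_eq_of_lt (by omega) (by omega)]
  rw [this, add_sub_cancel_right, Int.mul_ediv_cancel_left]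
  omega

theorem windowWord_eq {lam : Fin (m + 1) → YoungDiagram} {μ : YoungDiagram}
    (h : IsQuotient (m + 1) lam μ) (N : ℕ) :
    windowWord (m + 1) μ (N * (m + 1) + m) =
      ((posX m N).map (letterR lam)).map fun p => (p.1, expandX m p.2) := by
  have e : 2 * (N * (m + 1) + m) + 1 + 1 = (2 * N + 1 + 1) * (m + 1) := by ring
  rw [windowWord, List.ofFn_congr e, List.ofFn_mul, posX, List.map_map, List.map_flatten,
    List.map_ofFn]
  congr 2
  funext i
  rw [Function.comp_apply, List.map_ofFn]
  congr 1
  funext k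
  have e2 : (((i : ℕ) * (m + 1) + (k : ℕ) : ℕ) : ℤ) - (((N * (m + 1) + m : ℕ) : ℤ) + 1) =
      ((m + 1 : ℕ) : ℤ) * ((i : ℤ) - (N + 1)) + (k : ℕ) := by
    push_cast; ring
  simp only [Function.comp_apply, letterR, letterX, map_zpow₀, expandX_posMono, Fin.val_cast]
  rw [e2, slope_of_isQuotient h]

/-- The orbifold expectation is the limit of the words of rational functions in the order of
the positions `t = n s + k`. -/
theorem convX_posX {lam : Fin (m + 1) → YoungDiagram} {μ : YoungDiagram}
    (h : IsQuotient (m + 1) lam μ) (α β : YoungDiagram) :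
    ConvX (fun N => PowerSeries.map (expandX m) (wordCoeff ((posX m N).map (letterR lam)) α β))
      (expectation (m + 1) μ α β) := by
  have h1 := (convX_windowWord (m + 1) μ α β).comp (r := fun N => N * (m + 1) + m)
    fun N => by nlinarith
  simpa only [windowWord_eq h, wordCoeff_map] using h1

end WordX

section WordY

variable {m : ℕ}

theorem wordOp_flatten {A : Type*} [CommRing A] (ls : List (List (ℤˣ × A))) :
    wordOp ls.flatten = (ls.map wordOp).prod := by
  induction ls with
  | nil => simp [wordOp]
  | cons l ls ih =>
    rw [List.map_cons, List.prod_cons, ← ih]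
    simp [wordOp]

theorem chainOp_map {A B : Type*} [CommRing A] [CommRing B] (f : A →+* B) (m : ℕ)
    (w : Fin (m + 1) → List (ℤˣ × A)) (v : Fin m → A) (α β : YoungDiagram) :
    chainOp m (fun k => wordOp ((w k).map fun p => (p.1, f p.2))) (fun k => f (v k))
      (basisState β) α = PowerSeries.map f (chainOp m (fun k => wordOp (w k)) v (basisState β) α) := by
  ext j
  rw [coeff_chainOp _ _ _ _ _ le_rfl, PowerSeries.coeff_map, coeff_chainOp _ _ _ _ _ le_rfl,
    map_sum]
  refine Finset.sum_congr rfl fun τ _ => ?_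
  simp only [wordCoeff_map, ← map_prod, PowerSeries.coeff_map, map_mul]
  rw [map_prod f]
  simp only [map_pow]

theorem frakq_one (s : ℤ) : frakq 1 s = qtot 1 ^ s := by
  have := frakq_mul_add (m := 0) s 0
  rw [frakq_zero, mul_one] at this
  simpa using this

/-- The word of rational functions in the order of the resolved vertex is the chain of the
one-variable blocks, up to a monomial. -/
theorem wordCoeff_posY (lam : Fin (m + 1) → YoungDiagram) (N : ℕ) (α β : YoungDiagram) :
    PowerSeries.C (expandY m (ratC (Fin.last m)) ^ β.card) *
      PowerSeries.map (expandY m) (wordCoeff ((posY m N).map (letterR lam)) α β) =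
      PowerSeries.map (toYFrac m) (truncY lam α β N) := by
  have hc0 : ∀ k : Fin (m + 1), expandY m (ratC k) ≠ 0 := fun k =>
    (map_ne_zero _).2 (ratC_ne_zero k)
  have hw : ((posY m N).map (letterR lam)).map (fun p => (p.1, expandY m p.2)) =
      (List.ofFn fun k => (((windowWord 1 (lam k) N).map fun p =>
        (p.1, (MvPowerSeries.C p.2 : YSeries m))).map fun p => (p.1, toYFrac m p.2)).map
          (scaleLetter (expandY m (ratC k)) (expandY m (ratC k))⁻¹)).flatten := by
    rw [posY, List.map_map, List.map_flatten, List.map_ofFn]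
    congr 2
    funext k
    rw [Function.comp_apply, List.map_ofFn, windowWord, List.map_map, List.map_map, List.map_ofFn]
    congr 1
    funext i
    simp only [Function.comp_apply, letterR, letterX, scaleLetter, frakq_one, Prod.mk.injEq,
      true_and]
    by_cases hs : slope (lam k) ((i : ℤ) - (N + 1)) = 1
    · simp only [hs, if_true, Units.val_one, posMono, zpow_neg, zpow_one, mul_inv, map_mul, map_inv₀]
      rw [expandY_ratQ_zpow, mul_comm]
      congr 1
      have := map_inv₀ ((toYFrac m).comp MvPowerSeries.C) (qtot 1 ^ ((i : ℤ) - (N + 1)))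
      exact this.symm
    · rw [slope_ne_one hs, if_neg (by decide), Units.val_neg, Units.val_one, neg_neg, zpow_one,
        zpow_one, posMono, map_mul, expandY_ratQ_zpow, mul_comm]
  rw [← wordCoeff_map, hw, wordCoeff, wordOp_flatten, List.map_ofFn]
  have hconj := chainOp_conj m (fun k => wordOp (((windowWord 1 (lam k) N).map fun p =>
        (p.1, (MvPowerSeries.C p.2 : YSeries m))).map fun p => (p.1, toYFrac m p.2)))
    (fun k => toYFrac m (MvPowerSeries.X k)) (fun k => expandY m (ratC k))
    (fun k => (expandY m (ratC k))⁻¹) (fun k => mul_inv_cancel₀ (hc0 k))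
    (fun k => by rw [ratC_succ, map_mul, expandY_ratV])
  simp only [weightOp_wordOp _ _ (mul_inv_cancel₀ (hc0 _))] at hconj
  rw [Function.comp_def, hconj, ratC_zero, map_one, weightOp_one, one_mul, Module.End.mul_apply]
  have hb : weightOp (expandY m (ratC (Fin.last m)))⁻¹ (basisState β) =
      PowerSeries.C ((expandY m (ratC (Fin.last m)) ^ β.card)⁻¹) •
        (basisState β : State (YFrac m)) := by
    funext τ
    rw [weightOp_apply, Pi.smul_apply, smul_eq_mul, basisState]
    split_ifs with hτ
    · rw [hτ, inv_pow]
    · simp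
  rw [hb, map_smul, Pi.smul_apply, smul_eq_mul, ← mul_assoc, ← map_mul,
    mul_inv_cancel₀ (pow_ne_zero _ (hc0 _)), map_one, one_mul, chainOp_map, truncY]

end WordY

/-! ### The contribution of the boundary states -/

section Factorization

variable {m : ℕ} {lam : Fin (m + 1) → YoungDiagram}

theorem convY_posY (lam : Fin (m + 1) → YoungDiagram) (N : ℕ) (α β : YoungDiagram) :
    PowerSeries.map (toYFrac m) (truncY lam α β N) = PowerSeries.map (toYFrac m)
      (truncY lam ⊥ ⊥ N) * PowerSeries.map (expandY m)
        (PowerSeries.C (ratC (Fin.last m) ^ β.card) * windowNormal lam α β (N + 1)) := by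
  have hc : (⊥ : YoungDiagram).card = 0 := rfl
  rw [← wordCoeff_posY, ← wordCoeff_posY, wordCoeff_positions lam (nodup_posY N)
    (fun _ => mem_posY) α β, hc, pow_zero, map_one, one_mul, map_mul, map_mul, PowerSeries.map_C]
  simp only [map_pow]
  ring

theorem map_toYFrac_injective : Function.Injective (PowerSeries.map (toYFrac m)) := by
  intro f g h
  ext1 j
  apply toYFrac_injective
  rw [← PowerSeries.coeff_map, h, PowerSeries.coeff_map]

/-- The two expectations with boundary states `α` and `β`, relative to those with empty boundary
states, are the expansions of one rational function, up to the monomial `(v_1 ⋯ v_m)^{|β|}`. -/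
theorem exists_expectation_factor (lam : Fin (m + 1) → YoungDiagram) (α β : YoungDiagram) :
    ∃ G : RatField m, (∀ μ, IsQuotient (m + 1) lam μ →
      expandX m (ratC (Fin.last m) ^ β.card) * expectation (m + 1) μ α β =
        expectation (m + 1) μ ⊥ ⊥ * expandX m G) ∧
      toYFrac m (fullY lam α β) = toYFrac m (fullY lam ⊥ ⊥) * expandY m G := by
  set T := ∑ k, (lam k).card with hT
  obtain ⟨G, hGX, g, b, h1, h2, h3⟩ := exists_limXY_windowNormal (S := T + 1)
    ((slopeBound_sum_card lam).mono (Nat.le_succ _)) α β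
  refine ⟨G, fun μ hμ => ?_, ?_⟩
  · have e1 := (convX_posX hμ α β).comp (r := fun N => T + N) fun N => Nat.le_add_left _ _
    have e2 := ((convX_posX hμ ⊥ ⊥).comp (r := fun N => T + N) fun N => Nat.le_add_left _ _).mul hGX
    have e3 := ((regular_ratC (Fin.last m)).pow β.card).1
    refine (ConvX.mul e3 e1).unique e2 ⟨0, fun N _ => ?_⟩
    rw [wordCoeff_positions lam (nodup_posX _) (fun _ => mem_posX) α β,
      show T + N + 1 = T + 1 + N by ring]
    simp only [map_mul]
    ring
  · rw [h2, ← map_mul]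
    congr 1
    have e1 := (convY_truncY lam α β).comp (r := fun N => T + N) fun N => Nat.le_add_left _ _
    have e2 := ((convY_truncY lam ⊥ ⊥).comp (r := fun N => T + N)
      fun N => Nat.le_add_left _ _).mul h3
    refine e1.unique e2 ⟨0, fun N _ => map_toYFrac_injective ?_⟩
    rw [map_mul, ← h1, convY_posY, show T + N + 1 = T + 1 + N by ring]

end Factorization

/-! ### Exchanging two slopes in the denominator -/

section Denominators

variable {m : ℕ} {A : Type*} [CommRing A]

open Classical in
/-- The factor `1 - z Q(p') / Q(p)` if the condition holds, and `1` otherwise. The rational functions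
are mapped to `A` by `f`. -/
noncomputable def facIf (f : RatField m →+* A) (z : A) (c : Prop) (p p' : Fin (m + 1) × ℤ) : A :=
  if c then 1 - z * f (posMono p' / posMono p) else 1

theorem facIf_true (f : RatField m →+* A) (z : A) {c : Prop} (h : c) (p p' : Fin (m + 1) × ℤ) :
    facIf f z c p p' = 1 - z * f (posMono p' / posMono p) := if_pos h

theorem facIf_false (f : RatField m →+* A) (z : A) {c : Prop} (h : ¬ c) (p p' : Fin (m + 1) × ℤ) :
    facIf f z c p p' = 1 := if_neg h

theorem facIf_congr (f : RatField m →+* A) (z : A) {c c' : Prop} (h : c ↔ c')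
    (p p' : Fin (m + 1) × ℤ) : facIf f z c p p' = facIf f z c' p p' := by rw [h]

/-- The product of `1 - z Q(p') / Q(p)` over the positions `p, p'` of slope `+1` and `-1`, with `p` to
the left of `p'`. -/
noncomputable def pairProd (f : RatField m →+* A) (z : A)
    (R : Fin (m + 1) × ℤ → Fin (m + 1) × ℤ → Prop) (e : Fin (m + 1) × ℤ → Prop)
    (S : Finset (Fin (m + 1) × ℤ)) : A :=
  ∏ p ∈ S, ∏ p' ∈ S, facIf f z (R p p' ∧ e p ∧ ¬ e p') p p'

variable {f : RatField m →+* A} {z : A} {R : Fin (m + 1) × ℤ → Fin (m + 1) × ℤ → Prop}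
  {e e' : Fin (m + 1) × ℤ → Prop}

theorem pairProd_insert {S : Finset (Fin (m + 1) × ℤ)} {p : Fin (m + 1) × ℤ} (hp : p ∉ S) :
    pairProd f z R e (insert p S) = pairProd f z R e S *
      ∏ t ∈ S, (facIf f z (R p t ∧ e p ∧ ¬ e t) p t * facIf f z (R t p ∧ e t ∧ ¬ e p) t p) := by
  unfold pairProd
  rw [Finset.prod_insert hp, Finset.prod_insert hp, facIf_false _ _ (by tauto), one_mul,
    Finset.prod_mul_distrib]
  simp only [Finset.prod_insert hp]
  rw [Finset.prod_mul_distrib]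
  ring

theorem pairProd_congr {S : Finset (Fin (m + 1) × ℤ)} (h : ∀ t ∈ S, (e t ↔ e' t)) :
    pairProd f z R e S = pairProd f z R e' S := by
  unfold pairProd
  refine Finset.prod_congr rfl fun p hp => Finset.prod_congr rfl fun p' hp' => ?_
  rw [h p hp, h p' hp']

theorem prod_map_filter {α : Type*} (l : List α) (r : α → Prop) [DecidablePred r] (g : α → A) :
    ((l.filter fun t => r t).map g).prod = (l.map fun t => if r t then g t else 1).prod := by
  induction l with
  | nil => rfl
  | cons a l ih =>
    by_cases h : r a
    · simp [h, ih]
    · simp [h, ih]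

theorem wordDenom_eq_pairProd (lam : Fin (m + 1) → YoungDiagram)
    (hasymm : ∀ p p', R p p' → ¬ R p' p) {P : List (Fin (m + 1) × ℤ)} (hP : P.Pairwise R)
    (hnd : P.Nodup) :
    wordDenom (P.map (letterR lam)) = pairProd PowerSeries.C PowerSeries.X R
      (fun p => slope (lam p.1) p.2 = 1) P.toFinset := by
  classical
  induction P with
  | nil => simp [wordDenom, pairProd]
  | cons p P ih =>
    rw [List.pairwise_cons] at hP
    rw [List.nodup_cons] at hnd
    rw [List.map_cons, wordDenom, ih hP.2 hnd.2, List.toFinset_cons,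
      pairProd_insert (by simpa using hnd.1), minusArgs_map_letterR, List.map_map]
    congr 1
    have h1 : ∀ t ∈ P.toFinset, facIf PowerSeries.C PowerSeries.X
        (R p t ∧ slope (lam p.1) p.2 = 1 ∧ ¬ slope (lam t.1) t.2 = 1) p t *
        facIf PowerSeries.C PowerSeries.X
        (R t p ∧ slope (lam t.1) t.2 = 1 ∧ ¬ slope (lam p.1) p.2 = 1) t p =
        facIf PowerSeries.C PowerSeries.X
        (slope (lam p.1) p.2 = 1 ∧ ¬ slope (lam t.1) t.2 = 1) p t := by
      intro t ht
      have hR := hP.1 t (List.mem_toFinset.1 ht)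
      rw [facIf_false (c := R t p ∧ _) _ _ (fun h => hasymm _ _ hR h.1), mul_one]
      simp only [hR, true_and]
    rw [Finset.prod_congr rfl h1, List.prod_toFinset _ hnd.2]
    by_cases hp : slope (lam p.1) p.2 = 1
    · rw [if_pos (by exact hp), prod_map_filter]
      congr 1
      refine List.map_congr_left fun t _ => ?_
      simp only [facIf, hp, true_and, letterR, Function.comp_apply, Units.val_one, zpow_neg,
        zpow_one]
      rw [div_eq_inv_mul]
    · rw [if_neg (by exact hp), List.prod_eq_one]
      intro x hx
      obtain ⟨t, -, rfl⟩ := List.mem_map.1 hx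
      exact facIf_false _ _ (by tauto) _ _

/-- The factors that pair a position `t` with `p₀` of slope `+1` and `p₁` of slope `-1`. -/
noncomputable def crossBefore (f : RatField m →+* A) (z : A)
    (R : Fin (m + 1) × ℤ → Fin (m + 1) × ℤ → Prop) (e : Fin (m + 1) × ℤ → Prop)
    (p₀ p₁ t : Fin (m + 1) × ℤ) : A :=
  facIf f z ((t ≠ p₀ ∧ t ≠ p₁) ∧ R p₀ t ∧ ¬ e t) p₀ t *
    facIf f z ((t ≠ p₀ ∧ t ≠ p₁) ∧ R t p₁ ∧ e t) t p₁

/-- The factors that pair a position `t` with `p₁` of slope `+1` and `p₀` of slope `-1`. -/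
noncomputable def crossAfter (f : RatField m →+* A) (z : A)
    (R : Fin (m + 1) × ℤ → Fin (m + 1) × ℤ → Prop) (e : Fin (m + 1) × ℤ → Prop)
    (p₀ p₁ t : Fin (m + 1) × ℤ) : A :=
  facIf f z ((t ≠ p₀ ∧ t ≠ p₁) ∧ R p₁ t ∧ ¬ e t) p₁ t *
    facIf f z ((t ≠ p₀ ∧ t ≠ p₁) ∧ R t p₀ ∧ e t) t p₀

theorem crossBefore_self (p₀ p₁ t : Fin (m + 1) × ℤ) (ht : t = p₀ ∨ t = p₁) :
    crossBefore f z R e p₀ p₁ t = 1 := by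
  rw [crossBefore, facIf_false _ _ (by tauto), facIf_false _ _ (by tauto), mul_one]

theorem crossAfter_self (p₀ p₁ t : Fin (m + 1) × ℤ) (ht : t = p₀ ∨ t = p₁) :
    crossAfter f z R e p₀ p₁ t = 1 := by
  rw [crossAfter, facIf_false _ _ (by tauto), facIf_false _ _ (by tauto), mul_one]

/-- Exchanging the slopes at `p₀` and `p₁` changes the denominator by the factors of the positions
with `p₀` and `p₁`. -/
theorem pairProd_swap {S : Finset (Fin (m + 1) × ℤ)} {p₀ p₁ : Fin (m + 1) × ℤ} (h₀ : p₀ ∈ S)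
    (h₁ : p₁ ∈ S) (hR : R p₀ p₁) (hR' : ¬ R p₁ p₀) (hne : p₀ ≠ p₁) (he₀ : e p₀) (he₁ : ¬ e p₁)
    (he₀' : ¬ e' p₀) (he₁' : e' p₁) (he : ∀ t, t ≠ p₀ → t ≠ p₁ → (e' t ↔ e t)) :
    ∃ D, pairProd f z R e S = D * (1 - z * f (posMono p₁ / posMono p₀)) *
        ∏ t ∈ S, crossBefore f z R e p₀ p₁ t ∧
      pairProd f z R e' S = D * ∏ t ∈ S, crossAfter f z R e p₀ p₁ t := by
  classical
  set S' := (S.erase p₀).erase p₁ with hS'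
  have n1 : p₁ ∉ S' := Finset.notMem_erase _ _
  have hne1 : p₁ ∈ S.erase p₀ := Finset.mem_erase.2 ⟨hne.symm, h₁⟩
  have n0 : p₀ ∉ insert p₁ S' := by
    rw [hS', Finset.insert_erase hne1]
    exact Finset.notMem_erase _ _
  have hS : S = insert p₀ (insert p₁ S') := by
    rw [hS', Finset.insert_erase hne1, Finset.insert_erase h₀]
  have hmem : ∀ t ∈ S', t ≠ p₀ ∧ t ≠ p₁ := by
    intro t ht
    rw [hS', Finset.mem_erase, Finset.mem_erase] at ht
    exact ⟨ht.2.1, ht.1⟩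
  have hb : ∏ t ∈ S, crossBefore f z R e p₀ p₁ t =
      ∏ t ∈ S', (facIf f z (R p₀ t ∧ ¬ e t) p₀ t * facIf f z (R t p₁ ∧ e t) t p₁) := by
    rw [hS, Finset.prod_insert n0, Finset.prod_insert n1, crossBefore_self _ _ _ (Or.inl rfl),
      crossBefore_self _ _ _ (Or.inr rfl), one_mul, one_mul]
    refine Finset.prod_congr rfl fun t ht => ?_
    have h3 : (t ≠ p₀ ∧ t ≠ p₁) ↔ True := iff_true_intro (hmem t ht)
    simp only [crossBefore, h3, true_and]
  have ha : ∏ t ∈ S, crossAfter f z R e p₀ p₁ t =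
      ∏ t ∈ S', (facIf f z (R p₁ t ∧ ¬ e t) p₁ t * facIf f z (R t p₀ ∧ e t) t p₀) := by
    rw [hS, Finset.prod_insert n0, Finset.prod_insert n1, crossAfter_self _ _ _ (Or.inl rfl),
      crossAfter_self _ _ _ (Or.inr rfl), one_mul, one_mul]
    refine Finset.prod_congr rfl fun t ht => ?_
    have h3 : (t ≠ p₀ ∧ t ≠ p₁) ↔ True := iff_true_intro (hmem t ht)
    simp only [crossAfter, h3, true_and]
  refine ⟨pairProd f z R e S', ?_, ?_⟩
  · rw [hb, hS, pairProd_insert n0, pairProd_insert n1, Finset.prod_insert n1,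
      facIf_true f z (⟨hR, he₀, he₁⟩ : R p₀ p₁ ∧ e p₀ ∧ ¬ e p₁),
      facIf_false f z (show ¬ (R p₁ p₀ ∧ e p₁ ∧ ¬ e p₀) by tauto), mul_one, mul_assoc, mul_assoc,
      mul_left_comm (∏ t ∈ S', _), ← Finset.prod_mul_distrib]
    congr 2
    refine Finset.prod_congr rfl fun t ht => ?_
    simp only [he₀, he₁, true_and, false_and, and_false, not_true_eq_false, not_false_eq_true,
      and_true]
    rw [facIf_false f z not_false, facIf_false f z not_false]
    ring
  · have hc : pairProd f z R e S' = pairProd f z R e' S' :=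
      pairProd_congr fun t ht => (he t (hmem t ht).1 (hmem t ht).2).symm
    rw [ha, hS, pairProd_insert n0, pairProd_insert n1, Finset.prod_insert n1, hc,
      facIf_false f z (show ¬ (R p₀ p₁ ∧ e' p₀ ∧ ¬ e' p₁) by tauto),
      facIf_false f z (show ¬ (R p₁ p₀ ∧ e' p₁ ∧ ¬ e' p₀) by tauto), mul_one, one_mul, mul_assoc,
      ← Finset.prod_mul_distrib]
    congr 1
    refine Finset.prod_congr rfl fun t ht => ?_
    have h3 := he t (hmem t ht).1 (hmem t ht).2
    simp only [he₀', he₁', h3, true_and, false_and, and_false, not_true_eq_false,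
      not_false_eq_true, and_true]
    rw [facIf_false f z not_false, facIf_false f z not_false]
    ring

end Denominators

/-! ### Adding a box in a finite window -/

section Swap

variable {m : ℕ} {A : Type*} [CommRing A] {f : RatField m →+* A} {z : A}
  {R : Fin (m + 1) × ℤ → Fin (m + 1) × ℤ → Prop} {e : Fin (m + 1) × ℤ → Prop}

theorem prod_positions_succ (F : Fin (m + 1) × ℤ → A) (W : ℕ) :
    ∏ t ∈ positions m (W + 1), F t =
      (∏ t ∈ positions m W, F t) * ∏ k, (F (k, (W : ℤ)) * F (k, -(W : ℤ) - 1)) := by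
  have h : Finset.Ico (-((W + 1 : ℕ) : ℤ)) ((W + 1 : ℕ) : ℤ) =
      insert (W : ℤ) (insert (-(W : ℤ) - 1) (Finset.Ico (-(W : ℤ)) W)) := by
    ext s
    simp only [Finset.mem_insert, Finset.mem_Ico]
    push_cast
    omega
  rw [positions, positions, Finset.prod_product, Finset.prod_product, ← Finset.prod_mul_distrib]
  refine Finset.prod_congr rfl fun k _ => ?_
  rw [h, Finset.prod_insert (by simp; omega), Finset.prod_insert (by simp)]
  ring

theorem posMono_div (k l : Fin (m + 1)) (s t : ℤ) :
    posMono (k, s) / posMono (l, t) = ratQ m ^ (s - t) * (ratC k / ratC l) := by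
  rw [posMono, posMono, zpow_sub₀ ratQ_ne_zero, mul_div_mul_comm]

/-- The factors that pair `p₀ = (k₀, s₀)` and `p₁ = (k₀, s₀ + 1)` with the ends of a window; `Kr` and
`Kl` are the classes to the right and to the left of `p₀`, `p₁`. -/
noncomputable def boundaryProd (f : RatField m →+* A) (z : A) (Kr Kl : Fin (m + 1) → Prop)
    (k₀ : Fin (m + 1)) (s₀ : ℤ) (W : ℕ) : A :=
  ∏ k, (facIf f z (Kr k) (k₀, s₀) (k, (W : ℤ) - 1) *
    facIf f z (Kl k) (k, -(W : ℤ)) (k₀, s₀ + 1))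

variable {Kr Kl : Fin (m + 1) → Prop} {k₀ : Fin (m + 1)} {s₀ : ℤ} {S : ℕ}

/-- The relation `R` places far positions of the classes in `Kr` to the right and those in `Kl` to
the left of `(k₀, s₀)` and `(k₀, s₀ + 1)`. -/
structure EndOrder (R : Fin (m + 1) × ℤ → Fin (m + 1) × ℤ → Prop) (Kr Kl : Fin (m + 1) → Prop)
    (k₀ : Fin (m + 1)) (s₀ : ℤ) : Prop where
  right₀ : ∀ k, ∀ s : ℤ, s₀ + 1 < s → (R (k₀, s₀) (k, s) ↔ Kr k)
  right₁ : ∀ k, ∀ s : ℤ, s₀ + 1 < s → (R (k₀, s₀ + 1) (k, s) ↔ Kr k)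
  left₀ : ∀ k, ∀ s : ℤ, s < s₀ → (R (k, s) (k₀, s₀) ↔ Kl k)
  left₁ : ∀ k, ∀ s : ℤ, s < s₀ → (R (k, s) (k₀, s₀ + 1) ↔ Kl k)

theorem prod_crossBefore_succ (hR : EndOrder R Kr Kl k₀ s₀)
    (he : ∀ k, ∀ s : ℤ, (s < -(S : ℤ) → e (k, s)) ∧ ((S : ℤ) ≤ s → ¬ e (k, s)))
    (hs : -(S : ℤ) ≤ s₀) (hs' : s₀ + 1 < S) {W : ℕ} (hW : S ≤ W) :
    ∏ t ∈ positions m (W + 1), crossBefore f z R e (k₀, s₀) (k₀, s₀ + 1) t =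
      (∏ t ∈ positions m W, crossBefore f z R e (k₀, s₀) (k₀, s₀ + 1) t) *
        boundaryProd f z Kr Kl k₀ s₀ (W + 1) := by
  rw [prod_positions_succ, boundaryProd]
  congr 1
  refine Finset.prod_congr rfl fun k _ => ?_
  have h1 := (he k (W : ℤ)).2 (by omega)
  have h2 := (he k (-(W : ℤ) - 1)).1 (by omega)
  have h3 : (k, (W : ℤ)) ≠ (k₀, s₀) ∧ (k, (W : ℤ)) ≠ (k₀, s₀ + 1) := by
    constructor <;> · rw [Ne, Prod.mk.injEq]; omega
  have h4 : (k, -(W : ℤ) - 1) ≠ (k₀, s₀) ∧ (k, -(W : ℤ) - 1) ≠ (k₀, s₀ + 1) := by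
    constructor <;> · rw [Ne, Prod.mk.injEq]; omega
  unfold crossBefore
  rw [facIf_false f z (show ¬ (_ ∧ R (k, (W : ℤ)) _ ∧ e (k, (W : ℤ))) from fun h => h1 h.2.2),
    facIf_false f z (show ¬ (_ ∧ R _ (k, -(W : ℤ) - 1) ∧ ¬ e (k, -(W : ℤ) - 1)) from
      fun h => h.2.2 h2), mul_one, one_mul]
  have e1 : (((k, (W : ℤ)) ≠ (k₀, s₀) ∧ (k, (W : ℤ)) ≠ (k₀, s₀ + 1)) ∧
      R (k₀, s₀) (k, (W : ℤ)) ∧ ¬ e (k, (W : ℤ))) ↔ Kr k := by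
    rw [hR.right₀ _ _ (by omega)]; tauto
  have e2 : (((k, -(W : ℤ) - 1) ≠ (k₀, s₀) ∧ (k, -(W : ℤ) - 1) ≠ (k₀, s₀ + 1)) ∧
      R (k, -(W : ℤ) - 1) (k₀, s₀ + 1) ∧ e (k, -(W : ℤ) - 1)) ↔ Kl k := by
    rw [hR.left₁ _ _ (by omega)]; tauto
  rw [facIf_congr f z e1, facIf_congr f z e2, show ((W + 1 : ℕ) : ℤ) - 1 = W by push_cast; ring,
    show -((W + 1 : ℕ) : ℤ) = -(W : ℤ) - 1 by push_cast; ring]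

theorem prod_crossAfter_succ (hR : EndOrder R Kr Kl k₀ s₀)
    (he : ∀ k, ∀ s : ℤ, (s < -(S : ℤ) → e (k, s)) ∧ ((S : ℤ) ≤ s → ¬ e (k, s)))
    (hs : -(S : ℤ) ≤ s₀) (hs' : s₀ + 1 < S) {W : ℕ} (hW : S ≤ W) :
    ∏ t ∈ positions m (W + 1), crossAfter f z R e (k₀, s₀) (k₀, s₀ + 1) t =
      (∏ t ∈ positions m W, crossAfter f z R e (k₀, s₀) (k₀, s₀ + 1) t) *
        boundaryProd f z Kr Kl k₀ s₀ W := by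
  rw [prod_positions_succ, boundaryProd]
  congr 1
  refine Finset.prod_congr rfl fun k _ => ?_
  have h1 := (he k (W : ℤ)).2 (by omega)
  have h2 := (he k (-(W : ℤ) - 1)).1 (by omega)
  have h3 : (k, (W : ℤ)) ≠ (k₀, s₀) ∧ (k, (W : ℤ)) ≠ (k₀, s₀ + 1) := by
    constructor <;> · rw [Ne, Prod.mk.injEq]; omega
  have h4 : (k, -(W : ℤ) - 1) ≠ (k₀, s₀) ∧ (k, -(W : ℤ) - 1) ≠ (k₀, s₀ + 1) := by
    constructor <;> · rw [Ne, Prod.mk.injEq]; omega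
  unfold crossAfter
  rw [facIf_false f z (show ¬ (_ ∧ R (k, (W : ℤ)) _ ∧ e (k, (W : ℤ))) from fun h => h1 h.2.2),
    facIf_false f z (show ¬ (_ ∧ R _ (k, -(W : ℤ) - 1) ∧ ¬ e (k, -(W : ℤ) - 1)) from
      fun h => h.2.2 h2), mul_one, one_mul]
  have e1 : (((k, (W : ℤ)) ≠ (k₀, s₀) ∧ (k, (W : ℤ)) ≠ (k₀, s₀ + 1)) ∧
      R (k₀, s₀ + 1) (k, (W : ℤ)) ∧ ¬ e (k, (W : ℤ))) ↔ Kr k := by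
    rw [hR.right₁ _ _ (by omega)]; tauto
  have e2 : (((k, -(W : ℤ) - 1) ≠ (k₀, s₀) ∧ (k, -(W : ℤ) - 1) ≠ (k₀, s₀ + 1)) ∧
      R (k, -(W : ℤ) - 1) (k₀, s₀) ∧ e (k, -(W : ℤ) - 1)) ↔ Kl k := by
    rw [hR.left₀ _ _ (by omega)]; tauto
  rw [facIf_congr f z e1, facIf_congr f z e2]
  simp only [facIf, posMono_div]
  rw [show (W : ℤ) - (s₀ + 1) = W - 1 - s₀ by ring,
    show s₀ - (-(W : ℤ) - 1) = s₀ + 1 - -(W : ℤ) by ring]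

/-- The quotient of the factors of the positions of a window depends on the window only through
the factors of its ends. -/
theorem prod_cross_window (hR : EndOrder R Kr Kl k₀ s₀)
    (he : ∀ k, ∀ s : ℤ, (s < -(S : ℤ) → e (k, s)) ∧ ((S : ℤ) ≤ s → ¬ e (k, s)))
    (hs : -(S : ℤ) ≤ s₀) (hs' : s₀ + 1 < S) (N : ℕ) :
    (∏ t ∈ positions m (S + N), crossBefore f z R e (k₀, s₀) (k₀, s₀ + 1) t) *
        (∏ t ∈ positions m S, crossAfter f z R e (k₀, s₀) (k₀, s₀ + 1) t) *
        boundaryProd f z Kr Kl k₀ s₀ S =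
      (∏ t ∈ positions m (S + N), crossAfter f z R e (k₀, s₀) (k₀, s₀ + 1) t) *
        (∏ t ∈ positions m S, crossBefore f z R e (k₀, s₀) (k₀, s₀ + 1) t) *
        boundaryProd f z Kr Kl k₀ s₀ (S + N) := by
  induction N with
  | zero => simp only [Nat.add_zero]; ring
  | succ N ih =>
    rw [← Nat.add_assoc, prod_crossBefore_succ hR he hs hs' (Nat.le_add_right S N),
      prod_crossAfter_succ hR he hs hs' (Nat.le_add_right S N)]
    linear_combination boundaryProd f z Kr Kl k₀ s₀ (S + N + 1) * ih

/-- Two families of partitions, of which the second arises from the first by adding a box of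
content `s₀ + 1` to the partition with index `k₀`. -/
structure AddBox (lam' lam : Fin (m + 1) → YoungDiagram) (k₀ : Fin (m + 1)) (s₀ : ℤ) : Prop where
  old_left : slope (lam' k₀) s₀ = 1
  old_right : slope (lam' k₀) (s₀ + 1) ≠ 1
  new_left : slope (lam k₀) s₀ ≠ 1
  new_right : slope (lam k₀) (s₀ + 1) = 1
  eq : ∀ p : Fin (m + 1) × ℤ, p ≠ (k₀, s₀) → p ≠ (k₀, s₀ + 1) →
    slope (lam p.1) p.2 = slope (lam' p.1) p.2

/-- The positions of slope `+1`. -/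
def IsPlus (lam : Fin (m + 1) → YoungDiagram) (p : Fin (m + 1) × ℤ) : Prop :=
  slope (lam p.1) p.2 = 1

theorem prod_crossAfter_ne_zero (S : Finset (Fin (m + 1) × ℤ)) (p₀ p₁ : Fin (m + 1) × ℤ) :
    ∏ t ∈ S, crossAfter PowerSeries.C PowerSeries.X R e p₀ p₁ t ≠ 0 := by
  have hfac : ∀ c p p', PowerSeries.constantCoeff
      (facIf (m := m) PowerSeries.C PowerSeries.X c p p') = 1 := by
    intro c p p'
    by_cases hc : c
    · rw [facIf_true _ _ hc]; simp
    · rw [facIf_false _ _ hc]; simp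
  intro h
  have := congrArg PowerSeries.constantCoeff h
  rw [map_prod, map_zero, Finset.prod_eq_one] at this
  · exact one_ne_zero this
  · intro t _
    rw [crossAfter, map_mul, hfac, hfac, one_mul]

/-- Adding a box changes the truncated matrix coefficient by the factors that pair the two exchanged
slopes with the other positions. Only positions of the smaller window `S` contribute, up to a product
over the ends of the large window, which tends to `1`. -/
theorem wordCoeff_addBox {lam' lam : Fin (m + 1) → YoungDiagram} (h : AddBox lam' lam k₀ s₀)
    (hS : SlopeBound lam' S) (hs : -(S : ℤ) ≤ s₀) (hs' : s₀ + 1 < S)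
    (hR : EndOrder R Kr Kl k₀ s₀) (hasymm : ∀ p p', R p p' → ¬ R p' p)
    (h01 : R (k₀, s₀) (k₀, s₀ + 1)) {P : List (Fin (m + 1) × ℤ)} (hP : P.Pairwise R)
    (hnd : P.Nodup) {N : ℕ} (hmem : ∀ p, p ∈ P ↔ p ∈ positions m (S + N)) :
    wordCoeff (P.map (letterR lam)) ⊥ ⊥ *
        ((∏ t ∈ positions m S, crossAfter PowerSeries.C PowerSeries.X R (IsPlus lam')
          (k₀, s₀) (k₀, s₀ + 1) t) * boundaryProd PowerSeries.C PowerSeries.X Kr Kl k₀ s₀ S) =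
      wordCoeff (P.map (letterR lam')) ⊥ ⊥ *
        ((1 - PowerSeries.X * PowerSeries.C (ratQ m)) *
        (∏ t ∈ positions m S, crossBefore PowerSeries.C PowerSeries.X R (IsPlus lam')
          (k₀, s₀) (k₀, s₀ + 1) t) *
        boundaryProd PowerSeries.C PowerSeries.X Kr Kl k₀ s₀ (S + N)) := by
  have hPS : P.toFinset = positions m (S + N) := by
    ext p; rw [List.mem_toFinset, hmem]
  have d1 := wordDenom_mul_wordCoeff_bot (P.map (letterR lam))
  have d2 := wordDenom_mul_wordCoeff_bot (P.map (letterR lam'))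
  rw [wordDenom_eq_pairProd lam hasymm hP hnd, hPS] at d1
  rw [wordDenom_eq_pairProd lam' hasymm hP hnd, hPS] at d2
  have hin : ∀ s : ℤ, -(S : ℤ) ≤ s → s < S → (k₀, s) ∈ positions m (S + N) := fun s h1 h2 => by
    rw [mem_positions]; push_cast; omega
  obtain ⟨D, e1, e2⟩ := pairProd_swap (f := (PowerSeries.C : RatField m →+* _))
    (z := PowerSeries.X) (R := R) (e := IsPlus lam') (e' := IsPlus lam)
    (hin s₀ hs (by omega)) (hin (s₀ + 1) (by omega) hs') h01
    (hasymm _ _ h01) (by simp) h.old_left h.old_right h.new_left h.new_right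
    (fun t h1 h2 => by unfold IsPlus; rw [h.eq t h1 h2])
  have e3 := prod_cross_window (f := (PowerSeries.C : RatField m →+* _)) (z := PowerSeries.X)
    hR (e := IsPlus lam') (fun k s => hS k s) hs hs' N
  have hq : posMono (k₀, s₀ + 1) / posMono (k₀, s₀) = ratQ m := by
    rw [posMono_div, div_self (ratC_ne_zero _), mul_one, add_sub_cancel_left, zpow_one]
  rw [hq] at e1
  change pairProd _ _ R (IsPlus lam) _ * _ = 1 at d1
  change pairProd _ _ R (IsPlus lam') _ * _ = 1 at d2
  rw [e2] at d1
  rw [e1] at d2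
  set E := wordCoeff (P.map (letterR lam)) ⊥ ⊥
  set E' := wordCoeff (P.map (letterR lam')) ⊥ ⊥
  have hne := prod_crossAfter_ne_zero (R := R) (e := IsPlus lam') (positions m (S + N))
    (k₀, s₀) (k₀, s₀ + 1)
  apply mul_left_cancel₀ hne
  linear_combination
    (-(E * (∏ t ∈ positions m (S + N), crossAfter PowerSeries.C PowerSeries.X R (IsPlus lam')
      (k₀, s₀) (k₀, s₀ + 1) t) * ((∏ t ∈ positions m S, crossAfter PowerSeries.C PowerSeries.X R
      (IsPlus lam') (k₀, s₀) (k₀, s₀ + 1) t) *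
      boundaryProd PowerSeries.C PowerSeries.X Kr Kl k₀ s₀ S))) * d2 +
    (E' * (1 - PowerSeries.X * PowerSeries.C (ratQ m)) *
      (∏ t ∈ positions m (S + N), crossBefore PowerSeries.C PowerSeries.X R (IsPlus lam')
      (k₀, s₀) (k₀, s₀ + 1) t) * ((∏ t ∈ positions m S, crossAfter PowerSeries.C PowerSeries.X R
      (IsPlus lam') (k₀, s₀) (k₀, s₀ + 1) t) *
      boundaryProd PowerSeries.C PowerSeries.X Kr Kl k₀ s₀ S)) * d1 +
    (E' * (1 - PowerSeries.X * PowerSeries.C (ratQ m))) * e3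

end Swap

/-! ### Adding a box in the limit -/

section SwapLimit

variable {m : ℕ}

theorem limX_facIf (c : Prop) (p p' : Fin (m + 1) × ℤ) :
    LimX (fun _ => facIf PowerSeries.C PowerSeries.X c p p')
      (facIf (RingHom.id (RatField m)) 1 c p p') := by
  by_cases hc : c
  · simp only [facIf_true _ _ hc]
    have h1 := (limX_monomial (p'.2 - p.2) p'.1 p.1)
    rw [← posMono_div] at h1
    have h2 := LimX.one.add ((LimX.const (m := m) (c := 0) (a := -1) (by
      rw [map_neg, map_one]
      intro g hg
      exact expLowerBound_one g (by simpa using hg))).mul (LimX.X.mul h1))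
    convert h2 using 2
    · simp [sub_eq_add_neg]
    · simp [sub_eq_add_neg]
  · simp only [facIf_false _ _ hc]
    exact LimX.one

theorem limY_facIf {c : Prop} {p p' : Fin (m + 1) × ℤ} (h : c → p.1 ≤ p'.1) :
    LimY (fun _ => facIf PowerSeries.C PowerSeries.X c p p')
      (facIf (RingHom.id (RatField m)) 1 c p p') := by
  by_cases hc : c
  · simp only [facIf_true _ _ hc]
    have h1 := (limY_monomial (p'.2 - p.2) (h hc))
    rw [← posMono_div] at h1
    have h2 := LimY.one.add ((LimY.const (m := m) (a := -1) (b := -1) (by simp)).mul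
      (LimY.X.mul h1))
    convert h2 using 2
    · simp [sub_eq_add_neg]
    · simp [sub_eq_add_neg]
  · simp only [facIf_false _ _ hc]
    exact LimY.one

theorem LimX.one_sub_X_mul {g : ℕ → PowerSeries (RatField m)} (h : LimX g 0) :
    LimX (fun N => 1 - PowerSeries.X * g N) 1 := by
  have h2 := LimX.one.add ((LimX.const (m := m) (c := 0) (a := -1) (by
    rw [map_neg, map_one]
    intro g hg
    exact expLowerBound_one g (by simpa using hg))).mul (LimX.X.mul h))
  convert h2 using 2
  · simp [sub_eq_add_neg]
  · simp

theorem LimY.one_sub_X_mul {g : ℕ → PowerSeries (RatField m)} (h : LimY g 0) :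
    LimY (fun N => 1 - PowerSeries.X * g N) 1 := by
  have h2 := LimY.one.add ((LimY.const (m := m) (a := -1) (b := -1) (by simp)).mul
    (LimY.X.mul h))
  convert h2 using 2
  · simp [sub_eq_add_neg]
  · simp

theorem limX_boundaryProd (Kr Kl : Fin (m + 1) → Prop) (k₀ : Fin (m + 1)) (s₀ : ℤ) (S : ℕ) :
    LimX (fun N => boundaryProd PowerSeries.C PowerSeries.X Kr Kl k₀ s₀ (S + N)) 1 := by
  have key := LimX.prod (m := m) Finset.univ (f := fun k N =>
    facIf PowerSeries.C PowerSeries.X (Kr k) (k₀, s₀) (k, ((S + N : ℕ) : ℤ) - 1) *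
      facIf PowerSeries.C PowerSeries.X (Kl k) (k, -((S + N : ℕ) : ℤ)) (k₀, s₀ + 1))
    (a := fun _ => 1) (fun k _ => ?_)
  · simpa only [boundaryProd, Finset.prod_const_one] using key
  · have h1 : LimX (m := m) (fun N => facIf PowerSeries.C PowerSeries.X (Kr k) (k₀, s₀)
        (k, ((S + N : ℕ) : ℤ) - 1)) 1 := by
      by_cases hc : Kr k
      · simp only [facIf_true _ _ hc, posMono_div]
        refine LimX.one_sub_X_mul ?_
        convert limX_monomial_zero (S - 1 - s₀) k k₀ using 5 with N
        push_cast; ring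
      · simp only [facIf_false _ _ hc]
        exact LimX.one
    have h2 : LimX (m := m) (fun N => facIf PowerSeries.C PowerSeries.X (Kl k)
        (k, -((S + N : ℕ) : ℤ)) (k₀, s₀ + 1)) 1 := by
      by_cases hc : Kl k
      · simp only [facIf_true _ _ hc, posMono_div]
        refine LimX.one_sub_X_mul ?_
        convert limX_monomial_zero (s₀ + 1 + S) k₀ k using 5 with N
        push_cast; ring
      · simp only [facIf_false _ _ hc]
        exact LimX.one
    simpa only [one_mul] using h1.mul h2

theorem limY_boundaryProd {Kr Kl : Fin (m + 1) → Prop} {k₀ : Fin (m + 1)}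
    (hr : ∀ k, Kr k → k₀ ≤ k) (hl : ∀ k, Kl k → k ≤ k₀) (s₀ : ℤ) (S : ℕ) :
    LimY (fun N => boundaryProd PowerSeries.C PowerSeries.X Kr Kl k₀ s₀ (S + N)) 1 := by
  have key := LimY.prod (m := m) Finset.univ (f := fun k N =>
    facIf PowerSeries.C PowerSeries.X (Kr k) (k₀, s₀) (k, ((S + N : ℕ) : ℤ) - 1) *
      facIf PowerSeries.C PowerSeries.X (Kl k) (k, -((S + N : ℕ) : ℤ)) (k₀, s₀ + 1))
    (a := fun _ => 1) (fun k _ => ?_)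
  · simpa only [boundaryProd, Finset.prod_const_one] using key
  · have h1 : LimY (m := m) (fun N => facIf PowerSeries.C PowerSeries.X (Kr k) (k₀, s₀)
        (k, ((S + N : ℕ) : ℤ) - 1)) 1 := by
      by_cases hc : Kr k
      · simp only [facIf_true _ _ hc, posMono_div]
        refine LimY.one_sub_X_mul ?_
        convert limY_monomial_zero (S - 1 - s₀) (hr k hc) using 5 with N
        push_cast; ring
      · simp only [facIf_false _ _ hc]
        exact LimY.one
    have h2 : LimY (m := m) (fun N => facIf PowerSeries.C PowerSeries.X (Kl k)
        (k, -((S + N : ℕ) : ℤ)) (k₀, s₀ + 1)) 1 := by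
      by_cases hc : Kl k
      · simp only [facIf_true _ _ hc, posMono_div]
        refine LimY.one_sub_X_mul ?_
        convert limY_monomial_zero (s₀ + 1 + S) (hl k hc) using 5 with N
        push_cast; ring
      · simp only [facIf_false _ _ hc]
        exact LimY.one
    simpa only [one_mul] using h1.mul h2

/-- The numerator of the rational function that relates the expectations before and after adding a box
for the order `R`, at `z = 1`. -/
noncomputable def stepNum (R : Fin (m + 1) × ℤ → Fin (m + 1) × ℤ → Prop)
    (lam' : Fin (m + 1) → YoungDiagram) (k₀ : Fin (m + 1)) (s₀ : ℤ) (S : ℕ) : RatField m :=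
  (1 - ratQ m) * ∏ t ∈ positions m S, crossBefore (RingHom.id (RatField m)) 1 R (IsPlus lam')
    (k₀, s₀) (k₀, s₀ + 1) t

/-- The denominator of the rational function that relates the expectations before and after adding a
box for the order `R`, at `z = 1`. -/
noncomputable def stepDen (R : Fin (m + 1) × ℤ → Fin (m + 1) × ℤ → Prop)
    (lam' : Fin (m + 1) → YoungDiagram) (Kr Kl : Fin (m + 1) → Prop) (k₀ : Fin (m + 1)) (s₀ : ℤ)
    (S : ℕ) : RatField m :=
  (∏ t ∈ positions m S, crossAfter (RingHom.id (RatField m)) 1 R (IsPlus lam')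
    (k₀, s₀) (k₀, s₀ + 1) t) * boundaryProd (RingHom.id (RatField m)) 1 Kr Kl k₀ s₀ S

variable {lam lam' : Fin (m + 1) → YoungDiagram} {k₀ : Fin (m + 1)} {s₀ : ℤ} {S : ℕ}

theorem limX_one_sub_X_mul_ratQ :
    LimX (fun _ => 1 - PowerSeries.X * PowerSeries.C (ratQ m)) (1 - ratQ m) := by
  have h := limX_facIf (m := m) True (0, 0) (0, 1)
  have e : posMono ((0 : Fin (m + 1)), (1 : ℤ)) / posMono (0, 0) = ratQ m := by
    rw [posMono_div, div_self (ratC_ne_zero _), mul_one, sub_zero, zpow_one]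
  simp only [facIf_true _ _ trivial, e] at h
  simpa using h

theorem limY_one_sub_X_mul_ratQ :
    LimY (fun _ => 1 - PowerSeries.X * PowerSeries.C (ratQ m)) (1 - ratQ m) := by
  have h := limY_facIf (m := m) (c := True) (p := (0, 0)) (p' := (0, 1)) fun _ => le_rfl
  have e : posMono ((0 : Fin (m + 1)), (1 : ℤ)) / posMono (0, 0) = ratQ m := by
    rw [posMono_div, div_self (ratC_ne_zero _), mul_one, sub_zero, zpow_one]
  simp only [facIf_true _ _ trivial, e] at h
  simpa using h

theorem LtX.asymm {p p' : Fin (m + 1) × ℤ} (h : LtX p p') : ¬ LtX p' p := by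
  unfold LtX at *; omega

theorem LtY.asymm {p p' : Fin (m + 1) × ℤ} (h : LtY p p') : ¬ LtY p' p := by
  unfold LtY at *; omega

theorem endOrderX (k₀ : Fin (m + 1)) (s₀ : ℤ) :
    EndOrder LtX (fun _ => True) (fun _ => True) k₀ s₀ where
  right₀ k s h := by simp only [LtX, iff_true]; omega
  right₁ k s h := by simp only [LtX, iff_true]; omega
  left₀ k s h := by simp only [LtX, iff_true]; omega
  left₁ k s h := by simp only [LtX, iff_true]; omega

theorem endOrderY (k₀ : Fin (m + 1)) (s₀ : ℤ) :
    EndOrder LtY (fun k => k₀ ≤ k) (fun k => k ≤ k₀) k₀ s₀ where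
  right₀ k s h := by simp only [LtY]; omega
  right₁ k s h := by simp only [LtY]; omega
  left₀ k s h := by simp only [LtY]; omega
  left₁ k s h := by simp only [LtY]; omega

theorem limX_stepDen (R : Fin (m + 1) × ℤ → Fin (m + 1) × ℤ → Prop) (Kr Kl : Fin (m + 1) → Prop) :
    LimX (fun _ => (∏ t ∈ positions m S, crossAfter PowerSeries.C PowerSeries.X R (IsPlus lam')
      (k₀, s₀) (k₀, s₀ + 1) t) * boundaryProd PowerSeries.C PowerSeries.X Kr Kl k₀ s₀ S)
      (stepDen R lam' Kr Kl k₀ s₀ S) :=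
  (LimX.prod _ fun _ _ => (limX_facIf _ _ _).mul (limX_facIf _ _ _)).mul
    (LimX.prod _ fun _ _ => (limX_facIf _ _ _).mul (limX_facIf _ _ _))

theorem limX_stepNum (R : Fin (m + 1) × ℤ → Fin (m + 1) × ℤ → Prop) (Kr Kl : Fin (m + 1) → Prop) :
    LimX (fun N => (1 - PowerSeries.X * PowerSeries.C (ratQ m)) *
      (∏ t ∈ positions m S, crossBefore PowerSeries.C PowerSeries.X R (IsPlus lam')
        (k₀, s₀) (k₀, s₀ + 1) t) *
      boundaryProd PowerSeries.C PowerSeries.X Kr Kl k₀ s₀ (S + N))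
      (stepNum R lam' k₀ s₀ S) := by
  have := (limX_one_sub_X_mul_ratQ.mul (LimX.prod (positions m S) fun t _ =>
    (limX_facIf ((t ≠ (k₀, s₀) ∧ t ≠ (k₀, s₀ + 1)) ∧ R (k₀, s₀) t ∧ ¬ IsPlus lam' t)
        (k₀, s₀) t).mul
      (limX_facIf ((t ≠ (k₀, s₀) ∧ t ≠ (k₀, s₀ + 1)) ∧ R t (k₀, s₀ + 1) ∧ IsPlus lam' t)
        t (k₀, s₀ + 1)))).mul (limX_boundaryProd Kr Kl k₀ s₀ S)
  rw [mul_one] at this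
  exact this

theorem LtY.fst_le {p p' : Fin (m + 1) × ℤ} (h : LtY p p') : p.1 ≤ p'.1 := by
  unfold LtY at h
  omega

theorem limY_stepDen :
    LimY (fun _ => (∏ t ∈ positions m S, crossAfter PowerSeries.C PowerSeries.X LtY (IsPlus lam')
      (k₀, s₀) (k₀, s₀ + 1) t) *
        boundaryProd PowerSeries.C PowerSeries.X (fun k => k₀ ≤ k) (fun k => k ≤ k₀) k₀ s₀ S)
      (stepDen LtY lam' (fun k => k₀ ≤ k) (fun k => k ≤ k₀) k₀ s₀ S) := by
  have h1 := LimY.prod (positions m S) fun t _ =>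
    (limY_facIf (c := (t ≠ (k₀, s₀) ∧ t ≠ (k₀, s₀ + 1)) ∧ LtY (k₀, s₀ + 1) t ∧ ¬ IsPlus lam' t)
        (p := (k₀, s₀ + 1)) (p' := t) fun h => LtY.fst_le h.2.1).mul
      (limY_facIf (c := (t ≠ (k₀, s₀) ∧ t ≠ (k₀, s₀ + 1)) ∧ LtY t (k₀, s₀) ∧ IsPlus lam' t)
        (p := t) (p' := (k₀, s₀)) fun h => LtY.fst_le h.2.1)
  have h2 := LimY.prod Finset.univ fun k _ =>
    (limY_facIf (c := k₀ ≤ k) (p := (k₀, s₀)) (p' := (k, (S : ℤ) - 1)) id).mul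
      (limY_facIf (c := k ≤ k₀) (p := (k, -(S : ℤ))) (p' := (k₀, s₀ + 1)) id)
  exact h1.mul h2

theorem limY_stepNum :
    LimY (fun N => (1 - PowerSeries.X * PowerSeries.C (ratQ m)) *
      (∏ t ∈ positions m S, crossBefore PowerSeries.C PowerSeries.X LtY (IsPlus lam')
        (k₀, s₀) (k₀, s₀ + 1) t) *
      boundaryProd PowerSeries.C PowerSeries.X (fun k => k₀ ≤ k) (fun k => k ≤ k₀) k₀ s₀ (S + N))
      (stepNum LtY lam' k₀ s₀ S) := by
  have := (limY_one_sub_X_mul_ratQ.mul (LimY.prod (positions m S) fun t _ =>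
    (limY_facIf (c := (t ≠ (k₀, s₀) ∧ t ≠ (k₀, s₀ + 1)) ∧ LtY (k₀, s₀) t ∧ ¬ IsPlus lam' t)
        (p := (k₀, s₀)) (p' := t) fun h => LtY.fst_le h.2.1).mul
      (limY_facIf (c := (t ≠ (k₀, s₀) ∧ t ≠ (k₀, s₀ + 1)) ∧ LtY t (k₀, s₀ + 1) ∧ IsPlus lam' t)
        (p := t) (p' := (k₀, s₀ + 1)) fun h => LtY.fst_le h.2.1))).mul
    (limY_boundaryProd (Kr := fun k => k₀ ≤ k) (Kl := fun k => k ≤ k₀) (k₀ := k₀)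
      (fun _ => id) (fun _ => id) s₀ S)
  rw [mul_one] at this
  exact this

/-- The effect of adding a box to the `n`-quotient on the orbifold expectation. -/
theorem expectation_addBox (h : AddBox lam' lam k₀ s₀) (hS : SlopeBound lam' S)
    (hs : -(S : ℤ) ≤ s₀) (hs' : s₀ + 1 < S) (hS0 : 0 < S) {μ ν : YoungDiagram}
    (hμ : IsQuotient (m + 1) lam μ) (hν : IsQuotient (m + 1) lam' ν) :
    expectation (m + 1) μ ⊥ ⊥ *
        expandX m (stepDen LtX lam' (fun _ => True) (fun _ => True) k₀ s₀ S) =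
      expectation (m + 1) ν ⊥ ⊥ * expandX m (stepNum LtX lam' k₀ s₀ S) := by
  obtain ⟨T, rfl⟩ : ∃ T, S = T + 1 := ⟨S - 1, by omega⟩
  have e1 := (convX_posX hμ ⊥ ⊥).comp (r := fun N => T + N) fun N => Nat.le_add_left _ _
  have e2 := (convX_posX hν ⊥ ⊥).comp (r := fun N => T + N) fun N => Nat.le_add_left _ _
  have l1 := limX_stepDen (S := T + 1) (lam' := lam') (k₀ := k₀) (s₀ := s₀) LtX (fun _ => True)
    (fun _ => True)
  have l2 := limX_stepNum (S := T + 1) (lam' := lam') (k₀ := k₀) (s₀ := s₀) LtX (fun _ => True)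
    (fun _ => True)
  refine (ConvX.mul e1 l1).unique (ConvX.mul e2 l2) ⟨0, fun N _ => ?_⟩
  have key := wordCoeff_addBox h hS hs hs' (endOrderX k₀ s₀) (fun _ _ => LtX.asymm)
    (Or.inl (lt_add_one s₀)) (pairwise_posX (T + N)) (nodup_posX (T + N)) (N := N)
    (fun p => by rw [mem_posX, show T + N + 1 = T + 1 + N by ring])
  beta_reduce
  rw [← map_mul (PowerSeries.map (expandX m)), ← map_mul (PowerSeries.map (expandX m))]
  exact congrArg (PowerSeries.map (expandX m)) key

/-- The effect of adding a box to the `n`-quotient on the resolved expectation. -/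
theorem fullY_addBox (h : AddBox lam' lam k₀ s₀) (hS : SlopeBound lam' S)
    (hs : -(S : ℤ) ≤ s₀) (hs' : s₀ + 1 < S) (hS0 : 0 < S) :
    toYFrac m (fullY lam ⊥ ⊥) *
        expandY m (stepDen LtY lam' (fun k => k₀ ≤ k) (fun k => k ≤ k₀) k₀ s₀ S) =
      toYFrac m (fullY lam' ⊥ ⊥) * expandY m (stepNum LtY lam' k₀ s₀ S) := by
  obtain ⟨T, rfl⟩ : ∃ T, S = T + 1 := ⟨S - 1, by omega⟩
  have e1 := (convY_truncY lam ⊥ ⊥).comp (r := fun N => T + N) fun N => Nat.le_add_left _ _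
  have e2 := (convY_truncY lam' ⊥ ⊥).comp (r := fun N => T + N) fun N => Nat.le_add_left _ _
  obtain ⟨g1, b1, h1, h1', c1⟩ := limY_stepDen (S := T + 1) (lam' := lam') (k₀ := k₀) (s₀ := s₀)
  obtain ⟨g2, b2, h2, h2', c2⟩ := limY_stepNum (S := T + 1) (lam' := lam') (k₀ := k₀) (s₀ := s₀)
  rw [h1', h2', ← map_mul, ← map_mul]
  refine congrArg (toYFrac m) ?_
  refine (e1.mul c1).unique (e2.mul c2) ⟨0, fun N _ => map_toYFrac_injective ?_⟩
  have key := wordCoeff_addBox h hS hs hs' (endOrderY k₀ s₀) (fun _ _ => LtY.asymm)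
    (Or.inr ⟨rfl, lt_add_one s₀⟩) (pairwise_posY (T + N)) (nodup_posY (T + N)) (N := N)
    (fun p => by rw [mem_posY, show T + N + 1 = T + 1 + N by ring])
  have hb : ∀ l : Fin (m + 1) → YoungDiagram, PowerSeries.map (expandY m)
      (wordCoeff ((posY m (T + N)).map (letterR l)) ⊥ ⊥) =
      PowerSeries.map (toYFrac m) (truncY l ⊥ ⊥ (T + N)) := by
    intro l
    have hc : (⊥ : YoungDiagram).card = 0 := rfl
    have := wordCoeff_posY l (T + N) ⊥ ⊥
    rwa [hc, pow_zero, map_one, one_mul] at this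
  have key2 := congrArg (PowerSeries.map (expandY m)) key
  rw [map_mul (PowerSeries.map (expandY m)) (wordCoeff _ _ _),
    map_mul (PowerSeries.map (expandY m)) (wordCoeff _ _ _), hb, hb] at key2
  rw [map_mul (PowerSeries.map (toYFrac m)), map_mul (PowerSeries.map (toYFrac m)), ← h1 N, ← h2 N]
  exact key2

end SwapLimit

/-! ### Comparison of the two orders -/

section Comparison

open Classical

/-- Positions of slope `+1` are counted by the differences of `rk`. -/
theorem prod_slope {M : Type*} [CommMonoid M] (μ : YoungDiagram) (x : M) {a b : ℤ} (h : a ≤ b) :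
    ∏ s ∈ Finset.Ico a b, (if slope μ s = 1 then x else 1) = x ^ (rk μ a - rk μ b) := by
  induction b, h using Int.leInduction with
  | base => simp
  | succ b hb ih =>
    have e : Finset.Ico a (b + 1) = insert b (Finset.Ico a b) := by ext; simp; omega
    have h2 := rk_antitone μ hb
    rw [e, Finset.prod_insert (by simp), ih]
    by_cases hs : slope μ b = 1
    · have h1 := rk_of_slope_one hs
      rw [if_pos hs, ← pow_succ']
      congr 1
      omega
    · rw [if_neg hs, one_mul, rk_of_slope_ne hs]

variable {m : ℕ} {lam' : Fin (m + 1) → YoungDiagram} {k₀ : Fin (m + 1)} {s₀ : ℤ}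

/-- The contribution of the position `t` to the sign and the monomial of the border strip that starts
at `(k₀, s₀)` and ends at `(k₀, s₀ + 1)`. -/
noncomputable def stripWeight (lam' : Fin (m + 1) → YoungDiagram) (k₀ : Fin (m + 1)) (s₀ : ℤ)
    (t : Fin (m + 1) × ℤ) : RatField m :=
  if IsPlus lam' t ∧ LtX (k₀, s₀) t then
    (if LtX t (k₀, s₀ + 1) then -(posMono t / posMono (k₀, s₀)) else ratQ m) else 1

theorem posMono_div_ne_zero (p p' : Fin (m + 1) × ℤ) : posMono p / posMono p' ≠ 0 :=
  div_ne_zero (posMono_ne_zero _) (posMono_ne_zero _)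

/-- The quotients that occur in the factors of a position, in terms of `Q(t) / Q(k₀, s₀)` and `q`. -/
theorem posMono_quotients (k₀ : Fin (m + 1)) (s₀ : ℤ) (t : Fin (m + 1) × ℤ) :
    posMono t / posMono (k₀, s₀ + 1) = posMono t / posMono (k₀, s₀) / ratQ m ∧
    posMono (k₀, s₀) / posMono t = (posMono t / posMono (k₀, s₀))⁻¹ ∧
    posMono (k₀, s₀ + 1) / posMono t = ratQ m / (posMono t / posMono (k₀, s₀)) := by
  have h : posMono (k₀, s₀ + 1) = ratQ m * posMono (k₀, s₀) := by
    rw [posMono, posMono, zpow_add_one₀ ratQ_ne_zero]; ring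
  have h0 := posMono_ne_zero t
  have h1 := posMono_ne_zero (k₀, s₀)
  have h2 := ratQ_ne_zero (m := m)
  rw [h]
  refine ⟨?_, ?_, ?_⟩ <;> field_simp

/-- In a class to the right, the factors in the two orders differ by a telescoping quotient and a
monomial. Where the two orders disagree, `1 - x` stands on one side and `1 - x⁻¹` on the other. -/
theorem cross_right {k : Fin (m + 1)} (hk : k₀ < k) (s : ℤ) :
    crossBefore (RingHom.id (RatField m)) 1 LtY (IsPlus lam') (k₀, s₀) (k₀, s₀ + 1) (k, s) *
      crossAfter (RingHom.id (RatField m)) 1 LtX (IsPlus lam') (k₀, s₀) (k₀, s₀ + 1) (k, s) *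
      (if s ≤ s₀ then 1 - ratQ m ^ (s - s₀ - 1) * (ratC k / ratC k₀) else 1) =
    crossBefore (RingHom.id (RatField m)) 1 LtX (IsPlus lam') (k₀, s₀) (k₀, s₀ + 1) (k, s) *
      crossAfter (RingHom.id (RatField m)) 1 LtY (IsPlus lam') (k₀, s₀) (k₀, s₀ + 1) (k, s) *
      (if s + 1 ≤ s₀ then 1 - ratQ m ^ (s + 1 - s₀ - 1) * (ratC k / ratC k₀) else 1) *
      (stripWeight lam' k₀ s₀ (k, s) * (if slope (lam' k) s = 1 then (ratQ m)⁻¹ else 1)) := by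
  have hne : ∀ s' : ℤ, (k, s) ≠ (k₀, s') := fun s' h => hk.ne' (Prod.mk.inj h).1
  obtain ⟨e1, e2, e3⟩ := posMono_quotients k₀ s₀ (k, s)
  set y := posMono (k, s) / posMono (k₀, s₀) with hy
  have hy0 : y ≠ 0 := posMono_div_ne_zero _ _
  have hq := ratQ_ne_zero (m := m)
  have hyq : ratQ m ^ (s + 1 - s₀ - 1) * (ratC k / ratC k₀) = y := by
    rw [hy, posMono_div]; congr 2; ring
  have hyq' : ratQ m ^ (s - s₀ - 1) * (ratC k / ratC k₀) = y / ratQ m := by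
    rw [← hyq, show s + 1 - s₀ - 1 = s - s₀ - 1 + 1 by ring, zpow_add_one₀ hq]
    field_simp
  have y1 : LtY (k₀, s₀) (k, s) := Or.inl hk
  have y2 : LtY (k₀, s₀ + 1) (k, s) := Or.inl hk
  have y3 : ¬ LtY (k, s) (k₀, s₀) := y1.asymm
  have y4 : ¬ LtY (k, s) (k₀, s₀ + 1) := y2.asymm
  have x1 : LtX (k₀, s₀) (k, s) ↔ s₀ ≤ s := by simp only [LtX]; omega
  have x2 : LtX (k₀, s₀ + 1) (k, s) ↔ s₀ + 1 ≤ s := by simp only [LtX]; omega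
  have x3 : LtX (k, s) (k₀, s₀) ↔ s < s₀ := by simp only [LtX]; omega
  have x4 : LtX (k, s) (k₀, s₀ + 1) ↔ s < s₀ + 1 := by simp only [LtX]; omega
  have hplus : IsPlus lam' (k, s) ↔ slope (lam' k) s = 1 := Iff.rfl
  simp only [crossBefore, crossAfter, facIf, stripWeight, hne, ne_eq, not_false_eq_true, true_and,
    y1, y2, y3, y4, x1, x2, x3, x4, false_and, if_false, hplus, e1, e2, e3, hyq, hyq',
    RingHom.id_apply, one_mul, and_self, ← hy]
  by_cases hs : slope (lam' k) s = 1
  · rcases lt_trichotomy s s₀ with h | h | h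
    · simp only [hs, not_true_eq_false, if_false, if_true, and_true, and_false,
        show ¬ s₀ ≤ s by omega, show s ≤ s₀ by omega, show s < s₀ by omega,
        show s < s₀ + 1 by omega, show s + 1 ≤ s₀ by omega]
      field_simp
      ring
    · simp only [hs, not_true_eq_false, if_false, if_true, and_true, and_false,
        show s₀ ≤ s by omega, show s ≤ s₀ by omega, show ¬ s < s₀ by omega,
        show s < s₀ + 1 by omega, show ¬ s + 1 ≤ s₀ by omega]
      field_simp
      ring
    · simp only [hs, not_true_eq_false, if_false, if_true, and_true, and_false,
        show s₀ ≤ s by omega, show ¬ s ≤ s₀ by omega, show ¬ s < s₀ by omega,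
        show ¬ s < s₀ + 1 by omega, show ¬ s + 1 ≤ s₀ by omega]
      field_simp
  · rcases lt_trichotomy s s₀ with h | h | h
    · simp only [hs, not_false_eq_true, if_false, if_true, and_true, and_false,
        show ¬ s₀ ≤ s by omega, show s ≤ s₀ by omega, show ¬ s₀ + 1 ≤ s by omega,
        show s + 1 ≤ s₀ by omega]
      ring
    · simp only [hs, not_false_eq_true, if_false, if_true, and_true, and_false,
        show s₀ ≤ s by omega, show s ≤ s₀ by omega, show ¬ s₀ + 1 ≤ s by omega,
        show ¬ s + 1 ≤ s₀ by omega]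
      ring
    · simp only [hs, not_false_eq_true, if_false, if_true, and_true, and_false,
        show s₀ ≤ s by omega, show ¬ s ≤ s₀ by omega, show s₀ + 1 ≤ s by omega,
        show ¬ s + 1 ≤ s₀ by omega]
      ring

/-- In a class to the left, the factors in the two orders differ by a telescoping quotient and a
monomial. -/
theorem cross_left {k : Fin (m + 1)} (hk : k < k₀) (s : ℤ) :
    crossBefore (RingHom.id (RatField m)) 1 LtY (IsPlus lam') (k₀, s₀) (k₀, s₀ + 1) (k, s) *
      crossAfter (RingHom.id (RatField m)) 1 LtX (IsPlus lam') (k₀, s₀) (k₀, s₀ + 1) (k, s) *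
      (if s₀ + 2 ≤ s + 1 then 1 - ratQ m ^ (s + 1 - s₀ - 1) * (ratC k / ratC k₀) else 1) =
    crossBefore (RingHom.id (RatField m)) 1 LtX (IsPlus lam') (k₀, s₀) (k₀, s₀ + 1) (k, s) *
      crossAfter (RingHom.id (RatField m)) 1 LtY (IsPlus lam') (k₀, s₀) (k₀, s₀ + 1) (k, s) *
      (if s₀ + 2 ≤ s then 1 - ratQ m ^ (s - s₀ - 1) * (ratC k / ratC k₀) else 1) *
      stripWeight lam' k₀ s₀ (k, s) := by
  have hne : ∀ s' : ℤ, (k, s) ≠ (k₀, s') := fun s' h => hk.ne (Prod.mk.inj h).1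
  obtain ⟨e1, e2, e3⟩ := posMono_quotients k₀ s₀ (k, s)
  set y := posMono (k, s) / posMono (k₀, s₀) with hy
  have hy0 : y ≠ 0 := posMono_div_ne_zero _ _
  have hq := ratQ_ne_zero (m := m)
  have hyq : ratQ m ^ (s + 1 - s₀ - 1) * (ratC k / ratC k₀) = y := by
    rw [hy, posMono_div]; congr 2; ring
  have hyq' : ratQ m ^ (s - s₀ - 1) * (ratC k / ratC k₀) = y / ratQ m := by
    rw [← hyq, show s + 1 - s₀ - 1 = s - s₀ - 1 + 1 by ring, zpow_add_one₀ hq]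
    field_simp
  have y3 : LtY (k, s) (k₀, s₀) := Or.inl hk
  have y4 : LtY (k, s) (k₀, s₀ + 1) := Or.inl hk
  have y1 : ¬ LtY (k₀, s₀) (k, s) := y3.asymm
  have y2 : ¬ LtY (k₀, s₀ + 1) (k, s) := y4.asymm
  have x1 : LtX (k₀, s₀) (k, s) ↔ s₀ < s := by simp only [LtX]; omega
  have x2 : LtX (k₀, s₀ + 1) (k, s) ↔ s₀ + 1 < s := by simp only [LtX]; omega
  have x3 : LtX (k, s) (k₀, s₀) ↔ s ≤ s₀ := by simp only [LtX]; omega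
  have x4 : LtX (k, s) (k₀, s₀ + 1) ↔ s ≤ s₀ + 1 := by simp only [LtX]; omega
  have hplus : IsPlus lam' (k, s) ↔ slope (lam' k) s = 1 := Iff.rfl
  simp only [crossBefore, crossAfter, facIf, stripWeight, hne, ne_eq, not_false_eq_true, true_and,
    y1, y2, y3, y4, x1, x2, x3, x4, false_and, if_false, hplus, e1, e2, e3, hyq, hyq',
    RingHom.id_apply, one_mul, and_self, ← hy]
  by_cases hs : slope (lam' k) s = 1
  · rcases lt_trichotomy s (s₀ + 1) with h | h | h
    · simp only [hs, not_true_eq_false, if_false, if_true, and_true, and_false,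
        show ¬ s₀ < s by omega, show s ≤ s₀ by omega, show s ≤ s₀ + 1 by omega,
        show ¬ s₀ + 2 ≤ s + 1 by omega, show ¬ s₀ + 2 ≤ s by omega]
      ring
    · simp only [hs, not_true_eq_false, if_false, if_true, and_true, and_false,
        show s₀ < s by omega, show ¬ s ≤ s₀ by omega, show s ≤ s₀ + 1 by omega,
        show s₀ + 2 ≤ s + 1 by omega, show ¬ s₀ + 2 ≤ s by omega]
      field_simp
      ring
    · simp only [hs, not_true_eq_false, if_false, if_true, and_true, and_false,
        show s₀ < s by omega, show ¬ s ≤ s₀ by omega, show ¬ s ≤ s₀ + 1 by omega,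
        show s₀ + 2 ≤ s + 1 by omega, show s₀ + 2 ≤ s by omega]
      field_simp
      ring
  · rcases lt_trichotomy s (s₀ + 1) with h | h | h
    · simp only [hs, not_false_eq_true, if_false, and_true, and_false,
        show ¬ s₀ < s by omega, show ¬ s₀ + 1 < s by omega,
        show ¬ s₀ + 2 ≤ s + 1 by omega, show ¬ s₀ + 2 ≤ s by omega]
      ring
    · simp only [hs, not_false_eq_true, if_false, if_true, and_true, and_false,
        show s₀ < s by omega, show ¬ s₀ + 1 < s by omega,
        show s₀ + 2 ≤ s + 1 by omega, show ¬ s₀ + 2 ≤ s by omega]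
      ring
    · simp only [hs, not_false_eq_true, if_false, if_true, and_true, and_false,
        show s₀ < s by omega, show s₀ + 1 < s by omega,
        show s₀ + 2 ≤ s + 1 by omega, show s₀ + 2 ≤ s by omega]
      ring

/-- In the class of the added box the two orders agree. -/
theorem cross_self (s : ℤ) :
    crossBefore (RingHom.id (RatField m)) 1 LtY (IsPlus lam') (k₀, s₀) (k₀, s₀ + 1) (k₀, s) =
    crossBefore (RingHom.id (RatField m)) 1 LtX (IsPlus lam') (k₀, s₀) (k₀, s₀ + 1) (k₀, s) ∧
    crossAfter (RingHom.id (RatField m)) 1 LtY (IsPlus lam') (k₀, s₀) (k₀, s₀ + 1) (k₀, s) =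
    crossAfter (RingHom.id (RatField m)) 1 LtX (IsPlus lam') (k₀, s₀) (k₀, s₀ + 1) (k₀, s) := by
  have h : ∀ s s' : ℤ, LtY (k₀, s) (k₀, s') ↔ LtX (k₀, s) (k₀, s') := by
    intro s s'; simp [LtX, LtY]
  simp only [crossBefore, crossAfter, h, and_self]

theorem stripWeight_self (s : ℤ) :
    stripWeight lam' k₀ s₀ (k₀, s) =
      if s₀ + 1 ≤ s then (if slope (lam' k₀) s = 1 then ratQ m else 1) else 1 := by
  have x1 : LtX (k₀, s₀) (k₀, s) ↔ s₀ + 1 ≤ s := by simp only [LtX]; omega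
  have x2 : LtX (k₀, s) (k₀, s₀ + 1) ↔ s < s₀ + 1 := by simp only [LtX]; omega
  simp only [stripWeight, x1, x2, IsPlus]
  split_ifs <;> first | rfl | omega | tauto

/-- A product telescopes even where the factors `T` vanish. -/
theorem prod_telescope {K : Type*} [CommRing K] (F G T : ℤ → K)
    (h : ∀ s, F s * T s = G s * T (s + 1)) {a b : ℤ} (hab : a ≤ b) :
    (∏ s ∈ Finset.Ico a b, F s) * T a = (∏ s ∈ Finset.Ico a b, G s) * T b := by
  induction b, hab using Int.leInduction with
  | base => simp
  | succ b hb ih =>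
    have e : Finset.Ico a (b + 1) = insert b (Finset.Ico a b) := by ext; simp; omega
    rw [e, Finset.prod_insert (by simp), Finset.prod_insert (by simp)]
    linear_combination F b * ih + (∏ s ∈ Finset.Ico a b, G s) * h b

/-- The factor of a new box of content `s₀ + 1` of the partition with index `k₀` in the normalization
and in the change of variables. -/
noncomputable def boxWeight (lam' : Fin (m + 1) → YoungDiagram) (k₀ : Fin (m + 1)) (s₀ : ℤ) :
    RatField m :=
  ratQ m ^ rk (lam' k₀) (s₀ + 1) *
    ∏ k ∈ Finset.univ.filter (k₀ < ·), -(ratQ m ^ (-s₀ - 1) * (ratC k / ratC k₀))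

/-- The factors of a class to the right, including those of the ends of the window. -/
theorem class_right {k : Fin (m + 1)} (hk : k₀ < k) {S : ℕ} (hcard : (lam' k).card ≤ S)
    (hs : -(S : ℤ) ≤ s₀) (hs' : s₀ + 1 < S) :
    (∏ s ∈ Finset.Ico (-(S : ℤ)) S,
      (crossBefore (RingHom.id (RatField m)) 1 LtY (IsPlus lam') (k₀, s₀) (k₀, s₀ + 1) (k, s) *
      crossAfter (RingHom.id (RatField m)) 1 LtX (IsPlus lam') (k₀, s₀) (k₀, s₀ + 1) (k, s))) *
      (facIf (RingHom.id (RatField m)) 1 True (k₀, s₀) (k, (S : ℤ) - 1) *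
        facIf (RingHom.id (RatField m)) 1 True (k, -(S : ℤ)) (k₀, s₀ + 1)) *
      (-(ratQ m ^ (-s₀ - 1) * (ratC k / ratC k₀))) =
    (∏ s ∈ Finset.Ico (-(S : ℤ)) S,
      (crossBefore (RingHom.id (RatField m)) 1 LtX (IsPlus lam') (k₀, s₀) (k₀, s₀ + 1) (k, s) *
      crossAfter (RingHom.id (RatField m)) 1 LtY (IsPlus lam') (k₀, s₀) (k₀, s₀ + 1) (k, s))) *
      (facIf (RingHom.id (RatField m)) 1 (k₀ ≤ k) (k₀, s₀) (k, (S : ℤ) - 1) *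
        facIf (RingHom.id (RatField m)) 1 (k ≤ k₀) (k, -(S : ℤ)) (k₀, s₀ + 1)) *
      ∏ s ∈ Finset.Ico (-(S : ℤ)) S, stripWeight lam' k₀ s₀ (k, s) := by
  have hq := ratQ_ne_zero (m := m)
  have hle : -(S : ℤ) ≤ S := by omega
  have key := prod_telescope _
    (fun s => crossBefore (RingHom.id (RatField m)) 1 LtX (IsPlus lam') (k₀, s₀) (k₀, s₀ + 1) (k, s) *
      crossAfter (RingHom.id (RatField m)) 1 LtY (IsPlus lam') (k₀, s₀) (k₀, s₀ + 1) (k, s) *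
      (stripWeight lam' k₀ s₀ (k, s) * (if slope (lam' k) s = 1 then (ratQ m)⁻¹ else 1)))
    (fun s => if s ≤ s₀ then 1 - ratQ m ^ (s - s₀ - 1) * (ratC k / ratC k₀) else 1)
    (fun s => (cross_right (lam' := lam') (s₀ := s₀) hk s).trans (by ring)) hle
  have hr1 : rk (lam' k) S = 0 := rk_of_card_le (by omega)
  -- The window contains `S` positions of slope `+1`.
  have hr2 : rk (lam' k) (-(S : ℤ)) = S := by
    have := rk_of_le_neg_card (μ := lam' k) (t := -(S : ℤ)) (by omega)
    omega
  simp only [Finset.prod_mul_distrib, prod_slope _ _ hle, hr1, hr2, Nat.sub_zero,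
    if_pos hs, if_neg (show ¬ (S : ℤ) ≤ s₀ by omega), mul_one] at key ⊢
  rw [facIf_true _ _ trivial, facIf_true _ _ trivial, facIf_true _ _ hk.le,
    facIf_false _ _ (not_le.2 hk), RingHom.id_apply, RingHom.id_apply, posMono_div, posMono_div]
  set u := ratC k / ratC k₀ with hu
  have hu0 : u ≠ 0 := div_ne_zero (ratC_ne_zero _) (ratC_ne_zero _)
  have hu' : ratC k₀ / ratC k = u⁻¹ := by rw [hu, inv_div]
  have hz : ratQ m ^ (s₀ + 1 - -(S : ℤ)) * ratQ m ^ (-s₀ - 1) = ratQ m ^ S := by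
    rw [← zpow_add₀ hq, ← zpow_natCast]; congr 1; ring
  have hz' : ratQ m ^ (-(S : ℤ) - s₀ - 1) * ratQ m ^ S = ratQ m ^ (-s₀ - 1) := by
    rw [← zpow_natCast, ← zpow_add₀ hq]; congr 1; ring
  have hz2 : (ratQ m)⁻¹ ^ S * ratQ m ^ S = 1 := by
    rw [← mul_pow, inv_mul_cancel₀ hq, one_pow]
  have huu : u⁻¹ * u = 1 := inv_mul_cancel₀ hu0
  rw [hu']
  generalize (∏ s ∈ Finset.Ico (-(S : ℤ)) S, stripWeight lam' k₀ s₀ (k, s)) = V at key ⊢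
  generalize (∏ s ∈ Finset.Ico (-(S : ℤ)) S, crossBefore (RingHom.id (RatField m)) 1 LtY
    (IsPlus lam') (k₀, s₀) (k₀, s₀ + 1) (k, s)) = A₁ at key ⊢
  generalize (∏ s ∈ Finset.Ico (-(S : ℤ)) S, crossAfter (RingHom.id (RatField m)) 1 LtX
    (IsPlus lam') (k₀, s₀) (k₀, s₀ + 1) (k, s)) = A₂ at key ⊢
  generalize (∏ s ∈ Finset.Ico (-(S : ℤ)) S, crossBefore (RingHom.id (RatField m)) 1 LtX
    (IsPlus lam') (k₀, s₀) (k₀, s₀ + 1) (k, s)) = B₁ at key ⊢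
  generalize (∏ s ∈ Finset.Ico (-(S : ℤ)) S, crossAfter (RingHom.id (RatField m)) 1 LtY
    (IsPlus lam') (k₀, s₀) (k₀, s₀ + 1) (k, s)) = B₂ at key ⊢
  have key3 : (1 - ratQ m ^ (s₀ + 1 - -(S : ℤ)) * u⁻¹) * (-(ratQ m ^ (-s₀ - 1) * u)) =
      (1 - ratQ m ^ (-(S : ℤ) - s₀ - 1) * u) * ratQ m ^ S := by
    linear_combination hz * (u⁻¹ * u) + ratQ m ^ S * huu + u * hz'
  -- The factor of the left end in the order of the orbifold, which has no counterpart in the other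
  -- order, compensates the boundary term of the telescoping product.
  linear_combination A₁ * A₂ * (1 - ratQ m ^ ((S : ℤ) - 1 - s₀) * u) * key3 +
    (1 - ratQ m ^ ((S : ℤ) - 1 - s₀) * u) * ratQ m ^ S * key +
    (1 - ratQ m ^ ((S : ℤ) - 1 - s₀) * u) * B₁ * B₂ * V * hz2

/-- The factors of a class to the left, including those of the ends of the window. -/
theorem class_left {k : Fin (m + 1)} (hk : k < k₀) {S : ℕ}
    (hs : -(S : ℤ) ≤ s₀) (hs' : s₀ + 1 < S) :
    (∏ s ∈ Finset.Ico (-(S : ℤ)) S,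
      (crossBefore (RingHom.id (RatField m)) 1 LtY (IsPlus lam') (k₀, s₀) (k₀, s₀ + 1) (k, s) *
      crossAfter (RingHom.id (RatField m)) 1 LtX (IsPlus lam') (k₀, s₀) (k₀, s₀ + 1) (k, s))) *
      (facIf (RingHom.id (RatField m)) 1 True (k₀, s₀) (k, (S : ℤ) - 1) *
        facIf (RingHom.id (RatField m)) 1 True (k, -(S : ℤ)) (k₀, s₀ + 1)) =
    (∏ s ∈ Finset.Ico (-(S : ℤ)) S,
      (crossBefore (RingHom.id (RatField m)) 1 LtX (IsPlus lam') (k₀, s₀) (k₀, s₀ + 1) (k, s) *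
      crossAfter (RingHom.id (RatField m)) 1 LtY (IsPlus lam') (k₀, s₀) (k₀, s₀ + 1) (k, s))) *
      (facIf (RingHom.id (RatField m)) 1 (k₀ ≤ k) (k₀, s₀) (k, (S : ℤ) - 1) *
        facIf (RingHom.id (RatField m)) 1 (k ≤ k₀) (k, -(S : ℤ)) (k₀, s₀ + 1)) *
      ∏ s ∈ Finset.Ico (-(S : ℤ)) S, stripWeight lam' k₀ s₀ (k, s) := by
  have key := prod_telescope
    (fun s => crossBefore (RingHom.id (RatField m)) 1 LtX (IsPlus lam') (k₀, s₀) (k₀, s₀ + 1) (k, s) *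
      crossAfter (RingHom.id (RatField m)) 1 LtY (IsPlus lam') (k₀, s₀) (k₀, s₀ + 1) (k, s) *
      stripWeight lam' k₀ s₀ (k, s)) _
    (fun s => if s₀ + 2 ≤ s then 1 - ratQ m ^ (s - s₀ - 1) * (ratC k / ratC k₀) else 1)
    (fun s => Eq.trans (by ring) (cross_left (lam' := lam') (s₀ := s₀) hk s).symm)
    (show -(S : ℤ) ≤ S by omega)
  rw [Finset.prod_mul_distrib, if_neg (by omega), if_pos (by omega), mul_one] at key
  rw [facIf_true _ _ trivial, facIf_true _ _ trivial, facIf_true _ _ hk.le,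
    facIf_false _ _ (not_le.2 hk), RingHom.id_apply, RingHom.id_apply, posMono_div, posMono_div,
    show (S : ℤ) - 1 - s₀ = S - s₀ - 1 by ring]
  linear_combination -(1 - 1 * (ratQ m ^ (s₀ + 1 - -(S : ℤ)) * (ratC k₀ / ratC k))) * key

theorem prod_stripWeight_self {S : ℕ} (hcard : (lam' k₀).card ≤ S)
    (hs : -(S : ℤ) ≤ s₀) (hs' : s₀ + 1 < S) :
    ∏ s ∈ Finset.Ico (-(S : ℤ)) S, stripWeight lam' k₀ s₀ (k₀, s) =
      ratQ m ^ rk (lam' k₀) (s₀ + 1) := by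
  have hr : rk (lam' k₀) S = 0 := rk_of_card_le (by omega)
  have h := prod_slope (lam' k₀) (ratQ m) (show s₀ + 1 ≤ (S : ℤ) by omega)
  rw [hr, Nat.sub_zero] at h
  rw [← h]
  simp only [stripWeight_self]
  rw [← Finset.prod_filter]
  refine Finset.prod_congr ?_ fun _ _ => rfl
  ext s
  simp only [Finset.mem_filter, Finset.mem_Ico]
  omega

/-- The two orders change the expectation in the same way when a box is added, up to the signed
monomials of the strip and of the box. -/
theorem step_comparison {S : ℕ} (hcard : ∀ k, (lam' k).card ≤ S)
    (hs : -(S : ℤ) ≤ s₀) (hs' : s₀ + 1 < S) :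
    stepNum LtY lam' k₀ s₀ S * stepDen LtX lam' (fun _ => True) (fun _ => True) k₀ s₀ S *
        boxWeight lam' k₀ s₀ =
      stepNum LtX lam' k₀ s₀ S * stepDen LtY lam' (fun k => k₀ ≤ k) (fun k => k ≤ k₀) k₀ s₀ S *
        ∏ t ∈ positions m S, stripWeight lam' k₀ s₀ t := by
  have hbox : boxWeight lam' k₀ s₀ = ∏ k, (if k₀ < k then
      -(ratQ m ^ (-s₀ - 1) * (ratC k / ratC k₀)) else
      if k = k₀ then ratQ m ^ rk (lam' k₀) (s₀ + 1) else 1) := by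
    have h1 : ratQ m ^ rk (lam' k₀) (s₀ + 1) =
        ∏ k, if k = k₀ then ratQ m ^ rk (lam' k₀) (s₀ + 1) else 1 := by
      rw [Finset.prod_ite_eq' Finset.univ k₀, if_pos (Finset.mem_univ _)]
    rw [boxWeight, Finset.prod_filter]
    nth_rewrite 1 [h1]
    rw [← Finset.prod_mul_distrib]
    refine Finset.prod_congr rfl fun k _ => ?_
    rcases lt_trichotomy k₀ k with hk | rfl | hk
    · simp only [hk, hk.ne', if_true, if_false, one_mul]
    · simp only [lt_irrefl, if_true, if_false, mul_one]
    · simp only [hk.asymm, hk.ne, if_false, mul_one]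
  have main : ∀ k : Fin (m + 1),
    (∏ s ∈ Finset.Ico (-(S : ℤ)) S,
      (crossBefore (RingHom.id (RatField m)) 1 LtY (IsPlus lam') (k₀, s₀) (k₀, s₀ + 1) (k, s) *
      crossAfter (RingHom.id (RatField m)) 1 LtX (IsPlus lam') (k₀, s₀) (k₀, s₀ + 1) (k, s))) *
      (facIf (RingHom.id (RatField m)) 1 True (k₀, s₀) (k, (S : ℤ) - 1) *
        facIf (RingHom.id (RatField m)) 1 True (k, -(S : ℤ)) (k₀, s₀ + 1)) *
      (if k₀ < k then -(ratQ m ^ (-s₀ - 1) * (ratC k / ratC k₀)) else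
        if k = k₀ then ratQ m ^ rk (lam' k₀) (s₀ + 1) else 1) =
    (∏ s ∈ Finset.Ico (-(S : ℤ)) S,
      (crossBefore (RingHom.id (RatField m)) 1 LtX (IsPlus lam') (k₀, s₀) (k₀, s₀ + 1) (k, s) *
      crossAfter (RingHom.id (RatField m)) 1 LtY (IsPlus lam') (k₀, s₀) (k₀, s₀ + 1) (k, s))) *
      (facIf (RingHom.id (RatField m)) 1 (k₀ ≤ k) (k₀, s₀) (k, (S : ℤ) - 1) *
        facIf (RingHom.id (RatField m)) 1 (k ≤ k₀) (k, -(S : ℤ)) (k₀, s₀ + 1)) *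
      ∏ s ∈ Finset.Ico (-(S : ℤ)) S, stripWeight lam' k₀ s₀ (k, s) := by
    intro k
    rcases lt_trichotomy k₀ k with hk | rfl | hk
    · rw [if_pos hk]
      exact class_right hk (hcard k) hs hs'
    · rw [if_neg (lt_irrefl _), if_pos rfl, prod_stripWeight_self (hcard _) hs hs',
        facIf_true _ _ le_rfl, facIf_true _ _ le_rfl, facIf_true _ _ trivial,
        facIf_true _ _ trivial]
      simp only [(cross_self _).1, (cross_self _).2]
    · rw [if_neg hk.asymm, if_neg hk.ne, mul_one]
      exact class_left hk hs hs'
  have h := Finset.prod_congr (rfl : (Finset.univ : Finset (Fin (m + 1))) = _) fun k _ => main k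
  simp only [Finset.prod_mul_distrib] at h
  rw [← hbox] at h
  simp only [stepNum, stepDen, boundaryProd, positions, Finset.prod_product,
    Finset.prod_mul_distrib]
  linear_combination (1 - ratQ m) * h

end Comparison

/-! ### Nonvanishing of the factors -/

section NonVanishing

variable {m : ℕ}

theorem sum_colorInd (n : ℕ) [NeZero n] (t : ℤ) : ∑ i, colorInd n i t = 1 := by
  simp [colorInd]

theorem frakq_injective (n : ℕ) [NeZero n] : Function.Injective (frakq n) := by
  have hdeg : ∀ t : ℤ, ∑ i, (∑ s ∈ Finset.Ioc 0 t, colorInd n i s -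
      ∑ s ∈ Finset.Ioc t 0, colorInd n i s) = t := by
    intro t
    rw [Finset.sum_sub_distrib, Finset.sum_comm, Finset.sum_comm (t := Finset.Ioc t 0)]
    simp only [sum_colorInd, Finset.sum_const, Int.card_Ioc, nsmul_eq_mul, mul_one]
    omega
  intro s t h
  rw [frakq_eq_mono, frakq_eq_mono, mono, mono] at h
  have h2 := congrArg HahnSeries.order h
  rw [HahnSeries.order_single one_ne_zero, HahnSeries.order_single one_ne_zero] at h2
  rw [← hdeg s, ← hdeg t]
  exact congrArg (fun e : Fin n → ℤ => ∑ i, e i) (toLex.injective h2)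

/-- The position `ns + k` in the slope sequence of the diagram that belongs to `(k, s)`. -/
def place (p : Fin (m + 1) × ℤ) : ℤ := ((m + 1 : ℕ) : ℤ) * p.2 + (p.1 : ℕ)

theorem color_place (p : Fin (m + 1) × ℤ) : color (m + 1) (place p) = p.1 := color_mul_add _ _

theorem place_injective : Function.Injective (place (m := m)) := by
  intro p p' h
  have h1 : p.1 = p'.1 := by rw [← color_place p, h, color_place]
  have h2 : p.2 = p'.2 := by
    rw [place, place, h1, add_left_inj] at h
    exact mul_left_cancel₀ (by omega) h
  exact Prod.ext h1 h2

theorem exists_place (t : ℤ) : ∃ p : Fin (m + 1) × ℤ, place p = t := by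
  refine ⟨(color (m + 1) t, t / (m + 1 : ℕ)), ?_⟩
  have h1 := Int.emod_nonneg t (show ((m + 1 : ℕ) : ℤ) ≠ 0 by omega)
  have h2 := Int.mul_ediv_add_emod t ((m + 1 : ℕ) : ℤ)
  simp only [place, color]
  omega

theorem place_lt {p p' : Fin (m + 1) × ℤ} : place p < place p' ↔ LtX p p' := by
  have key : ∀ p p' : Fin (m + 1) × ℤ, LtX p p' → place p < place p' := by
    rintro ⟨k, s⟩ ⟨k', s'⟩ (h | ⟨h1, h2⟩)
    · have h' : s + 1 ≤ s' := h
      have := k.2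
      have := mul_le_mul_of_nonneg_left h' (show (0 : ℤ) ≤ (m + 1 : ℕ) by omega)
      rw [mul_add, mul_one] at this
      simp only [place]
      omega
    · have h1' : s = s' := h1
      have h2' : k < k' := h2
      subst h1'
      simp only [place]
      omega
  refine ⟨fun h => ?_, key p p'⟩
  by_contra hc
  rcases eq_or_ne p p' with rfl | hne
  · exact lt_irrefl _ h
  · have : LtX p' p := by
      have hne' : ¬ (p.1 = p'.1 ∧ p.2 = p'.2) := fun hh => hne (Prod.ext hh.1 hh.2)
      unfold LtX at hc ⊢
      omega
    exact absurd (key _ _ this) (not_lt.2 h.le)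

/-- The monomials of the positions are pairwise different. -/
theorem posMono_injective : Function.Injective (posMono (m := m)) := by
  intro p p' h
  have h1 := congrArg (expandX m) h
  rw [expandX_posMono, expandX_posMono] at h1
  exact place_injective (frakq_injective _ h1)

theorem facIf_ne_zero {c : Prop} {p p' : Fin (m + 1) × ℤ} (h : c → p ≠ p') :
    facIf (RingHom.id (RatField m)) 1 c p p' ≠ 0 := by
  by_cases hc : c
  · rw [facIf_true _ _ hc, RingHom.id_apply, one_mul, sub_ne_zero, Ne,
      eq_div_iff (posMono_ne_zero _), one_mul]
    exact fun he => h hc (posMono_injective he)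
  · rw [facIf_false _ _ hc]
    exact one_ne_zero

theorem stepDen_ne_zero {R : Fin (m + 1) × ℤ → Fin (m + 1) × ℤ → Prop} {Kr Kl : Fin (m + 1) → Prop}
    {lam' : Fin (m + 1) → YoungDiagram} {k₀ : Fin (m + 1)} {s₀ : ℤ} {S : ℕ}
    (hs : -(S : ℤ) ≤ s₀) (hs' : s₀ + 1 < S) : stepDen R lam' Kr Kl k₀ s₀ S ≠ 0 := by
  refine mul_ne_zero (Finset.prod_ne_zero_iff.2 fun t _ => mul_ne_zero ?_ ?_)
    (Finset.prod_ne_zero_iff.2 fun k _ => mul_ne_zero ?_ ?_)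
  · exact facIf_ne_zero fun h => h.1.2.symm
  · exact facIf_ne_zero fun h => h.1.1
  · refine facIf_ne_zero fun _ h => ?_
    have := congrArg Prod.snd h
    dsimp only at this
    omega
  · refine facIf_ne_zero fun _ h => ?_
    have := congrArg Prod.snd h
    dsimp only at this
    omega

end NonVanishing

/-! ### The monomial of a border strip -/

section StripMonomial

variable {m : ℕ}

open Classical in
/-- Summation by parts for the monomial of a border strip: `𝔮_p / 𝔮_a` is the product of the variables
between `a` and `p`. -/
theorem prod_strip (ν : YoungDiagram) {a b : ℤ} (hab : a ≤ b) :
    ∏ t ∈ Finset.Ioc a b, qvar (m + 1) (color (m + 1) t) ^ rk ν t =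
      (∏ p ∈ Finset.Ico a b,
        if slope ν p = 1 then frakq (m + 1) p / frakq (m + 1) a else 1) *
        (frakq (m + 1) b / frakq (m + 1) a) ^ rk ν b := by
  have ha := frakq_ne_zero (m + 1) a
  induction b, hab using Int.leInduction with
  | base => simp [div_self ha]
  | succ b hb ih =>
    have e1 : Finset.Ioc a (b + 1) = insert (b + 1) (Finset.Ioc a b) := by ext; simp; omega
    have e2 : Finset.Ico a (b + 1) = insert b (Finset.Ico a b) := by ext; simp; omega
    have hf : frakq (m + 1) (b + 1) =
        qvar (m + 1) (color (m + 1) (b + 1)) * frakq (m + 1) b := by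
      rw [frakq_rec, add_sub_cancel_right]
    rw [e1, e2, Finset.prod_insert (by simp), Finset.prod_insert (by simp), ih, hf, mul_div_assoc,
      mul_pow]
    by_cases hs : slope ν b = 1
    · rw [if_pos hs, rk_of_slope_one hs, pow_succ]
      ring
    · rw [if_neg hs, rk_of_slope_ne hs]
      ring

theorem prod_positions_place {M : Type*} [CommMonoid M] (F : ℤ → M) (S : ℕ) :
    ∏ t ∈ positions m S, F (place t) =
      ∏ p ∈ Finset.Ico (-(((m + 1) * S : ℕ) : ℤ)) ((m + 1) * S : ℕ), F p := by
  have hneg : -(((m + 1) * S : ℕ) : ℤ) = place ((0 : Fin (m + 1)), -(S : ℤ)) := by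
    simp [place]
  have hpos : (((m + 1) * S : ℕ) : ℤ) = place ((0 : Fin (m + 1)), (S : ℤ)) := by
    simp [place]
  have hmem : ∀ p, p ∈ positions m S ↔
      place p ∈ Finset.Ico (-(((m + 1) * S : ℕ) : ℤ)) ((m + 1) * S : ℕ) := by
    rintro ⟨k, s⟩
    have h0 : (0 : Fin (m + 1)) ≤ k := Fin.zero_le k
    rw [mem_positions, Finset.mem_Ico, hneg, hpos, place_lt,
      ← not_lt (b := place ((0 : Fin (m + 1)), -(S : ℤ))), place_lt]
    simp only [LtX]
    omega
  refine Finset.prod_nbij place (fun p hp => (hmem p).1 hp) (place_injective.injOn) ?_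
    (fun _ _ => rfl)
  intro t ht
  obtain ⟨p, rfl⟩ := exists_place (m := m) t
  exact ⟨p, (hmem p).2 ht, rfl⟩

open Classical in
/-- The sign and the monomial of a border strip are a product over the positions of slope `+1` to
the right of its start. -/
theorem prod_stripWeight {lam' : Fin (m + 1) → YoungDiagram} {ν μ : YoungDiagram}
    (hν : IsQuotient (m + 1) lam' ν) {k₀ : Fin (m + 1)} {s₀ : ℤ} {S : ℕ}
    (h : RimStep (place (k₀, s₀)) (place (k₀, s₀) + (m + 1 : ℕ)) ν μ)
    (hS : ν.card ≤ (m + 1) * S) (hs : -(S : ℤ) ≤ s₀) (hs' : s₀ + 1 < S) :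
    (-1) ^ stripHeight ν μ * ∏ t ∈ Finset.Ioc (place (k₀, s₀)) (place (k₀, s₀) + (m + 1 : ℕ)),
        qvar (m + 1) (color (m + 1) t) ^ rk ν t =
      expandX m (∏ t ∈ positions m S, stripWeight lam' k₀ s₀ t) := by
  set a := place (k₀, s₀) with ha
  have hb : place (k₀, s₀ + 1) = a + (m + 1 : ℕ) := by
    simp only [ha, place]; ring
  have hle : a + 1 ≤ a + (m + 1 : ℕ) := by omega
  have haS : -(((m + 1) * S : ℕ) : ℤ) ≤ a := by
    have := mul_le_mul_of_nonneg_left hs (show (0 : ℤ) ≤ (m + 1 : ℕ) by omega)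
    simp only [ha, place]
    push_cast at this ⊢
    linarith [Int.natCast_nonneg (k₀ : ℕ)]
  have hbS : a + (m + 1 : ℕ) ≤ ((m + 1) * S : ℕ) := by
    have h1 : s₀ + 2 ≤ S := by omega
    have := mul_le_mul_of_nonneg_left h1 (show (0 : ℤ) ≤ (m + 1 : ℕ) by omega)
    have := k₀.2
    simp only [ha, place]
    push_cast at *
    linarith
  have hw : ∀ t, expandX m (stripWeight lam' k₀ s₀ t) =
      if slope ν (place t) = 1 ∧ a < place t then
        (if place t < a + (m + 1 : ℕ) then -(frakq (m + 1) (place t) / frakq (m + 1) a)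
          else qtot (m + 1)) else 1 := by
    intro t
    have hp : IsPlus lam' t ↔ slope ν (place t) = 1 := by
      rw [place, slope_of_isQuotient hν]; rfl
    rw [stripWeight, ← hb]
    simp only [ha, place_lt, ← hp]
    split_ifs
    · rw [map_neg, map_div₀, expandX_posMono, expandX_posMono]
      rfl
    · exact expandX_ratQ
    · exact map_one _
  have hr : rk ν (((m + 1) * S : ℕ) : ℤ) = 0 := rk_of_card_le (by exact_mod_cast hS)
  have hsign := prod_slope ν (-1 : LaurentField (m + 1)) hle
  have hq := prod_slope ν (qtot (m + 1)) hbS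
  rw [hr, Nat.sub_zero] at hq
  have hht : stripHeight ν μ = rk ν (a + 1) - rk ν (a + (m + 1 : ℕ)) := by
    have := h.stripHeight_add (by omega)
    omega
  have e0 : Finset.Ico a (a + (m + 1 : ℕ)) = insert a (Finset.Ico (a + 1) (a + (m + 1 : ℕ))) := by
    ext; simp; omega
  rw [map_prod, Finset.prod_congr rfl fun t _ => hw t,
    prod_positions_place (fun p => if slope ν p = 1 ∧ a < p then
        (if p < a + (m + 1 : ℕ) then -(frakq (m + 1) p / frakq (m + 1) a)
          else qtot (m + 1)) else 1),
    prod_strip ν (by omega), hht, ← hsign, frakq_add_card,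
    mul_div_cancel_right₀ _ (frakq_ne_zero _ _), ← hq, e0, Finset.prod_insert (by simp),
    div_self (frakq_ne_zero _ _), ite_self, one_mul, ← mul_assoc, ← Finset.prod_mul_distrib]
  have e1 : Finset.Ico (-(((m + 1) * S : ℕ) : ℤ)) (((m + 1) * S : ℕ) : ℤ) =
      Finset.Ico (-(((m + 1) * S : ℕ) : ℤ)) (a + 1) ∪
        (Finset.Ico (a + 1) (a + (m + 1 : ℕ)) ∪
          Finset.Ico (a + (m + 1 : ℕ)) (((m + 1) * S : ℕ) : ℤ)) := by
    ext p
    simp only [Finset.mem_union, Finset.mem_Ico]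
    omega
  have d1 : Disjoint (Finset.Ico (a + 1) (a + (m + 1 : ℕ)))
      (Finset.Ico (a + (m + 1 : ℕ)) (((m + 1) * S : ℕ) : ℤ)) := by
    rw [Finset.disjoint_left]; intro p; simp only [Finset.mem_Ico]; omega
  have d2 : Disjoint (Finset.Ico (-(((m + 1) * S : ℕ) : ℤ)) (a + 1))
      (Finset.Ico (a + 1) (a + (m + 1 : ℕ)) ∪
          Finset.Ico (a + (m + 1 : ℕ)) (((m + 1) * S : ℕ) : ℤ)) := by
    rw [Finset.disjoint_left]; intro p; simp only [Finset.mem_union, Finset.mem_Ico]; omega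
  rw [e1, Finset.prod_union d2, Finset.prod_union d1]
  rw [Finset.prod_eq_one (s := Finset.Ico (-(((m + 1) * S : ℕ) : ℤ)) (a + 1)), one_mul]
  · refine congrArg₂ (· * ·) (Finset.prod_congr rfl fun p hp => ?_)
      (Finset.prod_congr rfl fun p hp => ?_)
    · rw [Finset.mem_Ico] at hp
      by_cases hsl : slope ν p = 1
      · rw [if_pos hsl, if_pos hsl, if_pos ⟨hsl, by omega⟩, if_pos hp.2, neg_one_mul]
      · rw [if_neg hsl, if_neg hsl, if_neg (fun hh => hsl hh.1), one_mul]
    · rw [Finset.mem_Ico] at hp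
      by_cases hsl : slope ν p = 1
      · rw [if_pos hsl, if_pos ⟨hsl, by omega⟩, if_neg (by omega)]
      · rw [if_neg hsl, if_neg (fun hh => hsl hh.1)]
  · intro p hp
    rw [Finset.mem_Ico] at hp
    exact if_neg fun hh => by omega

end StripMonomial

/-! ### The monomial of a box of the quotient -/

section BoxMonomial

variable {m : ℕ}

/-- The factor of the box `c` of the partition with index `k` in the normalization and in the change
of variables. -/
noncomputable def boxFactor (k : Fin (m + 1)) (c : ℕ × ℕ) : YSeries m :=
  MvPowerSeries.C (qtot 1 ^ c.1) * ((-1) ^ (m - (k : ℕ)) *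
      MvPowerSeries.C (qtot 1 ^ (((m : ℤ) - (k : ℕ)) * ((c.1 : ℤ) - c.2))) *
      ∏ l ∈ Finset.univ.filter (fun l : Fin m => (k : ℕ) < (l : ℕ) + 1),
        MvPowerSeries.X l ^ (m - (l : ℕ)))

theorem prod_boxFactor (lam : Fin (m + 1) → YoungDiagram) :
    ∏ k, ∏ c ∈ (lam k).cells, boxFactor k c =
      MvPowerSeries.C (∏ k, ∏ c ∈ (lam k).cells, qtot 1 ^ c.1) * changeFactor m lam := by
  rw [map_prod, changeFactor, ← Finset.prod_mul_distrib]
  refine Finset.prod_congr rfl fun k _ => ?_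
  rw [map_prod, ← Finset.prod_mul_distrib]
  rfl

/-- The variable `v_l` occurs in `v_{k₀+1} ⋯ v_k` for the `n - l` indices `k ≥ l`. -/
theorem prod_ratC_div (k₀ : Fin (m + 1)) :
    ∏ k ∈ Finset.univ.filter (k₀ < ·), ratC k / ratC k₀ =
      ∏ l ∈ Finset.univ.filter (fun l : Fin m => (k₀ : ℕ) < (l : ℕ) + 1),
        ratV l ^ (m - (l : ℕ)) := by
  have h1 : ∀ k ∈ Finset.univ.filter (k₀ < ·), ratC k / ratC k₀ =
      ∏ i ∈ Finset.univ.filter (fun i : Fin m => (k₀ : ℕ) ≤ i ∧ (i : ℕ) < k), ratV i :=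
    fun k hk => ratC_div (Finset.mem_filter.1 hk).2.le
  rw [Finset.prod_congr rfl h1, Finset.prod_comm' (t' := Finset.univ.filter
    (fun l : Fin m => (k₀ : ℕ) < (l : ℕ) + 1)) (s' := fun l => Finset.Ioi l.castSucc)]
  · refine Finset.prod_congr rfl fun l _ => ?_
    rw [Finset.prod_const, Fin.card_Ioi]
    simp
  · intro k l
    simp only [Finset.mem_filter, Finset.mem_univ, true_and, Finset.mem_Ioi, Fin.lt_def,
      Fin.val_castSucc]
    omega

theorem expandY_boxWeight (lam' : Fin (m + 1) → YoungDiagram) (k₀ : Fin (m + 1)) (s₀ : ℤ) :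
    expandY m (boxWeight lam' k₀ s₀) =
      toYFrac m (boxFactor k₀ (stripBox (lam' k₀) (s₀ + 1))) := by
  have hc := stripBox_content (lam' k₀) (s₀ + 1)
  have hcard : (Finset.univ.filter (k₀ < ·)).card = m - (k₀ : ℕ) := by
    have : Finset.univ.filter (k₀ < ·) = Finset.Ioi k₀ := by ext; simp
    rw [this, Fin.card_Ioi]
    omega
  have hk := k₀.2
  have hz : (ratQ m ^ (-s₀ - 1)) ^ (m - (k₀ : ℕ)) = ratQ m ^ (((m : ℤ) - (k₀ : ℕ)) *
      (((stripBox (lam' k₀) (s₀ + 1)).1 : ℤ) - (stripBox (lam' k₀) (s₀ + 1)).2)) := by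
    rw [← zpow_natCast, ← zpow_mul]
    congr 1
    rw [Nat.cast_sub (by omega)]
    linear_combination (((m : ℤ) - (k₀ : ℕ))) * hc
  have hbox : boxWeight lam' k₀ s₀ = ratQ m ^ ((stripBox (lam' k₀) (s₀ + 1)).1 : ℤ) *
      ((-1) ^ (m - (k₀ : ℕ)) * ratQ m ^ (((m : ℤ) - (k₀ : ℕ)) *
      (((stripBox (lam' k₀) (s₀ + 1)).1 : ℤ) - (stripBox (lam' k₀) (s₀ + 1)).2)) *
      ∏ l ∈ Finset.univ.filter (fun l : Fin m => (k₀ : ℕ) < (l : ℕ) + 1),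
        ratV l ^ (m - (l : ℕ))) := by
    rw [boxWeight, Finset.prod_neg, Finset.prod_mul_distrib, Finset.prod_const, hcard,
      prod_ratC_div, hz, zpow_natCast, mul_assoc ((-1) ^ _)]
    rfl
  rw [hbox, boxFactor]
  simp only [map_mul, map_pow, map_prod, map_neg, map_one, expandY_ratQ_zpow, expandY_ratV,
    zpow_natCast, expandY_ratQ]

end BoxMonomial

/-! ### Removing a border strip from a diagram and a box from its quotient -/

section Induction

variable {m : ℕ} {lam : Fin (m + 1) → YoungDiagram} {μ ν : YoungDiagram}

theorem isQuotient_iff : IsQuotient (m + 1) lam μ ↔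
    ∀ p : Fin (m + 1) × ℤ, slope μ (place p) = slope (lam p.1) p.2 := by
  refine ⟨fun h p => slope_of_isQuotient h p.1 p.2, fun h t => ?_⟩
  obtain ⟨⟨k, s⟩, rfl⟩ := exists_place (m := m) t
  have hk := k.2
  rw [h, color_place]
  congr 1
  have : place (k, s) % ((m + 1 : ℕ) : ℤ) = (k : ℕ) := by
    rw [place, add_comm, Int.add_mul_emod_self_left, Int.emod_eq_of_lt (by omega) (by omega)]
  rw [this, place, add_sub_cancel_right, Int.mul_ediv_cancel_left]
  omega

/-- Removing a strip of `n` boxes from a diagram removes one box from its quotient. -/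
theorem exists_addBox (hμ : IsQuotient (m + 1) lam μ) {k₀ : Fin (m + 1)} {s₀ : ℤ}
    (h : RimStep (place (k₀, s₀)) (place (k₀, s₀) + (m + 1 : ℕ)) ν μ) :
    ∃ κ, RimStep s₀ (s₀ + 1) κ (lam k₀) ∧
      IsQuotient (m + 1) (Function.update lam k₀ κ) ν ∧
      AddBox (Function.update lam k₀ κ) lam k₀ s₀ := by
  have hμ' := isQuotient_iff.1 hμ
  have hb : place (k₀, s₀) + (m + 1 : ℕ) = place (k₀, s₀ + 1) := by
    simp only [place]; ring
  obtain ⟨hl, hl'⟩ := h.slope_left (by omega)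
  obtain ⟨hr, hr'⟩ := h.slope_right (by omega)
  rw [hb] at hr hr'
  rw [hμ'] at hl' hr'
  obtain ⟨κ, hκ⟩ := exists_rimStep (lt_add_one s₀) hl' hr'
  obtain ⟨kl, -⟩ := hκ.slope_left (lt_add_one s₀)
  obtain ⟨kr, -⟩ := hκ.slope_right (lt_add_one s₀)
  have hother : ∀ p : Fin (m + 1) × ℤ, p ≠ (k₀, s₀) → p ≠ (k₀, s₀ + 1) →
      slope (lam p.1) p.2 = slope (Function.update lam k₀ κ p.1) p.2 := by
    rintro ⟨k, s⟩ h0 h1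
    by_cases hk : k = k₀
    · subst hk
      rw [Function.update_self]
      exact hκ.slope_eq (fun hs => h0 (Prod.ext rfl hs)) (fun hs => h1 (Prod.ext rfl hs))
    · rw [Function.update_of_ne hk]
  refine ⟨κ, hκ, isQuotient_iff.2 fun p => ?_, ?_, ?_, hl', hr', hother⟩
  · by_cases h0 : p = (k₀, s₀)
    · subst h0
      rw [hl, Function.update_self, kl]
    by_cases h1 : p = (k₀, s₀ + 1)
    · subst h1
      rw [slope_ne_one hr, Function.update_self, slope_ne_one kr]
    · rw [← hother p h0 h1, ← hμ' p]
      refine (h.slope_eq (fun hp => h0 (place_injective hp)) fun hp => h1 ?_).symm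
      rw [hb] at hp
      exact place_injective hp
  · rw [Function.update_self]
    exact kl
  · rw [Function.update_self]
    exact kr

theorem prod_cells_addBox {M : Type*} [CommMonoid M] {κ : YoungDiagram} {k₀ : Fin (m + 1)} {s₀ : ℤ}
    (h : RimStep s₀ (s₀ + 1) κ (lam k₀)) (F : Fin (m + 1) → ℕ × ℕ → M) :
    ∏ k, ∏ c ∈ (lam k).cells, F k c =
      (∏ k, ∏ c ∈ (Function.update lam k₀ κ k).cells, F k c) *
        F k₀ (stripBox κ (s₀ + 1)) := by
  have e : Finset.Ioc s₀ (s₀ + 1) = {s₀ + 1} := by ext; simp; omega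
  rw [← Finset.mul_prod_erase _ _ (Finset.mem_univ k₀),
    ← Finset.mul_prod_erase _ (fun k => ∏ c ∈ (Function.update lam k₀ κ k).cells, F k c)
      (Finset.mem_univ k₀), h.prod_cells, e, Finset.prod_singleton, Function.update_self]
  have : ∏ k ∈ Finset.univ.erase k₀, ∏ c ∈ (Function.update lam k₀ κ k).cells, F k c =
      ∏ k ∈ Finset.univ.erase k₀, ∏ c ∈ (lam k).cells, F k c :=
    Finset.prod_congr rfl fun k hk => by rw [Function.update_of_ne (Finset.ne_of_mem_erase hk)]
  rw [this]
  exact mul_right_comm _ _ _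

theorem slope_bot {t : ℤ} : slope ⊥ t = 1 ↔ t < 0 := by
  constructor
  · intro h
    by_contra hc
    rw [slope_of_pos (by simpa [YoungDiagram.card] using hc)] at h
    exact absurd h (by decide)
  · intro h
    exact slope_of_neg (by simpa [YoungDiagram.card] using h)

theorem slope_bot_place (p : Fin (m + 1) × ℤ) : slope ⊥ (place p) = slope ⊥ p.2 := by
  refine slope_eq_of_iff ?_
  have h0 : (0 : ℤ) = place ((0 : Fin (m + 1)), (0 : ℤ)) := by simp [place]
  rw [slope_bot, slope_bot, h0, place_lt, LtX]
  have := Fin.zero_le p.1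
  simp only [← h0]
  omega

theorem isQuotient_bot_iff : IsQuotient (m + 1) lam ⊥ ↔ lam = fun _ => ⊥ := by
  rw [isQuotient_iff]
  constructor
  · intro h
    funext k
    refine eq_of_slope_eq fun s => ?_
    have := h (k, s)
    rw [slope_bot_place] at this
    exact this.symm
  · rintro rfl p
    exact slope_bot_place p

/-- A nonempty partition has a box that can be removed; in the slope sequence it is a `-1` followed by
a `+1`. -/
theorem exists_slope_of_ne_bot {κ : YoungDiagram} (h : κ ≠ ⊥) :
    ∃ s, slope κ s ≠ 1 ∧ slope κ (s + 1) = 1 := by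
  by_contra hc
  push Not at hc
  by_cases h0 : slope κ 0 = 1
  · have key : ∀ T : ℕ, slope κ (-(T : ℤ)) = 1 ∧ T + 1 ≤ rk κ (-(T : ℤ)) := by
      intro T
      induction T with
      | zero =>
        have := rk_of_slope_one h0
        exact ⟨by simpa using h0, by simp; omega⟩
      | succ T ih =>
        have e : -((T + 1 : ℕ) : ℤ) + 1 = -(T : ℤ) := by push_cast; ring
        have hs : slope κ (-((T + 1 : ℕ) : ℤ)) = 1 := by
          by_contra hne
          exact hc _ hne (by rw [e]; exact ih.1)
        have := rk_of_slope_one hs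
        rw [e] at this
        exact ⟨hs, by omega⟩
    have h1 := (key κ.card).2
    have h2 := rk_of_le_neg_card (μ := κ) le_rfl
    omega
  · have key : ∀ T : ℕ, slope κ T ≠ 1 ∧ rk κ T = rk κ 0 := by
      intro T
      induction T with
      | zero => exact ⟨by simpa using h0, by simp⟩
      | succ T ih =>
        have := rk_of_slope_ne ih.1
        push_cast
        exact ⟨hc _ ih.1, by rw [← ih.2, this]⟩
    have h1 := (key κ.card).2
    rw [rk_of_card_le le_rfl] at h1
    refine h ?_
    ext ⟨i, j⟩
    rw [YoungDiagram.mem_cells]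
    constructor
    · intro hij
      have h00 : ((0 : ℕ), (0 : ℕ)) ∈ κ := κ.up_left_mem (Nat.zero_le _) (Nat.zero_le _) hij
      rw [mem_iff_lt_rk] at h00
      simp only [Nat.cast_zero, sub_zero] at h00
      omega
    · intro hij
      simp at hij

/-- A diagram with an `n`-quotient in the sense of `IsQuotient` has empty `n`-core. -/
theorem exists_stripDecomposition (hμ : IsQuotient (m + 1) lam μ) :
    ∃ H, StripDecomposition (m + 1) μ H := by
  induction hN : ∑ k, (lam k).card using Nat.strong_induction_on generalizing lam μ with
  | _ N ih =>
    by_cases hbot : lam = fun _ => ⊥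
    · subst hbot
      have : μ = ⊥ := by
        refine eq_of_slope_eq fun t => ?_
        rw [hμ t, ← isQuotient_bot_iff.2 rfl t]
      subst this
      exact ⟨0, .empty⟩
    · obtain ⟨k₀, hk₀⟩ : ∃ k, lam k ≠ ⊥ := by
        by_contra hc
        push Not at hc
        exact hbot (funext hc)
      obtain ⟨s₀, hl, hr⟩ := exists_slope_of_ne_bot hk₀
      have hμ' := isQuotient_iff.1 hμ
      have hb : place (k₀, s₀) + (m + 1 : ℕ) = place (k₀, s₀ + 1) := by
        simp only [place]; ring
      obtain ⟨ν, hν⟩ := exists_rimStep (μ := μ) (a := place (k₀, s₀))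
        (b := place (k₀, s₀) + (m + 1 : ℕ)) (by omega) (by rwa [hμ'])
        (by rw [hb, hμ']; exact hr)
      obtain ⟨κ, hκ, hq, -⟩ := exists_addBox hμ hν
      have hlt : ∑ k, (Function.update lam k₀ κ k).card < N := by
        rw [← hN]
        refine Finset.sum_lt_sum (fun k _ => ?_) ⟨k₀, Finset.mem_univ _, ?_⟩
        · by_cases hk : k = k₀
          · subst hk
            rw [Function.update_self]
            exact card_mono hκ.le
          · rw [Function.update_of_ne hk]
        · rw [Function.update_self]
          have := hκ.prod_cells (fun _ => Multiplicative.ofAdd 1)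
          have e : Finset.Ioc s₀ (s₀ + 1) = {s₀ + 1} := by ext; simp; omega
          rw [e, Finset.prod_const, Finset.prod_const, Finset.prod_singleton] at this
          have h2 := congrArg Multiplicative.toAdd this
          simp only [toAdd_pow, toAdd_mul, toAdd_ofAdd, smul_eq_mul, mul_one] at h2
          simp only [YoungDiagram.card]
          omega
      obtain ⟨H, hH⟩ := ih _ hlt hq rfl
      exact ⟨_, hH.add hν.isBorderStrip⟩

/-- The normalized expectations of a diagram and of its quotient, relative to those of the empty
diagrams, are the two expansions of one rational function. -/
theorem exists_expectation_ratio {H : ℕ} (hH : StripDecomposition (m + 1) μ H)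
    (hμ : IsQuotient (m + 1) lam μ) : ∃ R : RatField m,
      (-1) ^ H * (∏ c ∈ μ.cells, qvar (m + 1) (boxColor (m + 1) c) ^ c.1) *
        expectation (m + 1) μ ⊥ ⊥ = expandX m R * expectation (m + 1) ⊥ ⊥ ⊥ ∧
      toYFrac m (∏ k, ∏ c ∈ (lam k).cells, boxFactor k c) * toYFrac m (fullY lam ⊥ ⊥) =
        expandY m R * toYFrac m (fullY (fun _ => ⊥) ⊥ ⊥) := by
  induction hH generalizing lam with
  | empty =>
    rw [isQuotient_bot_iff] at hμ
    subst hμ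
    exact ⟨1, by simp, by simp⟩
  | @add ν μ H hν hstrip ih =>
    obtain ⟨a, ha⟩ := hstrip.exists_rimStep (show 0 < m + 1 from Nat.succ_pos m)
    obtain ⟨⟨k₀, s₀⟩, rfl⟩ := exists_place (m := m) a
    obtain ⟨κ, hκ, hq, hadd⟩ := exists_addBox hμ ha
    obtain ⟨R, hX, hY⟩ := ih hq
    set lam' := Function.update lam k₀ κ with hlam'
    have hself : lam' k₀ = κ := Function.update_self _ _ _
    -- A window that contains all positions where the slopes differ from those of the empty partition.
    obtain ⟨S, hS1, hS2, hS3⟩ : ∃ S : ℕ, ν.card ≤ S ∧ s₀.natAbs + 1 < S ∧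
        ∑ k, (lam' k).card ≤ S :=
      ⟨ν.card + s₀.natAbs + 2 + ∑ k, (lam' k).card, by omega, by omega, by omega⟩
    have hs : -(S : ℤ) ≤ s₀ := by omega
    have hs' : s₀ + 1 < S := by omega
    have hcard : ∀ k, (lam' k).card ≤ S := fun k =>
      (Finset.single_le_sum (f := fun k => (lam' k).card) (fun _ _ => Nat.zero_le _)
        (Finset.mem_univ k)).trans hS3
    have hSB : SlopeBound lam' S := (slopeBound_sum_card lam').mono hS3
    have eX := expectation_addBox hadd hSB hs hs' (by omega) hμ hq
    have eY := fullY_addBox hadd hSB hs hs' (by omega)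
    have hcmp := step_comparison (lam' := lam') (k₀ := k₀) hcard hs hs'
    have hmon := prod_stripWeight hq ha (hS1.trans (Nat.le_mul_of_pos_left S (Nat.succ_pos m))) hs hs'
    have hbox := expandY_boxWeight lam' k₀ s₀
    have hDX := stepDen_ne_zero (R := LtX) (Kr := fun _ => True) (Kl := fun _ => True)
      (lam' := lam') (k₀ := k₀) hs hs'
    have hDY := stepDen_ne_zero (R := LtY) (Kr := fun k => k₀ ≤ k) (Kl := fun k => k ≤ k₀)
      (lam' := lam') (k₀ := k₀) hs hs'
    set NX := stepNum LtX lam' k₀ s₀ S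
    set NY := stepNum LtY lam' k₀ s₀ S
    set DX := stepDen LtX lam' (fun _ => True) (fun _ => True) k₀ s₀ S
    set DY := stepDen LtY lam' (fun k => k₀ ≤ k) (fun k => k ≤ k₀) k₀ s₀ S
    set W := ∏ t ∈ positions m S, stripWeight lam' k₀ s₀ t
    have hR : R * NX * W / DX = R * NY * boxWeight lam' k₀ s₀ / DY := by
      rw [div_eq_div_iff hDX hDY]
      linear_combination -R * hcmp
    refine ⟨R * NX * W / DX, ?_, ?_⟩
    · have hDX' : expandX m DX ≠ 0 := (map_ne_zero _).2 hDX
      have hstripcol : ∀ t, qvar (m + 1) (boxColor (m + 1) (stripBox ν t)) ^ (stripBox ν t).1 =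
          qvar (m + 1) (color (m + 1) t) ^ rk ν t := by
        intro t
        rw [boxColor, stripBox_content]
        rfl
      apply mul_right_cancel₀ hDX'
      rw [ha.prod_cells, Finset.prod_congr rfl fun t _ => hstripcol t, map_div₀, map_mul, map_mul,
        ← hmon, pow_add, div_mul_eq_mul_div, div_mul_cancel₀ _ hDX']
      linear_combination (-1) ^ H * (-1) ^ stripHeight ν μ *
        (∏ c ∈ ν.cells, qvar (m + 1) (boxColor (m + 1) c) ^ c.1) *
        (∏ t ∈ Finset.Ioc (place (k₀, s₀)) (place (k₀, s₀) + (m + 1 : ℕ)),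
          qvar (m + 1) (color (m + 1) t) ^ rk ν t) * eX +
        (-1) ^ stripHeight ν μ * (∏ t ∈ Finset.Ioc (place (k₀, s₀))
          (place (k₀, s₀) + (m + 1 : ℕ)), qvar (m + 1) (color (m + 1) t) ^ rk ν t) *
          expandX m NX * hX
    · have hDY' : expandY m DY ≠ 0 := (map_ne_zero _).2 hDY
      apply mul_right_cancel₀ hDY'
      rw [hR, prod_cells_addBox hκ, ← hlam', map_mul (toYFrac m), ← hself, ← hbox,
        map_div₀, map_mul, map_mul]
      field_simp
      linear_combination toYFrac m (∏ k, ∏ c ∈ (lam' k).cells, boxFactor k c) *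
        expandY m (boxWeight lam' k₀ s₀) * eY + expandY m NY *
        expandY m (boxWeight lam' k₀ s₀) * hY

end Induction

/-! ### The comparison of the vertices -/

section Final

variable {m : ℕ}

theorem expandX_div_ratC_last : expandX m (ratQ m / ratC (Fin.last m)) = qvar (m + 1) 0 := by
  have h : expandX m (ratC (Fin.last m)) = ∏ i : Fin m, qvar (m + 1) i.succ := by
    rw [ratC, Finset.filter_true_of_mem fun i _ => by simp, map_prod]
    exact Finset.prod_congr rfl fun i _ => expandX_ratV i
  rw [map_div₀, expandX_ratQ, div_eq_iff ((map_ne_zero _).2 (ratC_ne_zero _)), h, qtot,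
    Fin.prod_univ_succ]

theorem transpose_bot : (⊥ : YoungDiagram).transpose = ⊥ := by
  ext c; simp [YoungDiagram.transpose]

theorem normalizedY_bot : normalizedY m ⊥ ⊥ (fun _ => ⊥) = vertexY m ⊥ ⊥ (fun _ => ⊥) := by
  simp [normalizedY]

end Final

end VertexCRC

open VertexCRC

theorem theorem3p1 (m : ℕ) (lamBar : YoungDiagram) (lam : Fin (m + 1) → YoungDiagram)
    (hbal : VertexCRC.Balanced (m + 1) lamBar)
    (hquot : VertexCRC.IsQuotient (m + 1) lam lamBar)
    (ρp ρm : YoungDiagram) :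
    VertexCRC.EqAfterChange m (VertexCRC.normalizedX (m + 1) ρp ρm lamBar)
      (VertexCRC.normalizedY m ρp ρm lam * (VertexCRC.normalizedY m ⊥ ⊥ (fun _ => ⊥))⁻¹ *
        VertexCRC.changeFactor m lam) := by
  have hex := exists_stripDecomposition hquot
  obtain ⟨R, hX, hY⟩ := exists_expectation_ratio hex.choose_spec hquot
  obtain ⟨G, hGX, hGY⟩ := exists_expectation_factor lam ρm.transpose ρp
  have hGX := hGX lamBar hquot
  have hE : expectation (m + 1) ⊥ ⊥ ⊥ ≠ 0 := by
    have := vertexV_empty_ne_zero (m + 1)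
    rw [vertexV, transpose_bot] at this
    exact right_ne_zero_of_mul this
  refine eqAfterChange_of_expand (R * G * ratQ m ^ (-(ρp.card : ℤ))) ?_ ?_
  · have hV : vertexV (m + 1) ⊥ ⊥ ⊥ = expectation (m + 1) ⊥ ⊥ ⊥ := by
      rw [vertexV, transpose_bot]
      simp [YoungDiagram.card]
    -- The prefactor `q_0^{-|ρ⁺|}` absorbs the monomial `(v_1 ⋯ v_m)^{|ρ⁺|}` of the boundary states.
    have hmon : (ratQ m / ratC (Fin.last m)) ^ (-(ρp.card : ℤ)) =
        ratQ m ^ (-(ρp.card : ℤ)) * ratC (Fin.last m) ^ ρp.card := by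
      rw [div_zpow, zpow_neg (ratC _), zpow_natCast, div_inv_eq_mul]
    rw [normalizedX, chiSign, dif_pos hex, vertexP, hV, vertexV, ← expandX_div_ratC_last,
      ← map_zpow₀, hmon, map_mul, map_mul, map_mul, mul_assoc (expandX m (ratQ m ^ _)), hGX,
      mul_div_assoc', div_eq_iff hE]
    push_cast
    linear_combination expandX m (ratQ m ^ (-(ρp.card : ℤ))) * expandX m G * hX
  · have hinv : toYFrac m (normalizedY m ⊥ ⊥ (fun _ => ⊥))⁻¹ *
        toYFrac m (vertexY m ⊥ ⊥ (fun _ => ⊥)) = 1 := by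
      rw [normalizedY_bot, ← map_mul, MvPowerSeries.inv_mul_cancel, map_one]
      rw [vertexY_empty]
      exact one_ne_zero
    rw [prod_boxFactor] at hY
    have hvb := vertexY_eq (m := m) ⊥ ⊥ (fun _ => ⊥)
    rw [transpose_bot, show (⊥ : YoungDiagram).card = 0 from rfl, Nat.cast_zero, neg_zero,
      zpow_zero, one_mul] at hvb
    have hv := vertexY_eq ρp ρm lam
    rw [normalizedY, hv]
    rw [hvb] at hinv
    simp only [map_mul] at hinv hY ⊢
    rw [hGY, ← expandY_ratQ_zpow]
    linear_combination expandY m (ratQ m ^ (-(ρp.card : ℤ))) * expandY m G *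
      (toYFrac m (normalizedY m ⊥ ⊥ (fun _ => ⊥))⁻¹ *
        toYFrac m (MvPowerSeries.C (vertexV 1 ⊥ ⊥ ⊥ ^ (m + 1))⁻¹) * hY +
      expandY m R * hinv)
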